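/- \textbf{Setting.} Let $n\ge 2$ be a size parameter. Let $G$ be a finite digraph with real edge weights $\omega_G$, without negative cycles, with at most $c_0\,n\log^2 n$ vertices ($c_0$ a constant). Every vertex $v$ is a copy of a base vertex $v_0$ and has a shift $\delta(v)\in\mathbb R$, with $\delta=0$ on base vertices, and every edge satisfies $\omega_G(u,v)\ge d_G(u_0,v_0)+\delta(v)-\delta(u)$. Negative edges join base vertices, every vertex is incident to at most one negative edge, and the negative edge $(r,r')$ out of a negative vertex $r$ is its only out-edge. Let $N$ be the set of negative vertices (tails of negative edges). Let $G^{+}$ be $G$ together with an edge $(v,\hat v)$ of weight $\delta(\hat v)-\delta(v)$ for any two distinct copies $v,\hat v$ of the same vertex. Let $\phi$ be a potential that makes no non-negative edge of $G^{+}$ negative, and let $\Gamma$ and $H$ be $G$ and $G^{+}$ with every edge weight $\omega(u,v)$ replaced by $\omega(u,v)+\phi(u)-\phi(v)$. The edges that were negative before the reweighting keep counting as negative edges (hops); $d^h$ is the minimum weight of a walk with at most $h$ hops. Write $\omega$ and $d,d^h$ for weights and distances in $\Gamma$, and put $\delta_\Gamma(v)=\delta(v)-\phi(v)+\phi(v_0)$.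 Assume that $\phi$ has reduced the betweenness: for all $s,t$ there are at most $|N|/b=2^{\sqrt{\log n}}$ (where $b=|N|/2^{\sqrt{\log n}}$) vertices $v\in N$ for which some $s',t'$ satisfy $d_H^2(s',s)+d_H^2(s,v)+d_H^2(v,t)+d_H^2(t,t')<0$. For every $r\in N$ let the result of the two searches from $r$ with hop bound $1$ in $H$ be given: $\Delta_r\in\mathbb R$ and sets $\tilde V_r^{out},\tilde V_r^{in}$ whose sizes differ by at most $1$ such that (1) every $v\in\tilde V_r^{out}$ lies on a walk with at most $2$ hops from $r$ of weight $\le-\Delta_r$, (2) for $v\notin\tilde V_r^{out}$ all such walks through $v$ have weight $\ge-\Delta_r$, (3) every $v\in\tilde V_r^{in}$ lies on a walk with at most $1$ hop to $r$ of weight $\le\Delta_r$, (4) for $v\notin\tilde V_r^{in}$ all such walks through $v$ have weight $\ge\Delta_r$, and (5) one of (1), (3) holds with strict inequality. Put $V_r^{out}=\{v:d^1(r,v)\le-\Delta_r\}$ and $V_r^{in}=\{v:d^0(v,r)\le\Delta_r\}$, where the inequality in the first (second) definition is strict if (1) (respectively (3)) is the one chosen to be strict in (5). The graph $G'$ (parallel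 edges allowed) is $\Gamma$ together with a new base vertex $\tilde r$ of shift $0$ (Steiner vertex) for each $r\in N$ and the edges (S2) $(\tilde r,v)$ of weight $d^1(r,v)+\Delta_r$ for $v\in V_r^{out}\cup\{r'\}$; (S3) $(v,\tilde r)$ of weight $d^0(v,r)-\Delta_r$ for $v\in V_r^{in}\cup\{r\}$; (S4) $(r,v')$ of weight $d^1(r,v)+\omega(v,v')$ for every negative edge $(v,v')$ with $v\in V_r^{out}$; (S5) $(u,r')$ of weight $\omega(u,u')+d^0(u',r)+\omega(r,r')$ for every negative edge $(u,u')$ with $u'\in V_r^{in}$. The edges (S4), (S5) count as negative edges. An imaginary negative edge is an edge of negative weight incident to a Steiner vertex. Two consecutive edges $(u,v),(v,w)$ of $G'$ form a locally-negative path if at least one of them is an imaginary negative edge and their total weight is $\ge0$. \textbf{Lemma.} There is an algorithm, a single program for a random access machine with $O(\log n)$-bit words and with real registers whose unit-cost operations are memory access, addition, subtraction and comparison, that, given $\Gamma$ with its negative edges, base vertices and shifts $\delta_\Gamma$, the numbers $\Delta_r$, the sets $\tilde V_r^{out},\tilde V_r^{in},V_r^{out},V_r^{in}$ and the Steiner edges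 (S2), (S3), constructs in $n^{2+o(1)}$ steps a graph $G_{\mathrm{new}}$ (as a list of edges, parallel edges allowed) whose vertices are those of $G'$ and new copies of base vertices of $G$ with shifts, such that $G_{\mathrm{new}}$ contains all edges of $G'$ except the imaginary negative ones, its only negative edges are edges of $\Gamma$ and edges (S4), (S5), every edge $(x,y)$ of $G_{\mathrm{new}}$ has weight at least $d_{G'}(x_0,y_0)+\delta(y)-\delta(x)$ (where $\delta$ is $\delta_\Gamma$ on the vertices of $\Gamma$, $0$ on Steiner vertices and the chosen shift on new copies), and 1. $d_{G_{\mathrm{new}}}(s,t)=d_\Gamma(s,t)$ for all base vertices $s,t$ of $G$; 2. for every locally-negative path $(u,v),(v,w)$ of $G'$ there is a walk from $u$ to $w$ in $G_{\mathrm{new}}$ of the same weight that consists of non-negative edges only; 3. every base vertex of $G$ has at most $O(\log n)$ new copies; 4. $G_{\mathrm{new}}$ contains all edges (S4) and (S5). The $o(1)$, the word length and the $O(\cdot)$ depend only on $c_0$. -/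

import Mathlib

/-! ## A real random access machine with a step count

Natural numbers (the machine words) and real numbers live in scalar variables and in
two-dimensional arrays.  Words can be added, subtracted (truncated) and compared, reals can be
added, subtracted and compared.  A run with word bound `W` never produces or uses
a word that exceeds `W`, and every elementary operation costs one step. -/

namespace RealRAM

/-- Memory: word variables, real variables, word arrays and real arrays. -/
structure Mem where
  nvar : ℕ → ℕ
  rvar : ℕ → ℝ
  narr : ℕ → ℕ → ℕ → ℕ
  rarr : ℕ → ℕ → ℕ → ℝ

/-- Word expressions; `get A i j` is the entry `(i, j)` of the word array `A`. -/
inductive NExp where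
  | lit (c : ℕ)
  | var (x : ℕ)
  | get (A : ℕ) (i j : NExp)
  | plus (a b : NExp)
  | minus (a b : NExp)

namespace NExp

def val (s : Mem) : NExp → ℕ
  | lit c => c
  | var x => s.nvar x
  | get A i j => s.narr A (i.val s) (j.val s)
  | plus a b => a.val s + b.val s
  | minus a b => a.val s - b.val s

/-- Every word that occurs in the evaluation is at most `W`. -/
def Fits (W : ℕ) (s : Mem) : NExp → Prop
  | lit c => c ≤ W
  | var x => s.nvar x ≤ W
  | get A i j => i.Fits W s ∧ j.Fits W s ∧ s.narr A (i.val s) (j.val s) ≤ W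
  | plus a b => a.Fits W s ∧ b.Fits W s ∧ a.val s + b.val s ≤ W
  | minus a b => a.Fits W s ∧ b.Fits W s

def cost : NExp → ℕ
  | lit _ => 1
  | var _ => 1
  | get _ i j => i.cost + j.cost + 1
  | plus a b => a.cost + b.cost + 1
  | minus a b => a.cost + b.cost + 1

end NExp

/-- Real expressions. -/
inductive RExp where
  | var (x : ℕ)
  | get (A : ℕ) (i j : NExp)
  | plus (a b : RExp)
  | minus (a b : RExp)

namespace RExp

def val (s : Mem) : RExp → ℝ
  | var x => s.rvar x
  | get A i j => s.rarr A (i.val s) (j.val s)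
  | plus a b => a.val s + b.val s
  | minus a b => a.val s - b.val s

def Fits (W : ℕ) (s : Mem) : RExp → Prop
  | var _ => True
  | get _ i j => i.Fits W s ∧ j.Fits W s
  | plus a b => a.Fits W s ∧ b.Fits W s
  | minus a b => a.Fits W s ∧ b.Fits W s

def cost : RExp → ℕ
  | var _ => 1
  | get _ i j => i.cost + j.cost + 1
  | plus a b => a.cost + b.cost + 1
  | minus a b => a.cost + b.cost + 1

end RExp

/-- Tests: strict comparison of two words or of two reals. -/
inductive Test where
  | nlt (a b : NExp)
  | rlt (a b : RExp)

namespace Test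

def Holds (s : Mem) : Test → Prop
  | nlt a b => a.val s < b.val s
  | rlt a b => a.val s < b.val s

def Fits (W : ℕ) (s : Mem) : Test → Prop
  | nlt a b => a.Fits W s ∧ b.Fits W s
  | rlt a b => a.Fits W s ∧ b.Fits W s

def cost : Test → ℕ
  | nlt a b => a.cost + b.cost + 1
  | rlt a b => a.cost + b.cost + 1

end Test

/-- Programs. -/
inductive Prog where
  | skip
  | nset (x : ℕ) (e : NExp)
  | rset (x : ℕ) (e : RExp)
  | nput (A : ℕ) (i j : NExp) (e : NExp)
  | rput (A : ℕ) (i j : NExp) (e : RExp)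
  | seq (c d : Prog)
  | ite (b : Test) (c d : Prog)
  | while (b : Test) (c : Prog)

namespace Mem

def setN (s : Mem) (x v : ℕ) : Mem :=
  { s with nvar := fun y => if y = x then v else s.nvar y }

noncomputable def setR (s : Mem) (x : ℕ) (v : ℝ) : Mem :=
  { s with rvar := fun y => if y = x then v else s.rvar y }

def putN (s : Mem) (A i j v : ℕ) : Mem :=
  { s with narr := fun B k l => if B = A ∧ k = i ∧ l = j then v else s.narr B k l }

noncomputable def putR (s : Mem) (A i j : ℕ) (v : ℝ) : Mem :=
  { s with rarr := fun B k l => if B = A ∧ k = i ∧ l = j then v else s.rarr B k l }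

end Mem

/-- `Run W c s t s'`: with word bound `W`, the program `c` started in memory `s` halts after
exactly `t` steps in memory `s'`. -/
inductive Run (W : ℕ) : Prog → Mem → ℕ → Mem → Prop
  | skip (s : Mem) : Run W .skip s 1 s
  | nset (s : Mem) (x : ℕ) (e : NExp) (he : e.Fits W s) :
      Run W (.nset x e) s (e.cost + 1) (s.setN x (e.val s))
  | rset (s : Mem) (x : ℕ) (e : RExp) (he : e.Fits W s) :
      Run W (.rset x e) s (e.cost + 1) (s.setR x (e.val s))
  | nput (s : Mem) (A : ℕ) (i j e : NExp) (hi : i.Fits W s) (hj : j.Fits W s)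
      (he : e.Fits W s) :
      Run W (.nput A i j e) s (i.cost + j.cost + e.cost + 1)
        (s.putN A (i.val s) (j.val s) (e.val s))
  | rput (s : Mem) (A : ℕ) (i j : NExp) (e : RExp) (hi : i.Fits W s) (hj : j.Fits W s)
      (he : e.Fits W s) :
      Run W (.rput A i j e) s (i.cost + j.cost + e.cost + 1)
        (s.putR A (i.val s) (j.val s) (e.val s))
  | seq (c d : Prog) (s s₁ s₂ : Mem) (t₁ t₂ : ℕ) (h₁ : Run W c s t₁ s₁)
      (h₂ : Run W d s₁ t₂ s₂) : Run W (.seq c d) s (t₁ + t₂) s₂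
  | iteTrue (b : Test) (c d : Prog) (s s₁ : Mem) (t : ℕ) (hf : b.Fits W s) (hb : b.Holds s)
      (h : Run W c s t s₁) : Run W (.ite b c d) s (b.cost + t) s₁
  | iteFalse (b : Test) (c d : Prog) (s s₁ : Mem) (t : ℕ) (hf : b.Fits W s) (hb : ¬ b.Holds s)
      (h : Run W d s t s₁) : Run W (.ite b c d) s (b.cost + t) s₁
  | whileTrue (b : Test) (c : Prog) (s s₁ s₂ : Mem) (t₁ t₂ : ℕ) (hf : b.Fits W s)
      (hb : b.Holds s) (h₁ : Run W c s t₁ s₁) (h₂ : Run W (.while b c) s₁ t₂ s₂) :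
      Run W (.while b c) s (b.cost + t₁ + t₂) s₂
  | whileFalse (b : Test) (c : Prog) (s : Mem) (hf : b.Fits W s) (hb : ¬ b.Holds s) :
      Run W (.while b c) s b.cost s

end RealRAM

namespace Shortcut

/-! ## Weighted directed graphs, hop distances, betweenness -/

/-- A weighted directed edge.  The flag `neg` records whether the edge counts as a negative edge
(a hop); it is frozen, that is, it is not changed by a reweighting. -/
structure Edge where
  src : ℕ
  tgt : ℕ
  wt : ℝ
  neg : Bool

/-- `p` is the edge list of a walk from `s` to `t` in the graph with edge set `E`
(parallel edges are allowed). -/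
def IsWalk (E : Set Edge) : ℕ → List Edge → ℕ → Prop
  | s, [], t => s = t
  | s, e :: p, t => e ∈ E ∧ e.src = s ∧ IsWalk E e.tgt p t

def weight (p : List Edge) : ℝ := (p.map Edge.wt).sum

/-- The number of negative edges of a walk. -/
def hops (p : List Edge) : ℕ := p.countP Edge.neg

/-- The distance `d(s, t)`. -/
noncomputable def dist (E : Set Edge) (s t : ℕ) : EReal :=
  ⨅ p : {p : List Edge // IsWalk E s p t}, ((weight p.1 : ℝ) : EReal)

/-- The `h`-negative hop distance `d^h(s, t)`. -/
noncomputable def hopDist (E : Set Edge) (h : ℕ) (s t : ℕ) : EReal :=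
  ⨅ p : {p : List Edge // IsWalk E s p t ∧ hops p ≤ h}, ((weight p.1 : ℝ) : EReal)

/-- Reweighting by a potential; the frozen flags stay. -/
def reweight (φ : ℕ → ℝ) (E : Set Edge) : Set Edge :=
  (fun e => { e with wt := e.wt + φ e.src - φ e.tgt }) '' E

/-- `φ` is a valid potential: it makes no non-negative edge negative. -/
def IsValidPotential (φ : ℕ → ℝ) (E : Set Edge) : Prop :=
  ∀ e ∈ E, 0 ≤ e.wt → 0 ≤ e.wt + φ e.src - φ e.tgt

/-- The `h`-hop strong betweenness of `(s, t)` with respect to `N`, in a graph with vertices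
`0, …, m - 1`. -/
noncomputable def strongBetweenness (E : Set Edge) (m : ℕ) (N : Set ℕ) (h s t : ℕ) : ℕ :=
  {v | v ∈ N ∧ ∃ s' < m, ∃ t' < m,
    hopDist E h s' s + hopDist E h s v + hopDist E h v t + hopDist E h t t' < 0}.ncard

/-- There is a walk of weight `x` with at most `h` negative edges that starts at `s`, visits `v`
and ends at `t`. -/
def WalkVia (E : Set Edge) (h s v t : ℕ) (x : ℝ) : Prop :=
  ∃ p q : List Edge, IsWalk E s p v ∧ IsWalk E v q t ∧ hops p + hops q ≤ h ∧
    weight p + weight q = x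

/-- `Δ`, `out` and `inn` are the result of the forward and backward search from `r` with hop
bound `h`; the flag tells which of the two families of walks has strictly smaller weight. -/
structure IsSearch (E : Set Edge) (m h r : ℕ) (Δ : ℝ) (out inn : Finset ℕ)
    (strictOut : Bool) : Prop where
  out_lt : ∀ v ∈ out, v < m
  inn_lt : ∀ v ∈ inn, v < m
  out_le : ∀ v ∈ out, ∃ t x, WalkVia E (h + 1) r v t x ∧ x ≤ -Δ
  out_ge : ∀ v < m, v ∉ out → ∀ t x, WalkVia E (h + 1) r v t x → -Δ ≤ x
  inn_le : ∀ v ∈ inn, ∃ s x, WalkVia E h s v r x ∧ x ≤ Δ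
  inn_ge : ∀ v < m, v ∉ inn → ∀ s x, WalkVia E h s v r x → Δ ≤ x
  out_strict : strictOut = true → ∀ v ∈ out, ∃ t x, WalkVia E (h + 1) r v t x ∧ x < -Δ
  inn_strict : strictOut = false → ∀ v ∈ inn, ∃ s x, WalkVia E h s v r x ∧ x < Δ
  card_out_le : out.card ≤ inn.card + 1
  card_inn_le : inn.card ≤ out.card + 1

/-! ## Graphs with copies of vertices -/

/-- A weighted digraph on the vertices `0, …, m - 1`; `base v` is the base vertex of which `v`
is a copy, and `shift v` is the shift of that copy. -/
structure CopyGraph where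
  m : ℕ
  adj : ℕ → ℕ → Bool
  wt : ℕ → ℕ → ℝ
  base : ℕ → ℕ
  shift : ℕ → ℝ

namespace CopyGraph

variable (G : CopyGraph)

/-- The edges of `G`; the negative ones are flagged. -/
def edges : Set Edge :=
  {e | G.adj e.src e.tgt = true ∧ e.wt = G.wt e.src e.tgt ∧ (e.neg = true ↔ e.wt < 0)}

/-- The edges between copies of the same vertex, weighted by the difference of the shifts. -/
def copyEdges : Set Edge :=
  {e | e.src < G.m ∧ e.tgt < G.m ∧ e.src ≠ e.tgt ∧ G.base e.src = G.base e.tgt ∧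
    e.wt = G.shift e.tgt - G.shift e.src ∧ (e.neg = true ↔ e.wt < 0)}

def IsBase (v : ℕ) : Prop := v < G.m ∧ G.base v = v

def IsNegEdge (u v : ℕ) : Prop := G.adj u v = true ∧ G.wt u v < 0

/-- The negative vertices. -/
def negVertices : Set ℕ := {r | ∃ v, G.IsNegEdge r v}

/-- The standing assumptions on a preprocessed graph with copies. -/
structure WellFormed : Prop where
  adj_lt : ∀ u v, G.adj u v = true → u < G.m ∧ v < G.m
  base_isBase : ∀ v < G.m, G.IsBase (G.base v)
  /-- Base vertices have shift zero. -/
  shift_base : ∀ v, G.IsBase v → G.shift v = 0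
  /-- The invariant on the weights of edges between copies. -/
  wt_ge : ∀ u v, G.adj u v = true →
    dist G.edges (G.base u) (G.base v) + ((G.shift v - G.shift u : ℝ) : EReal)
      ≤ ((G.wt u v : ℝ) : EReal)
  /-- There is no negative cycle. -/
  no_neg_cycle : ∀ v p, IsWalk G.edges v p v → 0 ≤ weight p
  /-- Negative edges join base vertices. -/
  neg_base : ∀ u v, G.IsNegEdge u v → G.IsBase u ∧ G.IsBase v
  /-- Every vertex is incident to at most one negative edge. -/
  neg_unique : ∀ x u v u' v', G.IsNegEdge u v → G.IsNegEdge u' v' →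
    (x = u ∨ x = v) → (x = u' ∨ x = v') → u = u' ∧ v = v'
  /-- The negative edge out of a negative vertex is its only out-edge. -/
  out_unique : ∀ r v w, G.IsNegEdge r v → G.adj r w = true → w = v

end CopyGraph

/-! ## One iteration of the shortcutting -/

/-- The data of one iteration: the graph, the betweenness-reducing potential, and the results of
the searches from the negative vertices. -/
structure Data where
  G : CopyGraph
  φ : ℕ → ℝ
  Δ : ℕ → ℝ
  outS : ℕ → Finset ℕ
  inS : ℕ → Finset ℕ
  strictOut : ℕ → Bool

namespace Data

variable (D : Data)

/-- The graph `Γ`: the graph `G` after reweighting. -/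
def gam : Set Edge := reweight D.φ D.G.edges

/-- The graph `H`: `G` with the edges between copies of the same vertex, after reweighting. -/
def hgr : Set Edge := reweight D.φ (D.G.edges ∪ D.G.copyEdges)

/-- The negative vertices. -/
def N : Set ℕ := D.G.negVertices

/-- Edge weights after reweighting. -/
def wtΓ (u v : ℕ) : ℝ := D.G.wt u v + D.φ u - D.φ v

/-- Shifts after reweighting. -/
def shiftΓ (v : ℕ) : ℝ := D.G.shift v - D.φ v + D.φ (D.G.base v)

/-- The assumptions on the data, where `n` is the size parameter: all 2-hop strong betweenness
values in `H` are at most `|N| / b` for `b = |N| / 2 ^ √(log n)`. -/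
structure WellFormed (n : ℕ) : Prop where
  graph : D.G.WellFormed
  valid : IsValidPotential D.φ (D.G.edges ∪ D.G.copyEdges)
  betweenness : ∀ s < D.G.m, ∀ t < D.G.m,
    (strongBetweenness D.hgr D.G.m D.N 2 s t : ℝ) ≤ (2 : ℝ) ^ Real.sqrt (Real.logb 2 n)
  search : ∀ r ∈ D.N,
    IsSearch D.hgr D.G.m 1 r (D.Δ r) (D.outS r) (D.inS r) (D.strictOut r)

/-- The set `V_r^out`. -/
def vOut (r : ℕ) : Set ℕ :=
  {v | v < D.G.m ∧ if D.strictOut r = true then hopDist D.gam 1 r v < ((-D.Δ r : ℝ) : EReal)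
    else hopDist D.gam 1 r v ≤ ((-D.Δ r : ℝ) : EReal)}

/-- The set `V_r^in`. -/
def vIn (r : ℕ) : Set ℕ :=
  {v | v < D.G.m ∧ if D.strictOut r = true then hopDist D.gam 0 v r ≤ ((D.Δ r : ℝ) : EReal)
    else hopDist D.gam 0 v r < ((D.Δ r : ℝ) : EReal)}

/-- The Steiner vertex of the negative vertex `r`. -/
def steiner (r : ℕ) : ℕ := D.G.m + r

/-- Edges from Steiner vertices. -/
def s2 : Set Edge :=
  {e | ∃ r ∈ D.N, e.src = D.steiner r ∧ (e.tgt ∈ D.vOut r ∨ D.G.IsNegEdge r e.tgt) ∧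
    (e.wt : EReal) = hopDist D.gam 1 r e.tgt + (D.Δ r : EReal) ∧ (e.neg = true ↔ e.wt < 0)}

/-- Edges to Steiner vertices. -/
def s3 : Set Edge :=
  {e | ∃ r ∈ D.N, e.tgt = D.steiner r ∧ (e.src ∈ D.vIn r ∨ e.src = r) ∧
    (e.wt : EReal) = hopDist D.gam 0 e.src r - (D.Δ r : EReal) ∧ (e.neg = true ↔ e.wt < 0)}

/-- Shortcuts `(r, v')` for a negative vertex `r` and a negative edge `(v, v')` with
`v ∈ V_r^out`.  They count as negative edges. -/
def s4 : Set Edge :=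
  {e | e.src ∈ D.N ∧ ∃ v ∈ D.vOut e.src, D.G.IsNegEdge v e.tgt ∧
    (e.wt : EReal) = hopDist D.gam 1 e.src v + (D.wtΓ v e.tgt : EReal) ∧ e.neg = true}

/-- Shortcuts `(u, r')` for negative edges `(r, r')` and `(u, u')` with `u' ∈ V_r^in`.
They count as negative edges. -/
def s5 : Set Edge :=
  {e | ∃ r u', D.G.IsNegEdge r e.tgt ∧ u' ∈ D.vIn r ∧ D.G.IsNegEdge e.src u' ∧
    (e.wt : EReal) = (D.wtΓ e.src u' : EReal) + hopDist D.gam 0 u' r + (D.wtΓ r e.tgt : EReal) ∧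
    e.neg = true}

/-- The auxiliary graph `G'`. -/
def aux : Set Edge := D.gam ∪ D.s2 ∪ D.s3 ∪ D.s4 ∪ D.s5

/-- An imaginary negative edge of `G'` is a negative edge that is incident to a Steiner vertex. -/
def IsImaginary (e : Edge) : Prop := e.wt < 0 ∧ (D.G.m ≤ e.src ∨ D.G.m ≤ e.tgt)

/-- Two edges of `G'` that form a locally-negative two-edge path. -/
def IsLocallyNegative (e f : Edge) : Prop :=
  e ∈ D.aux ∧ f ∈ D.aux ∧ e.tgt = f.src ∧ (D.IsImaginary e ∨ D.IsImaginary f) ∧ 0 ≤ e.wt + f.wt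

/-- A locally-negative two-edge path is shortcut in the graph with edge set `E`. -/
def IsShortcutIn (E : Set Edge) (e f : Edge) : Prop :=
  ∃ p, IsWalk E e.src p f.tgt ∧ weight p = e.wt + f.wt ∧ ∀ g ∈ p, g.neg = false ∧ 0 ≤ g.wt

/-! ### Input and output of the algorithm -/

open Classical in
/-- The memory in which the algorithm is started; whatever is not listed is zero.
Word variable 0: number of vertices.  Word arrays: 0 base vertices, 1 adjacency matrix of `Γ`,
2 its negative edges, 3 and 4 the search sets, 5 and 6 the sets `V_r^out` and `V_r^in`.
Real arrays: 0 the shifts and 1 the weights after reweighting, 2 the numbers `Δ_r`, 3 and 4 the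
weights of the edges from and to the Steiner vertices. -/
noncomputable def start : RealRAM.Mem where
  nvar := fun x => if x = 0 then D.G.m else 0
  rvar := fun _ => 0
  narr := fun A i j =>
    if A = 0 ∧ i < D.G.m ∧ j = 0 then D.G.base i
    else if A = 1 ∧ D.G.adj i j = true then 1
    else if A = 2 ∧ D.G.IsNegEdge i j then 1
    else if A = 3 ∧ i ∈ D.N ∧ j ∈ D.outS i then 1
    else if A = 4 ∧ i ∈ D.N ∧ j ∈ D.inS i then 1
    else if A = 5 ∧ i ∈ D.N ∧ j ∈ D.vOut i then 1
    else if A = 6 ∧ i ∈ D.N ∧ j ∈ D.vIn i then 1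
    else 0
  rarr := fun A i j =>
    if A = 0 ∧ i < D.G.m ∧ j = 0 then D.shiftΓ i
    else if A = 1 ∧ D.G.adj i j = true then D.wtΓ i j
    else if A = 2 ∧ i ∈ D.N ∧ j = 0 then D.Δ i
    else if A = 3 ∧ i ∈ D.N ∧ (j ∈ D.vOut i ∨ D.G.IsNegEdge i j) then
      (hopDist D.gam 1 i j).toReal + D.Δ i
    else if A = 4 ∧ i ∈ D.N ∧ (j ∈ D.vIn i ∨ j = i) then
      (hopDist D.gam 0 j i).toReal - D.Δ i
    else 0

end Data

/-! The output graph is read off the final memory.  Word variable 0 holds the number of new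
copies and word variable 1 the number of edges.  The `i`-th new copy is the vertex `2 * m + i`; its
base vertex is in word array 10 and its shift in real array 10.  The source, the target and the flag
of the `i`-th edge are in word arrays 11, 12 and 13, and its weight is in real array 11. -/

def outEdges (s : RealRAM.Mem) : Set Edge :=
  {e | ∃ i < s.nvar 1, e.src = s.narr 11 i 0 ∧ e.tgt = s.narr 12 i 0 ∧ e.wt = s.rarr 11 i 0 ∧
    (e.neg = true ↔ s.narr 13 i 0 = 1)}

namespace Data

variable (D : Data)

/-- The vertices of the output graph: the old vertices, the Steiner vertices, the new copies. -/
def IsOutVertex (s : RealRAM.Mem) (x : ℕ) : Prop :=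
  x < D.G.m ∨ (∃ r ∈ D.N, x = D.steiner r) ∨ (2 * D.G.m ≤ x ∧ x < 2 * D.G.m + s.nvar 0)

/-- The base vertex of a vertex of the output graph; Steiner vertices are base vertices. -/
def outBase (s : RealRAM.Mem) (x : ℕ) : ℕ :=
  if x < D.G.m then D.G.base x else if x < 2 * D.G.m then x else s.narr 10 (x - 2 * D.G.m) 0

/-- The shift of a vertex of the output graph. -/
noncomputable def outShift (s : RealRAM.Mem) (x : ℕ) : ℝ :=
  if x < D.G.m then D.shiftΓ x else if x < 2 * D.G.m then 0 else s.rarr 10 (x - 2 * D.G.m) 0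

/-- The final memory `s` holds a graph with all the required properties; `n` is the size
parameter and `C` the constant in the bound on the number of copies. -/
structure IsGoodOutput (n : ℕ) (C : ℝ) (s : RealRAM.Mem) : Prop where
  edge_mem : ∀ e ∈ outEdges s, D.IsOutVertex s e.src ∧ D.IsOutVertex s e.tgt
  /-- The output contains `G'`, except for the imaginary negative edges. -/
  contains : ∀ e ∈ D.aux, ¬ D.IsImaginary e → e ∈ outEdges s
  /-- The only negative edges are those of `Γ` and the shortcuts between its vertices. -/
  neg_edges : ∀ e ∈ outEdges s, (e.neg = false ∧ 0 ≤ e.wt) ∨ e ∈ D.gam ∪ D.s4 ∪ D.s5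
  /-- New copies are copies of base vertices of the given graph. -/
  copy_base : ∀ i < s.nvar 0, D.G.IsBase (s.narr 10 i 0)
  /-- New copies satisfy the invariant on edge weights. -/
  copy_wt : ∀ e ∈ outEdges s,
    dist D.aux (D.outBase s e.src) (D.outBase s e.tgt)
      + ((D.outShift s e.tgt - D.outShift s e.src : ℝ) : EReal) ≤ ((e.wt : ℝ) : EReal)
  /-- Shortest path distances are preserved. -/
  dist_eq : ∀ u v, D.G.IsBase u → D.G.IsBase v → dist (outEdges s) u v = dist D.gam u v
  /-- Every locally-negative two-edge path is shortcut. -/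
  shortcut : ∀ e f, D.IsLocallyNegative e f → IsShortcutIn (outEdges s) e f
  /-- There are `O(log n)` new copies of each base vertex. -/
  copies : ∀ v, D.G.IsBase v →
    (({i | i < s.nvar 0 ∧ s.narr 10 i 0 = v} : Set ℕ).ncard : ℝ) ≤ C * Real.logb 2 n
  /-- The output has all the shortcut edges. -/
  shortcutEdges : D.s4 ⊆ outEdges s ∧ D.s5 ⊆ outEdges s

end Data

end Shortcut

/-! Write `m` for the number of vertices of `Γ`. A locally-negative path is either a path between
Steiner edges only, `(u, r̃), (r̃, w)` or `(r̃, v), (v, s̃)`, or it joins an imaginary edge to an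
edge of `Γ`, (S4) or (S5).

In the first case, Steiner edges that come from `V_r^out` or `V_r^in` have weight at most `0`
(`w₂_le`, `w₃_le`). A non-negative total with an imaginary edge therefore forces one of the two
edges to be `(r̃, r')` or `(r, r̃)`. There are only `O(m ^ 2)` such paths, and each gets an edge of
its own (`Plain`).

In the second case there can be cubically many paths. Consider `r̃ → v → w`, and put `x = δ(v) -
ω(r̃, v)` and `y = ω(v, w) + δ(v)`, so that the path has non-negative weight iff `x ≤ y`. The
numbers `y` of all copies of one base vertex are comparable. For such a group, the targets `w` are
sorted by their least `y`, the key, and cut into blocks of lengths `1, 2, 4, …`; each block gets a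
new copy of the base vertex, whose shift is the smallest key of the block, its threshold. If `x` is
at most the threshold, the edges `r̃ → copy → w` of weights `thr - x` and `y - thr` shortcut the
path. If the threshold is below `x`, the targets of the block are inspected one by one and get
direct edges (`short_gadget`). Paths `w → v → r̃` are treated symmetrically. Each base vertex has
six groups, with `O(log m)` blocks each (`card_copies`).

If block `l` is inspected, its `2 ^ l` positions are paid for by the first `2 ^ l` targets, whose
keys are all below `x`; so the work for `(r, v)` is at most twice the number of these close targets
(`sum_two_pow_le`, `sum_enumCost_le`). A close target `w` and any `s` in the backward search set of
`r` give a walk through `s`, `r` and `w` of negative weight with few hops, so `r` is counted in the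
betweenness of `(s, t)`, where `t` is `w` or the tail of the last negative edge (`Close.forward`;
`Close.backward` is the mirror image). The number of relevant `v` is at most the size of the forward
search set, which exceeds the size of the backward one by at most one. Counting triples `(r, s, t)`
twice bounds the total work by `O(m ^ 2 * (K + 1))`, with `K ≤ 2 ^ √(log n)` (`sum_sum_close_le`).
Everything else, including sorting by tournament trees, takes `O(m ^ 2 log m)` steps.

No distance shrinks, because every new edge is a concatenation of edges of `G'` and of moves between
copies of one vertex that cost the difference of shifts; `Reach` telescopes along such
concatenations. The argument is run with two readings of Steiner vertices (`reach_output`): `r̃` as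
a copy of `r` with shift `-Δ r` gives the distances in `Γ`, and `r̃` as a base vertex with shift `0`
gives the invariant on weights.

The program is verified with weakest preconditions `WP` that bound the running time and the size of
words together: the counters of copies and of edges grow by at most one per step, so a bound on the
time also bounds the words. -/

namespace RealRAM

/-! ## Reasoning about programs -/

namespace NExp

/-- The word arrays that are read. -/
def arrs : NExp → List ℕ
  | lit _ => []
  | var _ => []
  | get A i j => A :: (i.arrs ++ j.arrs)
  | plus a b => a.arrs ++ b.arrs
  | minus a b => a.arrs ++ b.arrs

theorem val_putN {e : NExp} {A : ℕ} (h : A ∉ e.arrs) (s : Mem) (i j v : ℕ) :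
    e.val (s.putN A i j v) = e.val s := by
  induction e with
  | lit c => rfl
  | var x => rfl
  | get B a b iha ihb =>
    simp only [arrs, List.mem_cons, List.mem_append, not_or] at h
    simp only [val, iha h.2.1, ihb h.2.2]
    simp [Mem.putN, Ne.symm h.1]
  | plus a b iha ihb =>
    simp only [arrs, List.mem_append, not_or] at h
    simp only [val, iha h.1, ihb h.2]
  | minus a b iha ihb =>
    simp only [arrs, List.mem_append, not_or] at h
    simp only [val, iha h.1, ihb h.2]

theorem fits_putN {e : NExp} {A : ℕ} (h : A ∉ e.arrs) (W : ℕ) (s : Mem) (i j v : ℕ) :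
    e.Fits W (s.putN A i j v) ↔ e.Fits W s := by
  induction e with
  | lit c => rfl
  | var x => rfl
  | get B a b iha ihb =>
    simp only [arrs, List.mem_cons, List.mem_append, not_or] at h
    simp only [Fits, iha h.2.1, ihb h.2.2, val_putN h.2.1, val_putN h.2.2]
    simp [Mem.putN, Ne.symm h.1]
  | plus a b iha ihb =>
    simp only [arrs, List.mem_append, not_or] at h
    simp only [Fits, iha h.1, ihb h.2, val_putN h.1, val_putN h.2]
  | minus a b iha ihb =>
    simp only [arrs, List.mem_append, not_or] at h
    simp only [Fits, iha h.1, ihb h.2]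

end NExp

namespace RExp

/-- The word arrays that are read. -/
def arrs : RExp → List ℕ
  | var _ => []
  | get _ i j => i.arrs ++ j.arrs
  | plus a b => a.arrs ++ b.arrs
  | minus a b => a.arrs ++ b.arrs

theorem val_putN {e : RExp} {A : ℕ} (h : A ∉ e.arrs) (s : Mem) (i j v : ℕ) :
    e.val (s.putN A i j v) = e.val s := by
  induction e with
  | var x => rfl
  | get B a b =>
    simp only [arrs, List.mem_append, not_or] at h
    simp only [val, NExp.val_putN h.1, NExp.val_putN h.2]
    rfl
  | plus a b iha ihb =>
    simp only [arrs, List.mem_append, not_or] at h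
    simp only [val, iha h.1, ihb h.2]
  | minus a b iha ihb =>
    simp only [arrs, List.mem_append, not_or] at h
    simp only [val, iha h.1, ihb h.2]

theorem fits_putN {e : RExp} {A : ℕ} (h : A ∉ e.arrs) (W : ℕ) (s : Mem) (i j v : ℕ) :
    e.Fits W (s.putN A i j v) ↔ e.Fits W s := by
  induction e with
  | var x => rfl
  | get B a b =>
    simp only [arrs, List.mem_append, not_or] at h
    simp only [Fits, NExp.fits_putN h.1, NExp.fits_putN h.2]
  | plus a b iha ihb =>
    simp only [arrs, List.mem_append, not_or] at h
    simp only [Fits, iha h.1, ihb h.2]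
  | minus a b iha ihb =>
    simp only [arrs, List.mem_append, not_or] at h
    simp only [Fits, iha h.1, ihb h.2]

end RExp

theorem Test.cost_pos (b : Test) : 1 ≤ b.cost := by cases b <;> simp [Test.cost]

namespace Prog

/-- The word variables that are written. -/
def nvars : Prog → List ℕ
  | nset x _ => [x]
  | seq c d => c.nvars ++ d.nvars
  | ite _ c d => c.nvars ++ d.nvars
  | .while _ c => c.nvars
  | _ => []

/-- The real variables that are written. -/
def rvars : Prog → List ℕ
  | rset x _ => [x]
  | seq c d => c.rvars ++ d.rvars
  | ite _ c d => c.rvars ++ d.rvars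
  | .while _ c => c.rvars
  | _ => []

/-- The word arrays that are written. -/
def narrs : Prog → List ℕ
  | nput A _ _ _ => [A]
  | seq c d => c.narrs ++ d.narrs
  | ite _ c d => c.narrs ++ d.narrs
  | .while _ c => c.narrs
  | _ => []

/-- The real arrays that are written. -/
def rarrs : Prog → List ℕ
  | rput A _ _ _ => [A]
  | seq c d => c.rarrs ++ d.rarrs
  | ite _ c d => c.rarrs ++ d.rarrs
  | .while _ c => c.rarrs
  | _ => []

/-- A bound on the number of steps of a program without loops. -/
def steps : Prog → ℕ
  | skip => 1
  | nset _ e => e.cost + 1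
  | rset _ e => e.cost + 1
  | nput _ i j e => i.cost + j.cost + e.cost + 1
  | rput _ i j e => i.cost + j.cost + e.cost + 1
  | seq c d => c.steps + d.steps
  | ite b c d => b.cost + max c.steps d.steps
  | .while _ _ => 1

theorem steps_pos (c : Prog) : 1 ≤ c.steps := by
  induction c <;> simp [steps] <;> omega

end Prog

/-- The part of the memory that `c` never writes is the same in `s` and `s'`. -/
structure Frame (c : Prog) (s s' : Mem) : Prop where
  nvar : ∀ x, x ∉ c.nvars → s'.nvar x = s.nvar x
  rvar : ∀ x, x ∉ c.rvars → s'.rvar x = s.rvar x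
  narr : ∀ A, A ∉ c.narrs → s'.narr A = s.narr A
  rarr : ∀ A, A ∉ c.rarrs → s'.rarr A = s.rarr A

theorem Frame.refl (c : Prog) (s : Mem) : Frame c s s :=
  ⟨fun _ _ => rfl, fun _ _ => rfl, fun _ _ => rfl, fun _ _ => rfl⟩

theorem Frame.trans {c : Prog} {s s' s'' : Mem} (h : Frame c s s') (h' : Frame c s' s'') :
    Frame c s s'' :=
  ⟨fun x hx => (h'.nvar x hx).trans (h.nvar x hx), fun x hx => (h'.rvar x hx).trans (h.rvar x hx),
    fun x hx => (h'.narr x hx).trans (h.narr x hx), fun x hx => (h'.rarr x hx).trans (h.rarr x hx)⟩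

theorem Frame.mono {c d : Prog} {s s' : Mem} (h : Frame c s s') (h₁ : c.nvars ⊆ d.nvars)
    (h₂ : c.rvars ⊆ d.rvars) (h₃ : c.narrs ⊆ d.narrs) (h₄ : c.rarrs ⊆ d.rarrs) : Frame d s s' :=
  ⟨fun x hx => h.nvar x fun h => hx (h₁ h), fun x hx => h.rvar x fun h => hx (h₂ h),
    fun x hx => h.narr x fun h => hx (h₃ h), fun x hx => h.rarr x fun h => hx (h₄ h)⟩

theorem Frame.seq_left {c : Prog} (d : Prog) {s s' : Mem} (h : Frame c s s') :
    Frame (.seq c d) s s' :=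
  h.mono (List.subset_append_left _ _) (List.subset_append_left _ _)
    (List.subset_append_left _ _) (List.subset_append_left _ _)

theorem Frame.seq_right (c : Prog) {d : Prog} {s s' : Mem} (h : Frame d s s') :
    Frame (.seq c d) s s' :=
  h.mono (List.subset_append_right _ _) (List.subset_append_right _ _)
    (List.subset_append_right _ _) (List.subset_append_right _ _)

/-- Membership in the lists of written variables and arrays is decidable. Invariants on tables are
therefore carried across a fragment of the program by `decide`, with no reasoning about its run. -/
theorem Run.frame {W : ℕ} {c : Prog} {s s' : Mem} {t : ℕ} (h : Run W c s t s') :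
    Frame c s s' := by
  induction h with
  | skip s => exact Frame.refl _ _
  | nset s x e he =>
    refine ⟨fun y hy => ?_, fun _ _ => rfl, fun _ _ => rfl, fun _ _ => rfl⟩
    simp only [Prog.nvars, List.mem_singleton] at hy
    simp [Mem.setN, hy]
  | rset s x e he =>
    refine ⟨fun _ _ => rfl, fun y hy => ?_, fun _ _ => rfl, fun _ _ => rfl⟩
    simp only [Prog.rvars, List.mem_singleton] at hy
    simp [Mem.setR, hy]
  | nput s A i j e =>
    refine ⟨fun _ _ => rfl, fun _ _ => rfl, fun B hB => ?_, fun _ _ => rfl⟩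
    simp only [Prog.narrs, List.mem_singleton] at hB
    simp [Mem.putN, hB]
  | rput s A i j e =>
    refine ⟨fun _ _ => rfl, fun _ _ => rfl, fun _ _ => rfl, fun B hB => ?_⟩
    simp only [Prog.rarrs, List.mem_singleton] at hB
    simp [Mem.putR, hB]
  | seq c d s s₁ s₂ t₁ t₂ _ _ ih₁ ih₂ => exact (ih₁.seq_left d).trans (ih₂.seq_right c)
  | iteTrue b c d s s₁ t _ _ _ ih =>
    exact (ih.seq_left d).mono (fun _ h => h) (fun _ h => h) (fun _ h => h) (fun _ h => h)
  | iteFalse b c d s s₁ t _ _ _ ih =>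
    exact (ih.seq_right c).mono (fun _ h => h) (fun _ h => h) (fun _ h => h) (fun _ h => h)
  | whileTrue b c s s₁ s₂ t₁ t₂ _ _ _ _ ih₁ ih₂ =>
    exact (ih₁.mono (d := .while b c) (fun _ h => h) (fun _ h => h) (fun _ h => h) (fun _ h => h)).trans ih₂
  | whileFalse b c s => exact Frame.refl _ _

/-- All entries of the word arrays are at most `U`. -/
def Small (U : ℕ) (s : Mem) : Prop := ∀ A i j, s.narr A i j ≤ U

/-- Started in `s`, the program `c` halts after at most `T` steps, in a memory with `Q`.  The
counters `0` and `1` grow by at most one in a step, and as long as they stay below `B` and the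
entries of the word arrays below `U`, no word exceeds `W`. -/
def WP (W U B : ℕ) (c : Prog) (s : Mem) (T : ℕ) (Q : Mem → Prop) : Prop :=
  Small U s → s.nvar 0 + T ≤ B → s.nvar 1 + T ≤ B →
    ∃ t s', Run W c s t s' ∧ t ≤ T ∧ Small U s' ∧ s'.nvar 0 ≤ s.nvar 0 + t ∧
      s'.nvar 1 ≤ s.nvar 1 + t ∧ Q s'

namespace Prog

/-- The weakest precondition of a program without loops. -/
def pre (W U : ℕ) : Prog → Mem → (Mem → Prop) → Prop
  | skip, s, Q => Q s
  -- The variables `0` and `1` count the output; the clause for `x ≤ 1` keeps them from growing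
  -- faster than the time.
  | nset x e, s, Q => e.Fits W s ∧ (x ≤ 1 → e.val s ≤ s.nvar x + 1) ∧ Q (s.setN x (e.val s))
  | rset x e, s, Q => e.Fits W s ∧ Q (s.setR x (e.val s))
  | nput A i j e, s, Q => i.Fits W s ∧ j.Fits W s ∧ e.Fits W s ∧ e.val s ≤ U ∧
      (Small U (s.putN A (i.val s) (j.val s) (e.val s)) →
        Q (s.putN A (i.val s) (j.val s) (e.val s)))
  | rput A i j e, s, Q => i.Fits W s ∧ j.Fits W s ∧ e.Fits W s ∧
      Q (s.putR A (i.val s) (j.val s) (e.val s))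
  | seq c d, s, Q => c.pre W U s (fun s' => d.pre W U s' Q)
  | ite b c d, s, Q => b.Fits W s ∧ (b.Holds s → c.pre W U s Q) ∧ (¬ b.Holds s → d.pre W U s Q)
  -- Loops are handled by `WP.while` and `WP.forLoop`, which need invariants.
  | .while _ _, _, _ => False

end Prog

/-! ### Proof rules for programs with bounds on time and words. -/

section rules

variable {W U B : ℕ}

theorem Small.putN {s : Mem} (hs : Small U s) {A i j v : ℕ} (hv : v ≤ U) :
    Small U (s.putN A i j v) := by
  intro C k l
  simp only [Mem.putN]
  split_ifs
  exacts [hv, hs _ _ _]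

theorem Prog.pre_sound {c : Prog} {s : Mem} {Q : Mem → Prop} (h : c.pre W U s Q)
    (hs : Small U s) : ∃ t s', Run W c s t s' ∧ t ≤ c.steps ∧ Small U s' ∧
      s'.nvar 0 ≤ s.nvar 0 + t ∧ s'.nvar 1 ≤ s.nvar 1 + t ∧ Q s' := by
  induction c generalizing s Q with
  | skip => exact ⟨_, _, .skip s, le_rfl, hs, by omega, by omega, h⟩
  | nset x e =>
    obtain ⟨h₁, h₂, h₃⟩ := h
    refine ⟨_, _, .nset s x e h₁, le_rfl, hs, ?_, ?_, h₃⟩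
    · by_cases hx : 0 = x
      · subst hx; have := h₂ (by omega); simp [Mem.setN]; omega
      · simp [Mem.setN, hx]
    · by_cases hx : 1 = x
      · subst hx; have := h₂ (by omega); simp [Mem.setN]; omega
      · simp [Mem.setN, hx]
  | rset x e =>
    exact ⟨_, _, .rset s x e h.1, le_rfl, hs, by simp [Mem.setR], by simp [Mem.setR], h.2⟩
  | nput A i j e =>
    obtain ⟨h₁, h₂, h₃, h₄, h₅⟩ := h
    exact ⟨_, _, .nput s A i j e h₁ h₂ h₃, le_rfl, hs.putN h₄, by simp [Mem.putN],
      by simp [Mem.putN], h₅ (hs.putN h₄)⟩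
  | rput A i j e =>
    obtain ⟨h₁, h₂, h₃, h₄⟩ := h
    exact ⟨_, _, .rput s A i j e h₁ h₂ h₃, le_rfl, hs, by simp [Mem.putR],
      by simp [Mem.putR], h₄⟩
  | seq c d ihc ihd =>
    obtain ⟨t₁, s₁, r₁, ht₁, hs₁, a₁, b₁, q₁⟩ := ihc h hs
    obtain ⟨t₂, s₂, r₂, ht₂, hs₂, a₂, b₂, q₂⟩ := ihd q₁ hs₁
    exact ⟨_, _, .seq c d s s₁ s₂ t₁ t₂ r₁ r₂, by simp only [steps]; omega, hs₂, by omega,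
      by omega, q₂⟩
  | ite b c d ihc ihd =>
    obtain ⟨hf, h₁, h₂⟩ := h
    by_cases hb : b.Holds s
    · obtain ⟨t₁, s₁, r₁, ht₁, hs₁, a₁, b₁, q₁⟩ := ihc (h₁ hb) hs
      exact ⟨_, _, .iteTrue b c d s s₁ t₁ hf hb r₁, by simp only [steps]; omega, hs₁, by omega,
        by omega, q₁⟩
    · obtain ⟨t₁, s₁, r₁, ht₁, hs₁, a₁, b₁, q₁⟩ := ihd (h₂ hb) hs
      exact ⟨_, _, .iteFalse b c d s s₁ t₁ hf hb r₁, by simp only [steps]; omega, hs₁, by omega,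
        by omega, q₁⟩
  | _ => exact h.elim

/-- The bounds on array entries and counters are premises inside `WP`; this makes them available
while the judgement itself is being derived, which is where the conditions on word sizes come from.
-/
theorem WP.assume {c : Prog} {s : Mem} {T : ℕ} {Q : Mem → Prop}
    (h : Small U s → s.nvar 0 + T ≤ B → s.nvar 1 + T ≤ B → WP W U B c s T Q) :
    WP W U B c s T Q := fun h₁ h₂ h₃ => h h₁ h₂ h₃ h₁ h₂ h₃

theorem WP.of_pre {c : Prog} {s : Mem} {Q : Mem → Prop}
    (h : Small U s → s.nvar 0 < B → s.nvar 1 < B → c.pre W U s Q) :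
    WP W U B c s c.steps Q := fun h₁ h₂ h₃ =>
  Prog.pre_sound (h h₁ (by have := c.steps_pos; omega) (by have := c.steps_pos; omega)) h₁

/-- The final memory arrives with its frame, so postconditions only have to speak of what has
changed. -/
theorem WP.conseq {c : Prog} {s : Mem} {T T' : ℕ} {Q Q' : Mem → Prop} (h : WP W U B c s T Q)
    (hT : T ≤ T') (hQ : ∀ s', Frame c s s' → Q s' → Q' s') : WP W U B c s T' Q' := by
  intro h₁ h₂ h₃
  obtain ⟨t, s', r, ht, hs, a, b, q⟩ := h h₁ (by omega) (by omega)
  exact ⟨t, s', r, by omega, hs, a, b, hQ _ r.frame q⟩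

theorem WP.seq {c d : Prog} {s : Mem} {T₁ T₂ : ℕ} {Q R : Mem → Prop} (h₁ : WP W U B c s T₁ R)
    (h₂ : ∀ s', Frame c s s' → R s' → WP W U B d s' T₂ Q) :
    WP W U B (.seq c d) s (T₁ + T₂) Q := by
  intro k₁ k₂ k₃
  obtain ⟨t₁, s₁, r₁, ht₁, hs₁, a₁, b₁, q₁⟩ := h₁ k₁ (by omega) (by omega)
  obtain ⟨t₂, s₂, r₂, ht₂, hs₂, a₂, b₂, q₂⟩ := h₂ s₁ r₁.frame q₁ hs₁ (by omega) (by omega)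
  exact ⟨_, _, .seq c d s s₁ s₂ t₁ t₂ r₁ r₂, by omega, hs₂, by omega, by omega, q₂⟩

theorem WP.ite {b : Test} {c d : Prog} {s : Mem} {T : ℕ} {Q : Mem → Prop}
    (hf : Small U s → b.Fits W s) (hc : b.Holds s → WP W U B c s T Q)
    (hd : ¬ b.Holds s → WP W U B d s T Q) : WP W U B (.ite b c d) s (b.cost + T) Q := by
  intro k₁ k₂ k₃
  by_cases hb : b.Holds s
  · obtain ⟨t₁, s₁, r₁, ht₁, hs₁, a₁, b₁, q₁⟩ := hc hb k₁ (by omega) (by omega)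
    exact ⟨_, _, .iteTrue b c d s s₁ t₁ (hf k₁) hb r₁, by omega, hs₁, by omega, by omega, q₁⟩
  · obtain ⟨t₁, s₁, r₁, ht₁, hs₁, a₁, b₁, q₁⟩ := hd hb k₁ (by omega) (by omega)
    exact ⟨_, _, .iteFalse b c d s s₁ t₁ (hf k₁) hb r₁, by omega, hs₁, by omega, by omega, q₁⟩

theorem WP.skip {s : Mem} {Q : Mem → Prop} (h : Q s) : WP W U B .skip s 1 Q :=
  WP.of_pre fun _ _ _ => h

/-- The index `d` is a supply of iterations: each pass consumes one unit, and at `d = 0` the test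
must fail because `0 = d' + 1` has no solution. -/
theorem WP.while {b : Test} {c : Prog} {s₀ : Mem} {T : ℕ} (I : ℕ → Mem → Prop)
    (hf : ∀ d s, Frame (.while b c) s₀ s → Small U s → I d s → b.Fits W s)
    (hstep : ∀ d s, Frame (.while b c) s₀ s → I d s → b.Holds s →
      ∃ d', d = d' + 1 ∧ WP W U B c s T (I d')) {d : ℕ} (h : I d s₀) :
    WP W U B (.while b c) s₀ (d * (T + b.cost) + b.cost)
      (fun s' => (∃ d', I d' s') ∧ ¬ b.Holds s') := by
  suffices H : ∀ d s, Frame (.while b c) s₀ s → I d s →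
      WP W U B (.while b c) s (d * (T + b.cost) + b.cost)
        (fun s' => (∃ d', I d' s') ∧ ¬ b.Holds s') from H d s₀ (Frame.refl _ _) h
  intro d
  induction d with
  | zero =>
    intro s hF hI k₁ k₂ k₃
    by_cases hb : b.Holds s
    · obtain ⟨d', hd', -⟩ := hstep _ s hF hI hb
      omega
    · exact ⟨_, _, .whileFalse b c s (hf _ s hF k₁ hI) hb, by omega, k₁, by omega, by omega,
        ⟨_, hI⟩, hb⟩
  | succ d ih =>
    intro s hF hI k₁ k₂ k₃
    by_cases hb : b.Holds s
    · obtain ⟨d', hd', hc⟩ := hstep _ s hF hI hb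
      obtain rfl : d' = d := by omega
      have e : (d' + 1) * (T + b.cost) = d' * (T + b.cost) + (T + b.cost) := by ring
      rw [e] at k₂ k₃ ⊢
      obtain ⟨t₁, s₁, r₁, ht₁, hs₁, a₁, b₁, q₁⟩ := hc k₁ (by omega) (by omega)
      obtain ⟨t₂, s₂, r₂, ht₂, hs₂, a₂, b₂, q₂⟩ := ih s₁
        (hF.trans (r₁.frame.mono (fun _ h => h) (fun _ h => h) (fun _ h => h) (fun _ h => h)))
        q₁ hs₁ (by omega) (by omega)
      exact ⟨_, _, .whileTrue b c s s₁ s₂ t₁ t₂ (hf _ s hF k₁ hI) hb r₁ r₂, by omega, hs₂,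
        by omega, by omega, q₂⟩
    · exact ⟨_, _, .whileFalse b c s (hf _ s hF k₁ hI) hb, by omega, k₁, by omega, by omega,
        ⟨_, hI⟩, hb⟩

/-- `for x < y do c` -/
def forLoop (x y : ℕ) (c : Prog) : Prog :=
  .seq (.nset x (.lit 0))
    (.while (.nlt (.var x) (.var y)) (.seq c (.nset x (.plus (.var x) (.lit 1)))))

theorem Frame.setN {c : Prog} {s s' : Mem} (h : Frame c s s') {x : ℕ} (hx : x ∈ c.nvars) (v : ℕ) :
    Frame c s (s'.setN x v) := by
  refine ⟨fun y hy => ?_, h.rvar, h.narr, h.rarr⟩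
  have : y ≠ x := fun e => hy (e ▸ hx)
  simp [Mem.setN, this, h.nvar y hy]

/-- The cost `T k` may depend on the iteration, because single passes of the block enumeration are
expensive and only their sum is small. The overhead `7` is the test (`3`) plus the increment (`4`);
the final `5` is the initialisation (`2`) plus the failing test (`3`). The condition `2 ≤ x` keeps
the loop variable apart from the output counters. -/
theorem WP.forLoop {x y n : ℕ} {c : Prog} {s₀ : Mem} {T : ℕ → ℕ} (I : ℕ → Mem → Prop)
    (hx : 2 ≤ x) (hxc : x ∉ c.nvars) (hyc : y ∉ c.nvars) (hyx : y ≠ x) (hy : s₀.nvar y = n)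
    (hn : n ≤ W) (h₀ : I 0 (s₀.setN x 0))
    (hstep : ∀ k s, k < n → Frame (forLoop x y c) s₀ s → s.nvar x = k → I k s →
      WP W U B c s (T k) (fun s' => I (k + 1) (s'.setN x (k + 1)))) :
    WP W U B (forLoop x y c) s₀ (∑ k ∈ Finset.range n, (T k + 7) + 5) (I n) := by
  have hxm : x ∈ (RealRAM.forLoop x y c).nvars := by simp [RealRAM.forLoop, Prog.nvars]
  have hyl : y ∉ (RealRAM.forLoop x y c).nvars := by
    simp [RealRAM.forLoop, Prog.nvars, hyc, hyx]
  -- Induction on the number `d` of remaining iterations; the partial sum over `Ico k n` loses its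
  -- first term in each step.
  have key : ∀ d k s, n - k = d → k ≤ n → Frame (RealRAM.forLoop x y c) s₀ s → s.nvar x = k →
      I k s → WP W U B
        (.while (.nlt (.var x) (.var y)) (.seq c (.nset x (.plus (.var x) (.lit 1))))) s
        (∑ k ∈ Finset.Ico k n, (T k + 7) + 3) (I n) := by
    intro d
    induction d with
    | zero =>
      intro k s hd hk hF hxk hI k₁ k₂ k₃
      obtain rfl : k = n := by omega
      have hyk : s.nvar y = k := by rw [hF.nvar y hyl, hy]
      refine ⟨_, _, .whileFalse _ _ s ?_ ?_, ?_, k₁, by omega, by omega, hI⟩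
      · simp [Test.Fits, NExp.Fits, hxk, hyk, hn]
      · simp [Test.Holds, NExp.val, hxk, hyk]
      · simp [Test.cost, NExp.cost]
    | succ d ih =>
      intro k s hd hk hF hxk hI k₁ k₂ k₃
      have hkn : k < n := by omega
      have hyk : s.nvar y = n := by rw [hF.nvar y hyl, hy]
      rw [Finset.sum_eq_sum_Ico_succ_bot hkn] at k₂ k₃ ⊢
      obtain ⟨t₁, s₁, r₁, ht₁, hs₁, a₁, b₁, q₁⟩ :=
        hstep k s hkn hF hxk hI k₁ (by omega) (by omega)
      have hx₁ : s₁.nvar x = k := by rw [r₁.frame.nvar x hxc, hxk]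
      have r₂ : Run W (.nset x (.plus (.var x) (.lit 1))) s₁ 4 (s₁.setN x (k + 1)) := by
        have := Run.nset (W := W) s₁ x (.plus (.var x) (.lit 1)) (by
          simp only [NExp.Fits, NExp.val, hx₁]; omega)
        simpa [NExp.cost, NExp.val, hx₁] using this
      have hF₁ : Frame (RealRAM.forLoop x y c) s₀ s₁ := hF.trans (r₁.frame.mono
        (by simp [RealRAM.forLoop, Prog.nvars]) (by simp [RealRAM.forLoop, Prog.rvars])
        (by simp [RealRAM.forLoop, Prog.narrs]) (by simp [RealRAM.forLoop, Prog.rarrs]))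
      have h0x : (0 : ℕ) ≠ x := by omega
      have h1x : (1 : ℕ) ≠ x := by omega
      have e0 : (s₁.setN x (k + 1)).nvar 0 = s₁.nvar 0 := by simp [Mem.setN, h0x]
      have e1 : (s₁.setN x (k + 1)).nvar 1 = s₁.nvar 1 := by simp [Mem.setN, h1x]
      obtain ⟨t₃, s₃, r₃, ht₃, hs₃, a₃, b₃, q₃⟩ := ih (k + 1) (s₁.setN x (k + 1)) (by omega)
        (by omega) (hF₁.setN hxm _) (by simp [Mem.setN]) q₁ hs₁
        (by rw [e0]; omega) (by rw [e1]; omega)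
      rw [e0] at a₃
      rw [e1] at b₃
      refine ⟨_, _, .whileTrue _ _ s _ _ _ _ ?_ ?_ (.seq _ _ _ _ _ _ _ r₁ r₂) r₃, ?_, hs₃,
        by omega, by omega, q₃⟩
      · simp only [Test.Fits, NExp.Fits, hxk, hyk]; omega
      · simpa [Test.Holds, NExp.val, hxk, hyk] using hkn
      · simp only [Test.cost, NExp.cost]; omega
  have h0x : (0 : ℕ) ≠ x := by omega
  have h1x : (1 : ℕ) ≠ x := by omega
  intro k₁ k₂ k₃
  have e0 : (s₀.setN x 0).nvar 0 = s₀.nvar 0 := by simp [Mem.setN, h0x]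
  have e1 : (s₀.setN x 0).nvar 1 = s₀.nvar 1 := by simp [Mem.setN, h1x]
  obtain ⟨t, s, r, ht, hs, a, b, q⟩ := key n 0 (s₀.setN x 0) (by omega) (by omega)
    ((Frame.refl _ _).setN hxm _) (by simp [Mem.setN]) h₀ k₁
    (by rw [e0, ← Finset.range_eq_Ico]; omega) (by rw [e1, ← Finset.range_eq_Ico]; omega)
  rw [e0] at a
  rw [e1] at b
  rw [← Finset.range_eq_Ico] at ht
  exact ⟨_, _, .seq _ _ _ _ _ _ _ (.nset s₀ x (.lit 0) (by simp [NExp.Fits])) r,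
    by simp only [NExp.cost]; omega, hs, by omega, by omega, q⟩

/-- A loop with a constant bound on the number of steps of an iteration. -/
theorem WP.forLoop_const {x y n : ℕ} {c : Prog} {s₀ : Mem} {T : ℕ} (I : ℕ → Mem → Prop)
    (hx : 2 ≤ x) (hxc : x ∉ c.nvars) (hyc : y ∉ c.nvars) (hyx : y ≠ x) (hy : s₀.nvar y = n)
    (hn : n ≤ W) (h₀ : I 0 (s₀.setN x 0))
    (hstep : ∀ k s, k < n → Frame (RealRAM.forLoop x y c) s₀ s → s.nvar x = k → I k s →
      WP W U B c s T (fun s' => I (k + 1) (s'.setN x (k + 1)))) :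
    WP W U B (RealRAM.forLoop x y c) s₀ (n * (T + 7) + 5) (I n) := by
  refine (WP.forLoop (T := fun _ => T) I hx hxc hyc hyx hy hn h₀ hstep).conseq ?_
    fun _ _ h => h
  simp

/-- A loop whose `k`-th iteration establishes `φ k` and preserves the earlier ones. -/
theorem WP.forLoop_all {x y n : ℕ} {c : Prog} {s₀ : Mem} {T : ℕ} (φ : ℕ → Mem → Prop)
    (hφ : ∀ k s v, φ k s → φ k (s.setN x v))
    (hx : 2 ≤ x) (hxc : x ∉ c.nvars) (hyc : y ∉ c.nvars) (hyx : y ≠ x) (hy : s₀.nvar y = n)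
    (hn : n ≤ W)
    (hstep : ∀ k s, k < n → Frame (RealRAM.forLoop x y c) s₀ s → s.nvar x = k →
      WP W U B c s T (fun s' => φ k s' ∧ ∀ k' < k, φ k' s → φ k' s')) :
    WP W U B (RealRAM.forLoop x y c) s₀ (n * (T + 7) + 5) (fun s' => ∀ k < n, φ k s') := by
  refine WP.forLoop_const (fun k s' => ∀ k' < k, φ k' s') hx hxc hyc hyx hy hn (by simp) ?_
  intro k s hk hF hxk hI
  refine (hstep k s hk hF hxk).conseq le_rfl ?_
  rintro s' - ⟨h₁, h₂⟩ k' hk'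
  apply hφ
  rcases Nat.lt_succ_iff_lt_or_eq.mp hk' with h | rfl
  · exact h₂ k' h (hI k' h)
  · exact h₁

/-- Two nested loops that establish `φ i j` for all pairs. -/
theorem WP.forLoop₂_all {x x' y y' n n' : ℕ} {c : Prog} {s₀ : Mem} {T : ℕ}
    (φ : ℕ → ℕ → Mem → Prop) (hφ : ∀ i j s v, φ i j s → φ i j (s.setN x v))
    (hφ' : ∀ i j s v, φ i j s → φ i j (s.setN x' v))
    (hx : 2 ≤ x) (hxc : x ∉ c.nvars) (hyc : y ∉ c.nvars) (hyx : y ≠ x)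
    (hx' : 2 ≤ x') (hxc' : x' ∉ c.nvars) (hyc' : y' ∉ c.nvars) (hyx' : y' ≠ x')
    (hxx : x ≠ x') (hyx₁ : y ≠ x') (hyx₂ : y' ≠ x)
    (hy : s₀.nvar y = n) (hy' : s₀.nvar y' = n') (hn : n ≤ W) (hn' : n' ≤ W)
    (hstep : ∀ i j s, i < n → j < n' → Frame (RealRAM.forLoop x y (RealRAM.forLoop x' y' c)) s₀ s →
      s.nvar x = i → s.nvar x' = j →
      WP W U B c s T (fun s' => φ i j s' ∧
        ∀ i' j', (i' ≠ i ∨ j' ≠ j) → i' < n → j' < n' → φ i' j' s → φ i' j' s')) :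
    WP W U B (RealRAM.forLoop x y (RealRAM.forLoop x' y' c)) s₀ (n * (n' * (T + 7) + 5 + 7) + 5)
      (fun s' => ∀ i < n, ∀ j < n', φ i j s') := by
  have hxi : x ∉ (RealRAM.forLoop x' y' c).nvars := by
    simp [RealRAM.forLoop, Prog.nvars, hxc, hxx]
  have hyi : y ∉ (RealRAM.forLoop x' y' c).nvars := by
    simp [RealRAM.forLoop, Prog.nvars, hyc, hyx₁]
  have hyo : y' ∉ (RealRAM.forLoop x y (RealRAM.forLoop x' y' c)).nvars := by
    simp [RealRAM.forLoop, Prog.nvars, hyc', hyx₂, hyx']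
  refine WP.forLoop_all (fun i s => ∀ j < n', φ i j s)
    (fun i s v h j hj => hφ i j s v (h j hj)) hx hxi hyi hyx hy hn ?_
  intro i s hi hF hxs
  refine WP.conseq (WP.forLoop_const
    (fun k s' => (∀ j < k, φ i j s') ∧ ∀ i' < i, (∀ j < n', φ i' j s) → ∀ j < n', φ i' j s')
    hx' hxc' hyc' hyx' ((hF.nvar y' hyo).trans hy') hn' ?_ ?_) le_rfl fun s' _ h => h
  · exact ⟨by simp, fun i' _ h j hj => hφ' _ _ _ _ (h j hj)⟩
  · intro j s' hj hF' hxj hI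
    have hF₂ : Frame (RealRAM.forLoop x y (RealRAM.forLoop x' y' c)) s₀ s' :=
      hF.trans (hF'.mono
        (by intro a ha; simp only [RealRAM.forLoop, Prog.nvars] at ha ⊢; simp at ha ⊢; tauto)
        (by intro a ha; simp only [RealRAM.forLoop, Prog.rvars] at ha ⊢; simp at ha ⊢; tauto)
        (by intro a ha; simp only [RealRAM.forLoop, Prog.narrs] at ha ⊢; simp at ha ⊢; tauto)
        (by intro a ha; simp only [RealRAM.forLoop, Prog.rarrs] at ha ⊢; simp at ha ⊢; tauto))
    refine (hstep i j s' hi hj hF₂ ((hF'.nvar x hxi).trans hxs) hxj).conseq le_rfl ?_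
    rintro s'' - ⟨h₁, h₂⟩
    refine ⟨fun j' hj' => hφ' _ _ _ _ ?_, fun i' hi' h j' hj' => hφ' _ _ _ _ ?_⟩
    · rcases Nat.lt_succ_iff_lt_or_eq.mp hj' with h | rfl
      · exact h₂ i j' (Or.inr (by omega)) hi (by omega) (hI.1 j' h)
      · exact h₁
    · exact h₂ i' j' (Or.inl (by omega)) (by omega) hj' (hI.2 i' hi' h j' hj')

end rules

end RealRAM

namespace RealRAM

theorem Frame.loop {x y : ℕ} {c : Prog} {s s' : Mem} (h : Frame c s s') :
    Frame (forLoop x y c) s s' :=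
  h.mono (by simp [forLoop, Prog.nvars]) (by simp [forLoop, Prog.rvars])
    (by simp [forLoop, Prog.narrs]) (by simp [forLoop, Prog.rarrs])

/-! ## Output of edges -/

open Shortcut (outEdges Edge)

/-- Append an edge to the output. -/
def emit (a b f : NExp) (w : RExp) : Prog :=
  .seq (.nput 11 (.var 1) (.lit 0) a) (.seq (.nput 12 (.var 1) (.lit 0) b)
    (.seq (.nput 13 (.var 1) (.lit 0) f) (.seq (.rput 11 (.var 1) (.lit 0) w)
      (.nset 1 (.plus (.var 1) (.lit 1))))))

/-- All the tests have the prescribed outcome. -/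
def Passes (bs : List (Bool × Test)) (s : Mem) : Prop := ∀ b ∈ bs, (b.2.Holds s ↔ b.1 = true)

/-- Run `c` if all the tests have the prescribed outcome, and `d` otherwise. -/
def guardElse : List (Bool × Test) → Prog → Prog → Prog
  | [], c, _ => c
  | (true, b) :: bs, c, d => .ite b (guardElse bs c d) d
  | (false, b) :: bs, c, d => .ite b d (guardElse bs c d)

def guard (bs : List (Bool × Test)) (c : Prog) : Prog := guardElse bs c .skip

/-- The edge that `emit` appends. -/
noncomputable def emitted (a b f : NExp) (w : RExp) (s : Mem) : Edge :=
  ⟨a.val s, b.val s, w.val s, decide (f.val s = 1)⟩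

/-- The expression reads no output array. -/
def NExp.Clean (e : NExp) : Prop := 11 ∉ e.arrs ∧ 12 ∉ e.arrs ∧ 13 ∉ e.arrs

instance (e : NExp) : Decidable e.Clean := inferInstanceAs (Decidable (_ ∧ _ ∧ _))

def RExp.Clean (e : RExp) : Prop := 11 ∉ e.arrs ∧ 12 ∉ e.arrs ∧ 13 ∉ e.arrs

instance (e : RExp) : Decidable e.Clean := inferInstanceAs (Decidable (_ ∧ _ ∧ _))

theorem outEdges_congr {s s' : Mem} (h : s'.nvar 1 = s.nvar 1) (h₁ : s'.narr 11 = s.narr 11)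
    (h₂ : s'.narr 12 = s.narr 12) (h₃ : s'.narr 13 = s.narr 13) (h₄ : s'.rarr 11 = s.rarr 11) :
    outEdges s' = outEdges s := by
  simp only [outEdges, h, h₁, h₂, h₃, h₄]

theorem outEdges_setN {s : Mem} {x : ℕ} (hx : 1 ≠ x) (v : ℕ) :
    outEdges (s.setN x v) = outEdges s :=
  outEdges_congr (by simp [Mem.setN, hx]) rfl rfl rfl rfl

theorem outEdges_append {s s' : Mem} {a b f : ℕ} {w : ℝ} (h : s'.nvar 1 = s.nvar 1 + 1)
    (h₁ : ∀ i, s'.narr 11 i 0 = if i = s.nvar 1 then a else s.narr 11 i 0)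
    (h₂ : ∀ i, s'.narr 12 i 0 = if i = s.nvar 1 then b else s.narr 12 i 0)
    (h₃ : ∀ i, s'.narr 13 i 0 = if i = s.nvar 1 then f else s.narr 13 i 0)
    (h₄ : ∀ i, s'.rarr 11 i 0 = if i = s.nvar 1 then w else s.rarr 11 i 0) :
    outEdges s' = outEdges s ∪ {⟨a, b, w, decide (f = 1)⟩} := by
  ext ⟨es, et, ew, en⟩
  simp only [outEdges, h, h₁, h₂, h₃, h₄, Set.mem_ofPred_eq, Set.mem_union, Set.mem_singleton_iff,
    Edge.mk.injEq]
  constructor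
  · rintro ⟨i, hi, h⟩
    rcases Nat.lt_succ_iff_lt_or_eq.mp hi with hi | rfl
    · left
      rw [if_neg hi.ne, if_neg hi.ne, if_neg hi.ne, if_neg hi.ne] at h
      exact ⟨i, hi, h⟩
    · right
      simp only [if_true] at h
      refine ⟨h.1, h.2.1, h.2.2.1, ?_⟩
      rw [← Bool.coe_iff_coe, decide_eq_true_iff]
      exact h.2.2.2
  · rintro (⟨i, hi, h⟩ | h)
    · refine ⟨i, by omega, ?_⟩
      rw [if_neg hi.ne, if_neg hi.ne, if_neg hi.ne, if_neg hi.ne]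
      exact h
    · refine ⟨s.nvar 1, by omega, ?_⟩
      simp only [if_true]
      refine ⟨h.1, h.2.1, h.2.2.1, ?_⟩
      rw [h.2.2.2, decide_eq_true_iff]

/-! ### Rules for guarded output and for loops that output edges. -/

section rules

variable {W U B : ℕ}

theorem WP.guardElse {bs : List (Bool × Test)} {c d : Prog} {s : Mem} {Q : Mem → Prop} {T : ℕ}
    (hf : Small U s → ∀ b ∈ bs, b.2.Fits W s) (h : Passes bs s → WP W U B c s T Q)
    (h' : ¬ Passes bs s → WP W U B d s T Q) :
    WP W U B (guardElse bs c d) s ((bs.map fun b => b.2.cost).sum + T) Q := by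
  induction bs with
  | nil => simpa [RealRAM.guardElse] using h (by simp [Passes])
  | cons b bs ih =>
    obtain ⟨p, b⟩ := b
    have e : (List.map (fun b : Bool × Test => b.2.cost) ((p, b) :: bs)).sum + T
      = b.cost + ((bs.map fun b => b.2.cost).sum + T) := by simp; ring
    rw [e]
    have hc : (b.Holds s ↔ p = true) →
        WP W U B (RealRAM.guardElse bs c d) s ((bs.map fun b => b.2.cost).sum + T) Q := fun hb =>
      ih (fun hs b hb => hf hs b (by simp [hb]))
        (fun h₁ => h (by simpa [Passes, hb] using h₁))
        (fun h₁ => h' (by simpa [Passes, hb] using h₁))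
    have hd : ¬ (b.Holds s ↔ p = true) →
        WP W U B d s ((bs.map fun b => b.2.cost).sum + T) Q := fun hb =>
      (h' fun h => hb (h (p, b) (by simp))).conseq (by omega) fun _ _ h => h
    cases p
    · exact WP.ite (fun hs => hf hs (false, b) (by simp)) (fun hb => hd (by simpa using hb))
        fun hb => hc (by simpa using hb)
    · exact WP.ite (fun hs => hf hs (true, b) (by simp)) (fun hb => hc (by simpa using hb))
        fun hb => hd (by simpa using hb)

theorem WP.guard {bs : List (Bool × Test)} {c : Prog} {s : Mem} {Q : Mem → Prop} {T : ℕ}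
    (hT : 1 ≤ T) (hf : Small U s → ∀ b ∈ bs, b.2.Fits W s) (h : Passes bs s → WP W U B c s T Q)
    (h' : ¬ Passes bs s → Q s) :
    WP W U B (guard bs c) s ((bs.map fun b => b.2.cost).sum + T) Q :=
  WP.guardElse hf h fun hb => (WP.skip (h' hb)).conseq hT fun _ _ h => h

/-- The cost of `guard bs (emit a b f w)`. -/
def emitCost (bs : List (Bool × Test)) (a b f : NExp) (w : RExp) : ℕ :=
  (bs.map fun b => b.2.cost).sum + (emit a b f w).steps

/-- The expressions `b`, `f` and `w` are evaluated after the output arrays have been written to, so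
they must not read them; `a` is evaluated first and needs no such condition. The counter moves last,
so all four fields go to the same slot. -/
theorem WP.emit {a b f : NExp} {w : RExp} {s : Mem} (cb : b.Clean) (cf : f.Clean)
    (cw : w.Clean) (hB : B + 1 ≤ W)
    (hf : Small U s → (a.Fits W s ∧ a.val s ≤ U) ∧ (b.Fits W s ∧ b.val s ≤ U) ∧
      (f.Fits W s ∧ f.val s ≤ U) ∧ w.Fits W s) :
    WP W U B (emit a b f w) s (emit a b f w).steps
      (fun s' => outEdges s' = outEdges s ∪ {emitted a b f w s}) := by
  refine WP.of_pre fun hs h₀ h₁ => ?_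
  obtain ⟨⟨ha, ha'⟩, ⟨hb, hb'⟩, ⟨hf, hf'⟩, hw⟩ := hf hs
  refine ⟨?_, ?_, ha, ha', fun _ => ⟨?_, ?_, ?_, ?_, fun _ => ⟨?_, ?_, ?_, ?_, fun _ =>
    ⟨?_, ?_, ?_, ?_, ?_, ?_⟩⟩⟩⟩
  · simp only [NExp.Fits]; omega
  · simp only [NExp.Fits]; omega
  · simp only [NExp.Fits, Mem.putN]; omega
  · simp only [NExp.Fits]; omega
  · rwa [NExp.fits_putN cb.1]
  · rwa [NExp.val_putN cb.1]
  · simp only [NExp.Fits, Mem.putN]; omega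
  · simp only [NExp.Fits]; omega
  · rwa [NExp.fits_putN cf.2.1, NExp.fits_putN cf.1]
  · rwa [NExp.val_putN cf.2.1, NExp.val_putN cf.1]
  · simp only [NExp.Fits, Mem.putN]; omega
  · simp only [NExp.Fits]; omega
  · rwa [RExp.fits_putN cw.2.2, RExp.fits_putN cw.2.1, RExp.fits_putN cw.1]
  · simp only [NExp.Fits, NExp.val, Mem.putN, Mem.putR]; omega
  · intro _; simp [NExp.val]
  · rw [NExp.val_putN cb.1, NExp.val_putN cf.2.1, NExp.val_putN cf.1, RExp.val_putN cw.2.2,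
      RExp.val_putN cw.2.1, RExp.val_putN cw.1]
    refine outEdges_append ?_ ?_ ?_ ?_ ?_
    · simp [Mem.setN, Mem.putR, Mem.putN, NExp.val]
    · simp [Mem.setN, Mem.putR, Mem.putN, NExp.val]
    · simp [Mem.setN, Mem.putR, Mem.putN, NExp.val]
    · simp [Mem.setN, Mem.putR, Mem.putN, NExp.val]
    · simp [Mem.setN, Mem.putR, Mem.putN, NExp.val]

theorem WP.emitIf {bs : List (Bool × Test)} {a b f : NExp} {w : RExp} {s : Mem} (cb : b.Clean) (cf : f.Clean) (cw : w.Clean) (hB : B + 1 ≤ W)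
    (hf : Small U s → (∀ b ∈ bs, b.2.Fits W s) ∧ (Passes bs s → (a.Fits W s ∧ a.val s ≤ U) ∧
      (b.Fits W s ∧ b.val s ≤ U) ∧ (f.Fits W s ∧ f.val s ≤ U) ∧ w.Fits W s)) :
    WP W U B (RealRAM.guard bs (RealRAM.emit a b f w)) s (emitCost bs a b f w)
      (fun s' => outEdges s' = outEdges s ∪
        {e | Passes bs s ∧ e = emitted a b f w s}) := by
  refine WP.guard (Prog.steps_pos _) (fun hs => (hf hs).1) (fun h => ?_) (fun h => ?_)
  · refine (WP.emit cb cf cw hB fun hs => (hf hs).2 h).conseq le_rfl fun s' _ hs' => ?_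
    rw [hs']
    congr 1
    ext e
    simp only [Set.mem_singleton_iff, Set.mem_ofPred_eq]
    exact ⟨fun he => ⟨h, he⟩, fun he => he.2⟩
  · ext e
    simp only [Set.mem_union, Set.mem_ofPred_eq]
    exact ⟨Or.inl, fun he => he.resolve_right fun he => h he.1⟩

theorem WP.forLoop_emits {x y n : ℕ} {c : Prog} {s₀ : Mem} {T : ℕ → ℕ} (E : ℕ → Set Edge)
    (hx : 2 ≤ x) (hxc : x ∉ c.nvars) (hyc : y ∉ c.nvars) (hyx : y ≠ x) (hy : s₀.nvar y = n)
    (hn : n ≤ W)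
    (hstep : ∀ k s, k < n → Frame (RealRAM.forLoop x y c) s₀ s → s.nvar x = k →
      WP W U B c s (T k) (fun s' => outEdges s' = outEdges s ∪ E k)) :
    WP W U B (RealRAM.forLoop x y c) s₀ (∑ k ∈ Finset.range n, (T k + 7) + 5)
      (fun s' => outEdges s' = outEdges s₀ ∪ {e | ∃ k < n, e ∈ E k}) := by
  have h1x : 1 ≠ x := by omega
  refine WP.forLoop (fun k s' => outEdges s' = outEdges s₀ ∪ {e | ∃ k' < k, e ∈ E k'})
    hx hxc hyc hyx hy hn ?_ ?_
  · rw [outEdges_setN h1x]; simp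
  · intro k s hk hF hxs hI
    refine (hstep k s hk hF hxs).conseq le_rfl fun s' _ hs' => ?_
    rw [outEdges_setN h1x, hs', hI, Set.union_assoc]
    congr 1
    ext e
    simp only [Set.mem_union, Set.mem_ofPred_eq]
    constructor
    · rintro (⟨k', hk', h⟩ | h)
      · exact ⟨k', by omega, h⟩
      · exact ⟨k, by omega, h⟩
    · rintro ⟨k', hk', h⟩
      rcases Nat.lt_succ_iff_lt_or_eq.mp hk' with h' | rfl
      · exact Or.inl ⟨k', h', h⟩
      · exact Or.inr h

/-- Two nested loops that output edges. -/
theorem WP.forLoop₂_emits {x x' y y' n n' : ℕ} {c : Prog} {s₀ : Mem} {T : ℕ}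
    (E : ℕ → ℕ → Set Edge)
    (hx : 2 ≤ x) (hxc : x ∉ c.nvars) (hyc : y ∉ c.nvars) (hyx : y ≠ x)
    (hx' : 2 ≤ x') (hxc' : x' ∉ c.nvars) (hyc' : y' ∉ c.nvars) (hyx' : y' ≠ x')
    (hxx : x ≠ x') (hyx₁ : y ≠ x') (hyx₂ : y' ≠ x)
    (hy : s₀.nvar y = n) (hy' : s₀.nvar y' = n') (hn : n ≤ W) (hn' : n' ≤ W)
    (hstep : ∀ i j s, i < n → j < n' → Frame (RealRAM.forLoop x y (RealRAM.forLoop x' y' c)) s₀ s →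
      s.nvar x = i → s.nvar x' = j →
      WP W U B c s T (fun s' => outEdges s' = outEdges s ∪ E i j)) :
    WP W U B (RealRAM.forLoop x y (RealRAM.forLoop x' y' c)) s₀ (n * (n' * (T + 7) + 5 + 7) + 5)
      (fun s' => outEdges s' = outEdges s₀ ∪ {e | ∃ i < n, ∃ j < n', e ∈ E i j}) := by
  have hxi : x ∉ (RealRAM.forLoop x' y' c).nvars := by
    simp [RealRAM.forLoop, Prog.nvars, hxc, hxx]
  have hyi : y ∉ (RealRAM.forLoop x' y' c).nvars := by
    simp [RealRAM.forLoop, Prog.nvars, hyc, hyx₁]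
  have hyo : y' ∉ (RealRAM.forLoop x y (RealRAM.forLoop x' y' c)).nvars := by
    simp [RealRAM.forLoop, Prog.nvars, hyc', hyx₂, hyx']
  refine (WP.forLoop_emits (T := fun _ => n' * (T + 7) + 5)
    (fun i => {e | ∃ j < n', e ∈ E i j}) hx hxi hyi hyx hy hn ?_).conseq ?_
    fun s' _ h => h
  · intro i s hi hF hxs
    refine (WP.forLoop_emits (T := fun _ => T) (E i) hx' hxc' hyc' hyx'
      ((hF.nvar y' hyo).trans hy') hn' ?_).conseq ?_ fun s' _ h => h
    · intro j s' hj hF' hxj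
      exact hstep i j s' hi hj (hF.trans hF'.loop) ((hF'.nvar x hxi).trans hxs) hxj
    · simp
  · simp

end rules

/-- Set the entry `(a, b)` of the word array `A` to one and the entry of the real array `A` to `w`,
if all the tests have the prescribed outcome; set the word entry to zero otherwise. -/
def flagIf (bs : List (Bool × Test)) (A : ℕ) (a b : NExp) (w : RExp) : Prog :=
  guardElse bs (.seq (.rput A a b w) (.nput A a b (.lit 1))) (.nput A a b (.lit 0))

def flagCost (bs : List (Bool × Test)) (A : ℕ) (a b : NExp) (w : RExp) : ℕ :=
  (bs.map fun b => b.2.cost).sum + (Prog.seq (.rput A a b w) (.nput A a b (.lit 1))).steps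

theorem NExp.val_putR (e : NExp) (s : Mem) (A i j : ℕ) (v : ℝ) :
    e.val (s.putR A i j v) = e.val s := by
  induction e with
  | lit c => rfl
  | var x => rfl
  | get B a b iha ihb => simp only [val, iha, ihb]; rfl
  | plus a b iha ihb => simp only [val, iha, ihb]
  | minus a b iha ihb => simp only [val, iha, ihb]

theorem NExp.fits_putR (e : NExp) (W : ℕ) (s : Mem) (A i j : ℕ) (v : ℝ) :
    e.Fits W (s.putR A i j v) ↔ e.Fits W s := by
  induction e with
  | lit c => rfl
  | var x => rfl
  | get B a b iha ihb => simp only [Fits, iha, ihb, val_putR]; rfl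
  | plus a b iha ihb => simp only [Fits, iha, ihb, val_putR]
  | minus a b iha ihb => simp only [Fits, iha, ihb]

/-- The effect of `flagIf`. -/
structure Flagged (bs : List (Bool × Test)) (A : ℕ) (a b : NExp) (w : RExp) (s s' : Mem) : Prop where
  val : (s'.narr A (a.val s) (b.val s) = 1 ∧ Passes bs s ∧
    s'.rarr A (a.val s) (b.val s) = w.val s) ∨
      (s'.narr A (a.val s) (b.val s) = 0 ∧ ¬ Passes bs s)
  narr : ∀ i j, (i ≠ a.val s ∨ j ≠ b.val s) → s'.narr A i j = s.narr A i j
  rarr : ∀ i j, (i ≠ a.val s ∨ j ≠ b.val s) → s'.rarr A i j = s.rarr A i j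

theorem WP.flagIf {W U B : ℕ} {bs : List (Bool × Test)} {A : ℕ} {a b : NExp} {w : RExp} {s : Mem}
    (hU : 1 ≤ U) (hW : 1 ≤ W)
    (hf : Small U s → (∀ b ∈ bs, b.2.Fits W s) ∧ a.Fits W s ∧ b.Fits W s ∧ w.Fits W s) :
    WP W U B (flagIf bs A a b w) s (flagCost bs A a b w) (Flagged bs A a b w s) := by
  refine WP.assume fun hs _ _ => ?_
  obtain ⟨h₁, h₂, h₃, h₄⟩ := hf hs
  refine WP.guardElse (fun _ => h₁) (fun hp => ?_) (fun hp => ?_)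
  · refine WP.of_pre fun _ _ _ => ⟨h₂, h₃, h₄, ?_, ?_, hW, hU, fun _ => ?_⟩
    · rwa [NExp.fits_putR]
    · rwa [NExp.fits_putR]
    · rw [NExp.val_putR, NExp.val_putR]
      refine ⟨Or.inl ⟨?_, hp, ?_⟩, fun i j hij => ?_, fun i j hij => ?_⟩
      · simp [Mem.putN, NExp.val]
      · simp [Mem.putN, Mem.putR]
      · have : ¬ (i = a.val s ∧ j = b.val s) := by tauto
        simp [Mem.putN, Mem.putR, this]
      · have : ¬ (i = a.val s ∧ j = b.val s) := by tauto
        simp [Mem.putN, Mem.putR, this]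
  · refine (WP.of_pre (c := .nput A a b (.lit 0)) (Q := Flagged bs A a b w s) fun _ _ _ =>
      ⟨h₂, h₃, by simp [NExp.Fits], by simp [NExp.val], fun _ => ?_⟩).conseq ?_ fun _ _ h => h
    · refine ⟨Or.inr ⟨?_, hp⟩, fun i j hij => ?_, fun i j hij => ?_⟩
      · simp [Mem.putN, NExp.val]
      · have : ¬ (i = a.val s ∧ j = b.val s) := by tauto
        simp [Mem.putN, this]
      · simp [Mem.putN]
    · simp only [Prog.steps, NExp.cost]; omega

end RealRAM

namespace Shortcut

open RealRAM

/-! ## The program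

Word variable 2 holds the number `m` of vertices, 3 holds `6 * m` and 18 holds `3 * m`.
Word arrays: 20 and 21 heads and tails of negative edges (plus one), 22 halves, 25 and 26 the
shortcut edges, 27 the imaginary negative edges, 37 the edges next to them, 28 the vertex and 29
the group of an index, 30 the targets of a group, 31 and 32 the tournament tree, 33 and 34 the
sorted targets of a group, 35 the starts of the blocks, 36 the numbers of the new copies. -/

namespace Alg

abbrev get1 (A : ℕ) (i : NExp) : NExp := .get A i (.lit 0)

/-- One if `a = b`, and zero otherwise. -/
abbrev eqInd (a b : NExp) : NExp := .minus (.minus (.lit 1) (.minus a b)) (.minus b a)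

/-- One if `a` is positive, and zero otherwise. -/
abbrev posInd (a : NExp) : NExp := .minus (.lit 1) (.minus (.lit 1) a)

abbrev isPos (a : NExp) : Bool × Test := (true, .nlt (.lit 0) a)

abbrev isNeg (a : RExp) : Bool × Test := (true, .rlt a (.var 0))

abbrev isNonneg (a : RExp) : Bool × Test := (false, .rlt a (.var 0))

abbrev pred (a : NExp) : NExp := .minus a (.lit 1)

/-- There is a Steiner edge from `i` to `j`. -/
abbrev isOut (i j : NExp) : Bool × Test :=
  isPos (.plus (.get 5 i j) (eqInd (get1 20 i) (.plus j (.lit 1))))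

/-- There is a Steiner edge from `j` to `i`. -/
abbrev isIn (i j : NExp) : Bool × Test :=
  isPos (.plus (.get 6 i j) (.minus (.minus (posInd (get1 20 i)) (.minus i j)) (.minus j i)))

/-- Variable `0` holds the number of vertices in the input but counts the new copies in the output;
its value is saved in variable `2` before it is reset. -/
def init : Prog :=
  .seq (.nset 2 (.var 0)) (.seq (.nset 18 (.plus (.var 2) (.plus (.var 2) (.var 2))))
    (.seq (.nset 3 (.plus (.var 18) (.var 18))) (.nset 0 (.lit 0))))

def headBody : Prog :=
  .seq (guard [isPos (.get 2 (.var 4) (.var 5))] (.nput 20 (.var 4) (.lit 0)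
      (.plus (.var 5) (.lit 1))))
    (guard [isPos (.get 2 (.var 5) (.var 4))] (.nput 21 (.var 4) (.lit 0)
      (.plus (.var 5) (.lit 1))))

def heads : Prog :=
  forLoop 4 2 (.seq (.seq (.nput 20 (.var 4) (.lit 0) (.lit 0)) (.nput 21 (.var 4) (.lit 0) (.lit 0)))
    (forLoop 5 2 headBody))

/-- The machine cannot divide. Array 22 tabulates `i / 2`, the parent of the node `i` of a binary
tree. -/
def halfBody : Prog :=
  .seq (.nput 22 (.plus (.var 4) (.var 4)) (.lit 0) (.var 4))
    (.nput 22 (.plus (.plus (.var 4) (.var 4)) (.lit 1)) (.lit 0) (.var 4))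

def halves : Prog := forLoop 4 2 halfBody

/-- An index is `j = k * m + v` with `k < 6`. For `k = 0, 1, 2` it stands for the edges out of `v`
that lie in `Γ`, (S4), (S5); for `k = 3, 4, 5` for the edges of these kinds into `v`. Variable `8`
runs through `j % m`. Copies of one base vertex share a group for `k = 0` and for `k = 3`; the other
groups are singletons, since shortcuts join base vertices. -/
def indexBody : Prog :=
  .seq (.nput 28 (.var 5) (.lit 0) (.var 8))
    (.seq (.ite (.nlt (.var 5) (.var 2)) (.nput 29 (.var 5) (.lit 0) (get1 0 (.var 8)))
      (.ite (.nlt (.var 5) (.var 18)) (.nput 29 (.var 5) (.lit 0) (.var 5))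
        (.ite (.nlt (.var 5) (.plus (.var 18) (.var 2)))
          (.nput 29 (.var 5) (.lit 0) (.plus (.var 18) (get1 0 (.var 8))))
          (.nput 29 (.var 5) (.lit 0) (.var 5)))))
      (.seq (.nset 8 (.plus (.var 8) (.lit 1)))
        (.ite (.nlt (.var 8) (.var 2)) .skip (.nset 8 (.lit 0)))))

def indices : Prog := .seq (.nset 8 (.lit 0)) (forLoop 5 3 indexBody)

def core₁Tests : List (Bool × Test) :=
  [isPos (get1 21 (.var 5)), isPos (.get 5 (.var 4) (pred (get1 21 (.var 5))))]

/-- Real array 3 holds `d¹(r, v) + Δ r`, so `Δ r` is subtracted again before the weight of the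
negative edge is added. -/
def core₁Wt : RExp :=
  .plus (.minus (.get 3 (.var 4) (pred (get1 21 (.var 5)))) (.get 2 (.var 4) (.lit 0)))
    (.get 1 (pred (get1 21 (.var 5))) (.var 5))

def core₁ : Prog := forLoop 4 2 (forLoop 5 2 (flagIf core₁Tests 25 (.var 4) (.var 5) core₁Wt))

def core₂Tests : List (Bool × Test) :=
  [isPos (get1 21 (.var 5)), isPos (get1 20 (.var 4)),
    isPos (.get 6 (pred (get1 21 (.var 5))) (pred (get1 20 (.var 4))))]

def core₂Wt : RExp :=
  .plus (.plus (.get 1 (.var 4) (pred (get1 20 (.var 4))))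
    (.plus (.get 4 (pred (get1 21 (.var 5))) (pred (get1 20 (.var 4))))
      (.get 2 (pred (get1 21 (.var 5))) (.lit 0))))
    (.get 1 (pred (get1 21 (.var 5))) (.var 5))

def core₂ : Prog := forLoop 4 2 (forLoop 5 2 (flagIf core₂Tests 26 (.var 4) (.var 5) core₂Wt))

abbrev vtx : NExp := get1 28 (.var 5)

abbrev sh : RExp := .get 0 vtx (.lit 0)

/-- Entries that belong to no Steiner edge are `0` in the input, so a negative entry already
certifies an imaginary edge and no membership test is needed. -/
def left₁ : Prog :=
  flagIf [isNeg (.get 3 (.var 4) vtx)] 27 (.var 4) (.var 5) (.minus sh (.get 3 (.var 4) vtx))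

def left₂ : Prog :=
  flagIf [isNeg (.get 4 (.var 4) vtx)] 27 (.var 4) (.var 5)
    (.minus (.minus (.var 0) (.get 4 (.var 4) vtx)) sh)

def lefts : Prog :=
  forLoop 4 2 (forLoop 5 3 (.ite (.nlt (.var 5) (.var 18)) left₁ left₂))

/-- Adding the shift of the common vertex makes the entries for different copies of one base vertex
comparable. -/
def rightFwd (A : ℕ) : Prog :=
  flagIf [isPos (.get A vtx (.var 7))] 37 (.var 5) (.var 7) (.plus (.get A vtx (.var 7)) sh)

def rightBwd (A : ℕ) : Prog :=
  flagIf [isPos (.get A (.var 7) vtx)] 37 (.var 5) (.var 7) (.minus (.get A (.var 7) vtx) sh)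

def rightBody : Prog :=
  .ite (.nlt (.var 5) (.var 2)) (rightFwd 1)
    (.ite (.nlt (.var 5) (.plus (.var 2) (.var 2))) (rightFwd 25)
      (.ite (.nlt (.var 5) (.var 18)) (rightFwd 26)
        (.ite (.nlt (.var 5) (.plus (.var 18) (.var 2))) (rightBwd 1)
          (.ite (.nlt (.var 5) (.plus (.var 18) (.plus (.var 2) (.var 2)))) (rightBwd 25)
            (rightBwd 26)))))

def rights : Prog := forLoop 5 3 (forLoop 7 2 rightBody)

abbrev grp : NExp := get1 29 (.var 5)

def keyBody : Prog :=
  guard [isPos (.get 37 (.var 5) (.var 7))]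
    (.ite (.nlt (.lit 0) (.get 30 grp (.var 7)))
      (.ite (.rlt (.get 37 (.var 5) (.var 7)) (.get 30 grp (.var 7)))
        (.rput 30 grp (.var 7) (.get 37 (.var 5) (.var 7))) .skip)
      (.seq (.rput 30 grp (.var 7) (.get 37 (.var 5) (.var 7)))
        (.nput 30 grp (.var 7) (.lit 1))))

def keys : Prog := forLoop 7 2 (forLoop 5 3 keyBody)

/-- Recompute the node `10` of the tournament tree of the group `4`. -/
def fix : Prog :=
  .seq (.nset 12 (get1 32 (.plus (.var 10) (.var 10))))
    (.seq (.nset 13 (get1 32 (.plus (.plus (.var 10) (.var 10)) (.lit 1))))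
      (.ite (.nlt (.lit 0) (get1 31 (.var 12)))
        (.ite (.nlt (.lit 0) (get1 31 (.var 13)))
          (.ite (.rlt (.get 30 (.var 4) (.var 13)) (.get 30 (.var 4) (.var 12)))
            (.nput 32 (.var 10) (.lit 0) (.var 13)) (.nput 32 (.var 10) (.lit 0) (.var 12)))
          (.nput 32 (.var 10) (.lit 0) (.var 12)))
        (.nput 32 (.var 10) (.lit 0) (.var 13))))

def leafBody : Prog :=
  .seq (.nput 31 (.var 7) (.lit 0) (.get 30 (.var 4) (.var 7)))
    (.nput 32 (.plus (.var 2) (.var 7)) (.lit 0) (.var 7))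

def buildBody : Prog :=
  .seq (.nset 10 (.minus (.minus (.var 2) (.lit 1)) (.var 7))) fix

def climb : Prog :=
  .while (.nlt (.lit 0) (.var 10)) (.seq fix (.nset 10 (get1 22 (.var 10))))

def removeRoot : Prog :=
  .seq (.nset 11 (get1 32 (.lit 1)))
    (.seq (.nput 33 (.var 4) (get1 34 (.var 4)) (.var 11))
      (.seq (.nput 34 (.var 4) (.lit 0) (.plus (get1 34 (.var 4)) (.lit 1)))
        (.seq (.nput 31 (.var 11) (.lit 0) (.lit 0))
          (.nset 10 (get1 22 (.plus (.var 2) (.var 11)))))))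

def extractBody : Prog :=
  guard [isPos (get1 31 (get1 32 (.lit 1)))] (.seq removeRoot climb)

def sortGroup : Prog :=
  .seq (forLoop 7 2 leafBody) (.seq (forLoop 7 2 buildBody)
    (.seq (.nput 34 (.var 4) (.lit 0) (.lit 0)) (forLoop 7 2 extractBody)))

def sorts : Prog := forLoop 4 3 sortGroup

/-- The recursion `a ↦ 2 * a + 1` from `0` produces the starts `2 ^ l - 1`; block `l` has length `2
^ l`. -/
def blocks : Prog :=
  .seq (.seq (.nset 14 (.lit 0)) (.nset 15 (.lit 0)))
    (.while (.nlt (.var 14) (.var 2))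
      (.seq (.nput 35 (.var 15) (.lit 0) (.var 14))
        (.seq (.nset 14 (.plus (.plus (.var 14) (.var 14)) (.lit 1)))
          (.nset 15 (.plus (.var 15) (.lit 1))))))

/-- The threshold of the block `6` of the group `g`. -/
abbrev thr (g : NExp) : RExp := .get 30 g (.get 33 g (get1 35 (.var 6)))

/-- The shift of a new copy is the threshold of its block in a forward group and the negative of the
threshold in a backward group, as keys of backward groups contain the shift with the opposite sign.
Blocks that start beyond the end of the list get no copy. -/
def allocBody : Prog :=
  guard [(true, .nlt (get1 35 (.var 6)) (get1 34 (.var 4)))]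
    (.seq (.nput 36 (.var 4) (.var 6) (.var 0))
      (.seq (.nput 10 (.var 0) (.lit 0) (get1 28 (.var 4)))
        (.seq (.ite (.nlt (.var 4) (.var 18)) (.rput 10 (.var 0) (.lit 0) (thr (.var 4)))
            (.rput 10 (.var 0) (.lit 0) (.minus (.var 0) (thr (.var 4)))))
          (.nset 0 (.plus (.var 0) (.lit 1))))))

def alloc : Prog := forLoop 4 3 (forLoop 6 15 allocBody)

/-- Emit an edge, or its reverse. -/
abbrev emitDir (o : Bool) (a b : NExp) (w : RExp) : Prog :=
  bif o then emit a b (.lit 0) w else emit b a (.lit 0) w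

abbrev copy : NExp := .plus (.plus (.var 2) (.var 2)) (.get 36 grp (.var 6))

def rightTests (o : Bool) : List (Bool × Test) :=
  [isPos (.get 37 (.var 5) (.var 7)), (o, .nlt (.var 5) (.var 18)),
    (true, .nlt (get1 35 (.var 6)) (get1 34 grp)),
    (false, .rlt (.get 37 (.var 5) (.var 7)) (thr grp))]

def copyRight (o : Bool) : Prog :=
  forLoop 5 3 (forLoop 7 2 (forLoop 6 15 (guard (rightTests o)
    (emitDir o copy (.var 7) (.minus (.get 37 (.var 5) (.var 7)) (thr grp))))))

abbrev target : NExp := .get 33 grp (.plus (get1 35 (.var 6)) (.var 7))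

def directTests : List (Bool × Test) :=
  [(true, .nlt (.plus (get1 35 (.var 6)) (.var 7)) (get1 34 grp)),
    isPos (.get 37 (.var 5) target),
    (false, .rlt (.get 37 (.var 5) target) (.get 27 (.var 4) (.var 5)))]

/-- A block that starts at `2 ^ l - 1` has `2 ^ l` positions, one more than its start; this is the
bound put into variable `8`. -/
def direct (o : Bool) : Prog :=
  .seq (.nset 8 (.plus (get1 35 (.var 6)) (.lit 1)))
    (forLoop 7 8 (guard directTests (emitDir o (.plus (.var 2) (.var 4)) target
      (.minus (.get 37 (.var 5) target) (.get 27 (.var 4) (.var 5))))))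

def leftTests (o : Bool) : List (Bool × Test) :=
  [isPos (.get 27 (.var 4) (.var 5)), (o, .nlt (.var 5) (.var 18)),
    (true, .nlt (get1 35 (.var 6)) (get1 34 grp))]

/-- When the threshold is below the value of the imaginary edge, an edge to the copy would be
negative, so the block is inspected target by target. Otherwise one edge to the copy serves the
whole block. -/
def copyLeft (o : Bool) : Prog :=
  forLoop 4 2 (forLoop 5 3 (forLoop 6 15 (guard (leftTests o)
    (.ite (.rlt (thr grp) (.get 27 (.var 4) (.var 5))) (direct o)
      (emitDir o (.plus (.var 2) (.var 4)) copy
        (.minus (thr grp) (.get 27 (.var 4) (.var 5))))))))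

def emitAll (bs : List (Bool × Test)) (a b f : NExp) (w : RExp) : Prog :=
  forLoop 4 2 (forLoop 5 2 (guard bs (emit a b f w)))

/-- The number of the Steiner vertex of `i`. -/
abbrev stn (i : NExp) : NExp := .plus (.var 2) i

/-- The head of the negative edge out of `i`. -/
abbrev hd (i : NExp) : NExp := pred (get1 20 i)

def emitGraph : Prog :=
  emitAll [isPos (.get 1 (.var 4) (.var 5))] (.var 4) (.var 5) (.get 2 (.var 4) (.var 5))
    (.get 1 (.var 4) (.var 5))

def emitCore (A : ℕ) : Prog :=
  emitAll [isPos (.get A (.var 4) (.var 5))] (.var 4) (.var 5) (.lit 1) (.get A (.var 4) (.var 5))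

def emitOut : Prog :=
  emitAll [isOut (.var 4) (.var 5), isNonneg (.get 3 (.var 4) (.var 5))] (stn (.var 4)) (.var 5)
    (.lit 0) (.get 3 (.var 4) (.var 5))

def emitIn : Prog :=
  emitAll [isIn (.var 4) (.var 5), isNonneg (.get 4 (.var 4) (.var 5))] (.var 5) (stn (.var 4))
    (.lit 0) (.get 4 (.var 4) (.var 5))

/-- Paths `(u, r), (r, r')` through a Steiner vertex. -/
def emitMid₁ : Prog :=
  emitAll [isIn (.var 4) (.var 5), isPos (get1 20 (.var 4)),
      isNonneg (.plus (.get 4 (.var 4) (.var 5)) (.get 3 (.var 4) (hd (.var 4))))]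
    (.var 5) (hd (.var 4)) (.lit 0)
    (.plus (.get 4 (.var 4) (.var 5)) (.get 3 (.var 4) (hd (.var 4))))

/-- Paths `(r, r), (r, v)` through a Steiner vertex. -/
def emitMid₂ : Prog :=
  emitAll [isOut (.var 4) (.var 5), isPos (get1 20 (.var 4)),
      isNonneg (.plus (.get 4 (.var 4) (.var 4)) (.get 3 (.var 4) (.var 5)))]
    (.var 4) (.var 5) (.lit 0) (.plus (.get 4 (.var 4) (.var 4)) (.get 3 (.var 4) (.var 5)))

/-- Paths `(r, s), (s, s)` between Steiner vertices. -/
def emitTwo₁ : Prog :=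
  emitAll [isOut (.var 4) (.var 5), isPos (get1 20 (.var 4)), isPos (get1 20 (.var 5)),
      isNonneg (.plus (.get 3 (.var 4) (.var 5)) (.get 4 (.var 5) (.var 5)))]
    (stn (.var 4)) (stn (.var 5)) (.lit 0)
    (.plus (.get 3 (.var 4) (.var 5)) (.get 4 (.var 5) (.var 5)))

/-- Paths `(r, r'), (r', s)` between Steiner vertices. -/
def emitTwo₂ : Prog :=
  emitAll [isPos (get1 20 (.var 4)), isIn (.var 5) (hd (.var 4)), isPos (get1 20 (.var 5)),
      isNonneg (.plus (.get 3 (.var 4) (hd (.var 4))) (.get 4 (.var 5) (hd (.var 4))))]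
    (stn (.var 4)) (stn (.var 5)) (.lit 0)
    (.plus (.get 3 (.var 4) (hd (.var 4))) (.get 4 (.var 5) (hd (.var 4))))

def prepare : Prog :=
  .seq init (.seq heads (.seq halves (.seq indices (.seq core₁ (.seq core₂ (.seq lefts rights))))))

def sorting : Prog := .seq keys (.seq sorts (.seq blocks alloc))

def emitBase : Prog :=
  .seq emitGraph (.seq (emitCore 25) (.seq (emitCore 26) (.seq emitOut (.seq emitIn
    (.seq emitMid₁ (.seq emitMid₂ (.seq emitTwo₁ emitTwo₂)))))))

def emitCopies : Prog :=
  .seq (copyRight true) (.seq (copyRight false) (.seq (copyLeft true) (copyLeft false)))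

def main : Prog := .seq prepare (.seq sorting (.seq emitBase emitCopies))

end Alg

end Shortcut

namespace Shortcut

open RealRAM

/-- The bounds on words for a graph with `m` vertices. -/
structure Par (W U B m : ℕ) : Prop where
  hU : B + 20 * (m + 1) ≤ U
  hW : 3 * U ≤ W

namespace Alg

/-! ## The keys of the targets of a group -/

/-- After the indices below `n` have been processed, the key of the target `w` of the group `g` is
the least weight of an edge to `w` from a member of `g`. -/
structure KeySpec (s : Mem) (n g w : ℕ) : Prop where
  exists_eq : 0 < s.narr 30 g w →
    ∃ j < n, s.narr 29 j 0 = g ∧ 0 < s.narr 37 j w ∧ s.rarr 30 g w = s.rarr 37 j w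
  le : ∀ j < n, s.narr 29 j 0 = g → 0 < s.narr 37 j w →
    0 < s.narr 30 g w ∧ s.rarr 30 g w ≤ s.rarr 37 j w

theorem KeySpec.congr {s s' : Mem} {n g w : ℕ} (h : KeySpec s n g w)
    (h₁ : s'.narr 29 = s.narr 29) (h₂ : s'.narr 37 = s.narr 37) (h₃ : s'.rarr 37 = s.rarr 37)
    (h₄ : s'.narr 30 g w = s.narr 30 g w) (h₅ : s'.rarr 30 g w = s.rarr 30 g w) :
    KeySpec s' n g w := by
  constructor
  · rw [h₁, h₂, h₃, h₄, h₅]; exact h.exists_eq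
  · rw [h₁, h₂, h₃, h₄, h₅]; exact h.le

def keyCost : ℕ :=
  ([isPos (.get 37 (.var 5) (.var 7))].map fun b => b.2.cost).sum +
    (Prog.ite (.nlt (.lit 0) (.get 30 grp (.var 7)))
      (.ite (.rlt (.get 37 (.var 5) (.var 7)) (.get 30 grp (.var 7)))
        (.rput 30 grp (.var 7) (.get 37 (.var 5) (.var 7))) .skip)
      (.seq (.rput 30 grp (.var 7) (.get 37 (.var 5) (.var 7)))
        (.nput 30 grp (.var 7) (.lit 1)))).steps

variable {W U B m : ℕ}

theorem keyBody_wp (hP : Par W U B m) {s : Mem} {j w M : ℕ} (hj : s.nvar 5 = j) (hw : s.nvar 7 = w)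
    (hjM : j < M) (hM : M ≤ 6 * m) (hwm : w < m) (hk : ∀ g, KeySpec s j g w) :
    WP W U B keyBody s keyCost (fun s' => (∀ g, KeySpec s' (j + 1) g w) ∧
      ∀ g w', w' ≠ w → s'.narr 30 g w' = s.narr 30 g w' ∧ s'.rarr 30 g w' = s.rarr 30 g w') := by
  have := hP.hU
  have := hP.hW
  refine WP.assume fun hS _ _ => ?_
  have hS' : ∀ A i j, s.narr A i j ≤ W := fun A i j => (hS A i j).trans (by omega)
  refine WP.guard (Prog.steps_pos _) (fun _ => ?_) (fun hp => ?_) (fun hp => ?_)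
  · simp [Test.Fits, NExp.Fits, hj, hw, NExp.val, hS']; omega
  · have hp : 0 < s.narr 37 j w := by
      simpa [Passes, Test.Holds, NExp.val, hj, hw] using hp
    have hg := hk (s.narr 29 j 0)
    refine WP.of_pre fun _ _ _ => ?_
    refine ⟨by simp [Test.Fits, NExp.Fits, hj, hw, NExp.val, hS']; omega, fun h₁ => ?_,
      fun h₁ => ?_⟩
    · simp only [Test.Holds, NExp.val, hj, hw] at h₁
      refine ⟨by simp [Test.Fits, RExp.Fits, NExp.Fits, hj, hw, NExp.val, hS']; omega,
        fun h₂ => ?_, fun h₂ => ?_⟩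
      · simp only [Test.Holds, RExp.val, NExp.val, hj, hw] at h₂
        refine ⟨by simp [NExp.Fits, hj, NExp.val, hS']; omega, by simp [NExp.Fits, hw]; omega,
          by simp [RExp.Fits, NExp.Fits, hj, hw]; omega, fun g => ?_, fun g w' hw' => ?_⟩
        · simp only [NExp.val, RExp.val, hj, hw]
          by_cases hgg : g = s.narr 29 j 0
          · subst hgg
            constructor
            · intro _
              exact ⟨j, by omega, rfl, hp, by simp [Mem.putR]⟩
            · intro j' hj' hgj hR
              refine ⟨h₁, ?_⟩
              rcases Nat.lt_succ_iff_lt_or_eq.mp hj' with h | rfl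
              · have := (hg.le j' h hgj hR).2
                simp only [Mem.putR] at this ⊢
                simp
                linarith
              · simp [Mem.putR]
          · constructor
            · intro h
              obtain ⟨j', h₁, h₂, h₃, h₄⟩ := (hk g).exists_eq h
              exact ⟨j', by omega, h₂, h₃, by simpa [Mem.putR, hgg] using h₄⟩
            · intro j' hj' hgj hR
              rcases Nat.lt_succ_iff_lt_or_eq.mp hj' with h | rfl
              · simpa [Mem.putR, hgg] using (hk g).le j' h hgj hR
              · exact absurd hgj.symm hgg
        · simp [Mem.putR, NExp.val, hw, hw']
      · simp only [Test.Holds, RExp.val, NExp.val, hj, hw, not_lt] at h₂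
        refine ⟨fun g => ?_, fun g w' hw' => ⟨rfl, rfl⟩⟩
        constructor
        · intro h
          obtain ⟨j', h₁, h₂⟩ := (hk g).exists_eq h
          exact ⟨j', by omega, h₂⟩
        · intro j' hj' hgj hR
          rcases Nat.lt_succ_iff_lt_or_eq.mp hj' with h | rfl
          · exact (hk g).le j' h hgj hR
          · subst hgj; exact ⟨h₁, h₂⟩
    · simp only [Test.Holds, NExp.val, hj, hw, not_lt, Nat.le_zero] at h₁
      refine ⟨by simp [NExp.Fits, hj, NExp.val, hS']; omega, by simp [NExp.Fits, hw]; omega,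
        by simp [RExp.Fits, NExp.Fits, hj, hw]; omega,
        by simp [NExp.Fits, Mem.putR, hj, NExp.val, hS']; omega,
        by simp [NExp.Fits, Mem.putR, hw]; omega, by simp [NExp.Fits]; omega,
        by simp [NExp.val]; omega, fun _ => ⟨fun g => ?_, fun g w' hw' => ?_⟩⟩
      · by_cases hgg : g = s.narr 29 j 0
        · subst hgg
          constructor
          · intro _
            exact ⟨j, by omega, by simp [Mem.putR, Mem.putN], by simpa [Mem.putR, Mem.putN] using hp,
              by simp [Mem.putR, Mem.putN, NExp.val, RExp.val, hj, hw]⟩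
          · intro j' hj' hgj hR
            simp [Mem.putR, Mem.putN] at hgj hR
            rcases Nat.lt_succ_iff_lt_or_eq.mp hj' with h | rfl
            · have := (hg.le j' h hgj hR).1
              omega
            · simp [Mem.putR, Mem.putN, NExp.val, RExp.val, hj, hw]
        · refine KeySpec.congr (s := s) ⟨?_, ?_⟩ ?_ ?_ ?_ ?_ ?_
          · intro h
            obtain ⟨j', h₁, h₂⟩ := (hk g).exists_eq h
            exact ⟨j', by omega, h₂⟩
          · intro j' hj' hgj hR
            rcases Nat.lt_succ_iff_lt_or_eq.mp hj' with h | rfl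
            · exact (hk g).le j' h hgj hR
            · exact absurd hgj.symm hgg
          · ext; simp [Mem.putR, Mem.putN]
          · ext; simp [Mem.putR, Mem.putN]
          · ext; simp [Mem.putR, Mem.putN]
          · simp [Mem.putR, Mem.putN, NExp.val, hj, hgg]
          · simp [Mem.putR, Mem.putN, NExp.val, hj, hgg]
      · simp [Mem.putR, Mem.putN, NExp.val, hw, hw']
  · have hp : s.narr 37 j w = 0 := by
      simpa [Passes, Test.Holds, NExp.val, hj, hw] using hp
    refine ⟨fun g => ⟨fun h => ?_, fun j' hj' hgj hR => ?_⟩, fun g w' hw' => ⟨rfl, rfl⟩⟩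
    · obtain ⟨j', h₁, h₂⟩ := (hk g).exists_eq h
      exact ⟨j', by omega, h₂⟩
    · rcases Nat.lt_succ_iff_lt_or_eq.mp hj' with h | rfl
      · exact (hk g).le j' h hgj hR
      · omega

/-- All flags in array 30 start at zero and targets are treated one at a time, so a positive flag
for the current target means that some member of the group has already entered a key. -/
theorem keys_wp (hP : Par W U B m) {s : Mem} {M : ℕ} (hm : s.nvar 2 = m) (h3 : s.nvar 3 = M)
    (hM : M ≤ 6 * m) (h0 : ∀ g w, s.narr 30 g w = 0) :
    WP W U B keys s (m * (M * (keyCost + 7) + 5 + 7) + 5)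
      (fun s' => ∀ g, ∀ w < m, KeySpec s' M g w) := by
  have := hP.hU
  have := hP.hW
  refine (WP.forLoop_const (fun k s' => (∀ g, ∀ w < k, KeySpec s' M g w) ∧
    ∀ g, ∀ w, k ≤ w → s'.narr 30 g w = 0) (by decide) (by decide) (by decide) (by decide) hm
    (by omega) ?_ ?_).conseq le_rfl fun s' _ h => h.1
  · exact ⟨by simp, fun g w _ => h0 g w⟩
  · intro w s₁ hw hF hw₁ ⟨hk, hz⟩
    have hF₃ : s₁.nvar 3 = M := (hF.nvar 3 (by decide)).trans h3
    refine (WP.forLoop_const (fun j s' => (∀ g, KeySpec s' j g w) ∧ ∀ g w', w' ≠ w →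
      s'.narr 30 g w' = s₁.narr 30 g w' ∧ s'.rarr 30 g w' = s₁.rarr 30 g w')
      (by decide) (by decide) (by decide) (by decide) hF₃ (by omega) ?_ ?_).conseq le_rfl ?_
    · refine ⟨fun g => ⟨fun h => ?_, fun j hj => by omega⟩, fun g w' _ => ⟨rfl, rfl⟩⟩
      have : 0 < s₁.narr 30 g w := h
      have := hz g w le_rfl
      omega
    · rintro j s₂ hj hF₂ hj₂ ⟨hk₂, hz₂⟩
      refine (keyBody_wp hP hj₂ ((hF₂.nvar 7 (by decide)).trans hw₁) hj hM hw hk₂).conseq le_rfl ?_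
      rintro s₃ - ⟨h₁, h₂⟩
      refine ⟨fun g => (h₁ g).congr rfl rfl rfl rfl rfl, fun g w' hw' => ?_⟩
      exact ⟨(h₂ g w' hw').1.trans (hz₂ g w' hw').1, (h₂ g w' hw').2.trans (hz₂ g w' hw').2⟩
    · rintro s₂ hF₂ ⟨hk₂, hz₂⟩
      refine ⟨fun g w' hw' => ?_, fun g w' hw' => ?_⟩
      · rcases Nat.lt_succ_iff_lt_or_eq.mp hw' with h | rfl
        · exact (hk g w' h).congr (hF₂.narr 29 (by decide)) (hF₂.narr 37 (by decide))
            (hF₂.rarr 37 (by decide)) (hz₂ g w' h.ne).1 (hz₂ g w' h.ne).2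
        · exact (hk₂ g).congr rfl rfl rfl rfl rfl
      · exact (hz₂ g w' (by omega)).1.trans (hz g w' (by omega))

end Alg

end Shortcut

namespace Shortcut

open RealRAM

namespace Alg

/-! ## Sorting the targets of a group with a tournament tree -/

/-- In the tournament of the group `g`, the target `x` is at least as good as `y`. -/
def Le (s : Mem) (g x y : ℕ) : Prop :=
  0 < s.narr 31 y 0 → 0 < s.narr 31 x 0 ∧ s.rarr 30 g x ≤ s.rarr 30 g y

theorem Le.trans {s : Mem} {g x y z : ℕ} (h : Le s g x y) (h' : Le s g y z) : Le s g x z :=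
  fun hz => ⟨(h (h' hz).1).1, (h (h' hz).1).2.trans (h' hz).2⟩

theorem Le.refl (s : Mem) (g x : ℕ) : Le s g x x := fun h => ⟨h, le_rfl⟩

/-- The node `i` of the tree holds the better one of its two children. -/
structure Valid (s : Mem) (g i : ℕ) : Prop where
  mem : s.narr 32 i 0 = s.narr 32 (2 * i) 0 ∨ s.narr 32 i 0 = s.narr 32 (2 * i + 1) 0
  le : Le s g (s.narr 32 i 0) (s.narr 32 (2 * i) 0)
  le' : Le s g (s.narr 32 i 0) (s.narr 32 (2 * i + 1) 0)

theorem Valid.congr {s s' : Mem} {g i : ℕ} (h : Valid s g i)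
    (h₁ : s'.narr 31 = s.narr 31) (h₂ : s'.rarr 30 = s.rarr 30)
    (h₃ : s'.narr 32 i 0 = s.narr 32 i 0) (h₄ : s'.narr 32 (2 * i) 0 = s.narr 32 (2 * i) 0)
    (h₅ : s'.narr 32 (2 * i + 1) 0 = s.narr 32 (2 * i + 1) 0) : Valid s' g i := by
  constructor
  · rw [h₃, h₄, h₅]; exact h.mem
  · rw [h₃, h₄]; unfold Le; rw [h₁, h₂]; exact h.le
  · rw [h₃, h₅]; unfold Le; rw [h₁, h₂]; exact h.le'

variable {W U B m : ℕ}

/-- Node `0` would be its own left child, so validity can be expected for `1 ≤ i` only; there both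
children differ from `i` and are not overwritten. -/
theorem fix_wp (hP : Par W U B m) {s : Mem} {g i : ℕ} (hg : s.nvar 4 = g) (hi : s.nvar 10 = i)
    (him : i < m) (hgm : g < 6 * m) :
    WP W U B fix s fix.steps (fun s' => (1 ≤ i → Valid s' g i) ∧
      ∀ j, j ≠ i → s'.narr 32 j 0 = s.narr 32 j 0) := by
  have := hP.hU
  have := hP.hW
  refine WP.of_pre fun hS _ _ => ?_
  have hS' : ∀ A i j, s.narr A i j ≤ W := fun A i j => (hS A i j).trans (by omega)
  have hS'' : ∀ A i j, s.narr A i j ≤ U := hS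
  have e : i + i = 2 * i := by ring
  have h4 : g ≤ W := by omega
  have h10 : i ≤ W := by omega
  have h20 : 2 * i ≤ W := by omega
  have h21 : 2 * i + 1 ≤ W := by omega
  have hW1 : 1 ≤ W := by omega
  have key : ∀ z, (z = s.narr 32 (2 * i) 0 ∨ z = s.narr 32 (2 * i + 1) 0) →
      Le s g z (s.narr 32 (2 * i) 0) → Le s g z (s.narr 32 (2 * i + 1) 0) →
      ∀ s' : Mem, s'.narr 31 = s.narr 31 → s'.rarr 30 = s.rarr 30 →
      (∀ j, s'.narr 32 j 0 = if j = i then z else s.narr 32 j 0) →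
      (1 ≤ i → Valid s' g i) ∧ ∀ j, j ≠ i → s'.narr 32 j 0 = s.narr 32 j 0 := by
    intro z hz h₁ h₂ s' e₁ e₂ e₃
    refine ⟨fun hi1 => ?_, fun j hj => by rw [e₃, if_neg hj]⟩
    have n₁ : 2 * i ≠ i := by omega
    have n₂ : 2 * i + 1 ≠ i := by omega
    constructor
    · rw [e₃, e₃, e₃, if_pos rfl, if_neg n₁, if_neg n₂]; exact hz
    · rw [e₃, e₃, if_pos rfl, if_neg n₁]; unfold Le; rw [e₁, e₂]; exact h₁
    · rw [e₃, e₃, if_pos rfl, if_neg n₂]; unfold Le; rw [e₁, e₂]; exact h₂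
  simp only [fix, Prog.pre, NExp.Fits, NExp.val, Test.Fits, RExp.Fits, Test.Holds, RExp.val,
    Mem.setN, hi, hg, e]
  simp only [zero_le, true_and, and_true, Nat.reduceEqDiff, if_true, if_false, e, hS', hS'',
    h4, h10, h20, h21, hW1, not_lt, Nat.le_zero, Nat.reduceLeDiff, false_imp_iff]
  refine ⟨fun hx => ⟨fun hy => ⟨fun hlt => ?_, fun hlt => ?_⟩, fun hy => ?_⟩, fun hx => ?_⟩
  · intro _
    refine key _ (Or.inr rfl) (fun _ => ⟨hy, hlt.le⟩) (Le.refl _ _ _) _ rfl rfl fun j => ?_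
    simp [Mem.putN]
  · intro _
    refine key _ (Or.inl rfl) (Le.refl _ _ _) (fun _ => ⟨hx, hlt⟩) _ rfl rfl fun j => ?_
    simp [Mem.putN]
  · intro _
    refine key _ (Or.inl rfl) (Le.refl _ _ _) (fun h => ?_) _ rfl rfl fun j => ?_
    · exact absurd h (by omega)
    · simp [Mem.putN]
  · intro _
    refine key _ (Or.inr rfl) (fun h => ?_) (Le.refl _ _ _) _ rfl rfl fun j => ?_
    · exact absurd h (by omega)
    · simp [Mem.putN]

/-- `j` is `i` or an ancestor of `i` in the tree. -/
def Anc (j i : ℕ) : Prop := ∃ e : ℕ, i / 2 ^ e = j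

theorem Anc.self (i : ℕ) : Anc i i := ⟨0, by simp⟩

theorem Anc.parent {j i : ℕ} (h : Anc j i) : Anc (j / 2) i := by
  obtain ⟨e, he⟩ := h
  exact ⟨e + 1, by rw [← he, pow_succ, Nat.div_div_eq_div_mul]⟩

theorem Anc.eq_or {j i : ℕ} (h : Anc j i) : j = i ∨ Anc j (i / 2) := by
  obtain ⟨e, he⟩ := h
  cases e with
  | zero => left; simpa using he.symm
  | succ e => right; exact ⟨e, by rw [← he, pow_succ', Nat.div_div_eq_div_mul]⟩

theorem Anc.zero {j : ℕ} (h : Anc j 0) : j = 0 := by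
  obtain ⟨e, he⟩ := h
  simpa using he.symm

/-- The leaves of the tree. -/
def Leaves (s : Mem) (m : ℕ) : Prop := ∀ w < m, s.narr 32 (m + w) 0 = w

/-- An entry is always passed up unchanged from a child, so following it down ends at the leaf of
the target it names. Hence a target occurs only at ancestors of its own leaf, and its removal can
spoil only those nodes. -/
theorem node_mem {s : Mem} {g m : ℕ} (hl : Leaves s m)
    (hv : ∀ i, 1 ≤ i → i < m → Valid s g i) {j : ℕ} (hj : 1 ≤ j) (hjm : j < 2 * m) :
    ∃ w < m, s.narr 32 j 0 = w ∧ Anc j (m + w) := by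
  induction hd : 2 * m - j using Nat.strong_induction_on generalizing j with
  | _ d ih =>
    rcases lt_or_ge j m with h | h
    · rcases (hv j hj h).mem with hc | hc
      · obtain ⟨w, hw, h₁, h₂⟩ := ih (2 * m - 2 * j) (by omega) (j := 2 * j) (by omega)
          (by omega) rfl
        refine ⟨w, hw, hc.trans h₁, ?_⟩
        have := h₂.parent
        rwa [show 2 * j / 2 = j by omega] at this
      · obtain ⟨w, hw, h₁, h₂⟩ := ih (2 * m - (2 * j + 1)) (by omega) (j := 2 * j + 1) (by omega)
          (by omega) rfl
        refine ⟨w, hw, hc.trans h₁, ?_⟩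
        have := h₂.parent
        rwa [show (2 * j + 1) / 2 = j by omega] at this
    · refine ⟨j - m, by omega, ?_, ?_⟩
      · have := hl (j - m) (by omega)
        rwa [show m + (j - m) = j by omega] at this
      · rw [show m + (j - m) = j by omega]
        exact Anc.self j

theorem root_le {s : Mem} {g m : ℕ} (hv : ∀ i, 1 ≤ i → i < m → Valid s g i) {j : ℕ} (hj : 1 ≤ j)
    (hjm : j < 2 * m) : Le s g (s.narr 32 1 0) (s.narr 32 j 0) := by
  induction j using Nat.strong_induction_on with
  | _ j ih =>
    rcases Nat.lt_or_ge 1 j with h | h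
    · refine (ih (j / 2) (by omega) (by omega) (by omega)).trans ?_
      have := hv (j / 2) (by omega) (by omega)
      rcases Nat.mod_two_eq_zero_or_one j with h | h
      · have := this.le
        rwa [show 2 * (j / 2) = j by omega] at this
      · have := this.le'
        rwa [show 2 * (j / 2) + 1 = j by omega] at this
    · obtain rfl : j = 1 := by omega
      exact Le.refl _ _ _

def climbCost : ℕ := fix.steps + (Prog.nset 10 (get1 22 (.var 10))).steps +
  (Test.nlt (.lit 0) (.var 10)).cost

/-- Invalid nodes may lie only on the path from variable `10` to the root. Each pass repairs the
lowest of them and moves to its parent, and a number below `2 ^ d` can be halved at most `d` times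
before it is zero. -/
theorem climb_wp (hP : Par W U B m) {s : Mem} {g d : ℕ} (hg : s.nvar 4 = g) (hgm : g < 6 * m)
    (hh : ∀ i < 2 * m, s.narr 22 i 0 = i / 2) (hl : Leaves s m) (him : s.nvar 10 < m)
    (hd : s.nvar 10 < 2 ^ d) (hv : ∀ j, 1 ≤ j → j < m → ¬ Anc j (s.nvar 10) → Valid s g j) :
    WP W U B climb s (d * climbCost + 3) (fun s' => Leaves s' m ∧
      ∀ j, 1 ≤ j → j < m → Valid s' g j) := by
  have := hP.hU
  have := hP.hW
  refine (WP.while (s₀ := s) (T := fix.steps + (Prog.nset 10 (get1 22 (.var 10))).steps)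
    (fun d s' => s'.nvar 10 < m ∧ s'.nvar 10 < 2 ^ d ∧ Leaves s' m ∧
      ∀ j, 1 ≤ j → j < m → ¬ Anc j (s'.nvar 10) → Valid s' g j) ?_ ?_
      ⟨him, hd, hl, hv⟩).conseq le_rfl ?_
  · rintro d s' - - ⟨h, -⟩
    simp [Test.Fits, NExp.Fits]; omega
  · rintro d s₁ hF ⟨h₁, h₂, h₃, h₄⟩ hb
    replace hb : 0 < s₁.nvar 10 := hb
    obtain ⟨d', rfl⟩ : ∃ d', d = d' + 1 := by
      cases d with
      | zero => simp at h₂; omega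
      | succ d => exact ⟨d, rfl⟩
    refine ⟨d', rfl, WP.seq (fix_wp hP ((hF.nvar 4 (by decide)).trans hg) rfl h₁ hgm) ?_⟩
    rintro s₂ hF₂ ⟨h₅, h₆⟩
    have e10 : s₂.nvar 10 = s₁.nvar 10 := hF₂.nvar 10 (by decide)
    have e22 : s₂.narr 22 (s₁.nvar 10) 0 = s₁.nvar 10 / 2 := by
      rw [hF₂.narr 22 (by decide), hF.narr 22 (by decide)]
      exact hh _ (by omega)
    refine WP.of_pre fun hS _ _ => ⟨?_, ?_, ?_, ?_, ?_, ?_⟩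
    · have := hS 22 (s₂.nvar 10) 0
      simp only [NExp.Fits, NExp.val]; omega
    · simp
    · simp [Mem.setN, NExp.val, e10, e22]; omega
    · simp [Mem.setN, NExp.val, e10, e22]; rw [pow_succ] at h₂; omega
    · intro w hw
      have := h₆ (m + w) (by omega)
      simpa [Mem.setN, this] using h₃ w hw
    · intro j hj hjm hA
      have hA' : ¬ Anc j (s₁.nvar 10 / 2) := by
        simpa [Mem.setN, NExp.val, e10, e22] using hA
      suffices H : Valid s₂ g j from ⟨H.mem, H.le, H.le'⟩
      by_cases hji : j = s₁.nvar 10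
      · rw [hji]; exact h₅ (by omega)
      · have hn : ¬ Anc j (s₁.nvar 10) := fun h => (h.eq_or.resolve_left hji |> hA')
        -- If a child of `j` were the repaired node, then `j` would be its parent and hence one of
        -- the nodes still to be repaired; so the children of `j` are unchanged.
        refine (h₄ j hj hjm hn).congr (hF₂.narr 31 (by decide)) (hF₂.rarr 30 (by decide))
          (h₆ j hji) (h₆ _ fun h => hA' ?_) (h₆ _ fun h => hA' ?_)
        · rw [← h, show 2 * j / 2 = j by omega]; exact Anc.self j
        · rw [← h, show (2 * j + 1) / 2 = j by omega]; exact Anc.self j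
  · rintro s' hF ⟨⟨d', h₁, h₂, h₃, h₄⟩, hb⟩
    refine ⟨h₃, fun j hj hjm => h₄ j hj hjm fun hA => ?_⟩
    have h0 : s'.nvar 10 = 0 := by simpa [Test.Holds, NExp.val] using hb
    rw [h0] at hA
    have := hA.zero
    omega

end Alg

end Shortcut

/-! ### Correctness and cost of the tournament sort. -/

namespace Shortcut

open RealRAM

namespace Alg

/-- Row `g` of array 33 lists the targets of the group `g` by increasing keys. -/
structure Sorted (s : Mem) (m g : ℕ) : Prop where
  len_le : s.narr 34 g 0 ≤ m
  mem : ∀ p < s.narr 34 g 0, s.narr 33 g p < m ∧ 0 < s.narr 30 g (s.narr 33 g p)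
  surj : ∀ w < m, 0 < s.narr 30 g w → ∃ p < s.narr 34 g 0, s.narr 33 g p = w
  mono : ∀ p q, p ≤ q → q < s.narr 34 g 0 →
    s.rarr 30 g (s.narr 33 g p) ≤ s.rarr 30 g (s.narr 33 g q)
  inj : ∀ p q, p < s.narr 34 g 0 → q < s.narr 34 g 0 → s.narr 33 g p = s.narr 33 g q → p = q

theorem Sorted.congr {s s' : Mem} {m g : ℕ} (h : Sorted s m g) (h₁ : s'.narr 34 g 0 = s.narr 34 g 0)
    (h₂ : s'.narr 33 g = s.narr 33 g) (h₃ : s'.narr 30 = s.narr 30) (h₄ : s'.rarr 30 = s.rarr 30) :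
    Sorted s' m g := by
  constructor
  · rw [h₁]; exact h.len_le
  · rw [h₁, h₂, h₃]; exact h.mem
  · rw [h₁, h₂, h₃]; exact h.surj
  · rw [h₁, h₂, h₄]; exact h.mono
  · rw [h₁, h₂]; exact h.inj

/-- The state of the extraction after `k` rounds. -/
structure Extracted (s : Mem) (m g k : ℕ) : Prop where
  leaves : Leaves s m
  valid : ∀ j, 1 ≤ j → j < m → Valid s g j
  mem : ∀ p < s.narr 34 g 0, s.narr 33 g p < m ∧ 0 < s.narr 30 g (s.narr 33 g p) ∧
    s.narr 31 (s.narr 33 g p) 0 = 0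
  alive : ∀ w < m, 0 < s.narr 31 w 0 → 0 < s.narr 30 g w
  surj : ∀ w < m, 0 < s.narr 30 g w → 0 < s.narr 31 w 0 ∨ ∃ p < s.narr 34 g 0, s.narr 33 g p = w
  mono : ∀ p q, p ≤ q → q < s.narr 34 g 0 →
    s.rarr 30 g (s.narr 33 g p) ≤ s.rarr 30 g (s.narr 33 g q)
  inj : ∀ p q, p < s.narr 34 g 0 → q < s.narr 34 g 0 → s.narr 33 g p = s.narr 33 g q → p = q
  le : ∀ p < s.narr 34 g 0, ∀ w < m, 0 < s.narr 31 w 0 →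
    s.rarr 30 g (s.narr 33 g p) ≤ s.rarr 30 g w
  len : s.narr 34 g 0 = k ∨ (s.narr 34 g 0 ≤ k ∧ ∀ w < m, s.narr 31 w 0 = 0)

/-- If the list has length `m`, its entries are an injective and hence surjective self-map of `Fin
m`, so every target has been extracted. Otherwise some round was idle, which happens only when no
target is left. In both cases nothing with a key is missing. -/
theorem Extracted.sorted {s : Mem} {m g : ℕ} (h : Extracted s m g m) : Sorted s m g := by
  have hd : ∀ w < m, s.narr 31 w 0 = 0 := by
    rcases h.len with hl | hl
    · let f : Fin m → Fin m := fun p => ⟨s.narr 33 g p, (h.mem p (by rw [hl]; exact p.2)).1⟩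
      have hf : Function.Injective f := by
        intro p q hpq
        refine Fin.ext (h.inj p q (by rw [hl]; exact p.2) (by rw [hl]; exact q.2) ?_)
        simpa [f] using hpq
      intro w hw
      obtain ⟨p, hp⟩ := Finite.surjective_of_injective hf ⟨w, hw⟩
      have hp : s.narr 33 g p = w := by simpa [f] using hp
      rw [← hp]
      exact (h.mem p (by rw [hl]; exact p.2)).2.2
    · exact hl.2
  refine ⟨?_, fun p hp => ⟨(h.mem p hp).1, (h.mem p hp).2.1⟩, fun w hw hk => ?_, h.mono, h.inj⟩
  · rcases h.len with hl | hl
    · exact hl.le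
    · exact hl.1
  · exact (h.surj w hw hk).resolve_left (by rw [hd w hw]; simp)

variable {W U B m : ℕ}

theorem leaves_wp (hP : Par W U B m) {s : Mem} {g : ℕ} (hm : s.nvar 2 = m) (hg : s.nvar 4 = g)
    (hgm : g < 6 * m) :
    WP W U B (forLoop 7 2 leafBody) s (m * (leafBody.steps + 7) + 5)
      (fun s' => Leaves s' m ∧ ∀ w < m, s'.narr 31 w 0 = s.narr 30 g w) := by
  have := hP.hU
  have := hP.hW
  refine (WP.forLoop_all (fun w s' => s'.narr 32 (m + w) 0 = w ∧ s'.narr 31 w 0 = s.narr 30 g w)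
    (fun _ _ _ h => h) (by decide) (by decide) (by decide) (by decide) hm (by omega) ?_).conseq
    le_rfl fun s' _ h => ⟨fun w hw => (h w hw).1, fun w hw => (h w hw).2⟩
  intro w s₁ hw hF hw₁
  have h4 : s₁.nvar 4 = g := (hF.nvar 4 (by decide)).trans hg
  have h2 : s₁.nvar 2 = m := (hF.nvar 2 (by decide)).trans hm
  have h30 : s₁.narr 30 = s.narr 30 := hF.narr 30 (by decide)
  refine WP.of_pre fun hS _ _ => ?_
  have hS₁ : s.narr 30 g w ≤ U := by have := hS 30 g w; rwa [h30] at this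
  simp only [leafBody, Prog.pre, NExp.Fits, NExp.val, h4, h2, hw₁, h30, Mem.putN]
  refine ⟨by omega, by omega, ⟨by omega, by omega, by omega⟩, hS₁, fun _ =>
    ⟨⟨by omega, by omega, by omega⟩, by omega, by omega, by omega, fun _ => ⟨?_, ?_⟩⟩⟩
  · simp
  · intro w' hw' h
    have e₁ : w' ≠ w := by omega
    simpa [e₁] using h

/-- Nodes are treated in the order `m - 1, …, 0`, so children are final before their parent is
computed; the last round, for node `0`, is harmless. -/
theorem build_wp (hP : Par W U B m) {s : Mem} {g : ℕ} (hm : s.nvar 2 = m) (hg : s.nvar 4 = g)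
    (hgm : g < 6 * m) (hl : Leaves s m) :
    WP W U B (forLoop 7 2 buildBody) s
      (m * ((Prog.nset 10 (.minus (.minus (.var 2) (.lit 1)) (.var 7))).steps + fix.steps + 7) + 5)
      (fun s' => Leaves s' m ∧ ∀ i, 1 ≤ i → i < m → Valid s' g i) := by
  have := hP.hU
  have := hP.hW
  refine (WP.forLoop_const (fun k s' => Leaves s' m ∧ ∀ i, m - k ≤ i → 1 ≤ i → i < m →
    Valid s' g i) (by decide) (by decide) (by decide) (by decide) hm (by omega) ?_ ?_).conseq
    le_rfl fun s' _ h => ⟨h.1, fun i h₁ h₂ => h.2 i (by omega) h₁ h₂⟩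
  · exact ⟨hl, fun i h₁ _ h₂ => by omega⟩
  · rintro k s₁ hk hF hk₁ ⟨hl₁, hv₁⟩
    have h4 : s₁.nvar 4 = g := (hF.nvar 4 (by decide)).trans hg
    have h2 : s₁.nvar 2 = m := (hF.nvar 2 (by decide)).trans hm
    refine WP.seq (R := fun s' => s' = s₁.setN 10 (m - 1 - k)) (WP.of_pre fun _ _ _ => ?_) ?_
    · refine ⟨?_, by simp, ?_⟩
      · simp only [NExp.Fits]; omega
      · simp [NExp.val, h2, hk₁]
    · rintro s₂ - rfl
      refine (fix_wp hP (g := g) (i := m - 1 - k) (by simpa [Mem.setN] using h4)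
        (by simp [Mem.setN]) (by omega) hgm).conseq le_rfl ?_
      rintro s₃ hF₃ ⟨h₁, h₂⟩
      refine ⟨fun w hw => ?_, fun i h₃ h₄ h₅ => ?_⟩
      · have := h₂ (m + w) (by omega)
        exact this.trans (hl₁ w hw)
      · suffices H : Valid s₃ g i from ⟨H.mem, H.le, H.le'⟩
        by_cases hi : i = m - 1 - k
        · rw [hi]; exact h₁ (by omega)
        · refine Valid.congr (s := s₁) (hv₁ i (by omega) h₄ h₅) (hF₃.narr 31 (by decide))
            (hF₃.rarr 30 (by decide)) (h₂ i hi) (h₂ _ (by omega)) (h₂ _ (by omega))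

def extractCost (d : ℕ) : ℕ :=
  ([isPos (get1 31 (get1 32 (.lit 1)))].map fun b => b.2.cost).sum +
    (removeRoot.steps + (d * climbCost + 3))

/-- The root names a remaining target `w` of least key, if any target remains. Extracting it changes
only the flag of `w`, so a node becomes wrong only if it holds `w`; such nodes lie above the leaf `m
+ w`, and the climb starts at the parent of that leaf. If the root names a removed target, all
targets are removed and the round is idle. -/
theorem extractBody_wp (hP : Par W U B m) {s : Mem} {g k d : ℕ} (hm : s.nvar 2 = m)
    (hg : s.nvar 4 = g) (hgm : g < 6 * m) (hd : m ≤ 2 ^ d) (hk : k < m)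
    (hh : ∀ i < 2 * m, s.narr 22 i 0 = i / 2) (hE : Extracted s m g k) :
    WP W U B extractBody s (extractCost d) (fun s' => Extracted s' m g (k + 1) ∧
      ∀ g', g' ≠ g → s'.narr 33 g' = s.narr 33 g' ∧ s'.narr 34 g' 0 = s.narr 34 g' 0) := by
  have := hP.hU
  have := hP.hW
  obtain ⟨w, hwm, hw, -⟩ := node_mem hE.leaves hE.valid (j := 1) le_rfl (by omega)
  have hroot : ∀ w' < m, Le s g w w' := by
    intro w' hw'
    have := root_le hE.valid (j := m + w') (by omega) (by omega)
    rwa [hw, hE.leaves w' hw'] at this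
  refine WP.assume fun hS _ _ => WP.guard ?_ (fun _ => ?_) (fun hp => ?_) (fun hp => ?_)
  · have : 1 ≤ removeRoot.steps := Prog.steps_pos _
    omega
  · have h₁ := hS 32 1 0
    have h₂ := hS 31 (s.narr 32 1 0) 0
    simp [Test.Fits, NExp.Fits, NExp.val]
    omega
  · have hp : 0 < s.narr 31 w 0 := by
      simpa [Passes, Test.Holds, NExp.val, hw] using hp
    set l := s.narr 34 g 0 with hl
    have hlk : l = k := by
      rcases hE.len with h | h
      · exact h
      · have := h.2 w hwm; omega
    refine WP.seq (R := fun s' => s'.nvar 10 = (m + w) / 2 ∧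
      (∀ g' p, s'.narr 33 g' p = if g' = g ∧ p = l then w else s.narr 33 g' p) ∧
      (∀ g', s'.narr 34 g' 0 = if g' = g then l + 1 else s.narr 34 g' 0) ∧
      (∀ x, s'.narr 31 x 0 = if x = w then 0 else s.narr 31 x 0)) (WP.of_pre fun _ _ _ => ?_) ?_
    · have h22 := hh (m + w) (by omega)
      have hS34 := hS 34 g 0
      simp only [removeRoot, Prog.pre, NExp.Fits, NExp.val, Mem.setN, Mem.putN]
      simp [hg, hm, hw, h22, ← hl]
      refine ⟨?_, ?_, ?_, ?_, ?_, fun _ => ⟨?_, ?_, ?_, fun _ => ⟨?_, fun _ => ⟨?_, ?_⟩⟩⟩⟩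
      all_goals omega
    · rintro s₁ hF₁ ⟨h10, h33, h34, h31⟩
      have e32 : s₁.narr 32 = s.narr 32 := hF₁.narr 32 (by decide)
      have e30 : s₁.rarr 30 = s.rarr 30 := hF₁.rarr 30 (by decide)
      have e30' : s₁.narr 30 = s.narr 30 := hF₁.narr 30 (by decide)
      have e22 : s₁.narr 22 = s.narr 22 := hF₁.narr 22 (by decide)
      have hleaf : Leaves s₁ m := by unfold Leaves; rw [e32]; exact hE.leaves
      refine (climb_wp hP (g := g) (d := d) ((hF₁.nvar 4 (by decide)).trans hg) hgm
        (by rw [e22]; exact hh) hleaf (by rw [h10]; omega) (by rw [h10]; omega) ?_).conseq le_rfl ?_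
      · intro j hj hjm hA
        rw [h10] at hA
        have hv := hE.valid j hj hjm
        -- By `node_mem` a node that holds `w` is an ancestor of the leaf `m + w`; those are
        -- exempted by `hA`.
        have hjw : s.narr 32 j 0 ≠ w := by
          intro hjw
          obtain ⟨w', hw', h₁, h₂⟩ := node_mem hE.leaves hE.valid hj (by omega)
          obtain rfl : w' = w := by rw [← h₁, hjw]
          exact hA (h₂.eq_or.resolve_left (by omega))
        have hLe : ∀ y, Le s g (s.narr 32 j 0) y → Le s₁ g (s.narr 32 j 0) y := by
          intro y hy h
          rw [h31] at h
          split_ifs at h with hyw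
          · omega
          · rw [h31, if_neg hjw, e30]; exact hy h
        constructor
        · rw [e32]; exact hv.mem
        · rw [e32]; exact hLe _ hv.le
        · rw [e32]; exact hLe _ hv.le'
      · rintro s₂ hF₂ ⟨hl₂, hv₂⟩
        have f33 : s₂.narr 33 = s₁.narr 33 := hF₂.narr 33 (by decide)
        have f34 : s₂.narr 34 = s₁.narr 34 := hF₂.narr 34 (by decide)
        have f31 : s₂.narr 31 = s₁.narr 31 := hF₂.narr 31 (by decide)
        have f30 : s₂.rarr 30 = s.rarr 30 := (hF₂.rarr 30 (by decide)).trans e30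
        have f30' : s₂.narr 30 = s.narr 30 := (hF₂.narr 30 (by decide)).trans e30'
        have l2 : s₂.narr 34 g 0 = l + 1 := by rw [f34, h34, if_pos rfl]
        have o2 : ∀ p < l, s₂.narr 33 g p = s.narr 33 g p := fun p hp => by
          rw [f33, h33, if_neg (by omega)]
        have o2' : s₂.narr 33 g l = w := by rw [f33, h33, if_pos ⟨rfl, rfl⟩]
        have a2 : ∀ x, s₂.narr 31 x 0 = if x = w then 0 else s.narr 31 x 0 := fun x => by
          rw [f31, h31]
        have hfresh : ∀ p < l, s.narr 33 g p ≠ w := by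
          intro p hp h
          have := (hE.mem p hp).2.2
          rw [h] at this; omega
        refine ⟨⟨hl₂, hv₂, ?_, ?_, ?_, ?_, ?_, ?_, ?_⟩, ?_⟩
        · rw [l2]
          intro p hpl
          rcases Nat.lt_succ_iff_lt_or_eq.mp hpl with h | rfl
          · rw [o2 p h, a2, if_neg (hfresh p h), f30']; exact hE.mem p h
          · rw [o2', a2, if_pos rfl, f30']; exact ⟨hwm, hE.alive w hwm hp, rfl⟩
        · intro x hx h
          rw [a2] at h
          split_ifs at h with hxw
          · omega
          · rw [f30']; exact hE.alive x hx h
        · intro x hx h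
          rw [f30'] at h
          rw [l2, a2]
          by_cases hxw : x = w
          · right; exact ⟨l, by omega, by rw [o2', hxw]⟩
          · rw [if_neg hxw]
            rcases hE.surj x hx h with h' | ⟨p, hp, h'⟩
            · exact Or.inl h'
            · right; exact ⟨p, by omega, by rw [o2 p hp, h']⟩
        · intro p q hpq hq
          rw [l2] at hq
          rw [f30]
          rcases Nat.lt_succ_iff_lt_or_eq.mp hq with h | rfl
          · rw [o2 p (by omega), o2 q h]; exact hE.mono p q hpq h
          · rw [o2']
            rcases hpq.lt_or_eq with h | rfl
            · rw [o2 p h]; exact hE.le p h w hwm hp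
            · rw [o2']
        · intro p q hp hq h
          rw [l2] at hp hq
          rcases Nat.lt_succ_iff_lt_or_eq.mp hp with h₁ | rfl
          · rcases Nat.lt_succ_iff_lt_or_eq.mp hq with h₂ | rfl
            · rw [o2 p h₁, o2 q h₂] at h; exact hE.inj p q h₁ h₂ h
            · rw [o2 p h₁, o2'] at h; exact absurd h (hfresh p h₁)
          · rcases Nat.lt_succ_iff_lt_or_eq.mp hq with h₂ | h₂
            · rw [o2 q h₂, o2'] at h; exact absurd h.symm (hfresh q h₂)
            · exact h₂.symm
        · intro p hp x hx h
          rw [l2] at hp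
          rw [a2] at h
          rw [f30]
          split_ifs at h with hxw
          · omega
          · rcases Nat.lt_succ_iff_lt_or_eq.mp hp with h₁ | rfl
            · rw [o2 p h₁]; exact hE.le p h₁ x hx h
            · rw [o2']; exact (hroot x hx h).2
        · left; rw [l2, hlk]
        · intro g' hg'
          refine ⟨?_, ?_⟩
          · funext p; rw [f33, h33, if_neg (by tauto)]
          · rw [f34, h34, if_neg hg']
  · have hp : s.narr 31 w 0 = 0 := by
      simpa [Passes, Test.Holds, NExp.val, hw] using hp
    have hdead : ∀ x < m, s.narr 31 x 0 = 0 := by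
      intro x hx
      by_contra hne
      have := (hroot x hx (by omega)).1
      omega
    refine ⟨{ hE with len := Or.inr ⟨?_, hdead⟩ }, fun g' _ => ⟨rfl, rfl⟩⟩
    rcases hE.len with h | h <;> omega

def sortCost (d m : ℕ) : ℕ :=
  (m * (leafBody.steps + 7) + 5) +
    ((m * ((Prog.nset 10 (.minus (.minus (.var 2) (.lit 1)) (.var 7))).steps + fix.steps + 7) + 5) +
      ((Prog.nput 34 (.var 4) (.lit 0) (.lit 0)).steps + (m * (extractCost d + 7) + 5)))

theorem Extracted.setN {s : Mem} {m g k : ℕ} (h : Extracted s m g k) (x v : ℕ) :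
    Extracted (s.setN x v) m g k :=
  ⟨h.leaves, fun j h₁ h₂ => ⟨(h.valid j h₁ h₂).mem, (h.valid j h₁ h₂).le, (h.valid j h₁ h₂).le'⟩,
    h.mem, h.alive, h.surj, h.mono, h.inj, h.le, h.len⟩

theorem sortGroup_wp (hP : Par W U B m) {s : Mem} {g d : ℕ} (hm : s.nvar 2 = m)
    (hg : s.nvar 4 = g) (hgm : g < 6 * m) (hd : m ≤ 2 ^ d)
    (hh : ∀ i < 2 * m, s.narr 22 i 0 = i / 2) :
    WP W U B sortGroup s (sortCost d m) (fun s' => Sorted s' m g ∧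
      ∀ g', g' ≠ g → s'.narr 33 g' = s.narr 33 g' ∧ s'.narr 34 g' 0 = s.narr 34 g' 0) := by
  have := hP.hU
  have := hP.hW
  refine WP.seq (leaves_wp hP hm hg hgm) ?_
  rintro s₁ hF₁ ⟨hl₁, h₁⟩
  refine WP.seq (build_wp hP ((hF₁.nvar 2 (by decide)).trans hm)
    ((hF₁.nvar 4 (by decide)).trans hg) hgm hl₁) ?_
  rintro s₂ hF₂ ⟨hl₂, h₂⟩
  have h4 : s₂.nvar 4 = g := by rw [hF₂.nvar 4 (by decide), hF₁.nvar 4 (by decide), hg]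
  refine WP.seq (R := fun s' => s' = s₂.putN 34 g 0 0) (WP.of_pre fun _ _ _ => ?_) ?_
  · refine ⟨by simp only [NExp.Fits]; omega, by simp [NExp.Fits], by simp [NExp.Fits],
      by simp [NExp.val], fun _ => by simp [NExp.val, h4]⟩
  · rintro s₃ hF₃ rfl
    have e30 : s₂.narr 30 = s.narr 30 := by rw [hF₂.narr 30 (by decide), hF₁.narr 30 (by decide)]
    have e31 : s₂.narr 31 = s₁.narr 31 := hF₂.narr 31 (by decide)
    have e33 : s₂.narr 33 = s.narr 33 := by rw [hF₂.narr 33 (by decide), hF₁.narr 33 (by decide)]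
    have e34 : s₂.narr 34 = s.narr 34 := by rw [hF₂.narr 34 (by decide), hF₁.narr 34 (by decide)]
    have e22 : s₂.narr 22 = s.narr 22 := by rw [hF₂.narr 22 (by decide), hF₁.narr 22 (by decide)]
    set s₃ := s₂.putN 34 g 0 0 with hs₃
    have g31 : s₃.narr 31 = s₂.narr 31 := by rw [hs₃]; ext; simp [Mem.putN]
    have g30 : s₃.narr 30 = s₂.narr 30 := by rw [hs₃]; ext; simp [Mem.putN]
    have g32 : s₃.narr 32 = s₂.narr 32 := by rw [hs₃]; ext; simp [Mem.putN]
    have g33 : s₃.narr 33 = s₂.narr 33 := by rw [hs₃]; ext; simp [Mem.putN]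
    have g22 : s₃.narr 22 = s₂.narr 22 := by rw [hs₃]; ext; simp [Mem.putN]
    have g34 : s₃.narr 34 g 0 = 0 := by rw [hs₃]; simp [Mem.putN]
    have g34' : ∀ g', g' ≠ g → s₃.narr 34 g' 0 = s.narr 34 g' 0 := by
      intro g' hg'; rw [hs₃]; simp [Mem.putN, hg', e34]
    have hE : Extracted s₃ m g 0 := by
      refine ⟨by unfold Leaves; rw [g32]; exact hl₂, fun j h h' =>
        (h₂ j h h').congr g31 rfl (by rw [g32]) (by rw [g32]) (by rw [g32]), ?_, ?_, ?_, ?_, ?_, ?_,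
        Or.inl g34⟩
      · rw [g34]; simp
      · intro w hw; rw [g31, e31, h₁ w hw, g30, e30]; exact id
      · intro w hw h
        left
        rwa [g31, e31, h₁ w hw, ← e30, ← g30]
      · rw [g34]; simp
      · rw [g34]; simp
      · rw [g34]; simp
    refine (WP.forLoop_const (fun k s' => Extracted s' m g k ∧ ∀ g', g' ≠ g →
      s'.narr 33 g' = s₃.narr 33 g' ∧ s'.narr 34 g' 0 = s₃.narr 34 g' 0) (by decide) (by decide)
      (by decide) (by decide)
      (by rw [hF₃.nvar 2 (by decide), hF₂.nvar 2 (by decide), hF₁.nvar 2 (by decide), hm])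
      (by omega) ⟨hE.setN _ _, fun g' _ => ⟨rfl, rfl⟩⟩ ?_).conseq le_rfl ?_
    · rintro k s₄ hk hF₄ hk₄ ⟨hE₄, hg₄⟩
      refine (extractBody_wp hP (d := d) ?_ ?_ hgm hd hk ?_ hE₄).conseq le_rfl ?_
      · rw [hF₄.nvar 2 (by decide), hF₃.nvar 2 (by decide), hF₂.nvar 2 (by decide),
          hF₁.nvar 2 (by decide), hm]
      · rw [hF₄.nvar 4 (by decide), hF₃.nvar 4 (by decide), h4]
      · rw [hF₄.narr 22 (by decide), g22, e22]; exact hh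
      · rintro s₅ - ⟨h₃, h₄⟩
        exact ⟨h₃.setN _ _, fun g' hg' => ⟨(h₄ g' hg').1.trans (hg₄ g' hg').1,
          (h₄ g' hg').2.trans (hg₄ g' hg').2⟩⟩
    · rintro s₄ - ⟨h₃, h₄⟩
      exact ⟨h₃.sorted, fun g' hg' => ⟨by rw [(h₄ g' hg').1, g33, e33],
        by rw [(h₄ g' hg').2, g34' g' hg']⟩⟩

theorem sorts_wp (hP : Par W U B m) {s : Mem} {d : ℕ} (hm : s.nvar 2 = m)
    (h3 : s.nvar 3 = 6 * m) (hd : m ≤ 2 ^ d) (hh : ∀ i < 2 * m, s.narr 22 i 0 = i / 2) :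
    WP W U B sorts s (6 * m * (sortCost d m + 7) + 5) (fun s' => ∀ g < 6 * m, Sorted s' m g) := by
  have := hP.hU
  have := hP.hW
  refine WP.forLoop_all (fun g s' => Sorted s' m g)
    (fun g s v h => h.congr rfl rfl rfl rfl) (by decide) (by decide) (by decide) (by decide) h3
    (by omega) ?_
  intro g s₁ hg hF hg₁
  refine (sortGroup_wp hP ((hF.nvar 2 (by decide)).trans hm) hg₁ hg hd ?_).conseq le_rfl ?_
  · rw [hF.narr 22 (by decide)]; exact hh
  · rintro s₂ hF₂ ⟨h₁, h₂⟩
    exact ⟨h₁, fun g' hg' h => h.congr (h₂ g' hg'.ne).2 (h₂ g' hg'.ne).1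
      (hF₂.narr 30 (by decide)) (hF₂.rarr 30 (by decide))⟩

end Alg

end Shortcut

namespace Shortcut

open RealRAM

namespace Alg

/-! ## Blocks of the sorted lists, and new copies -/

variable {W U B m : ℕ}

def blockCost : ℕ :=
  (Prog.seq (.nput 35 (.var 15) (.lit 0) (.var 14))
        (.seq (.nset 14 (.plus (.plus (.var 14) (.var 14)) (.lit 1)))
          (.nset 15 (.plus (.var 15) (.lit 1))))).steps + (Test.nlt (.var 14) (.var 2)).cost

/-- The loop runs while `2 ^ l - 1 < m`, that is `2 ^ l ≤ m`, and this is the condition `l <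
m.size`. These blocks cover all positions below `m`. -/
theorem blocks_wp (hP : Par W U B m) {s : Mem} (hm : s.nvar 2 = m) :
    WP W U B blocks s ((Prog.seq (.nset 14 (.lit 0)) (.nset 15 (.lit 0))).steps +
        (m.size * blockCost + 3))
      (fun s' => s'.nvar 15 = m.size ∧ ∀ l < m.size, s'.narr 35 l 0 = 2 ^ l - 1) := by
  have := hP.hU
  have := hP.hW
  refine WP.seq (R := fun s' => s'.nvar 14 = 0 ∧ s'.nvar 15 = 0) (WP.of_pre fun _ _ _ => ?_) ?_
  · simp [Prog.pre, NExp.Fits, NExp.val, Mem.setN]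
  · rintro s₁ hF₁ ⟨h14, h15⟩
    refine (WP.while (T := (Prog.seq (.nput 35 (.var 15) (.lit 0) (.var 14))
        (.seq (.nset 14 (.plus (.plus (.var 14) (.var 14)) (.lit 1)))
          (.nset 15 (.plus (.var 15) (.lit 1))))).steps)
      (fun d s' => ∃ l, l + d = m.size ∧ s'.nvar 2 = m ∧ s'.nvar 15 = l ∧ s'.nvar 14 = 2 ^ l - 1 ∧
        s'.nvar 14 ≤ 2 * m ∧ ∀ l' < l, s'.narr 35 l' 0 = 2 ^ l' - 1) ?_ ?_ (d := m.size)
      ⟨0, by omega, (hF₁.nvar 2 (by decide)).trans hm, h15, by simpa using h14, by omega,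
        by simp⟩).conseq le_rfl ?_
    · rintro d s₂ - - ⟨l, h₁, h₂, h₃, h₄, h₅, h₆⟩
      simp only [Test.Fits, NExp.Fits]; omega
    · rintro d s₂ - ⟨l, h₁, h₂, h₃, h₄, h₅, h₆⟩ hb
      simp only [Test.Holds, NExp.val, h₄, h₂] at hb
      have hpos : 1 ≤ 2 ^ l := Nat.one_le_two_pow
      have hl : l < m.size := Nat.lt_size.mpr (by omega)
      have hlm : m.size ≤ m := Nat.size_le.mpr Nat.lt_two_pow_self
      refine ⟨d - 1, by omega, WP.of_pre fun _ _ _ => ?_⟩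
      simp only [Prog.pre, NExp.Fits, NExp.val, Mem.putN, Mem.setN, h₂, h₃, h₄,
        Nat.reduceEqDiff, if_false]
      refine ⟨by omega, by omega, by omega, by omega, fun _ => ⟨by omega, by simp, by omega,
        by simp, l + 1, by omega, by simp, by simp, ?_, ?_, ?_⟩⟩
      · simp [pow_succ]; omega
      · simp; omega
      · intro l' hl'
        rcases Nat.lt_succ_iff_lt_or_eq.mp hl' with h | rfl
        · have : l' ≠ l := h.ne
          simpa [this] using h₆ l' h
        · simp
    · rintro s₂ - ⟨⟨d, l, h₁, h₂, h₃, h₄, h₅, h₆⟩, hb⟩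
      simp only [Test.Holds, NExp.val, h₄, h₂] at hb
      have hpos : 1 ≤ 2 ^ l := Nat.one_le_two_pow
      have : m.size ≤ l := Nat.size_le.mpr (by omega)
      obtain rfl : l = m.size := by omega
      exact ⟨h₃, h₆⟩

/-- The threshold of the block `l` of the group `g`. -/
def thrv (s : Mem) (g l : ℕ) : ℝ := s.rarr 30 g (s.narr 33 g (s.narr 35 l 0))

/-- The new copies for the groups and blocks in `P` have been made. -/
structure Copies (s : Mem) (m : ℕ) (P : ℕ → ℕ → Prop) : Prop where
  copy : ∀ g l, P g l → s.narr 35 l 0 < s.narr 34 g 0 → s.narr 36 g l < s.nvar 0 ∧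
    s.narr 10 (s.narr 36 g l) 0 = s.narr 28 g 0 ∧
    s.rarr 10 (s.narr 36 g l) 0 = if g < 3 * m then thrv s g l else 0 - thrv s g l
  exists_eq : ∀ i < s.nvar 0, ∃ g l, P g l ∧ s.narr 35 l 0 < s.narr 34 g 0 ∧ s.narr 36 g l = i

theorem Copies.congr {s s' : Mem} {m : ℕ} {P P' : ℕ → ℕ → Prop} (h : Copies s m P)
    (hP : ∀ g l, P g l ↔ P' g l) (h₀ : s'.nvar 0 = s.nvar 0)
    (hn : ∀ A ∈ [10, 28, 33, 34, 35, 36], s'.narr A = s.narr A)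
    (hr : ∀ A ∈ [10, 30], s'.rarr A = s.rarr A) : Copies s' m P' := by
  have : ∀ g l, P g l = P' g l := fun g l => propext (hP g l)
  obtain rfl : P = P' := by funext g l; exact this g l
  have t : ∀ g l, thrv s' g l = thrv s g l := fun g l => by
    unfold thrv; rw [hr 30 (by simp), hn 33 (by simp), hn 35 (by simp)]
  constructor
  · rw [hn 35 (by simp), hn 34 (by simp), hn 36 (by simp), hn 10 (by simp), hn 28 (by simp),
      hr 10 (by simp), h₀]
    simp only [t]
    exact h.copy
  · rw [hn 35 (by simp), hn 34 (by simp), hn 36 (by simp), h₀]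
    exact h.exists_eq

/-- The predicate `P` marks the pairs already treated; `hp` guarantees that the number of an earlier
copy is not overwritten in array 36. -/
theorem allocBody_wp (hP : Par W U B m) {s : Mem} {g l : ℕ} {P : ℕ → ℕ → Prop} (hg : s.nvar 4 = g)
    (hl : s.nvar 6 = l) (h18 : s.nvar 18 = 3 * m) (hgm : g < 6 * m) (hlm : l < m) (hp : ¬ P g l)
    (h0 : s.rvar 0 = 0) (hC : Copies s m P) :
    WP W U B allocBody s allocBody.steps
      (fun s' => Copies s' m (fun g' l' => P g' l' ∨ (g' = g ∧ l' = l))) := by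
  have := hP.hU
  have := hP.hW
  refine WP.of_pre fun hS hB _ => ?_
  have hS' : ∀ A i j, s.narr A i j ≤ W := fun A i j => (hS A i j).trans (by omega)
  have fa : ∀ x ≤ W, x ≤ W := fun _ h => h
  have gW : g ≤ W := by omega
  have lW : l ≤ W := by omega
  have cW : s.nvar 0 ≤ W := by omega
  have mW : 3 * m ≤ W := by omega
  refine ⟨?_, fun ht => ?_, fun ht => ?_⟩
  · simp [Test.Fits, NExp.Fits, NExp.val, hg, hl, gW, lW, hS']
  · simp only [Test.Holds, NExp.val, hg, hl] at ht
    have fin : ∀ s' : Mem, s'.nvar 0 = s.nvar 0 + 1 →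
        (∀ g' l', s'.narr 36 g' l' = if g' = g ∧ l' = l then s.nvar 0 else s.narr 36 g' l') →
        (∀ i, s'.narr 10 i 0 = if i = s.nvar 0 then s.narr 28 g 0 else s.narr 10 i 0) →
        (∀ i, s'.rarr 10 i 0 = if i = s.nvar 0 then
          (if g < 3 * m then thrv s g l else 0 - thrv s g l) else s.rarr 10 i 0) →
        (∀ A ∈ [28, 33, 34, 35], s'.narr A = s.narr A) → s'.rarr 30 = s.rarr 30 →
        Copies s' m (fun g' l' => P g' l' ∨ (g' = g ∧ l' = l)) := by
      intro s' e₀ e36 e10 r10 en er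
      have t : ∀ g l, thrv s' g l = thrv s g l := fun g l => by
        unfold thrv; rw [er, en 33 (by simp), en 35 (by simp)]
      constructor
      · intro g' l' hP' hlt
        rw [en 35 (by simp), en 34 (by simp)] at hlt
        rw [e36, e₀, e10, r10, en 28 (by simp), t]
        by_cases hgl : g' = g ∧ l' = l
        · rw [if_pos hgl, if_pos rfl, if_pos rfl, hgl.1, hgl.2]
          exact ⟨by omega, rfl, rfl⟩
        · obtain ⟨h₁, h₂, h₃⟩ := hC.copy g' l' (hP'.resolve_right hgl) hlt
          rw [if_neg hgl, if_neg h₁.ne, if_neg h₁.ne]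
          exact ⟨by omega, h₂, h₃⟩
      · intro i hi
        rw [e₀] at hi
        rw [en 35 (by simp), en 34 (by simp)]
        rcases Nat.lt_succ_iff_lt_or_eq.mp hi with h | rfl
        · obtain ⟨g', l', h₁, h₂, h₃⟩ := hC.exists_eq i h
          refine ⟨g', l', Or.inl h₁, h₂, ?_⟩
          rw [e36, if_neg ?_, h₃]
          rintro ⟨rfl, rfl⟩
          exact hp h₁
        · exact ⟨g, l, Or.inr ⟨rfl, rfl⟩, ht, by rw [e36, if_pos ⟨rfl, rfl⟩]⟩
    have hS28 := hS 28 g 0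
    simp only [guardElse, Prog.pre, NExp.Fits, NExp.val, RExp.Fits, RExp.val, Test.Fits, Test.Holds,
      Mem.putN, Mem.putR, hg, hl, h18]
    simp only [Nat.reduceEqDiff, false_and, if_false, gW, lW, cW, hS', zero_le, true_and,
      and_true, h0, mW]
    refine ⟨by omega, fun _ => ⟨hS28, fun _ => ⟨fun h3 => ⟨by omega, fun _ => le_rfl, ?_⟩,
      fun h3 => ⟨by omega, fun _ => le_rfl, ?_⟩⟩⟩⟩
    · apply fin
      · simp [Mem.setN]
      · intro g' l'; simp [Mem.setN]
      · intro i; simp [Mem.setN]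
      · intro i; simp [Mem.setN, thrv, h3]
      · intro A hA; fin_cases hA <;> ext <;> simp [Mem.setN]
      · ext; simp [Mem.setN]
    · apply fin
      · simp [Mem.setN]
      · intro g' l'; simp [Mem.setN]
      · intro i; simp [Mem.setN]
      · intro i; simp [Mem.setN, thrv, h3]
      · intro A hA; fin_cases hA <;> ext <;> simp [Mem.setN]
      · ext; simp [Mem.setN]
  · simp only [Test.Holds, NExp.val, hg, hl, not_lt] at ht
    constructor
    · intro g' l' hP' hlt
      rcases hP' with h | ⟨rfl, rfl⟩
      · exact hC.copy g' l' h hlt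
      · omega
    · intro i hi
      obtain ⟨g', l', h₁, h₂⟩ := hC.exists_eq i hi
      exact ⟨g', l', Or.inl h₁, h₂⟩

theorem alloc_wp (hP : Par W U B m) {s : Mem} {k : ℕ} (h3 : s.nvar 3 = 6 * m)
    (h18 : s.nvar 18 = 3 * m) (h15 : s.nvar 15 = k) (hk : k ≤ m) (h0 : s.rvar 0 = 0)
    (hc : s.nvar 0 = 0) :
    WP W U B alloc s (6 * m * (k * (allocBody.steps + 7) + 5 + 7) + 5)
      (fun s' => Copies s' m (fun g l => g < 6 * m ∧ l < k)) := by
  have := hP.hU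
  have := hP.hW
  refine WP.forLoop_const (fun g s' => Copies s' m (fun g' l' => g' < g ∧ l' < k)) (by decide)
    (by decide) (by decide) (by decide) h3 (by omega) ?_ ?_
  · refine ⟨fun g l h => by omega, fun i hi => ?_⟩
    simp [Mem.setN, hc] at hi
  · intro g s₁ hg hF₁ hg₁ hC₁
    refine (WP.forLoop_const (fun l s' => Copies s' m
      (fun g' l' => (g' < g ∧ l' < k) ∨ (g' = g ∧ l' < l))) (by decide)
      (by decide) (by decide) (by decide) ((hF₁.nvar 15 (by decide)).trans h15) (by omega)
      (hC₁.congr (by simp) rfl (fun _ _ => rfl) (fun _ _ => rfl)) ?_).conseq le_rfl ?_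
    · intro l s₂ hl hF₂ hl₂ hC₂
      refine (allocBody_wp hP ((hF₂.nvar 4 (by decide)).trans hg₁) hl₂ ?_ hg (by omega) (by omega)
        ?_ hC₂).conseq le_rfl ?_
      · rw [hF₂.nvar 18 (by decide), hF₁.nvar 18 (by decide), h18]
      · rw [hF₂.rvar 0 (by decide), hF₁.rvar 0 (by decide), h0]
      · intro s₃ _ hC₃
        exact hC₃.congr (fun g' l' => by omega) rfl (fun _ _ => rfl) (fun _ _ => rfl)
    · intro s₂ _ hC₂
      exact hC₂.congr (fun g' l' => by omega) rfl (fun _ _ => rfl) (fun _ _ => rfl)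

end Alg

end Shortcut

namespace Shortcut

open RealRAM

namespace Alg

/-! ## Output of the edges at the new copies -/

variable {W U B m : ℕ}

/-- A new edge, or its reverse. -/
def dirEdge (o : Bool) (a b : ℕ) (x : ℝ) : Edge :=
  if o = true then ⟨a, b, x, false⟩ else ⟨b, a, x, false⟩

theorem emitDir_wp {o : Bool} {bs : List (Bool × Test)} {a b : NExp} {w : RExp} {s : Mem}
    (ca : a.Clean) (cb : b.Clean) (cw : w.Clean) (hB : B + 1 ≤ W)
    (hf : Small U s → (∀ b ∈ bs, b.2.Fits W s) ∧ (Passes bs s → (a.Fits W s ∧ a.val s ≤ U) ∧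
      (b.Fits W s ∧ b.val s ≤ U) ∧ w.Fits W s)) :
    WP W U B (guard bs (emitDir o a b w)) s
      (emitCost bs a b (.lit 0) w + emitCost bs b a (.lit 0) w)
      (fun s' => outEdges s' = outEdges s ∪
        {e | Passes bs s ∧ e = dirEdge o (a.val s) (b.val s) (w.val s)}) := by
  have c0 : (NExp.lit 0).Clean := by decide
  cases o
  · refine (WP.emitIf ca c0 cw hB fun hs => ⟨(hf hs).1, fun hp => ?_⟩).conseq
      (Nat.le_add_left _ _) fun s' _ h => h.trans ?_
    · obtain ⟨h₁, h₂, h₃⟩ := (hf hs).2 hp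
      exact ⟨h₂, h₁, by simp [NExp.Fits, NExp.val], h₃⟩
    · simp [emitted, dirEdge, NExp.val]
  · refine (WP.emitIf cb c0 cw hB fun hs => ⟨(hf hs).1, fun hp => ?_⟩).conseq
      (Nat.le_add_right _ _) fun s' _ h => h.trans ?_
    · obtain ⟨h₁, h₂, h₃⟩ := (hf hs).2 hp
      exact ⟨h₁, h₂, by simp [NExp.Fits, NExp.val], h₃⟩
    · simp [emitted, dirEdge, NExp.val]

/-- What the output of the edges at the new copies needs. -/
structure Ready (s : Mem) (m k : ℕ) : Prop where
  n2 : s.nvar 2 = m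
  n3 : s.nvar 3 = 6 * m
  n18 : s.nvar 18 = 3 * m
  n15 : s.nvar 15 = k
  km : k ≤ m
  grp_lt : ∀ j < 6 * m, s.narr 29 j 0 < 6 * m
  copies : Copies s m (fun g l => g < 6 * m ∧ l < k)
  len_le : ∀ g < 6 * m, s.narr 34 g 0 ≤ m
  mem_lt : ∀ g < 6 * m, ∀ p < s.narr 34 g 0, s.narr 33 g p < m

/-- Edges between a copy and the target `w`, for the index `j` and the block `l`. -/
def RightEdge (s : Mem) (m : ℕ) (o : Bool) (j w l : ℕ) (e : Edge) : Prop :=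
  0 < s.narr 37 j w ∧ (j < 3 * m ↔ o = true) ∧ s.narr 35 l 0 < s.narr 34 (s.narr 29 j 0) 0 ∧
    thrv s (s.narr 29 j 0) l ≤ s.rarr 37 j w ∧
    e = dirEdge o (2 * m + s.narr 36 (s.narr 29 j 0) l) w
      (s.rarr 37 j w - thrv s (s.narr 29 j 0) l)

abbrev rightWt : RExp := .minus (.get 37 (.var 5) (.var 7)) (thr grp)

def rightCost (o : Bool) : ℕ :=
  emitCost (rightTests o) copy (.var 7) (.lit 0) rightWt +
    emitCost (rightTests o) (.var 7) copy (.lit 0) rightWt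

theorem copyRight_wp (hP : Par W U B m) {s : Mem} {k : ℕ} (hR : Ready s m k) (o : Bool) :
    WP W U B (copyRight o) s
      (6 * m * (m * (k * (rightCost o + 7) + 5 + 7) + 5 + 7) + 5)
      (fun s' => outEdges s' = outEdges s ∪
        {e | ∃ j < 6 * m, ∃ w < m, ∃ l < k, RightEdge s m o j w l e}) := by
  have := hP.hU
  have := hP.hW
  have := hR.km
  -- The direction only swaps the ends of the emitted edge, so the written variables and arrays can
  -- be computed for `true`.
  have hnv : (copyRight o).nvars = (copyRight true).nvars := by cases o <;> rfl
  have hna : (copyRight o).narrs = (copyRight true).narrs := by cases o <;> rfl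
  have hra : (copyRight o).rarrs = (copyRight true).rarrs := by cases o <;> rfl
  refine WP.assume fun _ hB0 _ => ?_
  refine (WP.forLoop_emits (T := fun _ => m * (k * (rightCost o + 7) + 5 + 7) + 5)
    (fun j => {e | ∃ w < m, ∃ l < k, e ∈ {e | RightEdge s m o j w l e}}) (by decide)
    (by cases o <;> decide) (by cases o <;> decide) (by decide) hR.n3 (by omega) ?_).conseq
    ?_ ?_
  rotate_left
  · simp
  · intro s' _ h
    simpa using h
  intro j s₁ hj hF₁ hj₁
  refine WP.forLoop₂_emits (fun w l => {e | RightEdge s m o j w l e}) (by decide)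
    (by cases o <;> decide) (by cases o <;> decide) (by decide) (by decide)
    (by cases o <;> decide) (by cases o <;> decide) (by decide) (by decide) (by decide) (by decide)
    ?_ ?_ (by omega) (by omega) ?_
  · rw [hF₁.nvar 2 (by cases o <;> decide), hR.n2]
  · rw [hF₁.nvar 15 (by cases o <;> decide), hR.n15]
  intro w l s₂ hw hl hF₂ hw₂ hl₂
  have hF : Frame (copyRight o) s s₂ := hF₁.trans hF₂.loop
  have hj₂ : s₂.nvar 5 = j := (hF₂.nvar 5 (by cases o <;> decide)).trans hj₁
  have h2 : s₂.nvar 2 = m := (hF.nvar 2 (by rw [hnv]; decide)).trans hR.n2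
  have h18 : s₂.nvar 18 = 3 * m := (hF.nvar 18 (by rw [hnv]; decide)).trans hR.n18
  have e29 : s₂.narr 29 = s.narr 29 := hF.narr 29 (by rw [hna]; decide)
  have e33 : s₂.narr 33 = s.narr 33 := hF.narr 33 (by rw [hna]; decide)
  have e34 : s₂.narr 34 = s.narr 34 := hF.narr 34 (by rw [hna]; decide)
  have e35 : s₂.narr 35 = s.narr 35 := hF.narr 35 (by rw [hna]; decide)
  have e36 : s₂.narr 36 = s.narr 36 := hF.narr 36 (by rw [hna]; decide)
  have e37 : s₂.narr 37 = s.narr 37 := hF.narr 37 (by rw [hna]; decide)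
  have r30 : s₂.rarr 30 = s.rarr 30 := hF.rarr 30 (by rw [hra]; decide)
  have r37 : s₂.rarr 37 = s.rarr 37 := hF.rarr 37 (by rw [hra]; decide)
  have hpass : Passes (rightTests o) s₂ ↔ (0 < s.narr 37 j w ∧ (j < 3 * m ↔ o = true) ∧
      s.narr 35 l 0 < s.narr 34 (s.narr 29 j 0) 0 ∧
      thrv s (s.narr 29 j 0) l ≤ s.rarr 37 j w) := by
    simp [rightTests, Passes, Test.Holds, NExp.val, RExp.val, hj₂, hw₂, hl₂, h18, e29, e33, e34,
      e35, e37, r30, r37, thrv]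
  refine (emitDir_wp (by decide) (by decide) (by decide) (by omega) fun hS => ?_).conseq le_rfl ?_
  · have hS' : ∀ A i j, s₂.narr A i j ≤ W := fun A i j => (hS A i j).trans (by omega)
    refine ⟨?_, fun hp => ?_⟩
    · simp [rightTests, Test.Fits, NExp.Fits, RExp.Fits, NExp.val, hj₂, hw₂, hl₂, h18, hS']
      omega
    · obtain ⟨-, -, hp, -⟩ := hpass.mp hp
      have hg := hR.grp_lt j hj
      have := (hR.copies.copy _ l ⟨hg, hl⟩ hp).1
      have gW := hS' 36 (s.narr 29 j 0) l
      rw [e36] at gW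
      have jW : j ≤ W := by omega
      have lW : l ≤ W := by omega
      have wW : w ≤ W := by omega
      have mW : m ≤ W := by omega
      have mmW : m + m ≤ W := by omega
      have mcW : m + m + s.narr 36 (s.narr 29 j 0) l ≤ W := by omega
      simp [NExp.Fits, RExp.Fits, NExp.val, h2, hw₂, hj₂, hl₂, hS', jW, lW, wW, mW, mmW, mcW,
        e36, e29, gW]
      omega
  · intro s' _ h
    rw [h]
    congr 1
    ext e
    simp only [Set.mem_ofPred_eq, hpass, RightEdge, NExp.val, RExp.val, hj₂, hw₂, hl₂, h2, e29, e33,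
      e35, e36, r30, r37, thrv, and_assoc, two_mul]

/-- Edges at the Steiner vertex of `i`, for the index `j` and the block `l`. -/
def LeftEdge (s : Mem) (m : ℕ) (o : Bool) (i j l : ℕ) (e : Edge) : Prop :=
  0 < s.narr 27 i j ∧ (j < 3 * m ↔ o = true) ∧ s.narr 35 l 0 < s.narr 34 (s.narr 29 j 0) 0 ∧
    ((thrv s (s.narr 29 j 0) l < s.rarr 27 i j ∧ ∃ k < s.narr 35 l 0 + 1, ∃ w,
        w = s.narr 33 (s.narr 29 j 0) (s.narr 35 l 0 + k) ∧
        s.narr 35 l 0 + k < s.narr 34 (s.narr 29 j 0) 0 ∧ 0 < s.narr 37 j w ∧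
        s.rarr 27 i j ≤ s.rarr 37 j w ∧
        e = dirEdge o (m + i) w (s.rarr 37 j w - s.rarr 27 i j)) ∨
      (s.rarr 27 i j ≤ thrv s (s.narr 29 j 0) l ∧
        e = dirEdge o (m + i) (2 * m + s.narr 36 (s.narr 29 j 0) l)
          (thrv s (s.narr 29 j 0) l - s.rarr 27 i j)))

abbrev directWt : RExp := .minus (.get 37 (.var 5) target) (.get 27 (.var 4) (.var 5))

abbrev leftWt : RExp := .minus (thr grp) (.get 27 (.var 4) (.var 5))

abbrev src : NExp := .plus (.var 2) (.var 4)

/-- Covers both directions; the summand `7` is the overhead of one pass of the innermost loop. -/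
def directCost : ℕ :=
  emitCost directTests src target (.lit 0) directWt +
    emitCost directTests target src (.lit 0) directWt + 7

def leftCost (o : Bool) : ℕ :=
  ((leftTests o).map fun b => b.2.cost).sum + ((Test.rlt (thr grp) (.get 27 (.var 4) (.var 5))).cost
    + ((emitCost [] src copy (.lit 0) leftWt + emitCost [] copy src (.lit 0) leftWt) +
      ((Prog.nset 8 (.plus (get1 35 (.var 6)) (.lit 1))).steps + 5)))

open Classical in
/-- The number of positions that are looked at for `i`, `j` and the block `l`. -/
noncomputable def enumCost (s : Mem) (i j l : ℕ) : ℕ :=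
  if 0 < s.narr 27 i j ∧ s.narr 35 l 0 < s.narr 34 (s.narr 29 j 0) 0 ∧
    thrv s (s.narr 29 j 0) l < s.rarr 27 i j then s.narr 35 l 0 + 1 else 0

/-- The cost stays an explicit triple sum that contains `enumCost`: a single pass can look at
linearly many positions, and only the sum over all passes is controlled by the betweenness, in
`lefts₀Cost_le`. -/
theorem copyLeft_wp (hP : Par W U B m) {s : Mem} {k : ℕ} (hR : Ready s m k) (o : Bool) :
    WP W U B (copyLeft o) s
      (∑ i ∈ Finset.range m, (∑ j ∈ Finset.range (6 * m), (∑ l ∈ Finset.range k,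
        (leftCost o + enumCost s i j l * directCost + 7) + 5 + 7) + 5 + 7) + 5)
      (fun s' => outEdges s' = outEdges s ∪
        {e | ∃ i < m, ∃ j < 6 * m, ∃ l < k, LeftEdge s m o i j l e}) := by
  have := hP.hU
  have := hP.hW
  have := hR.km
  have hnv : (copyLeft o).nvars = (copyLeft true).nvars := by cases o <;> rfl
  have hna : (copyLeft o).narrs = (copyLeft true).narrs := by cases o <;> rfl
  have hra : (copyLeft o).rarrs = (copyLeft true).rarrs := by cases o <;> rfl
  refine WP.assume fun _ hB0 _ => ?_
  refine (WP.forLoop_emits (fun i => {e | ∃ j < 6 * m, e ∈ {e | ∃ l < k, e ∈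
    {e | LeftEdge s m o i j l e}}}) (by decide) (by cases o <;> decide) (by cases o <;> decide)
    (by decide) hR.n2 (by omega) ?_).conseq le_rfl ?_
  rotate_left
  · intro s' _ h
    simpa using h
  intro i s₁ hi hF₁ hi₁
  refine WP.forLoop_emits (fun j => {e | ∃ l < k, e ∈ {e | LeftEdge s m o i j l e}}) (by decide)
    (by cases o <;> decide) (by cases o <;> decide) (by decide)
    ((hF₁.nvar 3 (by cases o <;> decide)).trans hR.n3) (by omega) ?_
  intro j s₂ hj hF₂ hj₂
  have hF' : Frame (copyLeft o) s s₂ := hF₁.trans hF₂.loop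
  refine WP.forLoop_emits (fun l => {e | LeftEdge s m o i j l e}) (by decide)
    (by cases o <;> decide) (by cases o <;> decide) (by decide)
    ((hF'.nvar 15 (by rw [hnv]; decide)).trans hR.n15) (by omega) ?_
  intro l s₃ hl hF₃ hl₃
  have hF : Frame (copyLeft o) s s₃ := hF'.trans hF₃.loop.loop
  have hj₃ : s₃.nvar 5 = j := (hF₃.nvar 5 (by cases o <;> decide)).trans hj₂
  have hi₃ : s₃.nvar 4 = i := (hF₃.nvar 4 (by cases o <;> decide)).trans
    ((hF₂.nvar 4 (by cases o <;> decide)).trans hi₁)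
  have h2 : s₃.nvar 2 = m := (hF.nvar 2 (by rw [hnv]; decide)).trans hR.n2
  have h18 : s₃.nvar 18 = 3 * m := (hF.nvar 18 (by rw [hnv]; decide)).trans hR.n18
  have e27 : s₃.narr 27 = s.narr 27 := hF.narr 27 (by rw [hna]; decide)
  have e29 : s₃.narr 29 = s.narr 29 := hF.narr 29 (by rw [hna]; decide)
  have e33 : s₃.narr 33 = s.narr 33 := hF.narr 33 (by rw [hna]; decide)
  have e34 : s₃.narr 34 = s.narr 34 := hF.narr 34 (by rw [hna]; decide)
  have e35 : s₃.narr 35 = s.narr 35 := hF.narr 35 (by rw [hna]; decide)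
  have e36 : s₃.narr 36 = s.narr 36 := hF.narr 36 (by rw [hna]; decide)
  have e37 : s₃.narr 37 = s.narr 37 := hF.narr 37 (by rw [hna]; decide)
  have r27 : s₃.rarr 27 = s.rarr 27 := hF.rarr 27 (by rw [hra]; decide)
  have r30 : s₃.rarr 30 = s.rarr 30 := hF.rarr 30 (by rw [hra]; decide)
  have r37 : s₃.rarr 37 = s.rarr 37 := hF.rarr 37 (by rw [hra]; decide)
  have hpass : Passes (leftTests o) s₃ ↔ (0 < s.narr 27 i j ∧ (j < 3 * m ↔ o = true) ∧
      s.narr 35 l 0 < s.narr 34 (s.narr 29 j 0) 0) := by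
    simp [leftTests, Passes, Test.Holds, NExp.val, hi₃, hj₃, hl₃, h18, e29, e27, e34, e35]
  have hg := hR.grp_lt j hj
  have hcost : leftCost o = ((leftTests o).map fun b => b.2.cost).sum +
    ((Test.rlt (thr grp) (.get 27 (.var 4) (.var 5))).cost
    + ((emitCost [] src copy (.lit 0) leftWt + emitCost [] copy src (.lit 0) leftWt) +
      ((Prog.nset 8 (.plus (get1 35 (.var 6)) (.lit 1))).steps + 5))) := rfl
  refine WP.assume fun hS _ _ => ?_
  have hS' : ∀ A i j, s₃.narr A i j ≤ W := fun A i j => (hS A i j).trans (by omega)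
  have hpos := Test.cost_pos (Test.rlt (thr grp) (.get 27 (.var 4) (.var 5)))
  refine (WP.guard (T := (Test.rlt (thr grp) (.get 27 (.var 4) (.var 5))).cost
    + ((emitCost [] src copy (.lit 0) leftWt + emitCost [] copy src (.lit 0) leftWt) +
      ((Prog.nset 8 (.plus (get1 35 (.var 6)) (.lit 1))).steps + 5) +
      enumCost s i j l * directCost)) (by omega) (fun _ => ?_) (fun hp => ?_)
    (fun hp => ?_)).conseq (by rw [hcost]; omega) fun _ _ h => h
  · simp [leftTests, Test.Fits, NExp.Fits, NExp.val, hi₃, hj₃, hl₃, h18, hS']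
    omega
  · obtain ⟨p₁, p₂, p₃⟩ := hpass.mp hp
    have hcid := (hR.copies.copy _ l ⟨hg, hl⟩ p₃).1
    have hlen := hR.len_le _ hg
    refine WP.ite (fun _ => ?_) (fun ht => ?_) (fun ht => ?_)
    · simp [Test.Fits, RExp.Fits, NExp.Fits, NExp.val, hi₃, hj₃, hl₃, hS']
      omega
    · have ht : thrv s (s.narr 29 j 0) l < s.rarr 27 i j := by
        simpa [Test.Holds, RExp.val, NExp.val, hi₃, hj₃, hl₃, e29, e33, e35, r30, r27, thrv] using ht
      have hen : enumCost s i j l = s.narr 35 l 0 + 1 := by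
        unfold enumCost; rw [if_pos ⟨p₁, p₃, ht⟩]
      refine (WP.seq (R := fun s' => s' = s₃.setN 8 (s.narr 35 l 0 + 1))
        (WP.of_pre (c := .nset 8 (.plus (get1 35 (.var 6)) (.lit 1))) fun _ _ _ => ?_) ?_).conseq
        (T := (Prog.nset 8 (.plus (get1 35 (.var 6)) (.lit 1))).steps +
          ((s.narr 35 l 0 + 1) * directCost + 5)) (by rw [hen]; omega) fun _ _ h => h
      · have := hS' 35 l 0
        rw [e35] at this
        simp [Prog.pre, NExp.Fits, NExp.val, hl₃, e35]
        omega
      · rintro s₄ - rfl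
        refine (WP.forLoop_emits (T := fun _ => emitCost directTests src target (.lit 0) directWt +
            emitCost directTests target src (.lit 0) directWt)
          (fun k => {e | ∃ w, w = s.narr 33 (s.narr 29 j 0) (s.narr 35 l 0 + k) ∧
            s.narr 35 l 0 + k < s.narr 34 (s.narr 29 j 0) 0 ∧ 0 < s.narr 37 j w ∧
            s.rarr 27 i j ≤ s.rarr 37 j w ∧
            e = dirEdge o (m + i) w (s.rarr 37 j w - s.rarr 27 i j)}) (n := s.narr 35 l 0 + 1)
          (by decide) (by cases o <;> decide) (by cases o <;> decide) (by decide)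
          (by simp [Mem.setN]) (by omega) ?_).conseq ?_ ?_
        · intro k' s₅ hk' hF₅ hk₅
          have q5 : s₅.nvar 5 = j := (hF₅.nvar 5 (by cases o <;> decide)).trans
            (by simpa [Mem.setN] using hj₃)
          have q4 : s₅.nvar 4 = i := (hF₅.nvar 4 (by cases o <;> decide)).trans
            (by simpa [Mem.setN] using hi₃)
          have q6 : s₅.nvar 6 = l := (hF₅.nvar 6 (by cases o <;> decide)).trans
            (by simpa [Mem.setN] using hl₃)
          have q2 : s₅.nvar 2 = m := (hF₅.nvar 2 (by cases o <;> decide)).trans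
            (by simpa [Mem.setN] using h2)
          have f27 : s₅.narr 27 = s.narr 27 := (hF₅.narr 27 (by cases o <;> decide)).trans e27
          have f29 : s₅.narr 29 = s.narr 29 := (hF₅.narr 29 (by cases o <;> decide)).trans e29
          have f33 : s₅.narr 33 = s.narr 33 := (hF₅.narr 33 (by cases o <;> decide)).trans e33
          have f34 : s₅.narr 34 = s.narr 34 := (hF₅.narr 34 (by cases o <;> decide)).trans e34
          have f35 : s₅.narr 35 = s.narr 35 := (hF₅.narr 35 (by cases o <;> decide)).trans e35
          have f37 : s₅.narr 37 = s.narr 37 := (hF₅.narr 37 (by cases o <;> decide)).trans e37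
          have g27 : s₅.rarr 27 = s.rarr 27 := (hF₅.rarr 27 (by cases o <;> decide)).trans r27
          have g37 : s₅.rarr 37 = s.rarr 37 := (hF₅.rarr 37 (by cases o <;> decide)).trans r37
          have hpass' : Passes directTests s₅ ↔ (s.narr 35 l 0 + k' < s.narr 34 (s.narr 29 j 0) 0 ∧
              0 < s.narr 37 j (s.narr 33 (s.narr 29 j 0) (s.narr 35 l 0 + k')) ∧
              s.rarr 27 i j ≤ s.rarr 37 j (s.narr 33 (s.narr 29 j 0) (s.narr 35 l 0 + k'))) := by
            simp [directTests, Passes, Test.Holds, NExp.val, RExp.val, q4, q5, q6, hk₅, f29, f33,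
              f34, f35, f37, g27, g37]
          refine (emitDir_wp (by decide) (by decide) (by decide) (by omega) fun hS₅ => ?_).conseq
            le_rfl ?_
          · have hS₅' : ∀ A i j, s₅.narr A i j ≤ W := fun A i j => (hS₅ A i j).trans (by omega)
            have hlen' : s.narr 35 l 0 + k' ≤ W := by omega
            have gW := hS₅' 35 l 0
            rw [f35] at gW
            have jW : j ≤ W := by omega
            have lW : l ≤ W := by omega
            have kW : k' ≤ W := by omega
            have iW : i ≤ W := by omega
            have mW : m ≤ W := by omega
            have miW : m + i ≤ W := by omega
            refine ⟨?_, fun hp' => ?_⟩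
            · simp [directTests, Test.Fits, NExp.Fits, RExp.Fits, NExp.val, q4, q5, q6, hk₅, hS₅',
                f35, gW, jW, lW, kW, iW, hlen']
            · have hw := hR.mem_lt _ hg _ (hpass'.mp hp').1
              simp [NExp.Fits, RExp.Fits, NExp.val, q2, q4, q5, q6, hk₅, f35, gW, jW, lW, kW,
                iW, mW, miW, hlen', f33, f29]
              omega
          · intro s₆ _ h
            rw [h]
            congr 1
            ext e
            simp only [Set.mem_ofPred_eq, hpass', NExp.val, RExp.val, q2, q4, q5, q6, hk₅, f29, f33,
              f35, g27, g37, exists_eq_left, and_assoc]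
        · simp [directCost]
        · intro s₆ _ h
          rw [h, outEdges_setN (by decide)]
          congr 1
          ext e
          simp only [Set.mem_ofPred_eq, LeftEdge, p₁, p₂, p₃, ht, not_le.mpr ht, true_and,
            false_and, or_false]
    · have ht : s.rarr 27 i j ≤ thrv s (s.narr 29 j 0) l := by
        simpa [Test.Holds, RExp.val, NExp.val, hi₃, hj₃, hl₃, e29, e33, e35, r30, r27, thrv] using ht
      have hnil : ∀ c, guard [] c = c := fun _ => rfl
      have := emitDir_wp (W := W) (U := U) (B := B) (o := o) (bs := []) (a := src) (b := copy)
        (w := leftWt) (s := s₃) (by decide) (by decide) (by decide) (by omega) fun hS => ?_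
      · rw [hnil] at this
        refine this.conseq (by omega) fun s' _ h => h.trans ?_
        congr 1
        ext e
        have hp0 : Passes [] s₃ := by simp [Passes]
        unfold thrv at ht
        simp only [Set.mem_ofPred_eq, LeftEdge, p₁, p₂, p₃, ht, not_lt.mpr ht, true_and,
          false_and, false_or, NExp.val, RExp.val, hi₃, hj₃, hl₃, h2, e29, e33, e35, e36, r30, r27,
          thrv, two_mul, hp0]
      · refine ⟨by simp, fun _ => ?_⟩
        have gW := hS' 36 (s.narr 29 j 0) l
        rw [e36] at gW
        have jW : j ≤ W := by omega
        have lW : l ≤ W := by omega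
        have iW : i ≤ W := by omega
        have mW : m ≤ W := by omega
        have miW : m + i ≤ W := by omega
        have mmW : m + m ≤ W := by omega
        have mcW : m + m + s.narr 36 (s.narr 29 j 0) l ≤ W := by omega
        simp [NExp.Fits, RExp.Fits, NExp.val, h2, hi₃, hj₃, hl₃, hS', jW, lW, iW, mW, miW, mmW, mcW,
          e36, e29, gW]
        omega
  · ext e
    have : ¬ LeftEdge s m o i j l e := fun h => hp (hpass.mpr ⟨h.1, h.2.1, h.2.2.1⟩)
    simp [this]

end Alg

end Shortcut

/-! ### Real-valued weights, and the indexing of the two-edge paths. -/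

namespace Shortcut

open RealRAM

namespace Data

variable (D : Data)

/-- The real number `d¹(r, v)` in `Γ`. -/
noncomputable def d₁ (r v : ℕ) : ℝ := (hopDist D.gam 1 r v).toReal

/-- The real number `d⁰(u, r)` in `Γ`. -/
noncomputable def d₀ (u r : ℕ) : ℝ := (hopDist D.gam 0 u r).toReal

/-- There is an edge from the Steiner vertex of `r` to `v`. -/
def OutE (r v : ℕ) : Prop := r ∈ D.N ∧ (v ∈ D.vOut r ∨ D.G.IsNegEdge r v)

/-- There is an edge from `u` to the Steiner vertex of `r`. -/
def InE (r u : ℕ) : Prop := r ∈ D.N ∧ (u ∈ D.vIn r ∨ u = r)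

/-- The weights of the edges (S2), and below of the edges (S3), as real numbers. -/
noncomputable def w₂ (r v : ℕ) : ℝ := D.d₁ r v + D.Δ r

noncomputable def w₃ (r u : ℕ) : ℝ := D.d₀ u r - D.Δ r

/-- The edges of `G'` between vertices of `Γ`: for `k = 0` those of `Γ`, for `k = 1` and `k = 2`
the two kinds of shortcuts. -/
def Core (k v w : ℕ) (x : ℝ) : Prop :=
  if k = 0 then D.G.adj v w = true ∧ x = D.wtΓ v w
  else if k = 1 then v ∈ D.N ∧ ∃ z ∈ D.vOut v, D.G.IsNegEdge z w ∧ x = D.d₁ v z + D.wtΓ z w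
  else ∃ r u', D.G.IsNegEdge r w ∧ u' ∈ D.vIn r ∧ D.G.IsNegEdge v u' ∧
    x = D.wtΓ v u' + D.d₀ u' r + D.wtΓ r w

/-- The imaginary negative edges between `i` and the vertex of the index `j`. -/
def Lft (i j : ℕ) : Prop :=
  if j < 3 * D.G.m then D.OutE i (j % D.G.m) ∧ D.w₂ i (j % D.G.m) < 0
  else D.InE i (j % D.G.m) ∧ D.w₃ i (j % D.G.m) < 0

/-- Normalised against `Rgt`: a two-edge path made of the imaginary edge and an edge with value `y`
has weight `y - lftX`, whichever copy it passes through. So it is non-negative iff `lftX ≤ y`. -/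
noncomputable def lftX (i j : ℕ) : ℝ :=
  if j < 3 * D.G.m then D.shiftΓ (j % D.G.m) - D.w₂ i (j % D.G.m)
  else 0 - D.w₃ i (j % D.G.m) - D.shiftΓ (j % D.G.m)

/-- The edges between the vertex of the index `j` and `w`. -/
def Rgt (j w : ℕ) (y : ℝ) : Prop :=
  if j < 3 * D.G.m then ∃ x, D.Core (j / D.G.m) (j % D.G.m) w x ∧ y = x + D.shiftΓ (j % D.G.m)
  else ∃ x, D.Core (j / D.G.m - 3) w (j % D.G.m) x ∧ y = x - D.shiftΓ (j % D.G.m)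

/-- The group of the index `j`. -/
def grpOf (j : ℕ) : ℕ :=
  if j < D.G.m then D.G.base j else if j < 3 * D.G.m then j
  else if j < 4 * D.G.m then 3 * D.G.m + D.G.base (j % D.G.m) else j

end Data

namespace Alg

/-! ## Preparation of the tables -/

variable {W U B : ℕ} {D : Data}

open Classical in
/-- The part of the input that the program uses. -/
structure Input (D : Data) (s : Mem) : Prop where
  n2 : s.nvar 2 = D.G.m
  n3 : s.nvar 3 = 6 * D.G.m
  n18 : s.nvar 18 = 3 * D.G.m
  r0 : s.rvar 0 = 0
  base : ∀ v < D.G.m, s.narr 0 v 0 = D.G.base v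
  adj : ∀ i j, 0 < s.narr 1 i j ↔ D.G.adj i j = true
  neg : ∀ i j, s.narr 2 i j = if D.G.IsNegEdge i j then 1 else 0
  out : ∀ i j, s.narr 5 i j = if i ∈ D.N ∧ j ∈ D.vOut i then 1 else 0
  inn : ∀ i j, s.narr 6 i j = if i ∈ D.N ∧ j ∈ D.vIn i then 1 else 0
  shift : ∀ v < D.G.m, s.rarr 0 v 0 = D.shiftΓ v
  wt : ∀ i j, D.G.adj i j = true → s.rarr 1 i j = D.wtΓ i j
  del : ∀ i ∈ D.N, s.rarr 2 i 0 = D.Δ i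
  w₂ : ∀ i j, s.rarr 3 i j = if D.OutE i j then D.w₂ i j else 0
  w₃ : ∀ i j, s.rarr 4 i j = if D.InE i j then D.w₃ i j else 0

theorem Input.frame {c : Prog} {s s' : Mem} (h : Input D s) (hF : Frame c s s')
    (hc : ((∀ A ∈ [0, 1, 2, 5, 6], A ∉ c.narrs) ∧ (∀ A ∈ [0, 1, 2, 3, 4], A ∉ c.rarrs) ∧
      (∀ x ∈ [2, 3, 18], x ∉ c.nvars) ∧ 0 ∉ c.rvars)) : Input D s' := by
  obtain ⟨h₁, h₂, h₃, h₄⟩ := hc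
  constructor
  · rw [hF.nvar 2 (h₃ 2 (by simp))]; exact h.n2
  · rw [hF.nvar 3 (h₃ 3 (by simp))]; exact h.n3
  · rw [hF.nvar 18 (h₃ 18 (by simp))]; exact h.n18
  · rw [hF.rvar 0 h₄]; exact h.r0
  · rw [hF.narr 0 (h₁ 0 (by simp))]; exact h.base
  · rw [hF.narr 1 (h₁ 1 (by simp))]; exact h.adj
  · rw [hF.narr 2 (h₁ 2 (by simp))]; exact h.neg
  · rw [hF.narr 5 (h₁ 5 (by simp))]; exact h.out
  · rw [hF.narr 6 (h₁ 6 (by simp))]; exact h.inn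
  · rw [hF.rarr 0 (h₂ 0 (by simp))]; exact h.shift
  · rw [hF.rarr 1 (h₂ 1 (by simp))]; exact h.wt
  · rw [hF.rarr 2 (h₂ 2 (by simp))]; exact h.del
  · rw [hF.rarr 3 (h₂ 3 (by simp))]; exact h.w₂
  · rw [hF.rarr 4 (h₂ 4 (by simp))]; exact h.w₃

theorem init_wp (hP : Par W U B D.G.m) :
    WP W U B init D.start init.steps (fun s => Input D s ∧ s.nvar 0 = 0 ∧ s.nvar 1 = 0 ∧
      ∀ A, 6 < A → ∀ i j, s.narr A i j = 0) := by
  have := hP.hU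
  have := hP.hW
  have e0 : D.start.nvar 0 = D.G.m := by simp [Data.start]
  refine WP.of_pre fun _ _ _ => ?_
  simp only [init, Prog.pre, NExp.Fits, NExp.val, Mem.setN, e0]
  simp only [Nat.reduceEqDiff, if_true, if_false, Nat.reduceLeDiff, false_imp_iff, true_and]
  refine ⟨by omega, ⟨by omega, ⟨by omega, by omega, by omega⟩, by omega⟩,
    ⟨by omega, by omega, by omega⟩, by omega, fun _ => trivial, ?_, by simp [Data.start], ?_⟩
  · constructor
    · simp
    · simp; ring
    · simp; ring
    · simp [Data.start]
    · intro v hv; simp [Data.start, hv]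
    · intro i j; by_cases h : D.G.adj i j = true <;> simp [Data.start, h]
    · intro i j; by_cases h : D.G.IsNegEdge i j <;> simp [Data.start, h]
    · intro i j; by_cases h : i ∈ D.N ∧ j ∈ D.vOut i <;> simp [Data.start, h]
    · intro i j; by_cases h : i ∈ D.N ∧ j ∈ D.vIn i <;> simp [Data.start, h]
    · intro v hv; simp [Data.start, hv]
    · intro i j h; simp [Data.start, h]
    · intro i h; simp [Data.start, h]
    · intro i j
      by_cases h : i ∈ D.N ∧ (j ∈ D.vOut i ∨ D.G.IsNegEdge i j) <;>
        simp [Data.start, Data.OutE, Data.w₂, Data.d₁, h]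
    · intro i j
      by_cases h : i ∈ D.N ∧ (j ∈ D.vIn i ∨ j = i) <;>
        simp [Data.start, Data.InE, Data.w₃, Data.d₀, h]
  · intro A hA i j
    have : ∀ k ≤ 6, A ≠ k := by omega
    simp [Data.start, this]

/-- The first `n` candidates for the neighbour of `i` along a negative edge have been tried. -/
def NegSpec (R : ℕ → Prop) (n x : ℕ) : Prop :=
  (x = 0 ∧ ∀ j < n, ¬ R j) ∨ ∃ j < n, R j ∧ x = j + 1

theorem NegSpec.succ_of {R : ℕ → Prop} {n x y : ℕ} (h : NegSpec R n x)
    (h₁ : R n → y = n + 1) (h₂ : ¬ R n → y = x) : NegSpec R (n + 1) y := by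
  by_cases hR : R n
  · exact Or.inr ⟨n, by omega, hR, h₁ hR⟩
  · rw [h₂ hR]
    rcases h with ⟨h, h'⟩ | ⟨j, hj, h⟩
    · refine Or.inl ⟨h, fun j hj => ?_⟩
      rcases Nat.lt_succ_iff_lt_or_eq.mp hj with hj | rfl
      exacts [h' j hj, hR]
    · exact Or.inr ⟨j, by omega, h⟩

/-- The tables of heads and tails of negative edges. -/
structure Heads (D : Data) (s : Mem) : Prop where
  head : ∀ i < D.G.m, NegSpec (fun j => D.G.IsNegEdge i j) D.G.m (s.narr 20 i 0)
  tail : ∀ i < D.G.m, NegSpec (fun j => D.G.IsNegEdge j i) D.G.m (s.narr 21 i 0)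

def headsCost : ℕ :=
  (Prog.seq (.nput 20 (.var 4) (.lit 0) (.lit 0)) (.nput 21 (.var 4) (.lit 0) (.lit 0))).steps

theorem heads_wp (hP : Par W U B D.G.m) {s : Mem} (hI : Input D s) :
    WP W U B heads s (D.G.m * (headsCost + (D.G.m * (headBody.steps + 7) + 5) + 7) + 5)
      (Heads D) := by
  have := hP.hU
  have := hP.hW
  refine (WP.forLoop_all (fun i s' => NegSpec (fun j => D.G.IsNegEdge i j) D.G.m (s'.narr 20 i 0) ∧
    NegSpec (fun j => D.G.IsNegEdge j i) D.G.m (s'.narr 21 i 0)) (fun _ _ _ h => h) (by decide)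
    (by decide) (by decide) (by decide) hI.n2 (by omega) ?_).conseq le_rfl
    fun s' _ h => ⟨fun i hi => (h i hi).1, fun i hi => (h i hi).2⟩
  intro i s₁ hi hF₁ hi₁
  refine WP.seq (R := fun s' => s' = (s₁.putN 20 i 0 0).putN 21 i 0 0) (WP.of_pre fun _ _ _ => ?_) ?_
  · simp only [Prog.pre, NExp.Fits, NExp.val, Mem.putN, hi₁]
    simp
    omega
  rintro s₂ hF₂ hs₂
  have i20 : ∀ i', s₂.narr 20 i' 0 = if i' = i then 0 else s₁.narr 20 i' 0 := by
    intro i'; rw [hs₂]; simp [Mem.putN]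
  have i21 : ∀ i', s₂.narr 21 i' 0 = if i' = i then 0 else s₁.narr 21 i' 0 := by
    intro i'; rw [hs₂]; simp [Mem.putN]
  refine (WP.forLoop_const (fun k s' => NegSpec (fun j => D.G.IsNegEdge i j) k (s'.narr 20 i 0) ∧
    NegSpec (fun j => D.G.IsNegEdge j i) k (s'.narr 21 i 0) ∧ ∀ i', i' ≠ i →
    s'.narr 20 i' 0 = s₁.narr 20 i' 0 ∧ s'.narr 21 i' 0 = s₁.narr 21 i' 0) (by decide) (by decide)
    (by decide) (by decide) (n := D.G.m) ?_ (by omega) ?_ ?_).conseq le_rfl ?_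
  · rw [hF₂.nvar 2 (by decide), hF₁.nvar 2 (by decide), hI.n2]
  · refine ⟨Or.inl ⟨?_, by simp⟩, Or.inl ⟨?_, by simp⟩, fun i' hi' => ?_⟩
    · simpa [Mem.setN] using i20 i
    · simpa [Mem.setN] using i21 i
    · simp [Mem.setN, i20, i21, hi']
  · rintro k s₃ hk hF₃ hk₃ ⟨h20, h21, hne⟩
    have hi₃ : s₃.nvar 4 = i := by rw [hF₃.nvar 4 (by decide), hF₂.nvar 4 (by decide), hi₁]
    have e2 : s₃.narr 2 = s.narr 2 := by
      rw [hF₃.narr 2 (by decide), hF₂.narr 2 (by decide), hF₁.narr 2 (by decide)]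
    have p1 : 0 < s₃.narr 2 i k ↔ D.G.IsNegEdge i k := by
      rw [e2, hI.neg]; split_ifs with h <;> simp [h]
    have p2 : 0 < s₃.narr 2 k i ↔ D.G.IsNegEdge k i := by
      rw [e2, hI.neg]; split_ifs with h <;> simp [h]
    have u1 : s₃.narr 2 i k ≤ W := by rw [e2, hI.neg]; split_ifs <;> omega
    have u2 : s₃.narr 2 k i ≤ W := by rw [e2, hI.neg]; split_ifs <;> omega
    refine WP.of_pre fun _ _ _ => ?_
    have iW : i ≤ W := by omega
    have kW : k ≤ W := by omega
    have kW1 : k + 1 ≤ W := by omega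
    have kU : k + 1 ≤ U := by omega
    have W1 : 1 ≤ W := by omega
    by_cases c1 : D.G.IsNegEdge i k <;> by_cases c2 : D.G.IsNegEdge k i
    all_goals
      simp only [headBody, RealRAM.guard, guardElse, Prog.pre, NExp.Fits, NExp.val, Test.Fits, Test.Holds,
        Mem.putN, hi₃, hk₃, p1, p2, c1, c2]
      simp only [Nat.reduceEqDiff, false_and, if_false, iW, kW, kW1, kU, u1, u2, W1, zero_le,
        and_true, true_and, true_imp_iff, not_true, not_false_iff, false_imp_iff, p2, c2]
      try intro _
      try intro _
      refine ⟨h20.succ_of (fun h => ?_) (fun h => ?_), h21.succ_of (fun h => ?_) (fun h => ?_),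
        fun i' hi' => ?_⟩
      all_goals first
        | exact absurd h ‹¬ _›
        | exact absurd ‹_› h
        | (simp [Mem.setN]; done)
        | (simp [Mem.setN, hi']; exact hne i' hi')
  · rintro s₃ hF₃ ⟨h1, h2, h3⟩
    exact ⟨⟨h1, h2⟩, fun i' hi' h => by rw [(h3 i' hi'.ne).1, (h3 i' hi'.ne).2]; exact h⟩

theorem halves_wp (hP : Par W U B D.G.m) {s : Mem} (hI : Input D s) :
    WP W U B halves s (D.G.m * (halfBody.steps + 7) + 5)
      (fun s' => ∀ i < 2 * D.G.m, s'.narr 22 i 0 = i / 2) := by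
  have := hP.hU
  have := hP.hW
  refine (WP.forLoop_const (fun k s' => ∀ i < 2 * k, s'.narr 22 i 0 = i / 2) (by decide) (by decide)
    (by decide) (by decide) hI.n2 (by omega) (by simp) ?_).conseq le_rfl fun _ _ h => h
  intro k s₁ hk hF hk₁ h
  refine WP.of_pre fun _ _ _ => ?_
  simp only [halfBody, Prog.pre, NExp.Fits, NExp.val, Mem.putN, hk₁]
  refine ⟨⟨by omega, by omega, by omega⟩, by omega, by omega, by omega, fun _ =>
    ⟨⟨⟨by omega, by omega, by omega⟩, by omega, by omega⟩, by omega, by omega, by omega,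
      fun _ i hi => ?_⟩⟩
  by_cases h1 : i = k + k + 1
  · simp [Mem.setN, h1]; omega
  · by_cases h2 : i = k + k
    · simp [Mem.setN, h2]; omega
    · simpa [Mem.setN, h1, h2] using h i (by omega)

/-- The tables of the vertices and groups of the indices. -/
structure Indices (D : Data) (s : Mem) : Prop where
  vtx : ∀ j < 6 * D.G.m, s.narr 28 j 0 = j % D.G.m
  grp : ∀ j < 6 * D.G.m, s.narr 29 j 0 = D.grpOf j

theorem indices_wp (hP : Par W U B D.G.m) {s : Mem} (hI : Input D s)
    (hb : ∀ v < D.G.m, D.G.base v < D.G.m) :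
    WP W U B indices s ((Prog.nset 8 (.lit 0)).steps + (6 * D.G.m * (indexBody.steps + 7) + 5))
      (Indices D) := by
  have := hP.hU
  have := hP.hW
  refine WP.seq (R := fun s' => s'.nvar 8 = 0) (WP.of_pre fun _ _ _ => by
    simp [Prog.pre, NExp.Fits, NExp.val, Mem.setN]) ?_
  intro s₁ hF₁ h8
  refine (WP.forLoop_const (fun k s' => s'.nvar 8 = k % D.G.m ∧ ∀ j < k,
    s'.narr 28 j 0 = j % D.G.m ∧ s'.narr 29 j 0 = D.grpOf j) (by decide) (by decide)
    (by decide) (by decide) ((hF₁.nvar 3 (by decide)).trans hI.n3) (by omega)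
    (by simpa [Mem.setN] using h8) ?_).conseq le_rfl fun s' _ h =>
      ⟨fun j hj => (h.2 j hj).1, fun j hj => (h.2 j hj).2⟩
  rintro k s₂ hk hF₂ hk₂ ⟨h8, h⟩
  have hm : 0 < D.G.m := by omega
  have hv := Nat.mod_lt k hm
  have e2 : s₂.nvar 2 = D.G.m := by rw [hF₂.nvar 2 (by decide), hF₁.nvar 2 (by decide), hI.n2]
  have e18 : s₂.nvar 18 = 3 * D.G.m := by
    rw [hF₂.nvar 18 (by decide), hF₁.nvar 18 (by decide), hI.n18]
  have eb : s₂.narr 0 (k % D.G.m) 0 = D.G.base (k % D.G.m) := by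
    rw [hF₂.narr 0 (by decide), hF₁.narr 0 (by decide), hI.base _ hv]
  have hbk := hb _ hv
  -- Variable `8` follows `k % m` by wrapping around at `m`, as the machine has no remainder
  -- operation.
  have succ_mod : (k + 1) % D.G.m = if k % D.G.m + 1 < D.G.m then k % D.G.m + 1 else 0 := by
    have e : (k + 1) % D.G.m = (k % D.G.m + 1) % D.G.m := by simp [Nat.add_mod]
    split_ifs with h
    · rw [e, Nat.mod_eq_of_lt h]
    · rw [e, show k % D.G.m + 1 = D.G.m by omega, Nat.mod_self]
  refine WP.of_pre fun _ _ _ => ?_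
  have fin : ∀ j < k + 1, (if j = k then k % D.G.m else s₂.narr 28 j 0) = j % D.G.m ∧
      (if j = k then D.grpOf k else s₂.narr 29 j 0) = D.grpOf j := by
    intro j hj
    split_ifs with hjk
    · rw [hjk]; exact ⟨rfl, rfl⟩
    · exact h j (by omega)
  have kW : k ≤ W := by omega
  have vW : k % D.G.m ≤ W := by omega
  have vW1 : k % D.G.m + 1 ≤ W := by omega
  have vU : k % D.G.m ≤ U := by omega
  have bU : D.G.base (k % D.G.m) ≤ U := by omega
  have bW : D.G.base (k % D.G.m) ≤ W := by omega
  have b3U : 3 * D.G.m + D.G.base (k % D.G.m) ≤ U := by omega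
  have b3W : 3 * D.G.m + D.G.base (k % D.G.m) ≤ W := by omega
  have kU : k ≤ U := by omega
  have mW : D.G.m ≤ W := by omega
  have m3W : 3 * D.G.m ≤ W := by omega
  have m4W : 3 * D.G.m + D.G.m ≤ W := by omega
  have W1 : 1 ≤ W := by omega
  simp only [indexBody, Prog.pre, NExp.Fits, NExp.val, Test.Fits, Test.Holds, Mem.putN, Mem.setN,
    hk₂, h8, e2, e18]
  simp only [Nat.reduceEqDiff, false_and, if_false, if_true, kW, vW, vW1, vU, bU, bW, b3U, b3W, kU,
    mW, m3W, m4W, W1, eb, zero_le, and_true, true_and, Nat.reduceLeDiff,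
    false_imp_iff]
  intro _
  have tail : ∀ g : ℕ, g = D.grpOf k →
      ((k % D.G.m + 1 < D.G.m → k % D.G.m + 1 = (k + 1) % D.G.m ∧
        ∀ j < k + 1, (if j = k then k % D.G.m else s₂.narr 28 j 0) = j % D.G.m ∧
          (if j = k then g else s₂.narr 29 j 0) = D.grpOf j) ∧
      (¬ k % D.G.m + 1 < D.G.m → 0 = (k + 1) % D.G.m ∧
        ∀ j < k + 1, (if j = k then k % D.G.m else s₂.narr 28 j 0) = j % D.G.m ∧
          (if j = k then g else s₂.narr 29 j 0) = D.grpOf j)) := by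
    rintro g rfl
    refine ⟨fun h => ⟨by rw [succ_mod, if_pos h], fin⟩, fun h => ⟨by rw [succ_mod, if_neg h], fin⟩⟩
  refine ⟨fun c1 _ => tail _ ?_, fun c1 => ⟨fun c2 _ => tail _ ?_,
    fun c2 => ⟨fun c3 _ => tail _ ?_, fun c3 _ => tail _ ?_⟩⟩⟩
  · rw [Data.grpOf, if_pos c1, Nat.mod_eq_of_lt c1]
  · rw [Data.grpOf, if_neg c1, if_pos c2]
  · rw [Data.grpOf, if_neg c1, if_neg c2, if_pos (by omega)]
  · rw [Data.grpOf, if_neg c1, if_neg c2, if_neg (by omega)]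

end Alg

end Shortcut

namespace Shortcut

open RealRAM

namespace Alg

/-! ## The tables of weights -/

/-- The entry `(i, j)` of the table `A` holds a number with the property `R`, if there is one. -/
def Cell (s : Mem) (A i j : ℕ) (R : ℝ → Prop) : Prop :=
  (0 < s.narr A i j ∧ R (s.rarr A i j)) ∨ (s.narr A i j = 0 ∧ ∀ x, ¬ R x)

theorem Cell.pos_iff {s : Mem} {A i j : ℕ} {R : ℝ → Prop} (h : Cell s A i j R) :
    0 < s.narr A i j ↔ ∃ x, R x := by
  rcases h with ⟨h, h'⟩ | ⟨h, h'⟩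
  · exact ⟨fun _ => ⟨_, h'⟩, fun _ => h⟩
  · exact ⟨fun h₁ => by omega, fun ⟨x, hx⟩ => absurd hx (h' x)⟩

theorem Cell.val {s : Mem} {A i j : ℕ} {R : ℝ → Prop} (h : Cell s A i j R)
    (hp : 0 < s.narr A i j) : R (s.rarr A i j) := by
  rcases h with ⟨h, h'⟩ | ⟨h, h'⟩
  · exact h'
  · omega

theorem Cell.congr {s s' : Mem} {A i j : ℕ} {R : ℝ → Prop} (h : Cell s A i j R)
    (h₁ : s'.narr A i j = s.narr A i j) (h₂ : s'.rarr A i j = s.rarr A i j) : Cell s' A i j R := by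
  unfold Cell
  rw [h₁, h₂]
  exact h

theorem _root_.RealRAM.Flagged.cell {bs : List (Bool × Test)} {A i j : ℕ} {a b : NExp} {w : RExp} {s s' : Mem}
    (h : Flagged bs A a b w s s') (ha : a.val s = i) (hb : b.val s = j) (R : ℕ → ℕ → ℝ → Prop)
    (hp : Passes bs s → R i j (w.val s)) (hn : ∀ x, R i j x → Passes bs s) :
    Cell s' A i j (R i j) ∧ ∀ i' j', (i' ≠ i ∨ j' ≠ j) → Cell s A i' j' (R i' j') →
      Cell s' A i' j' (R i' j') := by
  subst ha hb
  refine ⟨?_, fun i' j' hij hc => hc.congr (h.narr _ _ hij) (h.rarr _ _ hij)⟩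
  rcases h.val with ⟨h₁, h₂, h₃⟩ | ⟨h₁, h₂⟩
  · refine Or.inl ⟨by omega, ?_⟩
    rw [h₃]; exact hp h₂
  · exact Or.inr ⟨h₁, fun x hx => h₂ (hn x hx)⟩

variable {W U B : ℕ} {D : Data}

theorem _root_.Shortcut.CopyGraph.WellFormed.tail_unique {G : CopyGraph} (hG : G.WellFormed)
    {u u' v : ℕ} (h : G.IsNegEdge u v) (h' : G.IsNegEdge u' v) : u = u' :=
  (hG.neg_unique v u v u' v h h' (Or.inr rfl) (Or.inr rfl)).1

theorem _root_.Shortcut.CopyGraph.WellFormed.head_unique {G : CopyGraph} (hG : G.WellFormed)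
    {u v v' : ℕ} (h : G.IsNegEdge u v) (h' : G.IsNegEdge u v') : v = v' :=
  (hG.neg_unique u u v u v' h h' (Or.inl rfl) (Or.inl rfl)).2

theorem _root_.Shortcut.CopyGraph.WellFormed.neg_lt {G : CopyGraph} (hG : G.WellFormed)
    {u v : ℕ} (h : G.IsNegEdge u v) : u < G.m ∧ v < G.m := hG.adj_lt u v h.1

/-- The entry of the table of heads is the head plus one. -/
theorem Heads.head_iff {s : Mem} (h : Heads D s) (hG : D.G.WellFormed) {i j : ℕ} (hi : i < D.G.m) :
    s.narr 20 i 0 = j + 1 ↔ D.G.IsNegEdge i j := by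
  rcases h.head i hi with ⟨h₁, h₂⟩ | ⟨j', h₁, h₂, h₃⟩
  · exact ⟨fun h => by omega, fun h => absurd h (h₂ j (hG.neg_lt h).2)⟩
  · constructor
    · intro h; obtain rfl : j = j' := by omega
      exact h₂
    · intro h; rw [hG.head_unique h h₂, h₃]

theorem Heads.tail_iff {s : Mem} (h : Heads D s) (hG : D.G.WellFormed) {i j : ℕ} (hi : i < D.G.m) :
    s.narr 21 i 0 = j + 1 ↔ D.G.IsNegEdge j i := by
  rcases h.tail i hi with ⟨h₁, h₂⟩ | ⟨j', h₁, h₂, h₃⟩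
  · exact ⟨fun h => by omega, fun h => absurd h (h₂ j (hG.neg_lt h).1)⟩
  · constructor
    · intro h; obtain rfl : j = j' := by omega
      exact h₂
    · intro h; rw [hG.tail_unique h h₂, h₃]

theorem Heads.head_pos {s : Mem} (h : Heads D s) (hG : D.G.WellFormed) {i : ℕ} (hi : i < D.G.m) :
    0 < s.narr 20 i 0 ↔ i ∈ D.N := by
  constructor
  · intro hp
    obtain ⟨j, hj⟩ : ∃ j, s.narr 20 i 0 = j + 1 := ⟨s.narr 20 i 0 - 1, by omega⟩
    exact ⟨j, (h.head_iff hG hi).mp hj⟩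
  · rintro ⟨j, hj⟩
    rw [(h.head_iff hG hi).mpr hj]
    omega

/-- Negative edges form a matching, so the pair `(r, v')` determines the tail `v` of the negative
edge into `v'`. One table look-up per pair replaces a search over `v`. -/
theorem core₁_wp (hP : Par W U B D.G.m) (hG : D.G.WellFormed) {s : Mem} (hI : Input D s)
    (hH : Heads D s) :
    WP W U B core₁ s (D.G.m * (D.G.m * (flagCost core₁Tests 25 (.var 4) (.var 5) core₁Wt + 7)
        + 5 + 7) + 5)
      (fun s' => ∀ i < D.G.m, ∀ j < D.G.m, Cell s' 25 i j (D.Core 1 i j)) := by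
  have := hP.hU
  have := hP.hW
  refine WP.forLoop₂_all (fun i j s => Cell s 25 i j (D.Core 1 i j)) (fun _ _ _ _ h => h)
    (fun _ _ _ _ h => h) (by decide) (by decide) (by decide) (by decide) (by decide) (by decide)
    (by decide) (by decide) (by decide) (by decide) (by decide) hI.n2 hI.n2 (by omega) (by omega) ?_
  intro i j s₁ hi hj hF hi₁ hj₁
  have hI := hI.frame (c := core₁) hF (by decide)
  have e20 : s₁.narr 20 = s.narr 20 := hF.narr 20 (by decide)
  have e21 : s₁.narr 21 = s.narr 21 := hF.narr 21 (by decide)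
  have hH : Heads D s₁ := ⟨by rw [e20]; exact hH.head, by rw [e21]; exact hH.tail⟩
  refine (WP.flagIf (by omega) (by omega) fun hS => ?_).conseq le_rfl fun s' _ h => ?_
  · have hS' : ∀ A i j, s₁.narr A i j ≤ W := fun A i j => (hS A i j).trans (by omega)
    have iW : i ≤ W := by omega
    have jW : j ≤ W := by omega
    have W1 : 1 ≤ W := by omega
    have hp : s₁.narr 21 j 0 - 1 ≤ W := (Nat.sub_le _ _).trans (hS' _ _ _)
    simp [core₁Tests, core₁Wt, Test.Fits, NExp.Fits, RExp.Fits, NExp.val, hi₁, hj₁, hS', iW, jW, W1]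
  · have key := h.cell hi₁ hj₁ (D.Core 1) ?_ ?_
    · exact ⟨key.1, fun i' j' hij _ _ => key.2 i' j' hij⟩
    · intro hp
      simp [core₁Tests, Passes, Test.Holds, NExp.val, hi₁, hj₁] at hp
      obtain ⟨h₁, h₂⟩ := hp
      obtain ⟨z, hz⟩ : ∃ z, s₁.narr 21 j 0 = z + 1 := ⟨s₁.narr 21 j 0 - 1, by omega⟩
      have hzj := (hH.tail_iff hG hj).mp hz
      rw [hz, Nat.add_sub_cancel, hI.out] at h₂
      split_ifs at h₂ with h₃
      · refine ⟨h₃.1, z, h₃.2, hzj, ?_⟩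
        have hO : D.OutE i z := ⟨h₃.1, Or.inl h₃.2⟩
        simp only [core₁Wt, RExp.val, NExp.val, hi₁, hj₁, hz, Nat.add_sub_cancel, hI.w₂,
          if_pos hO, hI.del i h₃.1, hI.wt _ _ hzj.1, Data.w₂]
        ring
      · simp at h₂
    · rintro x ⟨hN, z, hz, hzj, -⟩
      have := (hH.tail_iff hG hj).mpr hzj
      simp [core₁Tests, Passes, Test.Holds, NExp.val, hi₁, hj₁, this, hI.out, hN, hz]

/-- For a pair `(u, r')`, both the head `u'` of the negative edge out of `u` and the tail `r` of the
one into `r'` are determined, again by the matching property. -/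
theorem core₂_wp (hP : Par W U B D.G.m) (hG : D.G.WellFormed) {s : Mem} (hI : Input D s)
    (hH : Heads D s) :
    WP W U B core₂ s (D.G.m * (D.G.m * (flagCost core₂Tests 26 (.var 4) (.var 5) core₂Wt + 7)
        + 5 + 7) + 5)
      (fun s' => ∀ i < D.G.m, ∀ j < D.G.m, Cell s' 26 i j (D.Core 2 i j)) := by
  have := hP.hU
  have := hP.hW
  refine WP.forLoop₂_all (fun i j s => Cell s 26 i j (D.Core 2 i j)) (fun _ _ _ _ h => h)
    (fun _ _ _ _ h => h) (by decide) (by decide) (by decide) (by decide) (by decide) (by decide)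
    (by decide) (by decide) (by decide) (by decide) (by decide) hI.n2 hI.n2 (by omega) (by omega) ?_
  intro i j s₁ hi hj hF hi₁ hj₁
  have hI := hI.frame (c := core₂) hF (by decide)
  have e20 : s₁.narr 20 = s.narr 20 := hF.narr 20 (by decide)
  have e21 : s₁.narr 21 = s.narr 21 := hF.narr 21 (by decide)
  have hH : Heads D s₁ := ⟨by rw [e20]; exact hH.head, by rw [e21]; exact hH.tail⟩
  refine (WP.flagIf (by omega) (by omega) fun hS => ?_).conseq le_rfl fun s' _ h => ?_
  · have hS' : ∀ A i j, s₁.narr A i j ≤ W := fun A i j => (hS A i j).trans (by omega)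
    have iW : i ≤ W := by omega
    have jW : j ≤ W := by omega
    have W1 : 1 ≤ W := by omega
    simp [core₂Tests, core₂Wt, Test.Fits, NExp.Fits, RExp.Fits, NExp.val, hi₁, hj₁, hS', iW, jW, W1]
  · have key := h.cell hi₁ hj₁ (D.Core 2) ?_ ?_
    · exact ⟨key.1, fun i' j' hij _ _ => key.2 i' j' hij⟩
    · intro hp
      simp [core₂Tests, Passes, Test.Holds, NExp.val, hi₁, hj₁] at hp
      obtain ⟨h₁, h₂, h₃⟩ := hp
      obtain ⟨r, hr⟩ : ∃ z, s₁.narr 21 j 0 = z + 1 := ⟨s₁.narr 21 j 0 - 1, by omega⟩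
      obtain ⟨u, hu⟩ : ∃ z, s₁.narr 20 i 0 = z + 1 := ⟨s₁.narr 20 i 0 - 1, by omega⟩
      have hrj := (hH.tail_iff hG hj).mp hr
      have hiu := (hH.head_iff hG hi).mp hu
      rw [hr, hu, Nat.add_sub_cancel, Nat.add_sub_cancel, hI.inn] at h₃
      split_ifs at h₃ with h₄
      · refine ⟨r, u, hrj, h₄.2, hiu, ?_⟩
        have hE : D.InE r u := ⟨h₄.1, Or.inl h₄.2⟩
        simp only [core₂Wt, RExp.val, NExp.val, hi₁, hj₁, hr, hu, Nat.add_sub_cancel, hI.w₃,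
          if_pos hE, hI.del r h₄.1, hI.wt _ _ hrj.1, hI.wt _ _ hiu.1, Data.w₃]
        ring
      · simp at h₃
    · rintro x ⟨r, u, hr, hu, hiu, -⟩
      have h₁ := (hH.tail_iff hG hj).mpr hr
      have h₂ := (hH.head_iff hG hi).mpr hiu
      have h₃ : r ∈ D.N := ⟨j, hr⟩
      simp [core₂Tests, Passes, Test.Holds, NExp.val, hi₁, hj₁, h₁, h₂, hI.inn, h₃, hu]

/-- The weight of an imaginary edge, for the index `j`. -/
def LeftIs (D : Data) (i j : ℕ) (x : ℝ) : Prop := D.Lft i j ∧ x = D.lftX i j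

def leftsCost : ℕ :=
  (Test.nlt (.var 5) (.var 18)).cost + (left₁.steps + left₂.steps)

theorem lefts_wp (hP : Par W U B D.G.m) {s : Mem} (hI : Input D s) (hJ : Indices D s) :
    WP W U B lefts s (D.G.m * (6 * D.G.m * (leftsCost + 7) + 5 + 7) + 5)
      (fun s' => ∀ i < D.G.m, ∀ j < 6 * D.G.m, Cell s' 27 i j (LeftIs D i j)) := by
  have := hP.hU
  have := hP.hW
  refine WP.forLoop₂_all (fun i j s => Cell s 27 i j (LeftIs D i j)) (fun _ _ _ _ h => h)
    (fun _ _ _ _ h => h) (by decide) (by decide) (by decide) (by decide) (by decide) (by decide)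
    (by decide) (by decide) (by decide) (by decide) (by decide) hI.n2 hI.n3 (by omega) (by omega) ?_
  intro i j s₁ hi hj hF hi₁ hj₁
  have hI := hI.frame (c := lefts) hF (by decide)
  have e28 : s₁.narr 28 j 0 = j % D.G.m := by rw [hF.narr 28 (by decide), hJ.vtx j hj]
  have hv : j % D.G.m < D.G.m := Nat.mod_lt _ (by omega)
  have iW : i ≤ W := by omega
  have jW : j ≤ W := by omega
  have vW : j % D.G.m ≤ W := by omega
  have nW : 3 * D.G.m ≤ W := by omega
  refine WP.ite (fun _ => ?_) (fun hb => ?_) (fun hb => ?_)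
  · simp [Test.Fits, NExp.Fits, hj₁, hI.n18, jW, nW]
  · simp only [Test.Holds, NExp.val, hj₁, hI.n18] at hb
    refine (WP.flagIf (by omega) (by omega) fun hS => ?_).conseq
      ((show _ ≤ left₁.steps by decide).trans (Nat.le_add_right _ _)) fun s' _ h => ?_
    · simp [Test.Fits, NExp.Fits, RExp.Fits, NExp.val, hi₁, hj₁, iW, jW, e28, vW]
    · have key := h.cell hi₁ hj₁ (LeftIs D) ?_ ?_
      · exact ⟨key.1, fun i' j' hij _ _ => key.2 i' j' hij⟩
      · intro hp
        simp [Passes, Test.Holds, NExp.val, RExp.val, hi₁, hj₁, e28, hI.w₂, hI.r0] at hp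
        split_ifs at hp with h₁
        · refine ⟨by rw [Data.Lft, if_pos hb]; exact ⟨h₁, hp⟩, ?_⟩
          simp only [RExp.val, NExp.val, hi₁, hj₁, e28, hI.w₂, hI.shift _ hv, if_pos h₁,
            Data.lftX, if_pos hb]
        · simp at hp
      · rintro x ⟨h₁, -⟩
        rw [Data.Lft, if_pos hb] at h₁
        simp [Passes, Test.Holds, NExp.val, RExp.val, hi₁, hj₁, e28, hI.w₂, hI.r0, h₁]
  · simp only [Test.Holds, NExp.val, hj₁, hI.n18] at hb
    refine (WP.flagIf (by omega) (by omega) fun hS => ?_).conseq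
      ((show _ ≤ left₂.steps by decide).trans (Nat.le_add_left _ _)) fun s' _ h => ?_
    · simp [Test.Fits, NExp.Fits, RExp.Fits, NExp.val, hi₁, hj₁, iW, jW, e28, vW]
    · have key := h.cell hi₁ hj₁ (LeftIs D) ?_ ?_
      · exact ⟨key.1, fun i' j' hij _ _ => key.2 i' j' hij⟩
      · intro hp
        simp [Passes, Test.Holds, NExp.val, RExp.val, hi₁, hj₁, e28, hI.w₃, hI.r0] at hp
        split_ifs at hp with h₁
        · refine ⟨by rw [Data.Lft, if_neg hb]; exact ⟨h₁, hp⟩, ?_⟩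
          simp only [RExp.val, NExp.val, hi₁, hj₁, e28, hI.w₃, hI.shift _ hv, if_pos h₁,
            Data.lftX, if_neg hb, hI.r0]
        · simp at hp
      · rintro x ⟨h₁, -⟩
        rw [Data.Lft, if_neg hb] at h₁
        simp [Passes, Test.Holds, NExp.val, RExp.val, hi₁, hj₁, e28, hI.w₃, hI.r0, h₁]

theorem Input.cell {s : Mem} (hI : Input D s) (i j : ℕ) : Cell s 1 i j (D.Core 0 i j) := by
  by_cases h : D.G.adj i j = true
  · exact Or.inl ⟨(hI.adj i j).mpr h, h, hI.wt i j h⟩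
  · refine Or.inr ⟨?_, fun x hx => h hx.1⟩
    have := mt (hI.adj i j).mp h
    omega

theorem rightFwd_wp (hP : Par W U B D.G.m) {s : Mem} (hI : Input D s) {A k j w : ℕ}
    (h28 : s.narr 28 j 0 = j % D.G.m) (hj₁ : s.nvar 5 = j) (hw₁ : s.nvar 7 = w)
    (hj : j < 6 * D.G.m) (hw : w < D.G.m) (hA : Cell s A (j % D.G.m) w (D.Core k (j % D.G.m) w))
    (hk : j / D.G.m = k) (h3 : j < 3 * D.G.m) :
    WP W U B (rightFwd A) s (rightFwd 1).steps (fun s' => Cell s' 37 j w (D.Rgt j w) ∧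
      ∀ j' w', (j' ≠ j ∨ w' ≠ w) → Cell s 37 j' w' (D.Rgt j' w') →
        Cell s' 37 j' w' (D.Rgt j' w')) := by
  have := hP.hU
  have := hP.hW
  have hv : j % D.G.m < D.G.m := Nat.mod_lt _ (by omega)
  have jW : j ≤ W := by omega
  have vW : j % D.G.m ≤ W := by omega
  have wW : w ≤ W := by omega
  refine (WP.flagIf (by omega) (by omega) fun hS => ?_).conseq
      (show _ ≤ (rightFwd 1).steps by exact Nat.le_of_ble_eq_true rfl) fun s' _ h => h.cell hj₁ hw₁ D.Rgt ?_ ?_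
  · have hS' : ∀ A i j, s.narr A i j ≤ W := fun A i j => (hS A i j).trans (by omega)
    simp [Test.Fits, NExp.Fits, RExp.Fits, NExp.val, hj₁, hw₁, jW, h28, vW, wW, hS']
  · intro hp
    simp [Passes, Test.Holds, NExp.val, hj₁, hw₁, h28] at hp
    rw [Data.Rgt, if_pos h3, hk]
    refine ⟨_, hA.val hp, ?_⟩
    simp only [RExp.val, NExp.val, hj₁, hw₁, h28, hI.shift _ hv]
  · rintro x hx
    rw [Data.Rgt, if_pos h3, hk] at hx
    obtain ⟨y, hy, -⟩ := hx
    simpa [Passes, Test.Holds, NExp.val, hj₁, hw₁, h28] using hA.pos_iff.mpr ⟨y, hy⟩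

theorem rightBwd_wp (hP : Par W U B D.G.m) {s : Mem} (hI : Input D s) {A k j w : ℕ}
    (h28 : s.narr 28 j 0 = j % D.G.m) (hj₁ : s.nvar 5 = j) (hw₁ : s.nvar 7 = w)
    (hj : j < 6 * D.G.m) (hw : w < D.G.m) (hA : Cell s A w (j % D.G.m) (D.Core k w (j % D.G.m)))
    (hk : j / D.G.m = k + 3) (h3 : ¬ j < 3 * D.G.m) :
    WP W U B (rightBwd A) s (rightBwd 1).steps (fun s' => Cell s' 37 j w (D.Rgt j w) ∧
      ∀ j' w', (j' ≠ j ∨ w' ≠ w) → Cell s 37 j' w' (D.Rgt j' w') →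
        Cell s' 37 j' w' (D.Rgt j' w')) := by
  have := hP.hU
  have := hP.hW
  have hv : j % D.G.m < D.G.m := Nat.mod_lt _ (by omega)
  have jW : j ≤ W := by omega
  have vW : j % D.G.m ≤ W := by omega
  have wW : w ≤ W := by omega
  refine (WP.flagIf (by omega) (by omega) fun hS => ?_).conseq
      (show _ ≤ (rightBwd 1).steps by exact Nat.le_of_ble_eq_true rfl) fun s' _ h => h.cell hj₁ hw₁ D.Rgt ?_ ?_
  · have hS' : ∀ A i j, s.narr A i j ≤ W := fun A i j => (hS A i j).trans (by omega)
    simp [Test.Fits, NExp.Fits, RExp.Fits, NExp.val, hj₁, hw₁, jW, h28, vW, wW, hS']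
  · intro hp
    simp [Passes, Test.Holds, NExp.val, hj₁, hw₁, h28] at hp
    rw [Data.Rgt, if_neg h3, hk]
    refine ⟨_, hA.val hp, ?_⟩
    simp only [RExp.val, NExp.val, hj₁, hw₁, h28, hI.shift _ hv]
  · rintro x hx
    rw [Data.Rgt, if_neg h3, hk] at hx
    obtain ⟨y, hy, -⟩ := hx
    simpa [Passes, Test.Holds, NExp.val, hj₁, hw₁, h28] using hA.pos_iff.mpr ⟨y, hy⟩

theorem rights_wp (hP : Par W U B D.G.m) {s : Mem} (hI : Input D s) (hJ : Indices D s)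
    (h25 : ∀ i < D.G.m, ∀ j < D.G.m, Cell s 25 i j (D.Core 1 i j))
    (h26 : ∀ i < D.G.m, ∀ j < D.G.m, Cell s 26 i j (D.Core 2 i j)) :
    WP W U B rights s (6 * D.G.m * (D.G.m * (rightBody.steps + 7) + 5 + 7) + 5)
      (fun s' => ∀ j < 6 * D.G.m, ∀ w < D.G.m, Cell s' 37 j w (D.Rgt j w)) := by
  have := hP.hU
  have := hP.hW
  refine WP.forLoop₂_all (fun j w s => Cell s 37 j w (D.Rgt j w)) (fun _ _ _ _ h => h)
    (fun _ _ _ _ h => h) (by decide) (by decide) (by decide) (by decide) (by decide) (by decide)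
    (by decide) (by decide) (by decide) (by decide) (by decide) hI.n3 hI.n2 (by omega) (by omega) ?_
  intro j w s₁ hj hw hF hj₁ hw₁
  have hI := hI.frame (c := rights) hF (by decide)
  have e28 : s₁.narr 28 j 0 = j % D.G.m := by rw [hF.narr 28 (by decide), hJ.vtx j hj]
  have e25 : s₁.narr 25 = s.narr 25 := hF.narr 25 (by decide)
  have e26 : s₁.narr 26 = s.narr 26 := hF.narr 26 (by decide)
  have r25 : s₁.rarr 25 = s.rarr 25 := hF.rarr 25 (by decide)
  have r26 : s₁.rarr 26 = s.rarr 26 := hF.rarr 26 (by decide)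
  have hv : j % D.G.m < D.G.m := Nat.mod_lt _ (by omega)
  have c1 : ∀ i j, Cell s₁ 1 i j (D.Core 0 i j) := hI.cell
  have c25 : ∀ i < D.G.m, ∀ j < D.G.m, Cell s₁ 25 i j (D.Core 1 i j) := fun i hi j hj =>
    (h25 i hi j hj).congr (by rw [e25]) (by rw [r25])
  have c26 : ∀ i < D.G.m, ∀ j < D.G.m, Cell s₁ 26 i j (D.Core 2 i j) := fun i hi j hj =>
    (h26 i hi j hj).congr (by rw [e26]) (by rw [r26])
  have hmod := Nat.div_add_mod j D.G.m
  have hdiv : ∀ k, k * D.G.m ≤ j → j < (k + 1) * D.G.m → j / D.G.m = k := fun k h₁ h₂ =>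
    Nat.div_eq_of_lt_le h₁ h₂
  have jW : j ≤ W := by omega
  have fits : ∀ e : NExp, e ∈ [.var 2, .plus (.var 2) (.var 2), .var 18, .plus (.var 18) (.var 2),
      .plus (.var 18) (.plus (.var 2) (.var 2))] → (Test.nlt (.var 5) e).Fits W s₁ := by
    intro e he
    simp only [List.mem_cons, List.not_mem_nil, or_false] at he
    rcases he with rfl | rfl | rfl | rfl | rfl <;>
      simp only [Test.Fits, NExp.Fits, NExp.val, hj₁, hI.n2, hI.n18] <;> omega
  refine WP.conseq (Q := fun s' => Cell s' 37 j w (D.Rgt j w) ∧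
      ∀ j' w', (j' ≠ j ∨ w' ≠ w) → Cell s₁ 37 j' w' (D.Rgt j' w') →
        Cell s' 37 j' w' (D.Rgt j' w')) ?_ le_rfl fun s' _ h => ⟨h.1, fun j' w' hn _ _ => h.2 j' w' hn⟩
  have w1 := fun A k => rightFwd_wp (A := A) (k := k) hP hI e28 hj₁ hw₁ hj hw
  have w2 := fun A k => rightBwd_wp (A := A) (k := k) hP hI e28 hj₁ hw₁ hj hw
  have st : rightBody.steps = (Test.nlt (.var 5) (.var 2)).cost + max (rightFwd 1).steps
    ((Test.nlt (.var 5) (.plus (.var 2) (.var 2))).cost + max (rightFwd 25).steps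
    ((Test.nlt (.var 5) (.var 18)).cost + max (rightFwd 26).steps
    ((Test.nlt (.var 5) (.plus (.var 18) (.var 2))).cost + max (rightBwd 1).steps
    ((Test.nlt (.var 5) (.plus (.var 18) (.plus (.var 2) (.var 2)))).cost +
      max (rightBwd 25).steps (rightBwd 26).steps)))) := rfl
  have s1 : (rightFwd 25).steps = (rightFwd 1).steps := rfl
  have s2 : (rightFwd 26).steps = (rightFwd 1).steps := rfl
  have s3 : (rightBwd 25).steps = (rightBwd 1).steps := rfl
  have s4 : (rightBwd 26).steps = (rightBwd 1).steps := rfl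
  rw [st]
  refine WP.ite (fun _ => fits _ (by simp)) (fun b₁ => ?_) (fun b₁ => ?_)
  all_goals simp only [Test.Holds, NExp.val, hj₁, hI.n2] at b₁
  · exact (w1 1 0 (c1 _ _) (hdiv 0 (by omega) (by omega)) (by omega)).conseq (le_max_left _ _)
      fun _ _ h => h
  refine WP.conseq (WP.ite (fun _ => fits _ (by simp)) (fun b₂ => ?_) (fun b₂ => ?_))
    (le_max_right _ _) fun _ _ h => h
  all_goals simp only [Test.Holds, NExp.val, hj₁, hI.n2] at b₂
  · exact (w1 25 1 (c25 _ hv _ hw) (hdiv 1 (by omega) (by omega)) (by omega)).conseq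
      (s1.symm.le.trans (le_max_left _ _)) fun _ _ h => h
  refine WP.conseq (WP.ite (fun _ => fits _ (by simp)) (fun b₃ => ?_) (fun b₃ => ?_))
    (le_max_right _ _) fun _ _ h => h
  all_goals simp only [Test.Holds, NExp.val, hj₁, hI.n18] at b₃
  · exact (w1 26 2 (c26 _ hv _ hw) (hdiv 2 (by omega) (by omega)) (by omega)).conseq
      (s2.symm.le.trans (le_max_left _ _)) fun _ _ h => h
  refine WP.conseq (WP.ite (fun _ => fits _ (by simp)) (fun b₄ => ?_) (fun b₄ => ?_))
    (le_max_right _ _) fun _ _ h => h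
  all_goals simp only [Test.Holds, NExp.val, hj₁, hI.n2, hI.n18] at b₄
  · exact (w2 1 0 (c1 _ _) (hdiv 3 (by omega) (by omega)) (by omega)).conseq (le_max_left _ _)
      fun _ _ h => h
  refine WP.conseq (WP.ite (fun _ => fits _ (by simp)) (fun b₅ => ?_) (fun b₅ => ?_))
    (le_max_right _ _) fun _ _ h => h
  all_goals simp only [Test.Holds, NExp.val, hj₁, hI.n2, hI.n18] at b₅
  · exact (w2 25 1 (c25 _ hw _ hv) (hdiv 4 (by omega) (by omega)) (by omega)).conseq
      (s3.symm.le.trans (le_max_left _ _)) fun _ _ h => h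
  · exact (w2 26 2 (c26 _ hw _ hv) (hdiv 5 (by omega) (by omega)) (by omega)).conseq
      (s4.symm.le.trans (le_max_right _ _)) fun _ _ h => h

end Alg

end Shortcut

/-! ### Output edges that avoid the new copies. -/

namespace Shortcut

open RealRAM

namespace Data

variable {D : Data}

/-- The inner vertices of a shortcut are determined by its ends because negative edges form a
matching. Parallel edges thus occur only between different kinds, and one table entry per kind and
pair is enough. -/
theorem Core.unique (hG : D.G.WellFormed) {k v w : ℕ} {x y : ℝ} (hx : D.Core k v w x)
    (hy : D.Core k v w y) : x = y := by
  unfold Core at hx hy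
  split_ifs at hx hy with h₀ h₁
  · rw [hx.2, hy.2]
  · obtain ⟨-, z, -, hz, rfl⟩ := hx
    obtain ⟨-, z', -, hz', rfl⟩ := hy
    rw [hG.tail_unique hz hz']
  · obtain ⟨r, u, hr, -, hu, rfl⟩ := hx
    obtain ⟨r', u', hr', -, hu', rfl⟩ := hy
    rw [hG.tail_unique hr hr', hG.head_unique hu hu']

/-- The edges of the output between old vertices and Steiner vertices, found from the pair
`(i, j)`. -/
inductive Plain (D : Data) (i j : ℕ) : Edge → Prop
  | graph (h : D.G.adj i j = true) (b : Bool) (hb : b = true ↔ D.G.IsNegEdge i j) :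
      Plain D i j ⟨i, j, D.wtΓ i j, b⟩
  | core₁ (x : ℝ) (h : D.Core 1 i j x) : Plain D i j ⟨i, j, x, true⟩
  | core₂ (x : ℝ) (h : D.Core 2 i j x) : Plain D i j ⟨i, j, x, true⟩
  | out (h : D.OutE i j) (h₀ : 0 ≤ D.w₂ i j) : Plain D i j ⟨D.G.m + i, j, D.w₂ i j, false⟩
  | inn (h : D.InE i j) (h₀ : 0 ≤ D.w₃ i j) : Plain D i j ⟨j, D.G.m + i, D.w₃ i j, false⟩
  | mid₁ (h : D.InE i j) (r' : ℕ) (hr : D.G.IsNegEdge i r') (h₀ : 0 ≤ D.w₃ i j + D.w₂ i r') :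
      Plain D i j ⟨j, r', D.w₃ i j + D.w₂ i r', false⟩
  | mid₂ (h : D.OutE i j) (h₀ : 0 ≤ D.w₃ i i + D.w₂ i j) :
      Plain D i j ⟨i, j, D.w₃ i i + D.w₂ i j, false⟩
  | two₁ (h : D.OutE i j) (hj : j ∈ D.N) (h₀ : 0 ≤ D.w₂ i j + D.w₃ j j) :
      Plain D i j ⟨D.G.m + i, D.G.m + j, D.w₂ i j + D.w₃ j j, false⟩
  | two₂ (r' : ℕ) (hr : D.G.IsNegEdge i r') (h : D.InE j r') (h₀ : 0 ≤ D.w₂ i r' + D.w₃ j r') :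
      Plain D i j ⟨D.G.m + i, D.G.m + j, D.w₂ i r' + D.w₃ j r', false⟩

end Data

namespace Alg

/-! ## Output of the edges between old vertices and Steiner vertices -/

variable {W U B : ℕ} {D : Data}

structure Tables (D : Data) (s : Mem) : Prop where
  input : Input D s
  heads : Heads D s
  core₁ : ∀ i < D.G.m, ∀ j < D.G.m, Cell s 25 i j (D.Core 1 i j)
  core₂ : ∀ i < D.G.m, ∀ j < D.G.m, Cell s 26 i j (D.Core 2 i j)

theorem Tables.frame {c : Prog} {s s' : Mem} (h : Tables D s) (hF : Frame c s s')
    (hc : ((∀ A ∈ [0, 1, 2, 5, 6], A ∉ c.narrs) ∧ (∀ A ∈ [0, 1, 2, 3, 4], A ∉ c.rarrs) ∧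
      (∀ x ∈ [2, 3, 18], x ∉ c.nvars) ∧ 0 ∉ c.rvars))
    (hc' : (∀ A ∈ [20, 21, 25, 26], A ∉ c.narrs) ∧ (∀ A ∈ [25, 26], A ∉ c.rarrs)) :
    Tables D s' := by
  obtain ⟨h₁, h₂⟩ := hc'
  refine ⟨h.input.frame hF hc, ⟨?_, ?_⟩, ?_, ?_⟩
  · rw [hF.narr 20 (h₁ 20 (by simp))]; exact h.heads.head
  · rw [hF.narr 21 (h₁ 21 (by simp))]; exact h.heads.tail
  · exact fun i hi j hj => (h.core₁ i hi j hj).congr (by rw [hF.narr 25 (h₁ 25 (by simp))])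
      (by rw [hF.rarr 25 (h₂ 25 (by simp))])
  · exact fun i hi j hj => (h.core₂ i hi j hj).congr (by rw [hF.narr 26 (h₁ 26 (by simp))])
      (by rw [hF.rarr 26 (h₂ 26 (by simp))])

/-- Tests write nothing. This replaces `decide` where the list of tests is a variable. -/
theorem guardElse_vars (bs : List (Bool × Test)) (c : Prog) :
    (∀ x ∈ (guard bs c).nvars, x ∈ c.nvars) ∧ (∀ x ∈ (guard bs c).rvars, x ∈ c.rvars) ∧
      (∀ x ∈ (guard bs c).narrs, x ∈ c.narrs) ∧ ∀ x ∈ (guard bs c).rarrs, x ∈ c.rarrs := by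
  unfold RealRAM.guard
  induction bs with
  | nil => simp [guardElse]
  | cons b bs ih =>
    obtain ⟨p, b⟩ := b
    cases p <;> simpa [guardElse, Prog.nvars, Prog.rvars, Prog.narrs, Prog.rarrs] using ih

/-- The cost of `emitAll`. -/
def allCost (bs : List (Bool × Test)) (a b f : NExp) (w : RExp) (m : ℕ) : ℕ :=
  m * (m * (emitCost bs a b f w + 7) + 5 + 7) + 5

theorem emitAll_wp (hP : Par W U B D.G.m) {s : Mem} (hT : Tables D s) {bs : List (Bool × Test)}
    {a b f : NExp} {w : RExp} (cb : b.Clean) (cf : f.Clean) (cw : w.Clean) (E : ℕ → ℕ → Set Edge)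
    (hstep : ∀ i j s, i < D.G.m → j < D.G.m → Tables D s → s.nvar 4 = i → s.nvar 5 = j →
      Small U s → ((∀ b ∈ bs, b.2.Fits W s) ∧ (Passes bs s → (a.Fits W s ∧ a.val s ≤ U) ∧
      (b.Fits W s ∧ b.val s ≤ U) ∧ (f.Fits W s ∧ f.val s ≤ U) ∧ w.Fits W s)) ∧
      {e | Passes bs s ∧ e = emitted a b f w s} = E i j) :
    WP W U B (emitAll bs a b f w) s (allCost bs a b f w D.G.m)
      (fun s' => outEdges s' = outEdges s ∪ {e | ∃ i < D.G.m, ∃ j < D.G.m, e ∈ E i j}) := by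
  have := hP.hU
  have := hP.hW
  obtain ⟨v₁, v₂, v₃, v₄⟩ := guardElse_vars bs (emit a b f w)
  have n1 : ∀ x ∈ (guard bs (emit a b f w)).nvars, x = 1 := fun x hx => by
    simpa [emit, Prog.nvars] using v₁ x hx
  have n2 : ∀ x ∈ (guard bs (emit a b f w)).rvars, False := fun x hx => by
    simpa [emit, Prog.rvars] using v₂ x hx
  have n3 : ∀ x ∈ (guard bs (emit a b f w)).narrs, x = 11 ∨ x = 12 ∨ x = 13 := fun x hx => by
    simpa [emit, Prog.narrs] using v₃ x hx
  have n4 : ∀ x ∈ (guard bs (emit a b f w)).rarrs, x = 11 := fun x hx => by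
    simpa [emit, Prog.rarrs] using v₄ x hx
  have nv : ∀ x, x ≠ 1 → x ∉ (guard bs (emit a b f w)).nvars := fun x h h' => h (n1 x h')
  refine WP.assume fun _ hB0 _ => ?_
  refine WP.forLoop₂_emits E (by decide) (nv _ (by decide)) (nv _ (by decide)) (by decide)
    (by decide) (nv _ (by decide)) (nv _ (by decide)) (by decide) (by decide) (by decide)
    (by decide) hT.input.n2 hT.input.n2 (by omega) (by omega) ?_
  intro i j s₁ hi hj hF hi₁ hj₁
  have hT₁ : Tables D s₁ := by
    refine hT.frame hF ⟨?_, ?_, ?_, ?_⟩ ⟨?_, ?_⟩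
    · intro A hA h
      have h := n3 A (by simpa [RealRAM.forLoop, Prog.narrs] using h)
      simp at hA
      omega
    · intro A hA h
      have h := n4 A (by simpa [RealRAM.forLoop, Prog.rarrs] using h)
      simp at hA
      omega
    · intro x hx h
      simp [RealRAM.forLoop, Prog.nvars] at h
      have := n1 x
      simp at hx
      rcases hx with rfl | rfl | rfl <;> simp_all
    · intro h
      exact n2 0 (by simpa [RealRAM.forLoop, Prog.rvars] using h)
    · intro A hA h
      have h := n3 A (by simpa [RealRAM.forLoop, Prog.narrs] using h)
      simp at hA
      omega
    · intro A hA h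
      have h := n4 A (by simpa [RealRAM.forLoop, Prog.rarrs] using h)
      simp at hA
      omega
  refine WP.assume fun hS _ _ => ?_
  obtain ⟨h₁, h₂⟩ := hstep i j s₁ hi hj hT₁ hi₁ hj₁ hS
  rw [← h₂]
  exact WP.emitIf cb cf cw (by omega) fun _ => h₁

/-- The tested number is a sum of two indicators: one for `V_i^out` and one, read from the table of
heads, for the extra edge to the head of the negative edge out of `i`. -/
theorem isOut_iff (hG : D.G.WellFormed) {s : Mem} (hT : Tables D s) {a b : NExp} {i j : ℕ}
    (ha : a.val s = i) (hb : b.val s = j) (hi : i < D.G.m) :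
    (isOut a b).2.Holds s ↔ D.OutE i j := by
  have h := hT.heads.head_iff hG (j := j) hi
  simp only [Test.Holds, NExp.val, ha, hb, hT.input.out]
  unfold Data.OutE
  by_cases hn : D.G.IsNegEdge i j
  · rw [h.mpr hn]
    have : i ∈ D.N := ⟨j, hn⟩
    simp [hn, this]
  · have h' := mt h.mp hn
    split_ifs with hc
    · simp [hc]
    · have : ¬ (i ∈ D.N ∧ (j ∈ D.vOut i ∨ D.G.IsNegEdge i j)) := by tauto
      simp only [this, iff_false]
      omega

/-- The second summand of the test is the indicator of `i ∈ N` minus `|i - j|`, truncated at zero,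
and so is positive just when `j = i` is a negative vertex. -/
theorem isIn_iff (hG : D.G.WellFormed) {s : Mem} (hT : Tables D s) {a b : NExp} {i j : ℕ}
    (ha : a.val s = i) (hb : b.val s = j) (hi : i < D.G.m) :
    (isIn a b).2.Holds s ↔ D.InE i j := by
  have h := hT.heads.head_pos hG hi
  simp only [Test.Holds, NExp.val, ha, hb, hT.input.inn]
  unfold Data.InE
  by_cases hN : i ∈ D.N
  · have h' := h.mpr hN
    by_cases hc : j ∈ D.vIn i
    · simp [hN, hc]
    · simp only [hN, hc, and_false, if_false, true_and, false_or]
      omega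
  · have h' := mt h.mp hN
    simp only [hN, false_and, if_false, iff_false]
    omega

theorem isOut_fits {s : Mem} (hS : Small U s) (hU : 2 ≤ U) (hW : 3 * U ≤ W) {a b : NExp}
    (ha : a.Fits W s) (hb : b.Fits W s) (hb' : b.val s ≤ U) : (isOut a b).2.Fits W s := by
  have h₁ := hS 5 (a.val s) (b.val s)
  have h₂ := hS 20 (a.val s) 0
  simp only [Test.Fits, NExp.Fits, NExp.val, ha, hb, true_and, zero_le]
  omega

theorem isIn_fits {s : Mem} (hS : Small U s) (hU : 2 ≤ U) (hW : 3 * U ≤ W) {a b : NExp}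
    (ha : a.Fits W s) (hb : b.Fits W s) : (isIn a b).2.Fits W s := by
  have h₁ := hS 6 (a.val s) (b.val s)
  have h₂ := hS 20 (a.val s) 0
  simp only [Test.Fits, NExp.Fits, NExp.val, ha, hb, true_and, and_true, zero_le]
  omega

section phases

set_option linter.unusedSimpArgs false

theorem emitGraph_wp (hP : Par W U B D.G.m) {s : Mem} (hT : Tables D s) :
    WP W U B emitGraph s (allCost [isPos (.get 1 (.var 4) (.var 5))] (.var 4)
        (.var 5) (.get 2 (.var 4) (.var 5))
        (.get 1 (.var 4) (.var 5)) D.G.m)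
      (fun s' => outEdges s' = outEdges s ∪ {e | ∃ i < D.G.m, ∃ j < D.G.m, e ∈ {e : Edge |
        D.G.adj i j = true ∧ ∃ b, (b = true ↔ D.G.IsNegEdge i j) ∧ e = ⟨i, j, D.wtΓ i j, b⟩}}) := by
  have := hP.hU
  have := hP.hW
  refine emitAll_wp hP hT (by decide) (by decide) (by decide) _ ?_
  intro i j s hi hj hT hi₁ hj₁ hS
  have hI := hT.input
  have hS' : ∀ A i j, s.narr A i j ≤ W := fun A i j => (hS A i j).trans (by omega)
  have hp' : ∀ A i j, s.narr A i j - 1 ≤ U := fun A i j => (Nat.sub_le _ _).trans (hS A i j)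
  have iW : i ≤ W := by omega
  have jW : j ≤ W := by omega
  have iU : i ≤ U := by omega
  have jU : j ≤ U := by omega
  have mW : D.G.m ≤ W := by omega
  have miW : D.G.m + i ≤ W := by omega
  have mjW : D.G.m + j ≤ W := by omega
  have miU : D.G.m + i ≤ U := by omega
  have mjU : D.G.m + j ≤ U := by omega
  have W1 : 1 ≤ W := by omega
  have U1 : 1 ≤ U := by omega
  refine ⟨⟨?_, fun _ => ?_⟩, ?_⟩
  · simp [Test.Fits, NExp.Fits, NExp.val, hi₁, hj₁, hS', iW, jW]
  · simp [NExp.Fits, RExp.Fits, NExp.val, hi₁, hj₁, hS', iW, jW, iU, jU, mW, miW, mjW, miU, mjU, W1,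
      U1, hI.n2, hp', hS _ _ _]
  · ext e
    simp only [Set.mem_ofPred_eq, Passes, List.mem_cons, List.not_mem_nil, or_false,
      forall_eq_or_imp, forall_eq, emitted]
    simp only [Test.Holds, NExp.val, RExp.val, hi₁, hj₁, hI.adj, hI.neg, iff_true]
    refine and_congr_right fun h => ?_
    rw [hI.wt _ _ h]
    by_cases hn : D.G.IsNegEdge i j
    · simp [hn]
    · simp [hn]


theorem emitCore₁_wp (hP : Par W U B D.G.m) (hG : D.G.WellFormed) {s : Mem} (hT : Tables D s) :
    WP W U B (emitCore 25) s (allCost [isPos (.get 25 (.var 4) (.var 5))] (.var 4)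
        (.var 5) (.lit 1)
        (.get 25 (.var 4) (.var 5)) D.G.m)
      (fun s' => outEdges s' = outEdges s ∪ {e | ∃ i < D.G.m, ∃ j < D.G.m, e ∈ {e : Edge |
        ∃ x, D.Core 1 i j x ∧ e = ⟨i, j, x, true⟩}}) := by
  have := hP.hU
  have := hP.hW
  refine emitAll_wp hP hT (by decide) (by decide) (by decide) _ ?_
  intro i j s hi hj hT hi₁ hj₁ hS
  have hI := hT.input
  have hS' : ∀ A i j, s.narr A i j ≤ W := fun A i j => (hS A i j).trans (by omega)
  have hp' : ∀ A i j, s.narr A i j - 1 ≤ U := fun A i j => (Nat.sub_le _ _).trans (hS A i j)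
  have iW : i ≤ W := by omega
  have jW : j ≤ W := by omega
  have iU : i ≤ U := by omega
  have jU : j ≤ U := by omega
  have mW : D.G.m ≤ W := by omega
  have miW : D.G.m + i ≤ W := by omega
  have mjW : D.G.m + j ≤ W := by omega
  have miU : D.G.m + i ≤ U := by omega
  have mjU : D.G.m + j ≤ U := by omega
  have W1 : 1 ≤ W := by omega
  have U1 : 1 ≤ U := by omega
  refine ⟨⟨?_, fun _ => ?_⟩, ?_⟩
  · simp [Test.Fits, NExp.Fits, NExp.val, hi₁, hj₁, hS', iW, jW]
  · simp [NExp.Fits, RExp.Fits, NExp.val, hi₁, hj₁, hS', iW, jW, iU, jU, mW, miW, mjW, miU, mjU, W1,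
      U1, hI.n2, hp', hS _ _ _]
  · ext e
    simp only [Set.mem_ofPred_eq, Passes, List.mem_cons, List.not_mem_nil, or_false,
      forall_eq_or_imp, forall_eq, emitted]
    have hc := hT.core₁ i hi j hj
    simp only [Test.Holds, NExp.val, RExp.val, hi₁, hj₁, iff_true, decide_true, hc.pos_iff]
    constructor
    · rintro ⟨h, h'⟩
      exact ⟨_, hc.val (hc.pos_iff.mpr h), h'⟩
    · rintro ⟨x, h, h'⟩
      refine ⟨⟨x, h⟩, ?_⟩
      -- The table stores some admissible weight; by uniqueness it is the given one.
      rw [h', h.unique hG (hc.val (hc.pos_iff.mpr ⟨x, h⟩))]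


theorem emitCore₂_wp (hP : Par W U B D.G.m) (hG : D.G.WellFormed) {s : Mem} (hT : Tables D s) :
    WP W U B (emitCore 26) s (allCost [isPos (.get 26 (.var 4) (.var 5))] (.var 4)
        (.var 5) (.lit 1)
        (.get 26 (.var 4) (.var 5)) D.G.m)
      (fun s' => outEdges s' = outEdges s ∪ {e | ∃ i < D.G.m, ∃ j < D.G.m, e ∈ {e : Edge |
        ∃ x, D.Core 2 i j x ∧ e = ⟨i, j, x, true⟩}}) := by
  have := hP.hU
  have := hP.hW
  refine emitAll_wp hP hT (by decide) (by decide) (by decide) _ ?_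
  intro i j s hi hj hT hi₁ hj₁ hS
  have hI := hT.input
  have hS' : ∀ A i j, s.narr A i j ≤ W := fun A i j => (hS A i j).trans (by omega)
  have hp' : ∀ A i j, s.narr A i j - 1 ≤ U := fun A i j => (Nat.sub_le _ _).trans (hS A i j)
  have iW : i ≤ W := by omega
  have jW : j ≤ W := by omega
  have iU : i ≤ U := by omega
  have jU : j ≤ U := by omega
  have mW : D.G.m ≤ W := by omega
  have miW : D.G.m + i ≤ W := by omega
  have mjW : D.G.m + j ≤ W := by omega
  have miU : D.G.m + i ≤ U := by omega
  have mjU : D.G.m + j ≤ U := by omega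
  have W1 : 1 ≤ W := by omega
  have U1 : 1 ≤ U := by omega
  refine ⟨⟨?_, fun _ => ?_⟩, ?_⟩
  · simp [Test.Fits, NExp.Fits, NExp.val, hi₁, hj₁, hS', iW, jW]
  · simp [NExp.Fits, RExp.Fits, NExp.val, hi₁, hj₁, hS', iW, jW, iU, jU, mW, miW, mjW, miU, mjU, W1,
      U1, hI.n2, hp', hS _ _ _]
  · ext e
    simp only [Set.mem_ofPred_eq, Passes, List.mem_cons, List.not_mem_nil, or_false,
      forall_eq_or_imp, forall_eq, emitted]
    have hc := hT.core₂ i hi j hj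
    simp only [Test.Holds, NExp.val, RExp.val, hi₁, hj₁, iff_true, decide_true, hc.pos_iff]
    constructor
    · rintro ⟨h, h'⟩
      exact ⟨_, hc.val (hc.pos_iff.mpr h), h'⟩
    · rintro ⟨x, h, h'⟩
      refine ⟨⟨x, h⟩, ?_⟩
      rw [h', h.unique hG (hc.val (hc.pos_iff.mpr ⟨x, h⟩))]


theorem emitOut_wp (hP : Par W U B D.G.m) (hG : D.G.WellFormed) {s : Mem} (hT : Tables D s) :
    WP W U B emitOut s (allCost [isOut (.var 4) (.var 5), isNonneg (.get 3 (.var 4) (.var 5))] (stn (.var 4))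
        (.var 5) (.lit 0)
        (.get 3 (.var 4) (.var 5)) D.G.m)
      (fun s' => outEdges s' = outEdges s ∪ {e | ∃ i < D.G.m, ∃ j < D.G.m, e ∈ {e : Edge |
        D.OutE i j ∧ 0 ≤ D.w₂ i j ∧ e = ⟨D.G.m + i, j, D.w₂ i j, false⟩}}) := by
  have := hP.hU
  have := hP.hW
  refine emitAll_wp hP hT (by decide) (by decide) (by decide) _ ?_
  intro i j s hi hj hT hi₁ hj₁ hS
  have hI := hT.input
  have hS' : ∀ A i j, s.narr A i j ≤ W := fun A i j => (hS A i j).trans (by omega)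
  have hp' : ∀ A i j, s.narr A i j - 1 ≤ U := fun A i j => (Nat.sub_le _ _).trans (hS A i j)
  have iW : i ≤ W := by omega
  have jW : j ≤ W := by omega
  have iU : i ≤ U := by omega
  have jU : j ≤ U := by omega
  have mW : D.G.m ≤ W := by omega
  have miW : D.G.m + i ≤ W := by omega
  have mjW : D.G.m + j ≤ W := by omega
  have miU : D.G.m + i ≤ U := by omega
  have mjU : D.G.m + j ≤ U := by omega
  have W1 : 1 ≤ W := by omega
  have U1 : 1 ≤ U := by omega
  have hO := isOut_iff (a := .var 4) (b := .var 5) hG hT hi₁ hj₁ hi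
  have hOf := isOut_fits (a := .var 4) (b := .var 5) hS (by omega) hP.hW (by simpa [NExp.Fits, hi₁])
    (by simpa [NExp.Fits, hj₁]) (by simpa [NExp.val, hj₁])
  refine ⟨⟨?_, fun _ => ?_⟩, ?_⟩
  · intro b hb
    simp only [List.mem_cons, List.not_mem_nil, or_false] at hb
    rcases hb with rfl | rfl
    · exact hOf
    all_goals simp [Test.Fits, NExp.Fits, RExp.Fits, NExp.val, hi₁, hj₁, hS', iW, jW, W1]
  · simp [NExp.Fits, RExp.Fits, NExp.val, hi₁, hj₁, hS', iW, jW, iU, jU, mW, miW, mjW, miU, mjU, W1,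
      U1, hI.n2, hp', hS _ _ _]
  · ext e
    simp only [Set.mem_ofPred_eq, Passes, List.mem_cons, List.not_mem_nil, or_false,
      forall_eq_or_imp, forall_eq, emitted]
    rw [hO]
    simp only [Test.Holds, NExp.val, RExp.val, hi₁, hj₁, hI.n2, hI.w₂, hI.r0, iff_true, and_assoc]
    refine and_congr_right fun h => ?_
    simp [h]


theorem emitIn_wp (hP : Par W U B D.G.m) (hG : D.G.WellFormed) {s : Mem} (hT : Tables D s) :
    WP W U B emitIn s (allCost [isIn (.var 4) (.var 5), isNonneg (.get 4 (.var 4) (.var 5))] (.var 5)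
        (stn (.var 4)) (.lit 0)
        (.get 4 (.var 4) (.var 5)) D.G.m)
      (fun s' => outEdges s' = outEdges s ∪ {e | ∃ i < D.G.m, ∃ j < D.G.m, e ∈ {e : Edge |
        D.InE i j ∧ 0 ≤ D.w₃ i j ∧ e = ⟨j, D.G.m + i, D.w₃ i j, false⟩}}) := by
  have := hP.hU
  have := hP.hW
  refine emitAll_wp hP hT (by decide) (by decide) (by decide) _ ?_
  intro i j s hi hj hT hi₁ hj₁ hS
  have hI := hT.input
  have hS' : ∀ A i j, s.narr A i j ≤ W := fun A i j => (hS A i j).trans (by omega)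
  have hp' : ∀ A i j, s.narr A i j - 1 ≤ U := fun A i j => (Nat.sub_le _ _).trans (hS A i j)
  have iW : i ≤ W := by omega
  have jW : j ≤ W := by omega
  have iU : i ≤ U := by omega
  have jU : j ≤ U := by omega
  have mW : D.G.m ≤ W := by omega
  have miW : D.G.m + i ≤ W := by omega
  have mjW : D.G.m + j ≤ W := by omega
  have miU : D.G.m + i ≤ U := by omega
  have mjU : D.G.m + j ≤ U := by omega
  have W1 : 1 ≤ W := by omega
  have U1 : 1 ≤ U := by omega
  have hE := isIn_iff (a := .var 4) (b := .var 5) hG hT hi₁ hj₁ hi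
  have hEf := isIn_fits (a := .var 4) (b := .var 5) hS (by omega) hP.hW (by simpa [NExp.Fits, hi₁])
    (by simpa [NExp.Fits, hj₁])
  refine ⟨⟨?_, fun _ => ?_⟩, ?_⟩
  · intro b hb
    simp only [List.mem_cons, List.not_mem_nil, or_false] at hb
    rcases hb with rfl | rfl
    · exact hEf
    all_goals simp [Test.Fits, NExp.Fits, RExp.Fits, NExp.val, hi₁, hj₁, hS', iW, jW, W1]
  · simp [NExp.Fits, RExp.Fits, NExp.val, hi₁, hj₁, hS', iW, jW, iU, jU, mW, miW, mjW, miU, mjU, W1,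
      U1, hI.n2, hp', hS _ _ _]
  · ext e
    simp only [Set.mem_ofPred_eq, Passes, List.mem_cons, List.not_mem_nil, or_false,
      forall_eq_or_imp, forall_eq, emitted]
    rw [hE]
    simp only [Test.Holds, NExp.val, RExp.val, hi₁, hj₁, hI.n2, hI.w₃, hI.r0, iff_true, and_assoc]
    refine and_congr_right fun h => ?_
    simp [h]


theorem emitMid₁_wp (hP : Par W U B D.G.m) (hG : D.G.WellFormed) {s : Mem} (hT : Tables D s) :
    WP W U B emitMid₁ s (allCost [isIn (.var 4) (.var 5), isPos (get1 20 (.var 4)),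
        isNonneg (.plus (.get 4 (.var 4) (.var 5)) (.get 3 (.var 4) (hd (.var 4))))] (.var 5)
        (hd (.var 4)) (.lit 0)
        (.plus (.get 4 (.var 4) (.var 5)) (.get 3 (.var 4) (hd (.var 4)))) D.G.m)
      (fun s' => outEdges s' = outEdges s ∪ {e | ∃ i < D.G.m, ∃ j < D.G.m, e ∈ {e : Edge |
        D.InE i j ∧ ∃ r', D.G.IsNegEdge i r' ∧ 0 ≤ D.w₃ i j + D.w₂ i r' ∧
          e = ⟨j, r', D.w₃ i j + D.w₂ i r', false⟩}}) := by
  have := hP.hU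
  have := hP.hW
  refine emitAll_wp hP hT (by decide) (by decide) (by decide) _ ?_
  intro i j s hi hj hT hi₁ hj₁ hS
  have hI := hT.input
  have hS' : ∀ A i j, s.narr A i j ≤ W := fun A i j => (hS A i j).trans (by omega)
  have hp' : ∀ A i j, s.narr A i j - 1 ≤ U := fun A i j => (Nat.sub_le _ _).trans (hS A i j)
  have iW : i ≤ W := by omega
  have jW : j ≤ W := by omega
  have iU : i ≤ U := by omega
  have jU : j ≤ U := by omega
  have mW : D.G.m ≤ W := by omega
  have miW : D.G.m + i ≤ W := by omega
  have mjW : D.G.m + j ≤ W := by omega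
  have miU : D.G.m + i ≤ U := by omega
  have mjU : D.G.m + j ≤ U := by omega
  have W1 : 1 ≤ W := by omega
  have U1 : 1 ≤ U := by omega
  have hE := isIn_iff (a := .var 4) (b := .var 5) hG hT hi₁ hj₁ hi
  have hEf := isIn_fits (a := .var 4) (b := .var 5) hS (by omega) hP.hW (by simpa [NExp.Fits, hi₁])
    (by simpa [NExp.Fits, hj₁])
  refine ⟨⟨?_, fun _ => ?_⟩, ?_⟩
  · intro b hb
    simp only [List.mem_cons, List.not_mem_nil, or_false] at hb
    rcases hb with rfl | rfl | rfl
    · exact hEf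
    all_goals simp [Test.Fits, NExp.Fits, RExp.Fits, NExp.val, hi₁, hj₁, hS', iW, jW, W1]
  · simp [NExp.Fits, RExp.Fits, NExp.val, hi₁, hj₁, hS', iW, jW, iU, jU, mW, miW, mjW, miU, mjU, W1,
      U1, hI.n2, hp', hS _ _ _]
  · ext e
    simp only [Set.mem_ofPred_eq, Passes, List.mem_cons, List.not_mem_nil, or_false,
      forall_eq_or_imp, forall_eq, emitted]
    rw [hE]
    simp only [and_assoc, iff_true]
    refine and_congr_right fun h => ?_
    obtain ⟨r', hr⟩ := h.1
    have h20 := (hT.heads.head_iff hG hi).mpr hr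
    -- The edge from the Steiner vertex of `i` to `r'` exists whether or not `r'` lies in `V_i^out`,
    -- so its table entry is meaningful.
    have hO : D.OutE i r' := ⟨h.1, Or.inr hr⟩
    simp only [Test.Holds, NExp.val, RExp.val, hi₁, hj₁, hI.n2, hI.w₃, hI.w₂, hI.r0, h20,
      Nat.add_sub_cancel, if_pos h, if_pos hO]
    constructor
    · rintro ⟨-, h₁, h₂⟩
      exact ⟨r', hr, by simpa using h₁, by simpa using h₂⟩
    · rintro ⟨r₁, hr₁, h₁, h₂⟩
      obtain rfl := hG.head_unique hr hr₁
      exact ⟨by omega, by simpa using h₁, by simpa using h₂⟩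


theorem emitMid₂_wp (hP : Par W U B D.G.m) (hG : D.G.WellFormed) {s : Mem} (hT : Tables D s) :
    WP W U B emitMid₂ s (allCost [isOut (.var 4) (.var 5), isPos (get1 20 (.var 4)),
        isNonneg (.plus (.get 4 (.var 4) (.var 4)) (.get 3 (.var 4) (.var 5)))] (.var 4)
        (.var 5) (.lit 0)
        (.plus (.get 4 (.var 4) (.var 4)) (.get 3 (.var 4) (.var 5))) D.G.m)
      (fun s' => outEdges s' = outEdges s ∪ {e | ∃ i < D.G.m, ∃ j < D.G.m, e ∈ {e : Edge |
        D.OutE i j ∧ 0 ≤ D.w₃ i i + D.w₂ i j ∧ e = ⟨i, j, D.w₃ i i + D.w₂ i j, false⟩}}) := by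
  have := hP.hU
  have := hP.hW
  refine emitAll_wp hP hT (by decide) (by decide) (by decide) _ ?_
  intro i j s hi hj hT hi₁ hj₁ hS
  have hI := hT.input
  have hS' : ∀ A i j, s.narr A i j ≤ W := fun A i j => (hS A i j).trans (by omega)
  have hp' : ∀ A i j, s.narr A i j - 1 ≤ U := fun A i j => (Nat.sub_le _ _).trans (hS A i j)
  have iW : i ≤ W := by omega
  have jW : j ≤ W := by omega
  have iU : i ≤ U := by omega
  have jU : j ≤ U := by omega
  have mW : D.G.m ≤ W := by omega
  have miW : D.G.m + i ≤ W := by omega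
  have mjW : D.G.m + j ≤ W := by omega
  have miU : D.G.m + i ≤ U := by omega
  have mjU : D.G.m + j ≤ U := by omega
  have W1 : 1 ≤ W := by omega
  have U1 : 1 ≤ U := by omega
  have hO := isOut_iff (a := .var 4) (b := .var 5) hG hT hi₁ hj₁ hi
  have hOf := isOut_fits (a := .var 4) (b := .var 5) hS (by omega) hP.hW (by simpa [NExp.Fits, hi₁])
    (by simpa [NExp.Fits, hj₁]) (by simpa [NExp.val, hj₁])
  refine ⟨⟨?_, fun _ => ?_⟩, ?_⟩
  · intro b hb
    simp only [List.mem_cons, List.not_mem_nil, or_false] at hb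
    rcases hb with rfl | rfl | rfl
    · exact hOf
    all_goals simp [Test.Fits, NExp.Fits, RExp.Fits, NExp.val, hi₁, hj₁, hS', iW, jW, W1]
  · simp [NExp.Fits, RExp.Fits, NExp.val, hi₁, hj₁, hS', iW, jW, iU, jU, mW, miW, mjW, miU, mjU, W1,
      U1, hI.n2, hp', hS _ _ _]
  · ext e
    simp only [Set.mem_ofPred_eq, Passes, List.mem_cons, List.not_mem_nil, or_false,
      forall_eq_or_imp, forall_eq, emitted]
    rw [hO]
    simp only [and_assoc, iff_true]
    refine and_congr_right fun h => ?_
    have h20 := (hT.heads.head_pos hG hi).mpr h.1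
    have hE : D.InE i i := ⟨h.1, Or.inr rfl⟩
    simp only [Test.Holds, NExp.val, RExp.val, hi₁, hj₁, hI.n2, hI.w₃, hI.w₂, hI.r0, h20,
      if_pos h, if_pos hE]
    simp


theorem emitTwo₁_wp (hP : Par W U B D.G.m) (hG : D.G.WellFormed) {s : Mem} (hT : Tables D s) :
    WP W U B emitTwo₁ s (allCost [isOut (.var 4) (.var 5), isPos (get1 20 (.var 4)),
        isPos (get1 20 (.var 5)), isNonneg (.plus (.get 3 (.var 4) (.var 5)) (.get 4 (.var 5) (.var 5)))] (stn (.var 4))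
        (stn (.var 5)) (.lit 0)
        (.plus (.get 3 (.var 4) (.var 5)) (.get 4 (.var 5) (.var 5))) D.G.m)
      (fun s' => outEdges s' = outEdges s ∪ {e | ∃ i < D.G.m, ∃ j < D.G.m, e ∈ {e : Edge |
        D.OutE i j ∧ j ∈ D.N ∧ 0 ≤ D.w₂ i j + D.w₃ j j ∧
          e = ⟨D.G.m + i, D.G.m + j, D.w₂ i j + D.w₃ j j, false⟩}}) := by
  have := hP.hU
  have := hP.hW
  refine emitAll_wp hP hT (by decide) (by decide) (by decide) _ ?_
  intro i j s hi hj hT hi₁ hj₁ hS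
  have hI := hT.input
  have hS' : ∀ A i j, s.narr A i j ≤ W := fun A i j => (hS A i j).trans (by omega)
  have hp' : ∀ A i j, s.narr A i j - 1 ≤ U := fun A i j => (Nat.sub_le _ _).trans (hS A i j)
  have iW : i ≤ W := by omega
  have jW : j ≤ W := by omega
  have iU : i ≤ U := by omega
  have jU : j ≤ U := by omega
  have mW : D.G.m ≤ W := by omega
  have miW : D.G.m + i ≤ W := by omega
  have mjW : D.G.m + j ≤ W := by omega
  have miU : D.G.m + i ≤ U := by omega
  have mjU : D.G.m + j ≤ U := by omega
  have W1 : 1 ≤ W := by omega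
  have U1 : 1 ≤ U := by omega
  have hO := isOut_iff (a := .var 4) (b := .var 5) hG hT hi₁ hj₁ hi
  have hOf := isOut_fits (a := .var 4) (b := .var 5) hS (by omega) hP.hW (by simpa [NExp.Fits, hi₁])
    (by simpa [NExp.Fits, hj₁]) (by simpa [NExp.val, hj₁])
  refine ⟨⟨?_, fun _ => ?_⟩, ?_⟩
  · intro b hb
    simp only [List.mem_cons, List.not_mem_nil, or_false] at hb
    rcases hb with rfl | rfl | rfl | rfl
    · exact hOf
    all_goals simp [Test.Fits, NExp.Fits, RExp.Fits, NExp.val, hi₁, hj₁, hS', iW, jW, W1]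
  · simp [NExp.Fits, RExp.Fits, NExp.val, hi₁, hj₁, hS', iW, jW, iU, jU, mW, miW, mjW, miU, mjU, W1,
      U1, hI.n2, hp', hS _ _ _]
  · ext e
    simp only [Set.mem_ofPred_eq, Passes, List.mem_cons, List.not_mem_nil, or_false,
      forall_eq_or_imp, forall_eq, emitted]
    rw [hO]
    simp only [and_assoc, iff_true]
    refine and_congr_right fun h => ?_
    have h20 := (hT.heads.head_pos hG hi).mpr h.1
    have h20' := hT.heads.head_pos hG hj
    simp only [Test.Holds, NExp.val, RExp.val, hi₁, hj₁, hI.n2, hI.w₃, hI.w₂, hI.r0, h20, h20',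
      if_pos h, true_and]
    refine and_congr_right fun h' => ?_
    have hE : D.InE j j := ⟨h', Or.inr rfl⟩
    simp [hE]


theorem emitTwo₂_wp (hP : Par W U B D.G.m) (hG : D.G.WellFormed) {s : Mem} (hT : Tables D s) :
    WP W U B emitTwo₂ s (allCost [isPos (get1 20 (.var 4)), isIn (.var 5) (hd (.var 4)),
        isPos (get1 20 (.var 5)),
        isNonneg (.plus (.get 3 (.var 4) (hd (.var 4))) (.get 4 (.var 5) (hd (.var 4))))] (stn (.var 4))
        (stn (.var 5)) (.lit 0)
        (.plus (.get 3 (.var 4) (hd (.var 4))) (.get 4 (.var 5) (hd (.var 4)))) D.G.m)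
      (fun s' => outEdges s' = outEdges s ∪ {e | ∃ i < D.G.m, ∃ j < D.G.m, e ∈ {e : Edge |
        ∃ r', D.G.IsNegEdge i r' ∧ D.InE j r' ∧ 0 ≤ D.w₂ i r' + D.w₃ j r' ∧
          e = ⟨D.G.m + i, D.G.m + j, D.w₂ i r' + D.w₃ j r', false⟩}}) := by
  have := hP.hU
  have := hP.hW
  refine emitAll_wp hP hT (by decide) (by decide) (by decide) _ ?_
  intro i j s hi hj hT hi₁ hj₁ hS
  have hI := hT.input
  have hS' : ∀ A i j, s.narr A i j ≤ W := fun A i j => (hS A i j).trans (by omega)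
  have hp' : ∀ A i j, s.narr A i j - 1 ≤ U := fun A i j => (Nat.sub_le _ _).trans (hS A i j)
  have iW : i ≤ W := by omega
  have jW : j ≤ W := by omega
  have iU : i ≤ U := by omega
  have jU : j ≤ U := by omega
  have mW : D.G.m ≤ W := by omega
  have miW : D.G.m + i ≤ W := by omega
  have mjW : D.G.m + j ≤ W := by omega
  have miU : D.G.m + i ≤ U := by omega
  have mjU : D.G.m + j ≤ U := by omega
  have W1 : 1 ≤ W := by omega
  have U1 : 1 ≤ U := by omega
  have hE := isIn_iff (a := .var 5) (b := hd (.var 4)) hG hT hj₁ rfl hj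
  have hEf := isIn_fits (a := .var 5) (b := hd (.var 4)) hS (by omega) hP.hW
    (by simpa [NExp.Fits, hj₁]) (by simp [NExp.Fits, NExp.val, hi₁, iW, W1, hS'])
  refine ⟨⟨?_, fun _ => ?_⟩, ?_⟩
  · intro b hb
    simp only [List.mem_cons, List.not_mem_nil, or_false] at hb
    rcases hb with rfl | rfl | rfl | rfl
    rotate_left
    · exact hEf
    all_goals simp [Test.Fits, NExp.Fits, RExp.Fits, NExp.val, hi₁, hj₁, hS', iW, jW, W1]
  · simp [NExp.Fits, RExp.Fits, NExp.val, hi₁, hj₁, hS', iW, jW, iU, jU, mW, miW, mjW, miU, mjU, W1,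
      U1, hI.n2, hp', hS _ _ _]
  · ext e
    simp only [Set.mem_ofPred_eq, Passes, List.mem_cons, List.not_mem_nil, or_false,
      forall_eq_or_imp, forall_eq, emitted]
    rw [hE]
    simp only [Test.Holds, NExp.val, RExp.val, hi₁, hj₁, hI.n2, hI.w₃, hI.w₂, hI.r0, iff_true,
      hT.heads.head_pos hG hi, hT.heads.head_pos hG hj]
    constructor
    · rintro ⟨⟨⟨r', hr⟩, h₁, -, h₂⟩, h₃⟩
      have h20 := (hT.heads.head_iff hG hi).mpr hr
      have hO : D.OutE i r' := ⟨⟨r', hr⟩, Or.inr hr⟩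
      rw [h20, Nat.add_sub_cancel] at h₁ h₂ h₃
      rw [if_pos h₁, if_pos hO] at h₂ h₃
      exact ⟨r', hr, h₁, by simpa using h₂, by simpa using h₃⟩
    · rintro ⟨r', hr, h₁, h₂, h₃⟩
      have h20 := (hT.heads.head_iff hG hi).mpr hr
      have hO : D.OutE i r' := ⟨⟨r', hr⟩, Or.inr hr⟩
      rw [h20, Nat.add_sub_cancel, if_pos h₁, if_pos hO]
      exact ⟨⟨⟨r', hr⟩, h₁, h₁.1, by simpa using h₂⟩, by simpa using h₃⟩


end phases

end Alg

end Shortcut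

namespace Shortcut

open RealRAM

namespace Alg

/-! ## The run of the whole program -/

variable {W U B : ℕ} {D : Data}

structure Prepared (D : Data) (s : Mem) : Prop where
  tables : Tables D s
  indices : Indices D s
  half : ∀ i < 2 * D.G.m, s.narr 22 i 0 = i / 2
  left : ∀ i < D.G.m, ∀ j < 6 * D.G.m, Cell s 27 i j (LeftIs D i j)
  right : ∀ j < 6 * D.G.m, ∀ w < D.G.m, Cell s 37 j w (D.Rgt j w)
  n0 : s.nvar 0 = 0
  n1 : s.nvar 1 = 0
  zero : ∀ g w, s.narr 30 g w = 0

def prepareCost (m : ℕ) : ℕ :=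
  init.steps + (m * (headsCost + (m * (headBody.steps + 7) + 5) + 7) + 5 +
    (m * (halfBody.steps + 7) + 5 +
      ((Prog.nset 8 (.lit 0)).steps + (6 * m * (indexBody.steps + 7) + 5) +
        (m * (m * (flagCost core₁Tests 25 (.var 4) (.var 5) core₁Wt + 7) + 5 + 7) + 5 +
          (m * (m * (flagCost core₂Tests 26 (.var 4) (.var 5) core₂Wt + 7) + 5 + 7) + 5 +
            (m * (6 * m * (leftsCost + 7) + 5 + 7) + 5 +
              (6 * m * (m * (rightBody.steps + 7) + 5 + 7) + 5)))))))

theorem prepare_wp (hP : Par W U B D.G.m) (hG : D.G.WellFormed) :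
    WP W U B prepare D.start (prepareCost D.G.m) (Prepared D) := by
  refine WP.seq (init_wp hP) ?_
  rintro s₁ - ⟨hI₁, n0, n1, hz⟩
  refine WP.seq (heads_wp hP hI₁) ?_
  intro s₂ F₂ hH
  have hI₂ := hI₁.frame F₂ (by decide)
  refine WP.seq (halves_wp hP hI₂) ?_
  intro s₃ F₃ h22
  have hI₃ := hI₂.frame F₃ (by decide)
  refine WP.seq (indices_wp hP hI₃ fun v hv => (hG.base_isBase v hv).1) ?_
  intro s₄ F₄ hJ
  have hI₄ := hI₃.frame F₄ (by decide)
  have hH₄ : Heads D s₄ := by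
    constructor
    · rw [F₄.narr 20 (by decide), F₃.narr 20 (by decide)]; exact hH.head
    · rw [F₄.narr 21 (by decide), F₃.narr 21 (by decide)]; exact hH.tail
  refine WP.seq (core₁_wp hP hG hI₄ hH₄) ?_
  intro s₅ F₅ h25
  have hI₅ := hI₄.frame F₅ (by decide)
  have hH₅ : Heads D s₅ := by
    constructor
    · rw [F₅.narr 20 (by decide)]; exact hH₄.head
    · rw [F₅.narr 21 (by decide)]; exact hH₄.tail
  refine WP.seq (core₂_wp hP hG hI₅ hH₅) ?_
  intro s₆ F₆ h26
  have hT₆ : Tables D s₆ := by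
    refine ⟨hI₅.frame F₆ (by decide), ⟨?_, ?_⟩, fun i hi j hj => (h25 i hi j hj).congr
      (by rw [F₆.narr 25 (by decide)]) (by rw [F₆.rarr 25 (by decide)]), h26⟩
    · rw [F₆.narr 20 (by decide)]; exact hH₅.head
    · rw [F₆.narr 21 (by decide)]; exact hH₅.tail
  have hJ₆ : Indices D s₆ := by
    constructor
    · rw [F₆.narr 28 (by decide), F₅.narr 28 (by decide)]; exact hJ.vtx
    · rw [F₆.narr 29 (by decide), F₅.narr 29 (by decide)]; exact hJ.grp
  refine WP.seq (lefts_wp hP hT₆.input hJ₆) ?_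
  intro s₇ F₇ h27
  have hT₇ := hT₆.frame F₇ (by decide) (by decide)
  have hJ₇ : Indices D s₇ := by
    constructor
    · rw [F₇.narr 28 (by decide)]; exact hJ₆.vtx
    · rw [F₇.narr 29 (by decide)]; exact hJ₆.grp
  refine (rights_wp hP hT₇.input hJ₇ hT₇.core₁ hT₇.core₂).conseq le_rfl ?_
  intro s₈ F₈ h37
  refine ⟨hT₇.frame F₈ (by decide) (by decide), ⟨?_, ?_⟩, ?_, fun i hi j hj =>
    (h27 i hi j hj).congr (by rw [F₈.narr 27 (by decide)]) (by rw [F₈.rarr 27 (by decide)]), h37,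
    ?_, ?_, ?_⟩
  · rw [F₈.narr 28 (by decide)]; exact hJ₇.vtx
  · rw [F₈.narr 29 (by decide)]; exact hJ₇.grp
  · rw [F₈.narr 22 (by decide), F₇.narr 22 (by decide), F₆.narr 22 (by decide),
      F₅.narr 22 (by decide), F₄.narr 22 (by decide)]
    exact h22
  · rw [F₈.nvar 0 (by decide), F₇.nvar 0 (by decide), F₆.nvar 0 (by decide),
      F₅.nvar 0 (by decide), F₄.nvar 0 (by decide), F₃.nvar 0 (by decide), F₂.nvar 0 (by decide)]
    exact n0
  · rw [F₈.nvar 1 (by decide), F₇.nvar 1 (by decide), F₆.nvar 1 (by decide),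
      F₅.nvar 1 (by decide), F₄.nvar 1 (by decide), F₃.nvar 1 (by decide), F₂.nvar 1 (by decide)]
    exact n1
  · rw [F₈.narr 30 (by decide), F₇.narr 30 (by decide), F₆.narr 30 (by decide),
      F₅.narr 30 (by decide), F₄.narr 30 (by decide), F₃.narr 30 (by decide),
      F₂.narr 30 (by decide)]
    exact hz 30 (by decide)

/-- The tables after the preparation and the sorting. -/
structure Tabulated (D : Data) (s : Mem) : Prop where
  n2 : s.nvar 2 = D.G.m
  n3 : s.nvar 3 = 6 * D.G.m
  n18 : s.nvar 18 = 3 * D.G.m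
  n15 : s.nvar 15 = D.G.m.size
  r0 : s.rvar 0 = 0
  grp : ∀ j < 6 * D.G.m, s.narr 29 j 0 = D.grpOf j
  vtx : ∀ j < 6 * D.G.m, s.narr 28 j 0 = j % D.G.m
  left : ∀ i < D.G.m, ∀ j < 6 * D.G.m, Cell s 27 i j (LeftIs D i j)
  right : ∀ j < 6 * D.G.m, ∀ w < D.G.m, Cell s 37 j w (D.Rgt j w)
  key : ∀ g, ∀ w < D.G.m, KeySpec s (6 * D.G.m) g w
  sorted : ∀ g < 6 * D.G.m, Sorted s D.G.m g
  pow : ∀ l < D.G.m.size, s.narr 35 l 0 = 2 ^ l - 1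
  copies : Copies s D.G.m (fun g l => g < 6 * D.G.m ∧ l < D.G.m.size)

theorem Tabulated.congr {s s' : Mem} (h : Tabulated D s)
    (hv : ∀ x ∈ [0, 2, 3, 15, 18], s'.nvar x = s.nvar x) (hv' : s'.rvar 0 = s.rvar 0)
    (hn : ∀ A ∈ [10, 27, 28, 29, 30, 33, 34, 35, 36, 37], s'.narr A = s.narr A)
    (hr : ∀ A ∈ [10, 27, 30, 37], s'.rarr A = s.rarr A) : Tabulated D s' where
  n2 := (hv 2 (by simp)).trans h.n2
  n3 := (hv 3 (by simp)).trans h.n3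
  n18 := (hv 18 (by simp)).trans h.n18
  n15 := (hv 15 (by simp)).trans h.n15
  r0 := hv'.trans h.r0
  grp := by rw [hn 29 (by simp)]; exact h.grp
  vtx := by rw [hn 28 (by simp)]; exact h.vtx
  left := fun i hi j hj => (h.left i hi j hj).congr (by rw [hn 27 (by simp)])
    (by rw [hr 27 (by simp)])
  right := fun i hi j hj => (h.right i hi j hj).congr (by rw [hn 37 (by simp)])
    (by rw [hr 37 (by simp)])
  key := fun g w hw => (h.key g w hw).congr (hn 29 (by simp)) (hn 37 (by simp)) (hr 37 (by simp))
    (by rw [hn 30 (by simp)]) (by rw [hr 30 (by simp)])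
  sorted := fun g hg => (h.sorted g hg).congr (by rw [hn 34 (by simp)]) (by rw [hn 33 (by simp)])
    (hn 30 (by simp)) (hr 30 (by simp))
  pow := by rw [hn 35 (by simp)]; exact h.pow
  copies := h.copies.congr (fun _ _ => Iff.rfl) (hv 0 (by simp))
    (fun A hA => hn A (by simp at hA ⊢; tauto)) (fun A hA => hr A (by simp at hA ⊢; tauto))

theorem _root_.Shortcut.Data.grpOf_lt {D : Data} (hG : D.G.WellFormed) {j : ℕ}
    (hj : j < 6 * D.G.m) : D.grpOf j < 6 * D.G.m := by
  have hv := Nat.mod_lt j (show 0 < D.G.m by omega)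
  have h₁ := (hG.base_isBase _ hv).1
  unfold Data.grpOf
  split_ifs with h
  · have := (hG.base_isBase _ h).1
    omega
  all_goals omega

theorem size_le_self (m : ℕ) : m.size ≤ m := Nat.size_le.mpr Nat.lt_two_pow_self

theorem Tabulated.ready {s : Mem} (h : Tabulated D s) (hG : D.G.WellFormed) :
    Ready s D.G.m D.G.m.size where
  n2 := h.n2
  n3 := h.n3
  n18 := h.n18
  n15 := h.n15
  km := size_le_self _
  grp_lt := fun j hj => by rw [h.grp j hj]; exact Data.grpOf_lt hG hj
  copies := h.copies
  len_le := fun g hg => (h.sorted g hg).len_le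
  mem_lt := fun g hg p hp => ((h.sorted g hg).mem p hp).1

def sortingCost (m : ℕ) : ℕ :=
  m * (6 * m * (keyCost + 7) + 5 + 7) + 5 + (6 * m * (sortCost m.size m + 7) + 5 +
    ((Prog.seq (.nset 14 (.lit 0)) (.nset 15 (.lit 0))).steps + (m.size * blockCost + 3) +
      (6 * m * (m.size * (allocBody.steps + 7) + 5 + 7) + 5)))

theorem sorting_wp (hP : Par W U B D.G.m) {s : Mem} (h : Prepared D s) :
    WP W U B sorting s (sortingCost D.G.m)
      (fun s' => Tables D s' ∧ Tabulated D s' ∧ s'.nvar 1 = 0) := by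
  have hI := h.tables.input
  refine WP.seq (keys_wp hP hI.n2 hI.n3 le_rfl h.zero) ?_
  intro s₁ F₁ hk
  have hI₁ := hI.frame F₁ (by decide)
  -- A tournament tree on `m` leaves has depth at most `m.size`, as `m < 2 ^ m.size`.
  refine WP.seq (sorts_wp (d := D.G.m.size) hP hI₁.n2 hI₁.n3 (Nat.lt_size_self _).le ?_) ?_
  · rw [F₁.narr 22 (by decide)]; exact h.half
  intro s₂ F₂ hs
  have hI₂ := hI₁.frame F₂ (by decide)
  refine WP.seq (blocks_wp hP hI₂.n2) ?_
  rintro s₃ F₃ ⟨n15, hpow⟩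
  have hI₃ := hI₂.frame F₃ (by decide)
  have c0 : s₃.nvar 0 = 0 := by
    rw [F₃.nvar 0 (by decide), F₂.nvar 0 (by decide), F₁.nvar 0 (by decide), h.n0]
  refine (alloc_wp hP hI₃.n3 hI₃.n18 n15 (size_le_self _) hI₃.r0 c0).conseq le_rfl ?_
  intro s₄ F₄ hc
  refine ⟨((((h.tables.frame F₁ (by decide) (by decide)).frame F₂ (by decide) (by decide)).frame F₃
    (by decide) (by decide)).frame F₄ (by decide) (by decide)), ?_, ?_⟩
  · have hI₄ := hI₃.frame F₄ (by decide)
    have e : ∀ A ∈ [27, 28, 29, 37], s₄.narr A = s.narr A := by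
      intro A hA
      simp only [List.mem_cons, List.not_mem_nil, or_false] at hA
      rcases hA with rfl | rfl | rfl | rfl <;>
        rw [F₄.narr _ (by decide), F₃.narr _ (by decide), F₂.narr _ (by decide),
          F₁.narr _ (by decide)]
    have e' : ∀ A ∈ [27, 37], s₄.rarr A = s.rarr A := by
      intro A hA
      simp only [List.mem_cons, List.not_mem_nil, or_false] at hA
      rcases hA with rfl | rfl <;>
        rw [F₄.rarr _ (by decide), F₃.rarr _ (by decide), F₂.rarr _ (by decide),
          F₁.rarr _ (by decide)]
    refine ⟨hI₄.n2, hI₄.n3, hI₄.n18, (F₄.nvar 15 (by decide)).trans n15, hI₄.r0, ?_, ?_,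
      fun i hi j hj => (h.left i hi j hj).congr (by rw [e 27 (by simp)]) (by rw [e' 27 (by simp)]),
      fun i hi j hj => (h.right i hi j hj).congr (by rw [e 37 (by simp)]) (by rw [e' 37 (by simp)]),
      fun g w hw => (hk g w hw).congr ?_ ?_ ?_ ?_ ?_,
      fun g hg => (hs g hg).congr ?_ ?_ ?_ ?_, ?_, hc⟩
    · rw [e 29 (by simp)]; exact h.indices.grp
    · rw [e 28 (by simp)]; exact h.indices.vtx
    · rw [F₄.narr _ (by decide), F₃.narr _ (by decide), F₂.narr _ (by decide)]
    · rw [F₄.narr _ (by decide), F₃.narr _ (by decide), F₂.narr _ (by decide)]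
    · rw [F₄.rarr _ (by decide), F₃.rarr _ (by decide), F₂.rarr _ (by decide)]
    · rw [F₄.narr _ (by decide), F₃.narr _ (by decide), F₂.narr _ (by decide)]
    · rw [F₄.rarr _ (by decide), F₃.rarr _ (by decide), F₂.rarr _ (by decide)]
    · rw [F₄.narr _ (by decide), F₃.narr _ (by decide)]
    · rw [F₄.narr _ (by decide), F₃.narr _ (by decide)]
    · rw [F₄.narr _ (by decide), F₃.narr _ (by decide)]
    · rw [F₄.rarr _ (by decide), F₃.rarr _ (by decide)]
    · rw [F₄.narr _ (by decide)]; exact hpow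
  · rw [F₄.nvar 1 (by decide), F₃.nvar 1 (by decide), F₂.nvar 1 (by decide),
      F₁.nvar 1 (by decide), h.n1]

/-- A bound on the cost of `emitAll`. -/
def allBound (m : ℕ) : ℕ := m * (m * (200 + 7) + 5 + 7) + 5

/-- The number `200` dominates the cost of one pass of each of the nine output phases. -/
theorem allCost_le {bs : List (Bool × Test)} {a b f : NExp} {w : RExp}
    (h : emitCost bs a b f w ≤ 200) (m : ℕ) : allCost bs a b f w m ≤ allBound m := by
  unfold allCost allBound
  gcongr

/-- The disjuncts are in the order of the nine output phases, so the union of their postconditions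
matches term by term. -/
theorem _root_.Shortcut.Data.plain_iff {D : Data} {i j : ℕ} {e : Edge} : D.Plain i j e ↔
    (D.G.adj i j = true ∧ ∃ b, (b = true ↔ D.G.IsNegEdge i j) ∧ e = ⟨i, j, D.wtΓ i j, b⟩) ∨
    (∃ x, D.Core 1 i j x ∧ e = ⟨i, j, x, true⟩) ∨ (∃ x, D.Core 2 i j x ∧ e = ⟨i, j, x, true⟩) ∨
    (D.OutE i j ∧ 0 ≤ D.w₂ i j ∧ e = ⟨D.G.m + i, j, D.w₂ i j, false⟩) ∨
    (D.InE i j ∧ 0 ≤ D.w₃ i j ∧ e = ⟨j, D.G.m + i, D.w₃ i j, false⟩) ∨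
    (D.InE i j ∧ ∃ r', D.G.IsNegEdge i r' ∧ 0 ≤ D.w₃ i j + D.w₂ i r' ∧
      e = ⟨j, r', D.w₃ i j + D.w₂ i r', false⟩) ∨
    (D.OutE i j ∧ 0 ≤ D.w₃ i i + D.w₂ i j ∧ e = ⟨i, j, D.w₃ i i + D.w₂ i j, false⟩) ∨
    (D.OutE i j ∧ j ∈ D.N ∧ 0 ≤ D.w₂ i j + D.w₃ j j ∧
      e = ⟨D.G.m + i, D.G.m + j, D.w₂ i j + D.w₃ j j, false⟩) ∨
    (∃ r', D.G.IsNegEdge i r' ∧ D.InE j r' ∧ 0 ≤ D.w₂ i r' + D.w₃ j r' ∧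
      e = ⟨D.G.m + i, D.G.m + j, D.w₂ i r' + D.w₃ j r', false⟩) := by
  constructor
  · rintro (⟨h, b, hb⟩ | ⟨x, h⟩ | ⟨x, h⟩ | ⟨h, h₀⟩ | ⟨h, h₀⟩ | ⟨h, r', hr, h₀⟩ | ⟨h, h₀⟩ |
      ⟨h, hj, h₀⟩ | ⟨r', hr, h, h₀⟩)
    · exact Or.inl ⟨h, b, hb, rfl⟩
    · exact Or.inr (Or.inl ⟨x, h, rfl⟩)
    · exact Or.inr (Or.inr (Or.inl ⟨x, h, rfl⟩))
    · exact Or.inr (Or.inr (Or.inr (Or.inl ⟨h, h₀, rfl⟩)))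
    · exact Or.inr (Or.inr (Or.inr (Or.inr (Or.inl ⟨h, h₀, rfl⟩))))
    · exact Or.inr (Or.inr (Or.inr (Or.inr (Or.inr (Or.inl ⟨h, r', hr, h₀, rfl⟩)))))
    · exact Or.inr (Or.inr (Or.inr (Or.inr (Or.inr (Or.inr (Or.inl ⟨h, h₀, rfl⟩))))))
    · exact Or.inr (Or.inr (Or.inr (Or.inr (Or.inr (Or.inr (Or.inr (Or.inl
        ⟨h, hj, h₀, rfl⟩)))))))
    · exact Or.inr (Or.inr (Or.inr (Or.inr (Or.inr (Or.inr (Or.inr (Or.inr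
        ⟨r', hr, h, h₀, rfl⟩)))))))
  · rintro (⟨h, b, hb, rfl⟩ | ⟨x, h, rfl⟩ | ⟨x, h, rfl⟩ | ⟨h, h₀, rfl⟩ | ⟨h, h₀, rfl⟩ |
      ⟨h, r', hr, h₀, rfl⟩ | ⟨h, h₀, rfl⟩ | ⟨h, hj, h₀, rfl⟩ | ⟨r', hr, h, h₀, rfl⟩)
    · exact .graph h b hb
    · exact .core₁ x h
    · exact .core₂ x h
    · exact .out h h₀
    · exact .inn h h₀
    · exact .mid₁ h r' hr h₀
    · exact .mid₂ h h₀
    · exact .two₁ h hj h₀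
    · exact .two₂ r' hr h h₀

theorem emitBase_wp (hP : Par W U B D.G.m) (hG : D.G.WellFormed) {s : Mem} (hT : Tables D s) :
    WP W U B emitBase s (allBound D.G.m + (allBound D.G.m + (allBound D.G.m + (allBound D.G.m +
      (allBound D.G.m + (allBound D.G.m + (allBound D.G.m + (allBound D.G.m + allBound D.G.m))))))))
      (fun s' => outEdges s' = outEdges s ∪ {e | ∃ i < D.G.m, ∃ j < D.G.m, D.Plain i j e}) := by
  refine WP.seq ((emitGraph_wp hP hT).conseq (allCost_le (by decide) _) fun _ _ h => h) ?_
  intro s₁ F₁ h₁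
  have hT := hT.frame F₁ (by decide) (by decide)
  refine WP.seq ((emitCore₁_wp hP hG hT).conseq (allCost_le (by decide) _) fun _ _ h => h) ?_
  intro s₂ F₂ h₂
  have hT := hT.frame F₂ (by decide) (by decide)
  refine WP.seq ((emitCore₂_wp hP hG hT).conseq (allCost_le (by decide) _) fun _ _ h => h) ?_
  intro s₃ F₃ h₃
  have hT := hT.frame F₃ (by decide) (by decide)
  refine WP.seq ((emitOut_wp hP hG hT).conseq (allCost_le (by decide) _) fun _ _ h => h) ?_
  intro s₄ F₄ h₄
  have hT := hT.frame F₄ (by decide) (by decide)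
  refine WP.seq ((emitIn_wp hP hG hT).conseq (allCost_le (by decide) _) fun _ _ h => h) ?_
  intro s₅ F₅ h₅
  have hT := hT.frame F₅ (by decide) (by decide)
  refine WP.seq ((emitMid₁_wp hP hG hT).conseq (allCost_le (by decide) _) fun _ _ h => h) ?_
  intro s₆ F₆ h₆
  have hT := hT.frame F₆ (by decide) (by decide)
  refine WP.seq ((emitMid₂_wp hP hG hT).conseq (allCost_le (by decide) _) fun _ _ h => h) ?_
  intro s₇ F₇ h₇
  have hT := hT.frame F₇ (by decide) (by decide)
  refine WP.seq ((emitTwo₁_wp hP hG hT).conseq (allCost_le (by decide) _) fun _ _ h => h) ?_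
  intro s₈ F₈ h₈
  have hT := hT.frame F₈ (by decide) (by decide)
  refine (emitTwo₂_wp hP hG hT).conseq (allCost_le (by decide) _) ?_
  intro s₉ _ h₉
  rw [h₉, h₈, h₇, h₆, h₅, h₄, h₃, h₂, h₁]
  ext e
  simp only [Set.mem_union, Set.mem_ofPred_eq, Data.plain_iff, and_or_left, exists_or, or_assoc]

/-- The edges that the program outputs, read off the tables. -/
def Output (D : Data) (s : Mem) : Set Edge :=
  {e | (∃ i < D.G.m, ∃ j < D.G.m, D.Plain i j e) ∨
    (∃ o, ∃ j < 6 * D.G.m, ∃ w < D.G.m, ∃ l < D.G.m.size, RightEdge s D.G.m o j w l e) ∨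
    ∃ o, ∃ i < D.G.m, ∃ j < 6 * D.G.m, ∃ l < D.G.m.size, LeftEdge s D.G.m o i j l e}

theorem RightEdge.congr {s s' : Mem} {m : ℕ} {o : Bool} {j w l : ℕ} {e : Edge}
    (hn : ∀ A ∈ [29, 33, 34, 35, 36, 37], s'.narr A = s.narr A)
    (hr : ∀ A ∈ [30, 37], s'.rarr A = s.rarr A) :
    RightEdge s' m o j w l e ↔ RightEdge s m o j w l e := by
  unfold RightEdge thrv
  rw [hn 29 (by simp), hn 33 (by simp), hn 34 (by simp), hn 35 (by simp), hn 36 (by simp),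
    hn 37 (by simp), hr 30 (by simp), hr 37 (by simp)]

theorem LeftEdge.congr {s s' : Mem} {m : ℕ} {o : Bool} {i j l : ℕ} {e : Edge}
    (hn : ∀ A ∈ [27, 29, 33, 34, 35, 36, 37], s'.narr A = s.narr A)
    (hr : ∀ A ∈ [27, 30, 37], s'.rarr A = s.rarr A) :
    LeftEdge s' m o i j l e ↔ LeftEdge s m o i j l e := by
  unfold LeftEdge thrv
  rw [hn 27 (by simp), hn 29 (by simp), hn 33 (by simp), hn 34 (by simp), hn 35 (by simp),
    hn 36 (by simp), hn 37 (by simp), hr 27 (by simp), hr 30 (by simp), hr 37 (by simp)]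

/-- The cost of the output of the edges at Steiner vertices. -/
noncomputable def lefts₀Cost (s : Mem) (m : ℕ) (o : Bool) : ℕ :=
  ∑ i ∈ Finset.range m, (∑ j ∈ Finset.range (6 * m), (∑ l ∈ Finset.range m.size,
    (leftCost o + enumCost s i j l * directCost + 7) + 5 + 7) + 5 + 7) + 5

def rights₀Cost (m : ℕ) (o : Bool) : ℕ :=
  6 * m * (m * (m.size * (rightCost o + 7) + 5 + 7) + 5 + 7) + 5

/-- A frame of one of the output programs, whatever its direction. -/
theorem copies_frame {c : Prog} (hc : c ∈ [copyRight true, copyRight false, copyLeft true,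
    copyLeft false, emitBase]) {s s' : Mem} (hF : Frame c s s') :
    (∀ x ∈ [0, 2, 3, 15, 18], s'.nvar x = s.nvar x) ∧ s'.rvar 0 = s.rvar 0 ∧
    (∀ A ∈ [10, 27, 28, 29, 30, 33, 34, 35, 36, 37], s'.narr A = s.narr A) ∧
    (∀ A ∈ [10, 27, 30, 37], s'.rarr A = s.rarr A) := by
  have h : (∀ x ∈ [0, 2, 3, 15, 18], x ∉ c.nvars) ∧ 0 ∉ c.rvars ∧
      (∀ A ∈ [10, 27, 28, 29, 30, 33, 34, 35, 36, 37], A ∉ c.narrs) ∧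
      ∀ A ∈ [10, 27, 30, 37], A ∉ c.rarrs := by
    simp only [List.mem_cons, List.not_mem_nil, or_false] at hc
    rcases hc with rfl | rfl | rfl | rfl | rfl <;> decide
  exact ⟨fun x hx => hF.nvar x (h.1 x hx), hF.rvar 0 h.2.1, fun A hA => hF.narr A (h.2.2.1 A hA),
    fun A hA => hF.rarr A (h.2.2.2 A hA)⟩

theorem Tabulated.frame {c : Prog} (hc : c ∈ [copyRight true, copyRight false, copyLeft true,
    copyLeft false, emitBase]) {s s' : Mem} (h : Tabulated D s) (hF : Frame c s s') :
    Tabulated D s' := by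
  obtain ⟨h₁, h₂, h₃, h₄⟩ := copies_frame hc hF
  exact h.congr h₁ h₂ h₃ h₄

theorem Output.congr {s s' : Mem}
    (hn : ∀ A ∈ [10, 27, 28, 29, 30, 33, 34, 35, 36, 37], s'.narr A = s.narr A)
    (hr : ∀ A ∈ [10, 27, 30, 37], s'.rarr A = s.rarr A) : Output D s' = Output D s := by
  unfold Output
  simp only [RightEdge.congr (fun A hA => hn A (by simp at hA ⊢; tauto))
    (fun A hA => hr A (by simp at hA ⊢; tauto)), LeftEdge.congr
    (fun A hA => hn A (by simp at hA ⊢; tauto)) (fun A hA => hr A (by simp at hA ⊢; tauto))]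

-- The bound `T` isolates the only part of the cost that is not a function of `m`. Output phases do
-- not touch the tables, so `Output` can be read off the final memory, although the edges were
-- emitted in earlier ones.
set_option maxHeartbeats 1000000 in
theorem main_wp (hP : Par W U B D.G.m) (hG : D.G.WellFormed) {T : ℕ}
    (hT : ∀ s o, Tabulated D s → lefts₀Cost s D.G.m o ≤ T) :
    WP W U B main D.start (prepareCost D.G.m + (sortingCost D.G.m +
      ((allBound D.G.m + (allBound D.G.m + (allBound D.G.m + (allBound D.G.m + (allBound D.G.m +
        (allBound D.G.m + (allBound D.G.m + (allBound D.G.m + allBound D.G.m)))))))) +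
        (rights₀Cost D.G.m true + (rights₀Cost D.G.m false + (T + T))))))
      (fun s' => Tabulated D s' ∧ outEdges s' = Output D s') := by
  refine WP.seq (prepare_wp hP hG) ?_
  intro s₁ _ h₁
  refine WP.seq (sorting_wp hP h₁) ?_
  rintro s₂ - ⟨h₂, t₂, e₂⟩
  refine WP.seq (emitBase_wp hP hG h₂) ?_
  intro s₃ F₃ h₃
  have t₃ := t₂.frame (by simp) F₃
  refine WP.seq (copyRight_wp hP (t₃.ready hG) true) ?_
  intro s₄ F₄ h₄
  have t₄ := t₃.frame (by simp) F₄
  refine WP.seq (copyRight_wp hP (t₄.ready hG) false) ?_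
  intro s₅ F₅ h₅
  have t₅ := t₄.frame (by simp) F₅
  refine WP.seq ((copyLeft_wp hP (t₅.ready hG) true).conseq (hT _ true t₅) fun _ _ h => h) ?_
  intro s₆ F₆ h₆
  have t₆ := t₅.frame (by simp) F₆
  refine (copyLeft_wp hP (t₆.ready hG) false).conseq (hT _ false t₆) ?_
  intro s₇ F₇ h₇
  refine ⟨t₆.frame (by simp) F₇, ?_⟩
  obtain ⟨-, -, n₄, r₄⟩ := copies_frame (by simp) F₄
  obtain ⟨-, -, n₅, r₅⟩ := copies_frame (by simp) F₅
  obtain ⟨-, -, n₆, r₆⟩ := copies_frame (by simp) F₆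
  obtain ⟨-, -, n₇, r₇⟩ := copies_frame (by simp) F₇
  rw [Output.congr n₇ r₇, Output.congr n₆ r₆, h₇, h₆, h₅, h₄, h₃]
  have e₀ : outEdges s₂ = ∅ := by
    ext e; simp [outEdges, e₂]
  rw [e₀]
  ext e
  simp only [Output, Set.mem_union, Set.mem_ofPred_eq, Set.mem_empty_iff_false, false_or,
    Bool.exists_bool, LeftEdge.congr (fun A hA => n₆ A (by simp at hA ⊢; tauto))
    (fun A hA => r₆ A (by simp at hA ⊢; tauto)),
    RightEdge.congr (fun A hA => n₅ A (by simp at hA ⊢; tauto))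
    (fun A hA => r₅ A (by simp at hA ⊢; tauto)),
    RightEdge.congr (fun A hA => n₄ A (by simp at hA ⊢; tauto))
    (fun A hA => r₄ A (by simp at hA ⊢; tauto))]
  have perm : ∀ a b c d e : Prop, ((((a ∨ b) ∨ c) ∨ d) ∨ e ↔ a ∨ (c ∨ b) ∨ (e ∨ d)) := by tauto
  exact perm _ _ _ _ _

end Alg

end Shortcut

namespace Shortcut

/-! ## Walks and distances -/

theorem IsWalk.append {E : Set Edge} {s t u : ℕ} {p q : List Edge} (hp : IsWalk E s p t)
    (hq : IsWalk E t q u) : IsWalk E s (p ++ q) u := by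
  induction p generalizing s with
  | nil => obtain rfl : s = t := hp; exact hq
  | cons e p ih => exact ⟨hp.1, hp.2.1, ih hp.2.2⟩

theorem IsWalk.mono {E F : Set Edge} (h : E ⊆ F) {s t : ℕ} {p : List Edge}
    (hp : IsWalk E s p t) : IsWalk F s p t := by
  induction p generalizing s with
  | nil => exact hp
  | cons e p ih => exact ⟨h hp.1, hp.2.1, ih hp.2.2⟩

theorem IsWalk.single {E : Set Edge} {e : Edge} (h : e ∈ E) : IsWalk E e.src [e] e.tgt :=
  ⟨h, rfl, rfl⟩

@[simp] theorem weight_nil : weight [] = 0 := rfl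

@[simp] theorem weight_cons (e : Edge) (p : List Edge) : weight (e :: p) = e.wt + weight p := by
  simp [weight]

@[simp] theorem weight_append (p q : List Edge) : weight (p ++ q) = weight p + weight q := by
  simp [weight]

@[simp] theorem hops_nil : hops [] = 0 := rfl

theorem hops_cons (e : Edge) (p : List Edge) :
    hops (e :: p) = hops p + if e.neg = true then 1 else 0 := by
  simp [hops, List.countP_cons]

@[simp] theorem hops_append (p q : List Edge) : hops (p ++ q) = hops p + hops q := by
  simp [hops, List.countP_append]

theorem dist_le {E : Set Edge} {s t : ℕ} {p : List Edge} (hp : IsWalk E s p t) :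
    dist E s t ≤ ((weight p : ℝ) : EReal) :=
  iInf_le (fun p : {p : List Edge // IsWalk E s p t} => ((weight p.1 : ℝ) : EReal)) ⟨p, hp⟩

theorem exists_walk_of_dist_lt {E : Set Edge} {s t : ℕ} {x : ℝ} (h : dist E s t < (x : EReal)) :
    ∃ p, IsWalk E s p t ∧ weight p < x := by
  obtain ⟨⟨p, hp⟩, h⟩ := iInf_lt_iff.mp h
  exact ⟨p, hp, by exact_mod_cast h⟩

theorem hopDist_le {E : Set Edge} {h s t : ℕ} {p : List Edge} (hp : IsWalk E s p t)
    (hh : hops p ≤ h) : hopDist E h s t ≤ ((weight p : ℝ) : EReal) :=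
  iInf_le (fun p : {p : List Edge // IsWalk E s p t ∧ hops p ≤ h} => ((weight p.1 : ℝ) : EReal))
    ⟨p, hp, hh⟩

theorem exists_walk_of_hopDist_lt {E : Set Edge} {h s t : ℕ} {x : ℝ}
    (hx : hopDist E h s t < (x : EReal)) : ∃ p, IsWalk E s p t ∧ hops p ≤ h ∧ weight p < x := by
  obtain ⟨⟨p, hp⟩, h⟩ := iInf_lt_iff.mp hx
  exact ⟨p, hp.1, hp.2, by exact_mod_cast h⟩

/-- Distances are infima over infinitely many walks, and attainment is nowhere established.
Estimates therefore use walks that are optimal up to `ε`. -/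
theorem le_of_forall_real_lt {a : EReal} {x : ℝ} (h : ∀ ε : ℝ, 0 < ε → a ≤ ((x + ε : ℝ) : EReal)) :
    a ≤ (x : EReal) := by
  by_contra hc
  obtain ⟨q, h₁, h₂⟩ := EReal.lt_iff_exists_real_btwn.mp (not_le.mp hc)
  have h₁ : x < q := by exact_mod_cast h₁
  have := h (q - x) (by linarith)
  rw [add_sub_cancel] at this
  exact absurd h₂ (not_lt.mpr this)

theorem dist_mono {E F : Set Edge} (h : E ⊆ F) (s t : ℕ) : dist F s t ≤ dist E s t :=
  le_iInf fun p => dist_le (p.2.mono h)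

theorem dist_trans {E : Set Edge} {a b c : ℕ} {x y : ℝ} (h₁ : dist E a b ≤ (x : EReal))
    (h₂ : dist E b c ≤ (y : EReal)) : dist E a c ≤ ((x + y : ℝ) : EReal) := by
  refine le_of_forall_real_lt fun ε hε => ?_
  have h₁ : dist E a b < ((x + ε / 2 : ℝ) : EReal) :=
    h₁.trans_lt (by exact_mod_cast (by linarith : x < x + ε / 2))
  have h₂ : dist E b c < ((y + ε / 2 : ℝ) : EReal) :=
    h₂.trans_lt (by exact_mod_cast (by linarith : y < y + ε / 2))
  obtain ⟨p, hp, hp'⟩ := exists_walk_of_dist_lt h₁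
  obtain ⟨q, hq, hq'⟩ := exists_walk_of_dist_lt h₂
  refine (dist_le (hp.append hq)).trans ?_
  rw [weight_append]
  exact_mod_cast (by linarith : weight p + weight q ≤ x + y + ε)

theorem dist_self_le {E : Set Edge} (a : ℕ) : dist E a a ≤ ((0 : ℝ) : EReal) :=
  dist_le (p := []) rfl

/-- A bound for all walks with few hops holds for the hop distance. -/
theorem le_of_hopDist {E : Set Edge} {h s t : ℕ} {a c : ℝ} {X : EReal}
    (ha : (a : EReal) = hopDist E h s t)
    (hX : ∀ p, IsWalk E s p t → hops p ≤ h → X ≤ ((weight p + c : ℝ) : EReal)) :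
    X ≤ ((a + c : ℝ) : EReal) := by
  refine le_of_forall_real_lt fun ε hε => ?_
  have hlt : hopDist E h s t < ((a + ε : ℝ) : EReal) := by
    rw [← ha]; exact_mod_cast (by linarith : a < a + ε)
  obtain ⟨p, hp, hh, hw⟩ := exists_walk_of_hopDist_lt hlt
  exact (hX p hp hh).trans (by exact_mod_cast (by linarith : weight p + c ≤ a + c + ε))

/-- With base points `π` and shifts `σ`, an edge of weight `w` from `x` to `y` does not undercut
the distance of the base points. -/
def Reach (E : Set Edge) (π : ℕ → ℕ) (σ : ℕ → ℝ) (x y : ℕ) (w : ℝ) : Prop :=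
  dist E (π x) (π y) ≤ ((w + σ x - σ y : ℝ) : EReal)

namespace Reach

variable {E : Set Edge} {π : ℕ → ℕ} {σ : ℕ → ℝ} {x y z : ℕ} {w w' : ℝ}

/-- The triangle inequality for the base points; the shift of the middle vertex cancels. This is the
closure property that makes every composed edge admissible. -/
theorem trans (h : Reach E π σ x y w) (h' : Reach E π σ y z w') : Reach E π σ x z (w + w') := by
  have := dist_trans h h'
  rwa [show w + σ x - σ y + (w' + σ y - σ z) = w + w' + σ x - σ z by ring] at this

/-- Moving between two copies of one vertex at the price of the difference of shifts undercuts
nothing, as the base points coincide and the empty walk has weight zero. -/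
theorem of_base (h : π x = π y) (hw : w = σ y - σ x) : Reach E π σ x y w := by
  unfold Reach
  rw [h, hw, show σ y - σ x + σ x - σ y = 0 by ring]
  exact dist_self_le _

theorem mono_edges {F : Set Edge} (hE : E ⊆ F) (h : Reach E π σ x y w) : Reach F π σ x y w :=
  (dist_mono hE _ _).trans h

theorem congr {π' : ℕ → ℕ} {σ' : ℕ → ℝ} (h : Reach E π σ x y w) (h₁ : π' x = π x)
    (h₂ : π' y = π y) (h₃ : σ' x = σ x) (h₄ : σ' y = σ y) : Reach E π' σ' x y w := by
  unfold Reach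
  rw [h₁, h₂, h₃, h₄]
  exact h

theorem of_walk {F : Set Edge} (hF : ∀ e ∈ F, Reach E π σ e.src e.tgt e.wt) {p : List Edge}
    (hp : IsWalk F x p y) : Reach E π σ x y (weight p) := by
  induction p generalizing x with
  | nil => obtain rfl : x = y := hp; exact of_base rfl (by simp)
  | cons e p ih =>
    obtain ⟨h₁, rfl, h₃⟩ := hp
    rw [weight_cons]
    exact (hF e h₁).trans (ih h₃)

theorem of_hopDist {F : Set Edge} (hF : ∀ e ∈ F, Reach E π σ e.src e.tgt e.wt) {h : ℕ}
    (hw : (w : EReal) = hopDist F h x y) : Reach E π σ x y w := by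
  unfold Reach
  rw [add_sub_assoc]
  refine le_of_hopDist hw fun p hp _ => ?_
  rw [← add_sub_assoc]
  exact of_walk hF hp

end Reach

theorem mem_reweight {φ : ℕ → ℝ} {E : Set Edge} {e : Edge} :
    e ∈ reweight φ E ↔ (⟨e.src, e.tgt, e.wt - φ e.src + φ e.tgt, e.neg⟩ : Edge) ∈ E := by
  constructor
  · rintro ⟨f, hf, rfl⟩
    have : (⟨f.src, f.tgt, f.wt + φ f.src - φ f.tgt - φ f.src + φ f.tgt, f.neg⟩ : Edge) = f := by
      cases f; simp; ring
    simpa [this] using hf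
  · intro h
    refine ⟨_, h, ?_⟩
    cases e; simp; ring

/-- Potential differences telescope along a walk: reweighting is the case of `Reach` with every
vertex its own base point and `φ` as the shift. -/
theorem dist_reweight_le {φ : ℕ → ℝ} {E : Set Edge} {s t : ℕ} {x : ℝ}
    (h : dist E s t ≤ (x : EReal)) :
    dist (reweight φ E) s t ≤ ((x + φ s - φ t : ℝ) : EReal) := by
  have key : ∀ e ∈ E, Reach (reweight φ E) id φ e.src e.tgt e.wt := fun e he => by
    have hw : IsWalk (reweight φ E) e.src [⟨e.src, e.tgt, e.wt + φ e.src - φ e.tgt, e.neg⟩] e.tgt :=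
      ⟨⟨e, he, rfl⟩, rfl, rfl⟩
    refine (dist_le hw).trans ?_
    simp
  refine le_of_forall_real_lt fun ε hε => ?_
  obtain ⟨p, hp, hp'⟩ := exists_walk_of_dist_lt (h.trans_lt
    (by exact_mod_cast (by linarith : x < x + ε)))
  refine LE.le.trans (Reach.of_walk key hp : dist _ s t ≤ _) ?_
  exact_mod_cast (by linarith : weight p + φ s - φ t ≤ x + φ s - φ t + ε)

namespace Data

variable {D : Data} {n : ℕ}

/-! ## The graph `Γ` -/

theorem mem_gam {e : Edge} : e ∈ D.gam ↔ D.G.adj e.src e.tgt = true ∧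
    e.wt = D.wtΓ e.src e.tgt ∧ (e.neg = true ↔ D.G.IsNegEdge e.src e.tgt) := by
  simp only [gam, mem_reweight, CopyGraph.edges, Set.mem_ofPred_eq, wtΓ, CopyGraph.IsNegEdge]
  constructor
  · rintro ⟨h₁, h₂, h₃⟩
    refine ⟨h₁, by linarith, ?_⟩
    rw [h₃, ← h₂]
    simp [h₁]
  · rintro ⟨h₁, h₂, h₃⟩
    have : e.wt - D.φ e.src + D.φ e.tgt = D.G.wt e.src e.tgt := by rw [h₂]; ring
    refine ⟨h₁, this, ?_⟩
    rw [h₃, this]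
    simp [h₁]

theorem gam_subset_hgr : D.gam ⊆ D.hgr := Set.image_mono Set.subset_union_left

/-- An edge without the frozen flag was non-negative before the reweighting, and a valid potential
keeps it so. Walks without hops are therefore non-negative. -/
theorem WellFormed.gam_nonneg (hD : D.WellFormed n) {e : Edge} (he : e ∈ D.gam)
    (hn : ¬ e.neg = true) : 0 ≤ e.wt := by
  obtain ⟨f, hf, rfl⟩ := he
  exact hD.valid f (Or.inl hf) (not_lt.mp fun h => hn (hf.2.2.mpr h))

theorem WellFormed.weight_nonneg (hD : D.WellFormed n) {s t : ℕ} {p : List Edge}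
    (hp : IsWalk D.gam s p t) (hh : hops p ≤ 0) : 0 ≤ weight p := by
  induction p generalizing s with
  | nil => simp
  | cons e p ih =>
    rw [hops_cons] at hh
    split_ifs at hh with hn
    · omega
    · rw [weight_cons]
      have := ih hp.2.2 (by omega)
      have := hD.gam_nonneg hp.1 hn
      linarith

/-- A walk with at most one hop from a negative vertex is empty or starts with the negative edge. -/
theorem WellFormed.walk_cases (hD : D.WellFormed n) {r r' v : ℕ} (hr : D.G.IsNegEdge r r')
    {p : List Edge} (hp : IsWalk D.gam r p v) (hh : hops p ≤ 1) : (p = [] ∧ v = r) ∨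
      ∃ q, IsWalk D.gam r' q v ∧ hops q ≤ 0 ∧ weight p = D.wtΓ r r' + weight q := by
  cases p with
  | nil => exact Or.inl ⟨rfl, hp.symm⟩
  | cons e p =>
    obtain ⟨h₁, rfl, h₃⟩ := hp
    obtain ⟨a, b, c⟩ := mem_gam.mp h₁
    have ht := hD.graph.out_unique _ _ _ hr a
    rw [ht] at b c h₃
    rw [hops_cons, if_pos (c.mpr hr)] at hh
    exact Or.inr ⟨p, h₃, by omega, by rw [weight_cons, b]⟩

theorem WellFormed.hopDist_zero_nonneg (hD : D.WellFormed n) (u r : ℕ) :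
    0 ≤ hopDist D.gam 0 u r :=
  le_iInf fun p => by exact_mod_cast hD.weight_nonneg p.2.1 p.2.2

theorem WellFormed.hopDist_one_ge (hD : D.WellFormed n) {r r' : ℕ} (hr : D.G.IsNegEdge r r')
    (v : ℕ) : ((min 0 (D.wtΓ r r') : ℝ) : EReal) ≤ hopDist D.gam 1 r v := by
  refine le_iInf fun p => ?_
  rcases hD.walk_cases hr p.2.1 p.2.2 with ⟨h, -⟩ | ⟨q, hq, hh, h⟩
  · rw [h]; exact_mod_cast min_le_left _ _
  · rw [h]
    have := hD.weight_nonneg hq hh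
    exact_mod_cast (min_le_right _ _).trans (by linarith)

/-- Finiteness is the point. From above, the distance is bounded by `-Δ r` or by the single negative
edge; from below, a walk from `r` with one hop is empty or consists of its negative edge and a
non-negative rest. -/
theorem WellFormed.coe_d₁ (hD : D.WellFormed n) {r v : ℕ} (h : D.OutE r v) :
    (D.d₁ r v : EReal) = hopDist D.gam 1 r v := by
  obtain ⟨⟨r', hr⟩, h⟩ := h
  refine EReal.coe_toReal ?_ ?_
  · rcases h with h | h
    · refine ne_top_of_le_ne_top (EReal.coe_ne_top (-D.Δ r)) ?_
      obtain ⟨-, h⟩ := h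
      split_ifs at h
      exacts [h.le, h]
    · have hw : IsWalk D.gam r [⟨r, v, D.wtΓ r v, true⟩] v :=
        ⟨mem_gam.mpr ⟨h.1, rfl, by simpa using h⟩, rfl, rfl⟩
      exact ne_top_of_le_ne_top (EReal.coe_ne_top _) (hopDist_le hw (by simp [hops]))
  · exact ne_bot_of_le_ne_bot (EReal.coe_ne_bot _) (hD.hopDist_one_ge hr v)

theorem WellFormed.coe_d₀ (hD : D.WellFormed n) {r u : ℕ} (h : D.InE r u) :
    (D.d₀ u r : EReal) = hopDist D.gam 0 u r := by
  refine EReal.coe_toReal ?_ ?_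
  · rcases h.2 with h | rfl
    · refine ne_top_of_le_ne_top (EReal.coe_ne_top (D.Δ r)) ?_
      obtain ⟨-, h⟩ := h
      split_ifs at h
      exacts [h, h.le]
    · exact ne_top_of_le_ne_top (EReal.coe_ne_top _) (hopDist_le (p := []) rfl (by simp))
  · exact ne_bot_of_le_ne_bot (EReal.zero_ne_bot) (hD.hopDist_zero_nonneg u r)

theorem OutE.lt (hD : D.WellFormed n) {r v : ℕ} (h : D.OutE r v) : r < D.G.m ∧ v < D.G.m := by
  obtain ⟨⟨r', hr⟩, h⟩ := h
  refine ⟨(hD.graph.neg_lt hr).1, ?_⟩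
  rcases h with h | h
  exacts [h.1, (hD.graph.neg_lt h).2]

theorem InE.lt (hD : D.WellFormed n) {r u : ℕ} (h : D.InE r u) : r < D.G.m ∧ u < D.G.m := by
  obtain ⟨⟨r', hr⟩, h⟩ := h
  refine ⟨(hD.graph.neg_lt hr).1, ?_⟩
  rcases h with h | rfl
  exacts [h.1, (hD.graph.neg_lt hr).1]

theorem Core.lt (hD : D.WellFormed n) {k v w : ℕ} {x : ℝ} (h : D.Core k v w x) :
    v < D.G.m ∧ w < D.G.m := by
  unfold Core at h
  split_ifs at h
  · exact hD.graph.adj_lt v w h.1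
  · obtain ⟨⟨r', hr⟩, z, -, hz, -⟩ := h
    exact ⟨(hD.graph.neg_lt hr).1, (hD.graph.neg_lt hz).2⟩
  · obtain ⟨r, u', hr, -, hu, -⟩ := h
    exact ⟨(hD.graph.neg_lt hu).1, (hD.graph.neg_lt hr).2⟩

theorem mem_s2 (hD : D.WellFormed n) {e : Edge} : e ∈ D.s2 ↔ ∃ r, e.src = D.G.m + r ∧
    D.OutE r e.tgt ∧ e.wt = D.w₂ r e.tgt ∧ (e.neg = true ↔ e.wt < 0) := by
  have key : ∀ {r}, D.OutE r e.tgt → ((e.wt : EReal) = hopDist D.gam 1 r e.tgt + (D.Δ r : EReal) ↔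
      e.wt = D.w₂ r e.tgt) := fun {r} h => by
    rw [← hD.coe_d₁ h, ← EReal.coe_add, EReal.coe_eq_coe_iff]; rfl
  constructor
  · rintro ⟨r, hr, h₁, h₂, h₃, h₄⟩
    have hO : D.OutE r e.tgt := ⟨hr, h₂⟩
    exact ⟨r, h₁, hO, (key hO).mp h₃, h₄⟩
  · rintro ⟨r, h₁, h₂, h₃, h₄⟩
    exact ⟨r, h₂.1, h₁, h₂.2, (key h₂).mpr h₃, h₄⟩

theorem mem_s3 (hD : D.WellFormed n) {e : Edge} : e ∈ D.s3 ↔ ∃ r, e.tgt = D.G.m + r ∧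
    D.InE r e.src ∧ e.wt = D.w₃ r e.src ∧ (e.neg = true ↔ e.wt < 0) := by
  have key : ∀ {r}, D.InE r e.src → ((e.wt : EReal) = hopDist D.gam 0 e.src r - (D.Δ r : EReal) ↔
      e.wt = D.w₃ r e.src) := fun {r} h => by
    rw [← hD.coe_d₀ h, ← EReal.coe_sub, EReal.coe_eq_coe_iff]; rfl
  constructor
  · rintro ⟨r, hr, h₁, h₂, h₃, h₄⟩
    have hE : D.InE r e.src := ⟨hr, h₂⟩
    exact ⟨r, h₁, hE, (key hE).mp h₃, h₄⟩
  · rintro ⟨r, h₁, h₂, h₃, h₄⟩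
    exact ⟨r, h₂.1, h₁, h₂.2, (key h₂).mpr h₃, h₄⟩

theorem mem_s4 (hD : D.WellFormed n) {e : Edge} :
    e ∈ D.s4 ↔ D.Core 1 e.src e.tgt e.wt ∧ e.neg = true := by
  have key : ∀ {z}, D.OutE e.src z → ((e.wt : EReal) = hopDist D.gam 1 e.src z +
      (D.wtΓ z e.tgt : EReal) ↔ e.wt = D.d₁ e.src z + D.wtΓ z e.tgt) := fun {z} h => by
    rw [← hD.coe_d₁ h, ← EReal.coe_add, EReal.coe_eq_coe_iff]
  constructor
  · rintro ⟨hN, z, hz, h₁, h₂, h₃⟩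
    exact ⟨⟨hN, z, hz, h₁, (key ⟨hN, Or.inl hz⟩).mp h₂⟩, h₃⟩
  · rintro ⟨⟨hN, z, hz, h₁, h₂⟩, h₃⟩
    exact ⟨hN, z, hz, h₁, (key ⟨hN, Or.inl hz⟩).mpr h₂, h₃⟩

theorem mem_s5 (hD : D.WellFormed n) {e : Edge} :
    e ∈ D.s5 ↔ D.Core 2 e.src e.tgt e.wt ∧ e.neg = true := by
  have key : ∀ {r u}, D.InE r u → ((e.wt : EReal) = (D.wtΓ e.src u : EReal) +
      hopDist D.gam 0 u r + (D.wtΓ r e.tgt : EReal) ↔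
      e.wt = D.wtΓ e.src u + D.d₀ u r + D.wtΓ r e.tgt) := fun {r u} h => by
    rw [← hD.coe_d₀ h, ← EReal.coe_add, ← EReal.coe_add, EReal.coe_eq_coe_iff]
  constructor
  · rintro ⟨r, u, h₁, h₂, h₃, h₄, h₅⟩
    exact ⟨⟨r, u, h₁, h₂, h₃, (key ⟨⟨_, h₁⟩, Or.inl h₂⟩).mp h₄⟩, h₅⟩
  · rintro ⟨⟨r, u, h₁, h₂, h₃, h₄⟩, h₅⟩
    exact ⟨r, u, h₁, h₂, h₃, (key ⟨⟨_, h₁⟩, Or.inl h₂⟩).mpr h₄, h₅⟩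

/-- Membership in `V_r^out` is a bound of `-Δ r` on `d¹`. Hence a positive weight is possible only
on the extra edge to `r'`, which limits the locally-negative paths between Steiner edges. -/
theorem w₂_le (hD : D.WellFormed n) {r v : ℕ} (hr : r ∈ D.N) (h : v ∈ D.vOut r) :
    D.w₂ r v ≤ 0 := by
  have := hD.coe_d₁ ⟨hr, Or.inl h⟩
  obtain ⟨-, h⟩ := h
  rw [← this] at h
  unfold w₂
  split_ifs at h
  · have h : D.d₁ r v < -D.Δ r := by exact_mod_cast h
    linarith
  · have h : D.d₁ r v ≤ -D.Δ r := by exact_mod_cast h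
    linarith

theorem w₃_le (hD : D.WellFormed n) {r u : ℕ} (hr : r ∈ D.N) (h : u ∈ D.vIn r) :
    D.w₃ r u ≤ 0 := by
  have := hD.coe_d₀ ⟨hr, Or.inl h⟩
  obtain ⟨-, h⟩ := h
  rw [← this] at h
  unfold w₃
  split_ifs at h
  · have h : D.d₀ u r ≤ D.Δ r := by exact_mod_cast h
    linarith
  · have h : D.d₀ u r < D.Δ r := by exact_mod_cast h
    linarith

end Data

end Shortcut

namespace Shortcut

open RealRAM

namespace Data

variable {D : Data} {n : ℕ}

/-! ## The invariant on edge weights -/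

/-- The weights of the edges of `G'` respect the base points `π` and the shifts `σ`. -/
structure Sound (D : Data) (E : Set Edge) (π : ℕ → ℕ) (σ : ℕ → ℝ) : Prop where
  base : ∀ x < D.G.m, π x = D.G.base x
  shift : ∀ x < D.G.m, σ x = D.shiftΓ x
  core : ∀ k v w x, D.Core k v w x → Reach E π σ v w x
  out : ∀ r v, D.OutE r v → Reach E π σ (D.G.m + r) v (D.w₂ r v)
  inn : ∀ r u, D.InE r u → Reach E π σ u (D.G.m + r) (D.w₃ r u)

theorem WellFormed.reach_gam (hD : D.WellFormed n) {e : Edge} (he : e ∈ D.gam) :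
    Reach D.gam D.G.base D.shiftΓ e.src e.tgt e.wt := by
  obtain ⟨h₁, h₂, -⟩ := mem_gam.mp he
  have := hD.graph.wt_ge _ _ h₁
  have h : dist D.G.edges (D.G.base e.src) (D.G.base e.tgt) ≤
      ((D.G.wt e.src e.tgt - (D.G.shift e.tgt - D.G.shift e.src) : ℝ) : EReal) := by
    rw [EReal.coe_sub]
    exact EReal.le_sub_iff_add_le (Or.inl (EReal.coe_ne_bot _)) (Or.inl (EReal.coe_ne_top _)) |>.mpr
      this
  have := dist_reweight_le (φ := D.φ) h
  unfold Reach
  refine this.trans (le_of_eq ?_)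
  rw [h₂]
  unfold wtΓ shiftΓ
  congr 1
  ring

theorem WellFormed.base_of_isBase (hD : D.WellFormed n) {v : ℕ} (h : D.G.IsBase v) :
    D.G.base v = v ∧ D.shiftΓ v = 0 := by
  refine ⟨h.2, ?_⟩
  unfold shiftΓ
  rw [hD.graph.shift_base v h, h.2]
  ring

theorem WellFormed.base_of_mem (hD : D.WellFormed n) {r : ℕ} (h : r ∈ D.N) :
    D.G.base r = r ∧ D.shiftΓ r = 0 := by
  obtain ⟨r', hr⟩ := h
  exact hD.base_of_isBase (hD.graph.neg_base _ _ hr).1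

theorem WellFormed.reach_core (hD : D.WellFormed n) {k v w : ℕ} {x : ℝ} (h : D.Core k v w x) :
    Reach D.gam D.G.base D.shiftΓ v w x := by
  have edge : ∀ {u v}, D.G.adj u v = true → Reach D.gam D.G.base D.shiftΓ u v (D.wtΓ u v) := by
    classical
    intro u v huv
    exact hD.reach_gam (e := ⟨u, v, D.wtΓ u v, decide (D.G.IsNegEdge u v)⟩)
      (mem_gam.mpr ⟨huv, rfl, by simp⟩)
  unfold Core at h
  split_ifs at h
  · rw [h.2]; exact edge h.1
  · obtain ⟨hN, z, hz, hzw, rfl⟩ := h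
    exact (Reach.of_hopDist (fun e he => hD.reach_gam he) (hD.coe_d₁ ⟨hN, Or.inl hz⟩)).trans
      (edge hzw.1)
  · obtain ⟨r, u', hr, hu, hvu, rfl⟩ := h
    exact ((edge hvu.1).trans (Reach.of_hopDist (fun e he => hD.reach_gam he)
      (hD.coe_d₀ ⟨⟨_, hr⟩, Or.inl hu⟩))).trans (edge hr.1)

/-- The Steiner vertex of `r` can be regarded as a copy of `r` with the shift `-Δ r`. -/
theorem WellFormed.sound_gam (hD : D.WellFormed n) {π : ℕ → ℕ} {σ : ℕ → ℝ}
    (h₁ : ∀ x < D.G.m, π x = D.G.base x) (h₂ : ∀ x < D.G.m, σ x = D.shiftΓ x)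
    (h₃ : ∀ r < D.G.m, π (D.G.m + r) = r) (h₄ : ∀ r < D.G.m, σ (D.G.m + r) = -D.Δ r) :
    D.Sound D.gam π σ := by
  refine ⟨h₁, h₂, fun k v w x h => ?_, fun r v h => ?_, fun r u h => ?_⟩
  · obtain ⟨hv, hw⟩ := h.lt hD
    exact (hD.reach_core h).congr (h₁ _ hv) (h₁ _ hw) (h₂ _ hv) (h₂ _ hw)
  · obtain ⟨hr, hv⟩ := h.lt hD
    obtain ⟨b₁, b₂⟩ := hD.base_of_mem h.1
    have := Reach.of_hopDist (fun e he => hD.reach_gam he) (hD.coe_d₁ h)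
    unfold Reach at this ⊢
    rw [h₁ v hv, h₂ v hv, h₃ r hr, h₄ r hr]
    rw [b₁, b₂] at this
    refine this.trans (le_of_eq ?_)
    unfold w₂
    congr 1
    ring
  · obtain ⟨hr, hu⟩ := h.lt hD
    obtain ⟨b₁, b₂⟩ := hD.base_of_mem h.1
    have := Reach.of_hopDist (fun e he => hD.reach_gam he) (hD.coe_d₀ h)
    unfold Reach at this ⊢
    rw [h₁ u hu, h₂ u hu, h₃ r hr, h₄ r hr]
    rw [b₁, b₂] at this
    refine this.trans (le_of_eq ?_)
    unfold w₃
    congr 1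
    ring

theorem gam_subset_aux : D.gam ⊆ D.aux := fun _ h => Or.inl (Or.inl (Or.inl (Or.inl h)))

theorem WellFormed.dist_aux_out (hD : D.WellFormed n) {r v : ℕ} (h : D.OutE r v) :
    dist D.aux (D.G.m + r) v ≤ ((D.w₂ r v : ℝ) : EReal) := by
  classical
  have he : (⟨D.G.m + r, v, D.w₂ r v, decide (D.w₂ r v < 0)⟩ : Edge) ∈ D.aux :=
    Or.inl (Or.inl (Or.inl (Or.inr ((mem_s2 hD).mpr ⟨r, rfl, h, rfl, by simp⟩))))
  refine (dist_le (IsWalk.single he)).trans ?_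
  simp

theorem WellFormed.dist_aux_inn (hD : D.WellFormed n) {r u : ℕ} (h : D.InE r u) :
    dist D.aux u (D.G.m + r) ≤ ((D.w₃ r u : ℝ) : EReal) := by
  classical
  have he : (⟨u, D.G.m + r, D.w₃ r u, decide (D.w₃ r u < 0)⟩ : Edge) ∈ D.aux :=
    Or.inl (Or.inl (Or.inr ((mem_s3 hD).mpr ⟨r, rfl, h, rfl, by simp⟩)))
  refine (dist_le (IsWalk.single he)).trans ?_
  simp

/-- Here `r̃` is its own base point, so an edge between `r̃` and a proper copy must be compared with
a walk of `G'` to the base vertex. The extra edges `(r̃, r')` and `(r, r̃)` supply its first or last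
edge, and the invariant of `Γ` the rest. -/
theorem WellFormed.sound_aux (hD : D.WellFormed n) {π : ℕ → ℕ} {σ : ℕ → ℝ}
    (h₁ : ∀ x < D.G.m, π x = D.G.base x) (h₂ : ∀ x < D.G.m, σ x = D.shiftΓ x)
    (h₃ : ∀ r < D.G.m, π (D.G.m + r) = D.G.m + r) (h₄ : ∀ r < D.G.m, σ (D.G.m + r) = 0) :
    D.Sound D.aux π σ := by
  refine ⟨h₁, h₂, fun k v w x h => ?_, fun r v h => ?_, fun r u h => ?_⟩
  · obtain ⟨hv, hw⟩ := h.lt hD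
    exact ((hD.reach_core h).mono_edges gam_subset_aux).congr (h₁ _ hv) (h₁ _ hw) (h₂ _ hv)
      (h₂ _ hw)
  · obtain ⟨hr, hv⟩ := h.lt hD
    obtain ⟨r', hr'⟩ := h.1
    have hb := hD.graph.neg_base _ _ hr'
    unfold Reach
    rw [h₁ v hv, h₂ v hv, h₃ r hr, h₄ r hr]
    -- For `v = r` the walk of one hop may be empty, but then `v` is a base vertex and the edge
    -- `(r̃, r)` itself is the required walk.
    by_cases hvr : v = r
    · rw [hvr] at h ⊢
      obtain ⟨b₁, b₂⟩ := hD.base_of_isBase hb.1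
      rw [b₁, b₂, add_zero, sub_zero]
      exact hD.dist_aux_out h
    · rw [show D.w₂ r v + 0 - D.shiftΓ v = D.d₁ r v + (D.Δ r - D.shiftΓ v) by unfold w₂; ring]
      refine le_of_hopDist (hD.coe_d₁ h) fun p hp hh => ?_
      -- A nonempty walk leaves `r` by the negative edge `(r, r')`, its only out-edge; the detour
      -- through `r̃` replaces this first edge.
      rcases hD.walk_cases hr' hp hh with ⟨-, h'⟩ | ⟨q, hq, -, hw⟩
      · exact absurd h' hvr
      · obtain ⟨b₁, b₂⟩ := hD.base_of_isBase hb.2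
        have hO : D.OutE r r' := ⟨⟨r', hr'⟩, Or.inr hr'⟩
        have d1 : D.d₁ r r' ≤ D.wtΓ r r' := by
          have he : (⟨r, r', D.wtΓ r r', true⟩ : Edge) ∈ D.gam :=
            mem_gam.mpr ⟨hr'.1, rfl, by simpa using hr'⟩
          have := hopDist_le (h := 1) (IsWalk.single he) (by simp [hops])
          rw [← hD.coe_d₁ hO] at this
          simpa using this
        have d2 := (Reach.of_walk (fun e he => hD.reach_gam he) hq).mono_edges
          (gam_subset_aux (D := D))
        unfold Reach at d2
        rw [b₁, b₂] at d2
        refine (dist_trans (hD.dist_aux_out hO) d2).trans ?_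
        rw [hw]
        have : D.w₂ r r' + (weight q + 0 - D.shiftΓ v) ≤
          D.wtΓ r r' + weight q + (D.Δ r - D.shiftΓ v) := by unfold w₂; linarith
        exact_mod_cast this
  · obtain ⟨hr, hu⟩ := h.lt hD
    obtain ⟨b₁, b₂⟩ := hD.base_of_mem h.1
    unfold Reach
    rw [h₁ u hu, h₂ u hu, h₃ r hr, h₄ r hr]
    have hE : D.InE r r := ⟨h.1, Or.inr rfl⟩
    have d1 : D.d₀ r r ≤ 0 := by
      have := hopDist_le (E := D.gam) (h := 0) (s := r) (t := r) (p := []) rfl (by simp)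
      rw [← hD.coe_d₀ hE] at this
      simpa using this
    have d2 := (Reach.of_hopDist (fun e he => hD.reach_gam he) (hD.coe_d₀ h)).mono_edges
      (gam_subset_aux (D := D))
    unfold Reach at d2
    rw [b₁, b₂] at d2
    refine (dist_trans d2 (hD.dist_aux_inn hE)).trans ?_
    have : D.d₀ u r + D.shiftΓ u - 0 + D.w₃ r r ≤ D.w₃ r u + D.shiftΓ u - 0 := by
      unfold w₃; linarith
    exact_mod_cast this

theorem Sound.plain {E : Set Edge} {π : ℕ → ℕ} {σ : ℕ → ℝ} (h : D.Sound E π σ) {i j : ℕ} {e : Edge}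
    (he : D.Plain i j e) : Reach E π σ e.src e.tgt e.wt := by
  cases he with
  | graph ha b hb => exact h.core 0 i j _ ⟨ha, rfl⟩
  | core₁ x hx => exact h.core _ _ _ _ hx
  | core₂ x hx => exact h.core _ _ _ _ hx
  | out ho h₀ => exact h.out _ _ ho
  | inn ho h₀ => exact h.inn _ _ ho
  | mid₁ hi r' hr h₀ => exact (h.inn _ _ hi).trans (h.out _ _ ⟨⟨r', hr⟩, Or.inr hr⟩)
  | mid₂ ho h₀ => exact (h.inn _ _ ⟨ho.1, Or.inr rfl⟩).trans (h.out _ _ ho)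
  | two₁ ho hj h₀ => exact (h.out _ _ ho).trans (h.inn _ _ ⟨hj, Or.inr rfl⟩)
  | two₂ r' hr hi h₀ => exact (h.out _ _ ⟨⟨r', hr⟩, Or.inr hr⟩).trans (h.inn _ _ hi)

/-- The vertex of an index with `Rgt` that belongs to the group `g` is a copy of `g % m`. -/
theorem Rgt.base (hD : D.WellFormed n) {j w : ℕ} {y : ℝ} (h : D.Rgt j w y) (hj : j < 6 * D.G.m) :
    D.G.base (j % D.G.m) = D.grpOf j % D.G.m ∧ D.G.IsBase (D.grpOf j % D.G.m) := by
  have hv := Nat.mod_lt j (show 0 < D.G.m by omega)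
  have hb := hD.graph.base_isBase _ hv
  have hdm := Nat.div_add_mod j D.G.m
  -- Shortcuts start and end at ends of negative edges, which are base vertices.
  have tail : ∀ k v w x, k ≠ 0 → D.Core k v w x → D.G.IsBase v ∧ D.G.IsBase w := by
    intro k v w x hk h
    unfold Core at h
    rw [if_neg hk] at h
    split_ifs at h
    · obtain ⟨⟨r', hr⟩, z, -, hz, -⟩ := h
      exact ⟨(hD.graph.neg_base _ _ hr).1, (hD.graph.neg_base _ _ hz).2⟩
    · obtain ⟨r, u', hr, -, hu, -⟩ := h
      exact ⟨(hD.graph.neg_base _ _ hu).1, (hD.graph.neg_base _ _ hr).2⟩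
  have div0 : D.G.m ≤ j → 1 ≤ j / D.G.m := fun h => (Nat.one_le_div_iff (by omega)).mpr h
  have div4 : 4 * D.G.m ≤ j → 4 ≤ j / D.G.m := fun h => (Nat.le_div_iff_mul_le (by omega)).mpr h
  unfold grpOf
  split_ifs with h₁ h₂ h₃
  · rw [Nat.mod_eq_of_lt h₁] at hb ⊢
    rw [Nat.mod_eq_of_lt hb.1]
    exact ⟨rfl, hb⟩
  · rw [Rgt, if_pos h₂] at h
    obtain ⟨x, hx, -⟩ := h
    have := (tail _ _ _ _ (by have := div0 (by omega); omega) hx).1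
    exact ⟨this.2, this⟩
  · have e : (3 * D.G.m + D.G.base (j % D.G.m)) % D.G.m = D.G.base (j % D.G.m) := by
      rw [Nat.mul_add_mod', Nat.mod_eq_of_lt hb.1]
    rw [e]
    exact ⟨rfl, hb⟩
  · rw [Rgt, if_neg h₂] at h
    obtain ⟨x, hx, -⟩ := h
    have := (tail _ _ _ _ (by have := div4 (by omega); omega) hx).2
    exact ⟨this.2, this⟩

/-- No group mixes forward and backward indices, so the sign in the shift of a new copy can be read
off the number of its group. -/
theorem grpOf_lt_iff (hG : D.G.WellFormed) {j : ℕ} (hj : j < 6 * D.G.m) :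
    D.grpOf j < 3 * D.G.m ↔ j < 3 * D.G.m := by
  have hv := Nat.mod_lt j (show 0 < D.G.m by omega)
  have h₁ := (hG.base_isBase _ hv).1
  unfold grpOf
  split_ifs with h
  · have := (hG.base_isBase _ h).1
    omega
  all_goals omega

/-- The indices of one group belong to copies of the same vertex; outside of the first and the
fourth block of indices, groups are singletons. -/
theorem grpOf_eq (hG : D.G.WellFormed) {j j' : ℕ}
    (hj' : j' < 6 * D.G.m)
    (h : D.grpOf j' = D.grpOf j) : j' = j ∨ (j' / D.G.m = j / D.G.m ∧
      (j / D.G.m = 0 ∨ j / D.G.m = 3) ∧ D.G.base (j' % D.G.m) = D.G.base (j % D.G.m)) := by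
  have hv := Nat.mod_lt j (show 0 < D.G.m by omega)
  have hv' := Nat.mod_lt j' (show 0 < D.G.m by omega)
  have b₁ := (hG.base_isBase _ hv).1
  have b₂ := (hG.base_isBase _ hv').1
  have d0 : ∀ i, i < D.G.m → i / D.G.m = 0 := fun i h => Nat.div_eq_of_lt h
  have d3 : ∀ i, 3 * D.G.m ≤ i → i < 4 * D.G.m → i / D.G.m = 3 := fun i h h' =>
    Nat.div_eq_of_lt_le h (by omega)
  have c₁ : j < D.G.m → D.G.base j < D.G.m := fun h => (hG.base_isBase _ h).1
  have c₂ : j' < D.G.m → D.G.base j' < D.G.m := fun h => (hG.base_isBase _ h).1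
  unfold grpOf at h
  split_ifs at h with h₁ h₂ h₃ h₄ h₅ h₆ h₇ h₈ h₉ h₁₀ h₁₁ h₁₂
  · right
    rw [Nat.mod_eq_of_lt h₁, Nat.mod_eq_of_lt h₂, d0 _ h₁, d0 _ h₂]
    exact ⟨rfl, Or.inl rfl, h⟩
  all_goals first
    | exact Or.inl h
    | omega
    | (right
       rw [d3 j (by omega) (by omega), d3 j' (by omega) (by omega)]
       exact ⟨rfl, Or.inr rfl, by omega⟩)

end Data

end Shortcut

namespace Shortcut

open RealRAM

namespace Data

variable {D : Data} {n : ℕ}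

theorem Rgt.unique (hG : D.G.WellFormed) {j w : ℕ} {x y : ℝ} (hx : D.Rgt j w x)
    (hy : D.Rgt j w y) : x = y := by
  unfold Rgt at hx hy
  split_ifs at hx hy
  all_goals
    obtain ⟨x, hx, rfl⟩ := hx
    obtain ⟨y, hy, rfl⟩ := hy
    rw [hx.unique hG hy]

end Data

theorem Reach.of_eq {E : Set Edge} {π : ℕ → ℕ} {σ : ℕ → ℝ} {x y : ℕ} {w w' : ℝ}
    (h : Reach E π σ x y w) (hw : w = w') : Reach E π σ x y w' := hw ▸ h

namespace Alg

/-! ## Properties of the output -/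

variable {D : Data} {n : ℕ} {s : Mem}

theorem Tabulated.rgt (h : Tabulated D s) {j w : ℕ} (hj : j < 6 * D.G.m) (hw : w < D.G.m)
    (hp : 0 < s.narr 37 j w) : D.Rgt j w (s.rarr 37 j w) := (h.right j hj w hw).val hp

theorem Tabulated.lft (h : Tabulated D s) {i j : ℕ} (hi : i < D.G.m) (hj : j < 6 * D.G.m)
    (hp : 0 < s.narr 27 i j) : D.Lft i j ∧ s.rarr 27 i j = D.lftX i j :=
  (h.left i hi j hj).val hp

/-- Every entry of the sorted list of a group comes from a member of the group. -/
theorem Tabulated.member (h : Tabulated D s) {g w : ℕ} (hw : w < D.G.m) (hp : 0 < s.narr 30 g w) :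
    ∃ j < 6 * D.G.m, D.grpOf j = g ∧ D.Rgt j w (s.rarr 30 g w) := by
  obtain ⟨j, hj, h₁, h₂, h₃⟩ := (h.key g w hw).exists_eq hp
  refine ⟨j, hj, by rw [← h.grp j hj, h₁], ?_⟩
  rw [h₃]
  exact h.rgt hj hw h₂

theorem Tabulated.nonempty (h : Tabulated D s) {g p : ℕ} (hg : g < 6 * D.G.m)
    (hp : p < s.narr 34 g 0) : ∃ j < 6 * D.G.m, D.grpOf j = g ∧ ∃ w y, D.Rgt j w y := by
  obtain ⟨h₁, h₂⟩ := (h.sorted g hg).mem p hp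
  obtain ⟨j, hj, hjg, hR⟩ := h.member h₁ h₂
  exact ⟨j, hj, hjg, _, _, hR⟩

/-- A singleton group may belong to a proper copy, but then it has no targets: a group with a
nonempty list contains an index with an edge, and `Rgt.base` applies to it. -/
theorem Tabulated.isBase (hD : D.WellFormed n) (h : Tabulated D s) {g p : ℕ} (hg : g < 6 * D.G.m)
    (hp : p < s.narr 34 g 0) : D.G.IsBase (g % D.G.m) := by
  obtain ⟨j, hj, rfl, w, y, hR⟩ := h.nonempty hg hp
  exact (hR.base hD hj).2

theorem Tabulated.base (hD : D.WellFormed n) (h : Tabulated D s) {j p : ℕ} (hj : j < 6 * D.G.m)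
    (hp : p < s.narr 34 (D.grpOf j) 0) : D.G.base (j % D.G.m) = D.grpOf j % D.G.m := by
  obtain ⟨j', hj', hg, w, y, hR⟩ := h.nonempty (Data.grpOf_lt hD.graph hj) hp
  rw [← hg, ← (hR.base hD hj').1]
  rcases Data.grpOf_eq hD.graph hj' hg with rfl | ⟨-, -, hb⟩
  exacts [rfl, hb.symm]

/-- The number of the new copy for a group and a block. -/
theorem Tabulated.copy (h : Tabulated D s) {g l : ℕ} (hg : g < 6 * D.G.m) (hl : l < D.G.m.size)
    (hp : s.narr 35 l 0 < s.narr 34 g 0) : s.narr 36 g l < s.nvar 0 ∧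
      s.narr 10 (s.narr 36 g l) 0 = g % D.G.m ∧
      s.rarr 10 (s.narr 36 g l) 0 = if g < 3 * D.G.m then thrv s g l else 0 - thrv s g l := by
  obtain ⟨h₁, h₂, h₃⟩ := h.copies.copy g l ⟨hg, hl⟩ hp
  exact ⟨h₁, h₂.trans (h.vtx g hg), h₃⟩

/-- A new copy has the base point of every member of its group, so `Reach.of_base` prices the moves
between them in both directions; the sign of the threshold depends on the half of the indices. -/
theorem reach_copy {E : Set Edge} {π : ℕ → ℕ} {σ : ℕ → ℝ} (hD : D.WellFormed n)
    (h : Tabulated D s) (hS : D.Sound E π σ)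
    (hc : ∀ i < s.nvar 0, π (2 * D.G.m + i) = s.narr 10 i 0 ∧ σ (2 * D.G.m + i) = s.rarr 10 i 0)
    {j l : ℕ} (hj : j < 6 * D.G.m) (hl : l < D.G.m.size)
    (hp : s.narr 35 l 0 < s.narr 34 (D.grpOf j) 0) :
    (j < 3 * D.G.m → Reach E π σ (2 * D.G.m + s.narr 36 (D.grpOf j) l) (j % D.G.m)
        (D.shiftΓ (j % D.G.m) - thrv s (D.grpOf j) l) ∧
      Reach E π σ (j % D.G.m) (2 * D.G.m + s.narr 36 (D.grpOf j) l)
        (thrv s (D.grpOf j) l - D.shiftΓ (j % D.G.m))) ∧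
    (¬ j < 3 * D.G.m → Reach E π σ (2 * D.G.m + s.narr 36 (D.grpOf j) l) (j % D.G.m)
        (D.shiftΓ (j % D.G.m) + thrv s (D.grpOf j) l) ∧
      Reach E π σ (j % D.G.m) (2 * D.G.m + s.narr 36 (D.grpOf j) l)
        (- thrv s (D.grpOf j) l - D.shiftΓ (j % D.G.m))) := by
  have hg := Data.grpOf_lt hD.graph hj
  have hv : j % D.G.m < D.G.m := Nat.mod_lt _ (by omega)
  obtain ⟨c₁, c₂, c₃⟩ := h.copy hg hl hp
  obtain ⟨p₁, p₂⟩ := hc _ c₁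
  have hb : π (2 * D.G.m + s.narr 36 (D.grpOf j) l) = π (j % D.G.m) := by
    rw [p₁, c₂, hS.base _ hv, h.base hD hj hp]
  rw [c₃] at p₂
  refine ⟨fun hj3 => ?_, fun hj3 => ?_⟩
  · rw [if_pos ((Data.grpOf_lt_iff hD.graph hj).mpr hj3)] at p₂
    exact ⟨.of_base hb (by rw [p₂, hS.shift _ hv]), .of_base hb.symm (by rw [p₂, hS.shift _ hv])⟩
  · rw [if_neg (mt (Data.grpOf_lt_iff hD.graph hj).mp hj3)] at p₂
    exact ⟨.of_base hb (by rw [p₂, hS.shift _ hv]; ring),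
      .of_base hb.symm (by rw [p₂, hS.shift _ hv]; ring)⟩

/-- Such an edge is the move from the new copy to a member `v` of the group, followed by an edge
from `v` to `w`, or the reverse of this. -/
theorem reach_right {E : Set Edge} {π : ℕ → ℕ} {σ : ℕ → ℝ} (hD : D.WellFormed n)
    (h : Tabulated D s) (hS : D.Sound E π σ)
    (hc : ∀ i < s.nvar 0, π (2 * D.G.m + i) = s.narr 10 i 0 ∧ σ (2 * D.G.m + i) = s.rarr 10 i 0)
    {o : Bool} {j w l : ℕ} {e : Edge} (hj : j < 6 * D.G.m) (hw : w < D.G.m)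
    (hl : l < D.G.m.size) (he : RightEdge s D.G.m o j w l e) : Reach E π σ e.src e.tgt e.wt := by
  obtain ⟨h₁, h₂, h₃, h₄, rfl⟩ := he
  rw [h.grp j hj] at h₃ h₄ ⊢
  have hR := h.rgt hj hw h₁
  obtain ⟨k₁, k₂⟩ := reach_copy hD h hS hc hj hl h₃
  unfold Data.Rgt at hR
  cases o
  · have hj3 : ¬ j < 3 * D.G.m := by simpa using h₂
    rw [if_neg hj3] at hR
    obtain ⟨x, hx, hy⟩ := hR
    exact ((hS.core _ _ _ _ hx).trans (k₂ hj3).2).of_eq (by simp [dirEdge, hy]; ring)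
  · have hj3 : j < 3 * D.G.m := by simpa using h₂
    rw [if_pos hj3] at hR
    obtain ⟨x, hx, hy⟩ := hR
    exact ((k₁ hj3).1.trans (hS.core _ _ _ _ hx)).of_eq (by simp [dirEdge, hy]; ring)

/-- A direct edge is the two-edge path that it shortcuts; an edge to a new copy is the Steiner edge
followed by a move between copies. The backward direction reverses both. -/
theorem reach_left {E : Set Edge} {π : ℕ → ℕ} {σ : ℕ → ℝ} (hD : D.WellFormed n)
    (h : Tabulated D s) (hS : D.Sound E π σ)
    (hc : ∀ i < s.nvar 0, π (2 * D.G.m + i) = s.narr 10 i 0 ∧ σ (2 * D.G.m + i) = s.rarr 10 i 0)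
    {o : Bool} {i j l : ℕ} {e : Edge} (hi : i < D.G.m) (hj : j < 6 * D.G.m)
    (hl : l < D.G.m.size) (he : LeftEdge s D.G.m o i j l e) : Reach E π σ e.src e.tgt e.wt := by
  obtain ⟨h₁, h₂, h₃, h₄⟩ := he
  rw [h.grp j hj] at h₃ h₄
  obtain ⟨hL, hX⟩ := h.lft hi hj h₁
  obtain ⟨k₁, k₂⟩ := reach_copy hD h hS hc hj hl h₃
  unfold Data.lftX at hX
  unfold Data.Lft at hL
  rcases h₄ with ⟨-, k, -, w, hw, h₅, h₆, -, rfl⟩ | ⟨-, rfl⟩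
  · have hwm := ((h.sorted _ (Data.grpOf_lt hD.graph hj)).mem _ h₅).1
    rw [← hw] at hwm
    have hR := h.rgt hj hwm h₆
    unfold Data.Rgt at hR
    cases o
    · have hj3 : ¬ j < 3 * D.G.m := by simpa using h₂
      rw [if_neg hj3] at hR hL hX
      obtain ⟨x, hx, hy⟩ := hR
      exact ((hS.core _ _ _ _ hx).trans (hS.inn _ _ hL.1)).of_eq (by simp [dirEdge, hy, hX])
    · have hj3 : j < 3 * D.G.m := by simpa using h₂
      rw [if_pos hj3] at hR hL hX
      obtain ⟨x, hx, hy⟩ := hR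
      exact ((hS.out _ _ hL.1).trans (hS.core _ _ _ _ hx)).of_eq (by simp [dirEdge, hy, hX]; ring)
  · cases o
    · have hj3 : ¬ j < 3 * D.G.m := by simpa using h₂
      rw [if_neg hj3] at hL hX
      exact ((k₂ hj3).1.trans (hS.inn _ _ hL.1)).of_eq (by simp [dirEdge, hX]; ring)
    · have hj3 : j < 3 * D.G.m := by simpa using h₂
      rw [if_pos hj3] at hL hX
      exact ((hS.out _ _ hL.1).trans (k₁ hj3).2).of_eq (by simp [dirEdge, hX]; ring)

/-- Base points and shifts are left abstract because two choices are needed: one for the distances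
of `Γ` in `dist_output`, the other for the invariant over `G'` in `output_ge`. -/
theorem reach_output {E : Set Edge} {π : ℕ → ℕ} {σ : ℕ → ℝ} (hD : D.WellFormed n)
    (h : Tabulated D s) (hS : D.Sound E π σ)
    (hc : ∀ i < s.nvar 0, π (2 * D.G.m + i) = s.narr 10 i 0 ∧ σ (2 * D.G.m + i) = s.rarr 10 i 0)
    {e : Edge} (he : e ∈ Output D s) : Reach E π σ e.src e.tgt e.wt := by
  rcases he with ⟨i, -, j, -, he⟩ | ⟨o, j, hj, w, hw, l, hl, he⟩ | ⟨o, i, hi, j, hj, l, hl, he⟩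
  · exact hS.plain he
  · exact reach_right hD h hS hc hj hw hl he
  · exact reach_left hD h hS hc hi hj hl he

/-- There is a walk of weight `x` from `a` to `b`, or from `b` to `a`, along non-negative edges. -/
def Short (E : Set Edge) (o : Bool) (a b : ℕ) (x : ℝ) : Prop :=
  ∃ p, (if o = true then IsWalk E a p b else IsWalk E b p a) ∧ weight p = x ∧
    ∀ g ∈ p, g.neg = false ∧ 0 ≤ g.wt

/-- The core of the construction. Let `l` be the block that contains `w`. If its threshold is below
`lftX`, the enumeration has produced a direct edge. Otherwise `lftX ≤ thr ≤ y`, because the list is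
sorted and the key of `w` is at most `y`; the two edges through the copy are non-negative and their
weights `thr - lftX` and `y - thr` add up correctly. -/
theorem short_gadget (hD : D.WellFormed n) (h : Tabulated D s) {i j w : ℕ} {y : ℝ}
    (hi : i < D.G.m) (hj : j < 6 * D.G.m) (hw : w < D.G.m) (hL : D.Lft i j) (hR : D.Rgt j w y)
    (hxy : D.lftX i j ≤ y) {o : Bool} (ho : j < 3 * D.G.m ↔ o = true) :
    Short (Output D s) o (D.G.m + i) w (y - D.lftX i j) := by
  have a₁ : 0 < s.narr 27 i j := (h.left i hi j hj).pos_iff.mpr ⟨_, hL, rfl⟩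
  have a₂ := (h.lft hi hj a₁).2
  have b₁ : 0 < s.narr 37 j w := (h.right j hj w hw).pos_iff.mpr ⟨y, hR⟩
  have b₂ : s.rarr 37 j w = y := (h.rgt hj hw b₁).unique hD.graph hR
  have hg := Data.grpOf_lt hD.graph hj
  obtain ⟨k₁, k₂⟩ := (h.key (D.grpOf j) w hw).le j hj (h.grp j hj) b₁
  have hs := h.sorted _ hg
  obtain ⟨p, hp, hpw⟩ := hs.surj w hw k₁
  -- The block of position `p` is the `l` with `2 ^ l ≤ p + 1 < 2 ^ (l + 1)`, since block `l` starts
  -- at `2 ^ l - 1`.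
  have hl₁ := Nat.pow_log_le_self 2 (show p + 1 ≠ 0 by omega)
  have hl₂ := Nat.lt_pow_succ_log_self (b := 2) (by omega) (p + 1)
  rw [pow_succ] at hl₂
  set l := Nat.log 2 (p + 1)
  have hlen := hs.len_le
  have hl : l < D.G.m.size := Nat.lt_size.mpr (by omega)
  have e35 := h.pow l hl
  have hpos : 1 ≤ 2 ^ l := Nat.one_le_two_pow
  have hne : s.narr 35 l 0 < s.narr 34 (D.grpOf j) 0 := by omega
  rcases lt_or_ge (thrv s (D.grpOf j) l) (D.lftX i j) with ht | ht
  · refine ⟨[dirEdge o (D.G.m + i) w (y - D.lftX i j)], ?_, by cases o <;> simp [dirEdge], ?_⟩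
    · have he : dirEdge o (D.G.m + i) w (y - D.lftX i j) ∈ Output D s := by
        refine Or.inr (Or.inr ⟨o, i, hi, j, hj, l, hl, a₁, ho, ?_, Or.inl ⟨?_, p - (2 ^ l - 1), ?_,
          w, ?_, ?_, b₁, ?_, ?_⟩⟩)
        · rwa [h.grp j hj]
        · rwa [h.grp j hj, a₂]
        · rw [e35]; omega
        · rw [h.grp j hj, e35, show 2 ^ l - 1 + (p - (2 ^ l - 1)) = p by omega, hpw]
        · rw [h.grp j hj, e35]; omega
        · rwa [a₂, b₂]
        · rw [a₂, b₂]
      cases o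
      · simpa [dirEdge] using IsWalk.single he
      · simpa [dirEdge] using IsWalk.single he
    · intro g hgm
      rw [List.mem_singleton] at hgm
      rw [hgm]
      cases o <;> simpa [dirEdge] using hxy
  · have hty : thrv s (D.grpOf j) l ≤ y := by
      rw [← b₂]
      refine LE.le.trans ?_ k₂
      rw [← hpw]
      exact hs.mono _ _ (by omega) hp
    set c := 2 * D.G.m + s.narr 36 (D.grpOf j) l
    have he : dirEdge o (D.G.m + i) c (thrv s (D.grpOf j) l - D.lftX i j) ∈ Output D s := by
      refine Or.inr (Or.inr ⟨o, i, hi, j, hj, l, hl, a₁, ho, ?_, Or.inr ⟨?_, ?_⟩⟩)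
      · rwa [h.grp j hj]
      · rwa [h.grp j hj, a₂]
      · rw [h.grp j hj, a₂]
    have hf : dirEdge o c w (y - thrv s (D.grpOf j) l) ∈ Output D s := by
      refine Or.inr (Or.inl ⟨o, j, hj, w, hw, l, hl, b₁, ho, ?_, ?_, ?_⟩)
      · rwa [h.grp j hj]
      · rwa [h.grp j hj, b₂]
      · rw [h.grp j hj, b₂]
    cases o
    · refine ⟨[_, _], ⟨hf, rfl, he, rfl, rfl⟩, by simp [dirEdge], ?_⟩
      intro g hgm
      simp only [List.mem_cons, List.not_mem_nil, or_false] at hgm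
      rcases hgm with rfl | rfl
      · simpa [dirEdge] using hty
      · simpa [dirEdge] using ht
    · refine ⟨[_, _], ⟨he, rfl, hf, rfl, rfl⟩, by simp [dirEdge], ?_⟩
      intro g hgm
      simp only [List.mem_cons, List.not_mem_nil, or_false] at hgm
      rcases hgm with rfl | rfl
      · simpa [dirEdge] using ht
      · simpa [dirEdge] using hty

/-- The edges of `G'` by their kind. -/
theorem aux_cases (hD : D.WellFormed n) {e : Edge} (he : e ∈ D.aux) :
    (∃ k < 3, D.Core k e.src e.tgt e.wt) ∨
    (∃ r, e.src = D.G.m + r ∧ D.OutE r e.tgt ∧ e.wt = D.w₂ r e.tgt ∧ (e.neg = true ↔ e.wt < 0)) ∨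
    (∃ r, e.tgt = D.G.m + r ∧ D.InE r e.src ∧ e.wt = D.w₃ r e.src ∧ (e.neg = true ↔ e.wt < 0)) := by
  rcases he with (((he | he) | he) | he) | he
  · obtain ⟨h₁, h₂, -⟩ := Data.mem_gam.mp he
    exact Or.inl ⟨0, by omega, h₁, h₂⟩
  · exact Or.inr (Or.inl ((Data.mem_s2 hD).mp he))
  · exact Or.inr (Or.inr ((Data.mem_s3 hD).mp he))
  · exact Or.inl ⟨1, by omega, ((Data.mem_s4 hD).mp he).1⟩
  · exact Or.inl ⟨2, by omega, ((Data.mem_s5 hD).mp he).1⟩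

theorem shortcut_single {F : Set Edge} {e f g : Edge} (hg : g ∈ F)
    (h₁ : g.src = e.src) (h₂ : g.tgt = f.tgt) (h₃ : g.wt = e.wt + f.wt) (h₄ : g.neg = false)
    (h₅ : 0 ≤ e.wt + f.wt) : Data.IsShortcutIn F e f := by
  refine ⟨[g], ?_, by simp [h₃], by simpa [h₄, h₃] using h₅⟩
  rw [← h₁, ← h₂]
  exact IsWalk.single hg

/-- Two edges without Steiner ends contain no imaginary edge. One Steiner edge leads to the gadget,
with the index made of the kind of the other edge and the middle vertex. Two Steiner edges with
non-negative total must use one of the extra edges `(r̃, r')`, `(r, r̃)` and have an edge of their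
own. -/
theorem shortcut_output (hD : D.WellFormed n) (h : Tabulated D s) {e f : Edge}
    (hef : D.IsLocallyNegative e f) : Data.IsShortcutIn (Output D s) e f := by
  obtain ⟨he, hf, hv, him, hsum⟩ := hef
  have hmod : ∀ k v, v < D.G.m → (k * D.G.m + v) % D.G.m = v := fun k v h => by
    rw [Nat.mul_add_mod', Nat.mod_eq_of_lt h]
  have hdiv : ∀ k v, v < D.G.m → (k * D.G.m + v) / D.G.m = k := fun k v h => by
    rw [Nat.add_comm, Nat.add_mul_div_right _ _ (by omega), Nat.div_eq_of_lt h, zero_add]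
  rcases aux_cases hD he with ⟨k, hk, hC⟩ | ⟨r, e₁, e₂, e₃, e₄⟩ | ⟨r, e₁, e₂, e₃, e₄⟩
  · have hlt := hC.lt hD
    rcases aux_cases hD hf with ⟨k', -, hC'⟩ | ⟨r, f₁, -⟩ | ⟨r, f₁, f₂, f₃, f₄⟩
    · have hlt' := hC'.lt hD
      rcases him with him | him <;> have := him.2 <;> omega
    · omega
    · have hlt' := f₂.lt hD
      have hneg : f.wt < 0 := by
        rcases him with him | him
        · have := him.2; omega
        · exact him.1
      have hj : (3 + k) * D.G.m + f.src < 6 * D.G.m := by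
        have : (3 + k) * D.G.m ≤ 5 * D.G.m := Nat.mul_le_mul_right _ (by omega)
        omega
      have hj3 : ¬ (3 + k) * D.G.m + f.src < 3 * D.G.m := by
        have : 3 * D.G.m ≤ (3 + k) * D.G.m := Nat.mul_le_mul_right _ (by omega)
        omega
      have hL : D.Lft r ((3 + k) * D.G.m + f.src) := by
        rw [Data.Lft, if_neg hj3, hmod _ _ hlt'.2]
        exact ⟨f₂, f₃ ▸ hneg⟩
      have hX : D.lftX r ((3 + k) * D.G.m + f.src) = 0 - f.wt - D.shiftΓ f.src := by
        rw [Data.lftX, if_neg hj3, hmod _ _ hlt'.2, f₃]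
      have hR : D.Rgt ((3 + k) * D.G.m + f.src) e.src (e.wt - D.shiftΓ f.src) := by
        rw [Data.Rgt, if_neg hj3, hmod _ _ hlt'.2, hdiv _ _ hlt'.2, Nat.add_sub_cancel_left]
        exact ⟨e.wt, hv ▸ hC, rfl⟩
      obtain ⟨p, hp, hp', hpn⟩ := short_gadget hD h hlt'.1 hj hlt.1 hL hR (by rw [hX]; linarith)
        (o := false) (by simpa using hj3)
      refine ⟨p, ?_, by rw [hp', hX]; ring, hpn⟩
      rw [f₁]
      simpa using hp
  · have hlt := e₂.lt hD
    rcases aux_cases hD hf with ⟨k, hk, hC⟩ | ⟨r', f₁, -⟩ | ⟨q, f₁, f₂, f₃, f₄⟩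
    · have hlt' := hC.lt hD
      have hneg : e.wt < 0 := by
        rcases him with him | him
        · exact him.1
        · have := him.2; omega
      have hj3 : k * D.G.m + f.src < 3 * D.G.m := by
        have : k * D.G.m ≤ 2 * D.G.m := Nat.mul_le_mul_right _ (by omega)
        omega
      have hL : D.Lft r (k * D.G.m + f.src) := by
        rw [Data.Lft, if_pos hj3, hmod _ _ hlt'.1, ← hv]
        exact ⟨e₂, e₃ ▸ hneg⟩
      have hX : D.lftX r (k * D.G.m + f.src) = D.shiftΓ f.src - e.wt := by
        rw [Data.lftX, if_pos hj3, hmod _ _ hlt'.1, e₃, hv]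
      have hR : D.Rgt (k * D.G.m + f.src) f.tgt (f.wt + D.shiftΓ f.src) := by
        rw [Data.Rgt, if_pos hj3, hmod _ _ hlt'.1, hdiv _ _ hlt'.1]
        exact ⟨f.wt, hC, rfl⟩
      obtain ⟨p, hp, hp', hpn⟩ := short_gadget hD h hlt.1 (by omega) hlt'.2 hL hR
        (by rw [hX]; linarith) (o := true) (by simpa using hj3)
      refine ⟨p, ?_, by rw [hp', hX]; ring, hpn⟩
      rw [e₁]
      simpa using hp
    · omega
    · have hlt' := f₂.lt hD
      rw [← hv] at f₂ f₃ hlt'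
      have h₀ : 0 ≤ D.w₂ r e.tgt + D.w₃ q e.tgt := by rw [← e₃, ← f₃]; exact hsum
      rcases e₂.2 with hout | hr
      · rcases f₂.2 with hin | hq
        -- Both weights are at most zero and one of them is negative, against the non-negative
        -- total.
        · have := Data.w₂_le hD e₂.1 hout
          have := Data.w₃_le hD f₂.1 hin
          rcases him with him | him <;> have := him.1 <;> linarith
        · have hpl : D.Plain r e.tgt ⟨D.G.m + r, D.G.m + e.tgt, D.w₂ r e.tgt + D.w₃ e.tgt e.tgt,
              false⟩ := .two₁ e₂ (hq ▸ f₂.1) (by rw [← hq] at h₀; exact h₀)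
          exact shortcut_single (Or.inl ⟨r, hlt.1, e.tgt, hlt.2, hpl⟩) e₁.symm
            (by rw [f₁, ← hq]) (by rw [e₃, f₃, ← hq]) rfl hsum
      · have hpl : D.Plain r q ⟨D.G.m + r, D.G.m + q, D.w₂ r e.tgt + D.w₃ q e.tgt, false⟩ :=
          .two₂ _ hr f₂ h₀
        exact shortcut_single (Or.inl ⟨r, hlt.1, q, hlt'.1, hpl⟩) e₁.symm f₁.symm
          (by rw [e₃, f₃]) rfl hsum
  · have hlt := e₂.lt hD
    rcases aux_cases hD hf with ⟨k, -, hC⟩ | ⟨q, f₁, f₂, f₃, f₄⟩ | ⟨q, -, f₂, -⟩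
    · have := hC.lt hD
      omega
    · obtain rfl : q = r := by omega
      have hlt' := f₂.lt hD
      have h₀ : 0 ≤ D.w₃ q e.src + D.w₂ q f.tgt := by rw [← e₃, ← f₃]; exact hsum
      rcases f₂.2 with hout | hr
      · rcases e₂.2 with hin | hq
        · have := Data.w₂_le hD f₂.1 hout
          have := Data.w₃_le hD e₂.1 hin
          rcases him with him | him <;> have := him.1 <;> linarith
        · have hpl : D.Plain q f.tgt ⟨q, f.tgt, D.w₃ q q + D.w₂ q f.tgt, false⟩ :=
            .mid₂ f₂ (by rw [hq] at h₀; exact h₀)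
          exact shortcut_single (Or.inl ⟨q, hlt.1, f.tgt, hlt'.2, hpl⟩) hq.symm rfl
            (by rw [e₃, f₃, hq]) rfl hsum
      · have hpl : D.Plain q e.src ⟨e.src, f.tgt, D.w₃ q e.src + D.w₂ q f.tgt, false⟩ :=
          .mid₁ e₂ _ hr h₀
        exact shortcut_single (Or.inl ⟨q, hlt.1, e.src, hlt.2, hpl⟩) rfl rfl
          (by rw [e₃, f₃]) rfl hsum
    · have := f₂.lt hD
      omega

end Alg

end Shortcut

/-! ### The requirements on the output. -/

namespace Shortcut

open RealRAM

namespace Alg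

variable {D : Data} {n : ℕ} {s : Mem}

theorem isOutVertex_steiner {r : ℕ} (h : r ∈ D.N) : D.IsOutVertex s (D.G.m + r) :=
  Or.inr (Or.inl ⟨r, h, rfl⟩)

theorem isOutVertex_copy {i : ℕ} (h : i < s.nvar 0) : D.IsOutVertex s (2 * D.G.m + i) :=
  Or.inr (Or.inr ⟨by omega, by omega⟩)

theorem plain_isOutVertex (hD : D.WellFormed n) {i j : ℕ} {e : Edge} (hi : i < D.G.m)
    (hj : j < D.G.m) (he : D.Plain i j e) : D.IsOutVertex s e.src ∧ D.IsOutVertex s e.tgt := by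
  have ii : D.IsOutVertex s i := Or.inl hi
  have jj : D.IsOutVertex s j := Or.inl hj
  cases he with
  | graph ha b hb => exact ⟨ii, jj⟩
  | core₁ x hx => exact ⟨ii, jj⟩
  | core₂ x hx => exact ⟨ii, jj⟩
  | out ho h₀ => exact ⟨isOutVertex_steiner ho.1, jj⟩
  | inn ho h₀ => exact ⟨jj, isOutVertex_steiner ho.1⟩
  | mid₁ hi r' hr h₀ => exact ⟨jj, Or.inl (hD.graph.neg_lt hr).2⟩
  | mid₂ ho h₀ => exact ⟨ii, jj⟩
  | two₁ ho hj h₀ => exact ⟨isOutVertex_steiner ho.1, isOutVertex_steiner hj⟩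
  | two₂ r' hr hi h₀ => exact ⟨isOutVertex_steiner ⟨r', hr⟩, isOutVertex_steiner hi.1⟩

theorem dirEdge_isOutVertex {o : Bool} {a b : ℕ} {x : ℝ} (ha : D.IsOutVertex s a)
    (hb : D.IsOutVertex s b) :
    D.IsOutVertex s (dirEdge o a b x).src ∧ D.IsOutVertex s (dirEdge o a b x).tgt := by
  cases o
  exacts [⟨hb, ha⟩, ⟨ha, hb⟩]

theorem output_isOutVertex (hD : D.WellFormed n) (h : Tabulated D s) {e : Edge}
    (he : e ∈ Output D s) : D.IsOutVertex s e.src ∧ D.IsOutVertex s e.tgt := by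
  rcases he with ⟨i, hi, j, hj, he⟩ | ⟨o, j, hj, w, hw, l, hl, h₁, h₂, h₃, h₄, rfl⟩ |
    ⟨o, i, hi, j, hj, l, hl, h₁, h₂, h₃, ⟨-, k, -, w, hw, h₅, -, -, rfl⟩ | ⟨-, rfl⟩⟩
  · exact plain_isOutVertex hD hi hj he
  all_goals
    rw [h.grp j hj] at h₃
    have hg := Data.grpOf_lt hD.graph hj
    refine dirEdge_isOutVertex ?_ ?_
  · rw [h.grp j hj]; exact isOutVertex_copy (h.copy hg hl h₃).1
  · exact Or.inl hw
  all_goals try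
    have hL := (h.lft hi hj h₁).1
    unfold Data.Lft at hL
    refine isOutVertex_steiner ?_
    split_ifs at hL
    exacts [hL.1.1, hL.1.1]
  · rw [h.grp j hj] at h₅ hw
    rw [hw]
    exact Or.inl ((h.sorted _ hg).mem _ h₅).1
  · rw [h.grp j hj]; exact isOutVertex_copy (h.copy hg hl h₃).1

theorem output_nonneg (hD : D.WellFormed n) {e : Edge} (he : e ∈ Output D s) :
    (e.neg = false ∧ 0 ≤ e.wt) ∨ e ∈ D.gam ∪ D.s4 ∪ D.s5 := by
  have dir : ∀ {o a b x}, (0 : ℝ) ≤ x → (dirEdge o a b x).neg = false ∧ 0 ≤ (dirEdge o a b x).wt := by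
    intro o a b x hx
    cases o
    exacts [⟨rfl, hx⟩, ⟨rfl, hx⟩]
  rcases he with ⟨i, hi, j, hj, he⟩ | ⟨o, j, hj, w, hw, l, hl, h₁, h₂, h₃, h₄, rfl⟩ |
    ⟨o, i, hi, j, hj, l, hl, h₁, h₂, h₃, ⟨-, k, -, w, hw, -, -, h₄, rfl⟩ | ⟨h₄, rfl⟩⟩
  · cases he with
    | graph ha b hb => exact Or.inr (Or.inl (Or.inl (Data.mem_gam.mpr ⟨ha, rfl, hb⟩)))
    | core₁ x hx => exact Or.inr (Or.inl (Or.inr ((Data.mem_s4 hD).mpr ⟨hx, rfl⟩)))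
    | core₂ x hx => exact Or.inr (Or.inr ((Data.mem_s5 hD).mpr ⟨hx, rfl⟩))
    | out ho h₀ => exact Or.inl ⟨rfl, h₀⟩
    | inn ho h₀ => exact Or.inl ⟨rfl, h₀⟩
    | mid₁ hi r' hr h₀ => exact Or.inl ⟨rfl, h₀⟩
    | mid₂ ho h₀ => exact Or.inl ⟨rfl, h₀⟩
    | two₁ ho hj h₀ => exact Or.inl ⟨rfl, h₀⟩
    | two₂ r' hr hi h₀ => exact Or.inl ⟨rfl, h₀⟩
  · exact Or.inl (dir (by linarith))
  · exact Or.inl (dir (by linarith))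
  · exact Or.inl (dir (by linarith))

theorem gam_subset_output (hD : D.WellFormed n) : D.gam ⊆ Output D s := by
  rintro ⟨u, v, w, b⟩ he
  obtain ⟨h₁, h₂, h₃⟩ := Data.mem_gam.mp he
  obtain ⟨hu, hv⟩ := hD.graph.adj_lt _ _ h₁
  simp only at h₁ h₂ h₃ hu hv
  subst h₂
  exact Or.inl ⟨u, hu, v, hv, .graph h₁ b h₃⟩

theorem s4_subset_output (hD : D.WellFormed n) : D.s4 ⊆ Output D s := by
  rintro ⟨u, v, w, b⟩ he
  obtain ⟨h₁, h₂⟩ := (Data.mem_s4 hD).mp he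
  obtain ⟨hu, hv⟩ := h₁.lt hD
  simp only at h₁ h₂ hu hv
  subst h₂
  exact Or.inl ⟨u, hu, v, hv, .core₁ w h₁⟩

theorem s5_subset_output (hD : D.WellFormed n) : D.s5 ⊆ Output D s := by
  rintro ⟨u, v, w, b⟩ he
  obtain ⟨h₁, h₂⟩ := (Data.mem_s5 hD).mp he
  obtain ⟨hu, hv⟩ := h₁.lt hD
  simp only at h₁ h₂ hu hv
  subst h₂
  exact Or.inl ⟨u, hu, v, hv, .core₂ w h₁⟩

theorem aux_subset_output (hD : D.WellFormed n) {e : Edge} (he : e ∈ D.aux)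
    (hi : ¬ D.IsImaginary e) : e ∈ Output D s := by
  rcases he with (((he | he) | he) | he) | he
  · exact gam_subset_output hD he
  · obtain ⟨r, h₁, h₂, h₃, h₄⟩ := (Data.mem_s2 hD).mp he
    have h₀ : 0 ≤ e.wt := not_lt.mp fun h => hi ⟨h, Or.inl (by omega)⟩
    obtain ⟨hr, hv⟩ := h₂.lt hD
    obtain ⟨u, v, w, b⟩ := e
    simp only at h₁ h₂ h₃ h₄ h₀ hv
    obtain rfl : b = false := by simpa [not_lt.mpr h₀] using h₄
    subst h₁ h₃
    exact Or.inl ⟨r, hr, v, hv, .out h₂ h₀⟩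
  · obtain ⟨r, h₁, h₂, h₃, h₄⟩ := (Data.mem_s3 hD).mp he
    have h₀ : 0 ≤ e.wt := not_lt.mp fun h => hi ⟨h, Or.inr (by omega)⟩
    obtain ⟨hr, hv⟩ := h₂.lt hD
    obtain ⟨u, v, w, b⟩ := e
    simp only at h₁ h₂ h₃ h₄ h₀ hv
    obtain rfl : b = false := by simpa [not_lt.mpr h₀] using h₄
    subst h₁ h₃
    exact Or.inl ⟨r, hr, u, hv, .inn h₂ h₀⟩
  · exact s4_subset_output hD he
  · exact s5_subset_output hD he

/-- The output contains `Γ`, which gives one inequality. For the other, `Reach` over `Γ` telescopes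
along any walk of the output, with the Steiner vertex of `r` read as a copy of `r` with shift `-Δ
r`; base vertices have shift zero, so no correction remains at the ends. -/
theorem dist_output (hD : D.WellFormed n) (h : Tabulated D s) {u v : ℕ} (hu : D.G.IsBase u)
    (hv : D.G.IsBase v) : dist (Output D s) u v = dist D.gam u v := by
  refine le_antisymm (dist_mono (gam_subset_output hD) u v) (le_iInf fun ⟨p, hp⟩ => ?_)
  let π : ℕ → ℕ := fun x => if x < D.G.m then D.G.base x else if x < 2 * D.G.m then x - D.G.m
    else s.narr 10 (x - 2 * D.G.m) 0
  let σ : ℕ → ℝ := fun x => if x < D.G.m then D.shiftΓ x else if x < 2 * D.G.m then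
    -D.Δ (x - D.G.m) else s.rarr 10 (x - 2 * D.G.m) 0
  have hπ : ∀ x < D.G.m, π x = D.G.base x := fun x hx => if_pos hx
  have hσ : ∀ x < D.G.m, σ x = D.shiftΓ x := fun x hx => if_pos hx
  have st : ∀ r < D.G.m, ¬ D.G.m + r < D.G.m ∧ D.G.m + r < 2 * D.G.m := by omega
  have cp : ∀ i, ¬ 2 * D.G.m + i < D.G.m ∧ ¬ 2 * D.G.m + i < 2 * D.G.m := by omega
  have hS : D.Sound D.gam π σ := hD.sound_gam hπ hσ
    (fun r hr => by simp only [π, if_neg (st r hr).1, if_pos (st r hr).2, Nat.add_sub_cancel_left])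
    (fun r hr => by simp only [σ, if_neg (st r hr).1, if_pos (st r hr).2, Nat.add_sub_cancel_left])
  have := Reach.of_walk (fun e he => reach_output hD h hS (fun i _ => by
    simp only [π, σ, if_neg (cp i).1, if_neg (cp i).2, Nat.add_sub_cancel_left, and_self]) he) hp
  unfold Reach at this
  rw [hπ u hu.1, hπ v hv.1, hσ u hu.1, hσ v hv.1, (hD.base_of_isBase hu).1,
    (hD.base_of_isBase hu).2, (hD.base_of_isBase hv).1, (hD.base_of_isBase hv).2, add_zero,
    sub_zero] at this
  exact this

theorem output_ge (hD : D.WellFormed n) (h : Tabulated D s) {e : Edge} (he : e ∈ Output D s) :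
    dist D.aux (D.outBase s e.src) (D.outBase s e.tgt)
      + ((D.outShift s e.tgt - D.outShift s e.src : ℝ) : EReal) ≤ ((e.wt : ℝ) : EReal) := by
  have hπ : ∀ x < D.G.m, D.outBase s x = D.G.base x := fun x hx => if_pos hx
  have hσ : ∀ x < D.G.m, D.outShift s x = D.shiftΓ x := fun x hx => if_pos hx
  have st : ∀ r < D.G.m, ¬ D.G.m + r < D.G.m ∧ D.G.m + r < 2 * D.G.m := by omega
  have cp : ∀ i, ¬ 2 * D.G.m + i < D.G.m ∧ ¬ 2 * D.G.m + i < 2 * D.G.m := by omega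
  have hS : D.Sound D.aux (D.outBase s) (D.outShift s) := hD.sound_aux hπ hσ
    (fun r hr => by simp only [Data.outBase, if_neg (st r hr).1, if_pos (st r hr).2])
    (fun r hr => by simp only [Data.outShift, if_neg (st r hr).1, if_pos (st r hr).2])
  have := reach_output hD h hS (fun i _ => by
    simp only [Data.outBase, Data.outShift, if_neg (cp i).1, if_neg (cp i).2,
      Nat.add_sub_cancel_left, and_self]) he
  refine (add_le_add_left this _).trans (le_of_eq ?_)
  rw [← EReal.coe_add]
  congr 1
  ring

/-- A copy of `v` comes from a group `g < 6 * m` with `g % m = v`, so from one of six groups, and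
from one of `m.size` blocks. -/
theorem card_copies (h : Tabulated D s) (v : ℕ) :
    ({i | i < s.nvar 0 ∧ s.narr 10 i 0 = v} : Set ℕ).ncard ≤ 6 * D.G.m.size := by
  have hsub : ({i | i < s.nvar 0 ∧ s.narr 10 i 0 = v} : Set ℕ) ⊆
      ((Finset.range 6 ×ˢ Finset.range D.G.m.size).image
        fun p => s.narr 36 (p.1 * D.G.m + v) p.2 : Finset ℕ) := by
    rintro i ⟨hi, hiv⟩
    obtain ⟨g, l, ⟨hg, hl⟩, hp, rfl⟩ := h.copies.exists_eq i hi
    have := (h.copy hg hl hp).2.1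
    rw [hiv] at this
    refine Finset.mem_coe.mpr (Finset.mem_image.mpr ⟨(g / D.G.m, l), ?_, ?_⟩)
    · simp only [Finset.mem_product, Finset.mem_range]
      exact ⟨Nat.div_lt_of_lt_mul (by rw [mul_comm]; exact hg), hl⟩
    · simp only
      rw [this, mul_comm, Nat.div_add_mod]
  refine (Set.ncard_le_ncard hsub (Finset.finite_toSet _)).trans ?_
  rw [Set.ncard_coe_finset]
  refine Finset.card_image_le.trans ?_
  simp

theorem isGoodOutput (hD : D.WellFormed n) (h : Tabulated D s) (ho : outEdges s = Output D s)
    {C : ℝ} (hC : 0 < D.G.m → (6 * D.G.m.size : ℝ) ≤ C * Real.logb 2 n) :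
    D.IsGoodOutput n C s := by
  constructor
  · rw [ho]; exact fun e he => output_isOutVertex hD h he
  · rw [ho]; exact fun e he hi => aux_subset_output hD he hi
  · rw [ho]; exact fun e he => output_nonneg hD he
  · intro i hi
    obtain ⟨g, l, ⟨hg, hl⟩, hp, rfl⟩ := h.copies.exists_eq i hi
    rw [(h.copy hg hl hp).2.1]
    exact h.isBase hD hg hp
  · rw [ho]; exact fun e he => output_ge hD h he
  · rw [ho]; exact fun u v hu hv => dist_output hD h hu hv
  · rw [ho]; exact fun e f hef => shortcut_output hD h hef
  · intro v hv
    refine le_trans ?_ (hC (by have := hv.1; omega))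
    exact_mod_cast card_copies h v
  · rw [ho]; exact ⟨s4_subset_output hD, s5_subset_output hD⟩

end Alg

end Shortcut

namespace Shortcut

open RealRAM

theorem IsWalk.lt {E : Set Edge} {m s t : ℕ} (hE : ∀ e ∈ E, e.tgt < m) (hs : s < m)
    {p : List Edge} (hp : IsWalk E s p t) : t < m := by
  induction p generalizing s with
  | nil => obtain rfl : s = t := hp; exact hs
  | cons e p ih => exact ih (hE e hp.1) hp.2.2

theorem IsWalk.src_lt {E : Set Edge} {m s t : ℕ} (hE : ∀ e ∈ E, e.src < m) (ht : t < m)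
    {p : List Edge} (hp : IsWalk E s p t) : s < m := by
  cases p with
  | nil => obtain rfl : s = t := hp; exact ht
  | cons e p => rw [← hp.2.1]; exact hE e hp.1

/-! ## Geometric sums and double counting -/

/-- Distinct powers of two add up to less than twice the largest. This is why doubling block lengths
make the enumeration affordable. -/
theorem sum_two_pow_le (P : ℕ → Prop) [DecidablePred P] {c : ℕ} (k : ℕ)
    (h : ∀ l < k, P l → 2 ^ l ≤ c) : ∑ l ∈ Finset.range k, (if P l then 2 ^ l else 0) ≤ 2 * c := by
  -- The bound by `2 ^ k` is what allows the next power to be added to the sum.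
  suffices ∑ l ∈ Finset.range k, (if P l then 2 ^ l else 0) < 2 ^ k ∧
      ∑ l ∈ Finset.range k, (if P l then 2 ^ l else 0) ≤ 2 * c from this.2
  induction k with
  | zero => simp
  | succ k ih =>
    obtain ⟨h₁, h₂⟩ := ih fun l hl => h l (by omega)
    rw [Finset.sum_range_succ, pow_succ]
    split_ifs with hP
    · have := h k (by omega) hP
      omega
    · omega

/-- Double counting of the triples `(i, s, t)` with `s ∈ A i` and `t ∈ T i`: by `i` on the left, by
`(s, t)` on the right. -/
theorem sum_card_mul_card_le {m K : ℕ} (S : Finset ℕ) (A T : ℕ → Finset ℕ)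
    (hA : ∀ i ∈ S, A i ⊆ Finset.range m) (hT : ∀ i ∈ S, T i ⊆ Finset.range m)
    (h : ∀ s < m, ∀ t < m, (S.filter fun i => s ∈ A i ∧ t ∈ T i).card ≤ K) :
    ∑ i ∈ S, (A i).card * (T i).card ≤ m * m * K := by
  have h₁ : ∀ i ∈ S, (A i).card * (T i).card =
      ((Finset.range m ×ˢ Finset.range m).filter fun q => q.1 ∈ A i ∧ q.2 ∈ T i).card := by
    intro i hi
    rw [← Finset.card_product]
    congr 1
    ext ⟨s, t⟩
    simp only [Finset.mem_product, Finset.mem_filter]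
    exact ⟨fun h => ⟨⟨hA i hi h.1, hT i hi h.2⟩, h⟩, fun h => h.2⟩
  rw [Finset.sum_congr rfl h₁]
  refine (Finset.sum_card_bipartiteAbove_eq_sum_card_bipartiteBelow
    (fun i (q : ℕ × ℕ) => q.1 ∈ A i ∧ q.2 ∈ T i)).trans_le ?_
  refine (Finset.sum_le_card_nsmul _ _ K fun q hq => ?_).trans_eq (by simp)
  rw [Finset.mem_product, Finset.mem_range, Finset.mem_range] at hq
  exact h q.1 hq.1 q.2 hq.2

/-! ### Close targets give walks of negative weight. -/

namespace Data

variable {D : Data} {n : ℕ}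

/-- The vertices that are counted in the betweenness of `(s, t)`. -/
def Between (D : Data) (s v t : ℕ) : Prop :=
  v ∈ D.N ∧ ∃ s' < D.G.m, ∃ t' < D.G.m, hopDist D.hgr 2 s' s + hopDist D.hgr 2 s v +
    hopDist D.hgr 2 v t + hopDist D.hgr 2 t t' < 0

theorem WellFormed.hgr_lt (hD : D.WellFormed n) {e : Edge} (he : e ∈ D.hgr) :
    e.src < D.G.m ∧ e.tgt < D.G.m := by
  obtain ⟨f, hf | hf, rfl⟩ := he
  · exact hD.graph.adj_lt _ _ hf.1
  · exact ⟨hf.1, hf.2.1⟩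

theorem between_of_walks (hD : D.WellFormed n) {s' s v t t' : ℕ} {p₁ p₂ p₃ p₄ : List Edge}
    (hv : v ∈ D.N) (h₁ : IsWalk D.hgr s' p₁ s) (h₂ : IsWalk D.hgr s p₂ v)
    (h₃ : IsWalk D.hgr v p₃ t) (h₄ : IsWalk D.hgr t p₄ t') (l₁ : hops p₁ ≤ 2) (l₂ : hops p₂ ≤ 2)
    (l₃ : hops p₃ ≤ 2) (l₄ : hops p₄ ≤ 2)
    (h : weight p₁ + weight p₂ + weight p₃ + weight p₄ < 0) : D.Between s v t := by
  have hvm : v < D.G.m := by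
    obtain ⟨r, hr⟩ := hv
    exact (hD.graph.neg_lt hr).1
  refine ⟨hv, s', (h₁.append h₂).src_lt (fun e he => (hD.hgr_lt he).1) hvm, t',
    (h₃.append h₄).lt (fun e he => (hD.hgr_lt he).2) hvm, ?_⟩
  refine (add_le_add (add_le_add (add_le_add (hopDist_le h₁ l₁) (hopDist_le h₂ l₂))
    (hopDist_le h₃ l₃)) (hopDist_le h₄ l₄)).trans_lt ?_
  exact_mod_cast h

/-- The edge between copies of one vertex in `H`, as a walk. -/
theorem exists_copy_walk {u v : ℕ} (hu : u < D.G.m) (hv : v < D.G.m)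
    (h : D.G.base u = D.G.base v) :
    ∃ p, IsWalk D.hgr u p v ∧ hops p ≤ 1 ∧ weight p = D.shiftΓ v - D.shiftΓ u := by
  by_cases huv : u = v
  · subst huv
    exact ⟨[], rfl, by simp, by simp⟩
  -- An edge between copies counts as a hop if it was negative before the reweighting, hence the
  -- bound of one hop.
  · obtain ⟨b, hb⟩ : ∃ b : Bool, (b = true ↔ D.G.shift v - D.G.shift u < 0) :=
      ⟨@decide _ (Classical.propDecidable _), @decide_eq_true_iff _ (Classical.propDecidable _)⟩
    refine ⟨[⟨u, v, D.G.shift v - D.G.shift u + D.φ u - D.φ v, b⟩],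
      ⟨⟨⟨u, v, D.G.shift v - D.G.shift u, b⟩, Or.inr ⟨hu, hv, huv, h, rfl, hb⟩, rfl⟩, rfl, rfl⟩,
      ?_, ?_⟩
    · rw [hops_cons]; split_ifs <;> simp
    · simp [shiftΓ, h]; ring

theorem adj_walk {u v : ℕ} (h : D.G.adj u v = true) :
    ∃ p, IsWalk D.gam u p v ∧ hops p ≤ 1 ∧ weight p = D.wtΓ u v ∧
      (¬ D.G.IsNegEdge u v → hops p ≤ 0) := by
  classical
  refine ⟨[⟨u, v, D.wtΓ u v, decide (D.G.IsNegEdge u v)⟩],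
    ⟨mem_gam.mpr ⟨h, rfl, by simp⟩, rfl, rfl⟩, ?_, by simp, ?_⟩
  · rw [hops_cons]; split_ifs <;> simp
  · intro hn
    simp [hops_cons, hn]

theorem OutE.exists_walk (hD : D.WellFormed n) {r v : ℕ} (h : D.OutE r v) {ε : ℝ} (hε : 0 < ε) :
    ∃ p, IsWalk D.gam r p v ∧ hops p ≤ 1 ∧ weight p < D.d₁ r v + ε := by
  refine exists_walk_of_hopDist_lt ?_
  rw [← hD.coe_d₁ h]
  exact_mod_cast (by linarith : D.d₁ r v < D.d₁ r v + ε)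

theorem InE.exists_walk (hD : D.WellFormed n) {r u : ℕ} (h : D.InE r u) {ε : ℝ} (hε : 0 < ε) :
    ∃ p, IsWalk D.gam u p r ∧ hops p ≤ 0 ∧ weight p < D.d₀ u r + ε := by
  refine exists_walk_of_hopDist_lt ?_
  rw [← hD.coe_d₀ h]
  exact_mod_cast (by linarith : D.d₀ u r < D.d₀ u r + ε)

/-- An imaginary edge means that some walk of one hop in `Γ` ends at `v` with weight strictly below
`-Δ r`. Such a walk is forbidden for vertices outside the search set, so the search set bounds the
number of imaginary edges out of `r̃`. -/
theorem OutE.mem_outS (hD : D.WellFormed n) {r v : ℕ} (h : D.OutE r v) (hw : D.w₂ r v < 0) :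
    v ∈ D.outS r := by
  by_contra hv
  obtain ⟨p, hp, hh, hx⟩ := h.exists_walk hD (ε := -D.w₂ r v) (by linarith)
  have := (hD.search r h.1).out_ge v (h.lt hD).2 hv v (weight p)
    ⟨p, [], hp.mono gam_subset_hgr, rfl, by rw [hops_nil]; omega, by simp⟩
  unfold w₂ at hx
  linarith

theorem InE.mem_inS (hD : D.WellFormed n) {r u : ℕ} (h : D.InE r u) (hw : D.w₃ r u < 0) :
    u ∈ D.inS r := by
  by_contra hv
  obtain ⟨p, hp, hh, hx⟩ := h.exists_walk hD (ε := -D.w₃ r u) (by linarith)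
  have := (hD.search r h.1).inn_ge u (h.lt hD).2 hv u (weight p)
    ⟨[], p, rfl, hp.mono gam_subset_hgr, by rw [hops_nil]; omega, by simp⟩
  unfold w₃ at hx
  linarith

/-- Some entry of the group of `j` with vertex `w` is smaller than the value of `(i, j)`. -/
def Close (D : Data) (i j w : ℕ) : Prop :=
  ∃ j' < 6 * D.G.m, D.grpOf j' = D.grpOf j ∧ ∃ y, D.Rgt j' w y ∧ y < D.lftX i j

theorem Close.copies (hD : D.WellFormed n) {j j' : ℕ} (hj' : j' < 6 * D.G.m)
    (h : D.grpOf j' = D.grpOf j) : j' / D.G.m = j / D.G.m ∧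
      D.G.base (j' % D.G.m) = D.G.base (j % D.G.m) ∧
      (j / D.G.m ≠ 0 → j / D.G.m ≠ 3 → j' = j) := by
  rcases grpOf_eq hD.graph hj' h with rfl | ⟨h₁, h₂, h₃⟩
  · exact ⟨rfl, rfl, fun _ _ => rfl⟩
  · exact ⟨h₁, h₃, fun a b => absurd h₂ (by tauto)⟩

/-- The negative walk is `s' → s → i → v → v' → w`, with the copy edge `(v, v')` of `H` in the
middle. The walk from `i` to `v` may use one hop, so only one more is allowed before `t`. A final
negative edge is therefore moved behind `t`, which becomes the tail of that edge: `v'` for an edge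
of `Γ`, `z` for (S4), `r` for (S5). -/
theorem Close.forward (hD : D.WellFormed n) {i j w : ℕ} (hj : j < 3 * D.G.m) (hL : D.Lft i j)
    (h : D.Close i j w) : ∃ t < D.G.m, (w = t ∨ D.G.IsNegEdge t w) ∧
      ∀ s ∈ D.inS i, D.Between s i t := by
  obtain ⟨j', hj', hg, y, hR, hy⟩ := h
  obtain ⟨hdiv, hbase, hsame⟩ := Close.copies hD hj' hg
  have hm : 0 < D.G.m := by omega
  have hj3 : j' < 3 * D.G.m := (grpOf_lt_iff hD.graph hj').mp (by
    rw [hg]; exact (grpOf_lt_iff hD.graph (by omega)).mpr hj)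
  rw [Lft, if_pos hj] at hL
  rw [lftX, if_pos hj] at hy
  rw [Rgt, if_pos hj3, hdiv] at hR
  obtain ⟨hO, hw⟩ := hL
  obtain ⟨x, hC, rfl⟩ := hR
  have hvm := Nat.mod_lt j hm
  have hvm' := Nat.mod_lt j' hm
  set v := j % D.G.m
  set v' := j' % D.G.m
  unfold w₂ at hy
  -- A third of the slack `lftX - y`; nearly optimal walks with this error still have negative total
  -- weight.
  obtain ⟨ε, hε⟩ : ∃ ε, ε = (D.shiftΓ v - (D.d₁ i v + D.Δ i) - (x + D.shiftΓ v')) / 3 := ⟨_, rfl⟩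
  have hε0 : 0 < ε := by rw [hε]; linarith
  obtain ⟨p₁, hp₁, hh₁, hx₁⟩ := hO.exists_walk hD hε0
  suffices ∃ t < D.G.m, (w = t ∨ D.G.IsNegEdge t w) ∧ ∃ p q t', IsWalk D.hgr v p t ∧
      IsWalk D.hgr t q t' ∧ hops p ≤ 1 ∧ hops q ≤ 2 ∧
      weight p + weight q < D.shiftΓ v' - D.shiftΓ v + x + 2 * ε by
    obtain ⟨t, ht, hwt, p, q, t', hp, hq, hhp, hhq, hpq⟩ := this
    refine ⟨t, ht, hwt, fun s hs => ?_⟩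
    -- The backward search provides a walk through `s` to `i` of weight at most `Δ i`, with at most
    -- one hop in total; it pays for the summand `Δ i` in the weight of the Steiner edge.
    obtain ⟨s', z, ⟨a, b, ha, hb, hh, rfl⟩, hz⟩ := (hD.search i hO.1).inn_le s hs
    refine between_of_walks hD hO.1 ha hb ((hp₁.mono gam_subset_hgr).append hp) hq (by omega)
      (by omega) (by rw [hops_append]; omega) hhq ?_
    rw [weight_append]
    linarith
  unfold Core at hC
  split_ifs at hC with h0 h1
  · obtain ⟨hadj, rfl⟩ := hC
    obtain ⟨p, hp, hh, hx⟩ := exists_copy_walk hvm hvm' hbase.symm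
    obtain ⟨q, hq, hq1, hqx, hq0⟩ := adj_walk hadj
    -- A negative edge could be the third hop after `i`, so it is deferred and `t = v'`; a
    -- non-negative edge costs no hop and `t = w`.
    by_cases hneg : D.G.IsNegEdge v' w
    · exact ⟨v', hvm', Or.inr hneg, p, q, w, hp, hq.mono gam_subset_hgr, hh, by omega,
        by linarith⟩
    · have := hq0 hneg
      exact ⟨w, (hD.graph.adj_lt _ _ hadj).2, Or.inl rfl, p ++ q, [], w,
        hp.append (hq.mono gam_subset_hgr), rfl, by rw [hops_append]; omega, by simp,
        by rw [weight_append, weight_nil]; linarith⟩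
  · obtain rfl := hsame h0 (by omega)
    obtain ⟨hN, z, hz, hzw, rfl⟩ := hC
    obtain ⟨p, hp, hh, hx⟩ := (show D.OutE v' z from ⟨hN, Or.inl hz⟩).exists_walk hD hε0
    obtain ⟨q, hq, hq1, hqx, -⟩ := adj_walk hzw.1
    exact ⟨z, (hD.graph.neg_lt hzw).1, Or.inr hzw, p, q, w, hp.mono gam_subset_hgr,
      hq.mono gam_subset_hgr, hh, by omega, by linarith⟩
  · have h3 : j / D.G.m < 3 := Nat.div_lt_of_lt_mul (by omega)
    obtain rfl := hsame h0 (by omega)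
    obtain ⟨r, u', hrw, hu', hvu, rfl⟩ := hC
    obtain ⟨p, hp, hh, hx, -⟩ := adj_walk hvu.1
    obtain ⟨p', hp', hh', hx'⟩ := (show D.InE r u' from ⟨⟨_, hrw⟩, Or.inl hu'⟩).exists_walk hD hε0
    obtain ⟨q, hq, hq1, hqx, -⟩ := adj_walk hrw.1
    exact ⟨r, (hD.graph.neg_lt hrw).1, Or.inr hrw, p ++ p', q, w,
      (hp.append hp').mono gam_subset_hgr, hq.mono gam_subset_hgr, by rw [hops_append]; omega,
      by omega, by rw [weight_append]; linarith⟩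

/-- Here the walk from `v` to `i` has no hops, so two hops are free for the part from `w` to `v`.
This suffices for an edge of `Γ` with a copy edge, and for (S4) and (S5); nothing has to be deferred
and `w` itself is the source. -/
theorem Close.backward (hD : D.WellFormed n) {i j w : ℕ} (hj : ¬ j < 3 * D.G.m)
    (hj6 : j < 6 * D.G.m) (hL : D.Lft i j) (h : D.Close i j w) :
    w < D.G.m ∧ ∀ t ∈ D.outS i, D.Between w i t := by
  obtain ⟨j', hj', hg, y, hR, hy⟩ := h
  obtain ⟨hdiv, hbase, hsame⟩ := Close.copies hD hj' hg
  have hm : 0 < D.G.m := by omega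
  have hj3 : ¬ j' < 3 * D.G.m := fun h => hj ((grpOf_lt_iff hD.graph hj6).mp (by
    rw [← hg]; exact (grpOf_lt_iff hD.graph hj').mpr h))
  rw [Lft, if_neg hj] at hL
  rw [lftX, if_neg hj] at hy
  rw [Rgt, if_neg hj3, hdiv] at hR
  obtain ⟨hO, hw⟩ := hL
  obtain ⟨x, hC, rfl⟩ := hR
  have hvm := Nat.mod_lt j hm
  have hvm' := Nat.mod_lt j' hm
  set v := j % D.G.m
  set v' := j' % D.G.m
  unfold w₃ at hy
  obtain ⟨ε, hε⟩ : ∃ ε, ε = (0 - (D.d₀ v i - D.Δ i) - D.shiftΓ v - (x - D.shiftΓ v')) / 3 :=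
    ⟨_, rfl⟩
  have hε0 : 0 < ε := by rw [hε]; linarith
  obtain ⟨p₁, hp₁, hh₁, hx₁⟩ := hO.exists_walk hD hε0
  refine ⟨(hC.lt hD).1, ?_⟩
  suffices ∃ p, IsWalk D.hgr w p v ∧ hops p ≤ 2 ∧
      weight p < D.shiftΓ v - D.shiftΓ v' + x + 2 * ε by
    obtain ⟨p, hp, hhp, hpx⟩ := this
    intro t ht
    obtain ⟨t', z, ⟨a, b, ha, hb, hh, rfl⟩, hz⟩ := (hD.search i hO.1).out_le t ht
    refine between_of_walks hD hO.1 (p₁ := []) rfl (hp.append (hp₁.mono gam_subset_hgr)) ha hb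
      (by simp) (by rw [hops_append]; omega) (by omega) (by omega) ?_
    rw [weight_append, weight_nil]
    linarith
  have h3 : 3 ≤ j / D.G.m := (Nat.le_div_iff_mul_le hm).mpr (by omega)
  unfold Core at hC
  split_ifs at hC with h0 h1
  · obtain ⟨hadj, rfl⟩ := hC
    obtain ⟨q, hq, hq1, hqx, -⟩ := adj_walk hadj
    obtain ⟨p, hp, hh, hx⟩ := exists_copy_walk hvm' hvm hbase
    exact ⟨q ++ p, (hq.mono gam_subset_hgr).append hp, by rw [hops_append]; omega,
      by rw [weight_append]; linarith⟩
  · obtain rfl := hsame (by omega) (by omega)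
    obtain ⟨hN, z, hz, hzw, rfl⟩ := hC
    obtain ⟨p, hp, hh, hx⟩ := (show D.OutE w z from ⟨hN, Or.inl hz⟩).exists_walk hD hε0
    obtain ⟨q, hq, hq1, hqx, -⟩ := adj_walk hzw.1
    exact ⟨p ++ q, (hp.append hq).mono gam_subset_hgr, by rw [hops_append]; omega,
      by rw [weight_append]; linarith⟩
  · obtain rfl := hsame (by omega) (by omega)
    obtain ⟨r, u', hrw, hu', hvu, rfl⟩ := hC
    obtain ⟨p, hp, hh, hx, -⟩ := adj_walk hvu.1
    obtain ⟨p', hp', hh', hx'⟩ := (show D.InE r u' from ⟨⟨_, hrw⟩, Or.inl hu'⟩).exists_walk hD hε0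
    obtain ⟨q, hq, hq1, hqx, -⟩ := adj_walk hrw.1
    exact ⟨p ++ p' ++ q, ((hp.append hp').append hq).mono gam_subset_hgr,
      by rw [hops_append, hops_append]; omega, by rw [weight_append, weight_append]; linarith⟩

end Data

end Shortcut

/-! ### The betweenness bounds the cost of the enumeration. -/

namespace Shortcut

open RealRAM

namespace Alg

open Classical in
/-- The entries smaller than the value of `(i, j)` that are enumerated number at most twice the
close vertices. -/
theorem sum_enumCost_le {D : Data} {s : Mem} (h : Tabulated D s) (hG : D.G.WellFormed) {i j : ℕ}
    (hi : i < D.G.m) (hj : j < 6 * D.G.m) :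
    ∑ l ∈ Finset.range D.G.m.size, enumCost s i j l ≤
      if D.Lft i j then 2 * ((Finset.range D.G.m).filter (D.Close i j)).card else 0 := by
  set g := D.grpOf j
  have hg : g < 6 * D.G.m := Data.grpOf_lt hG hj
  have hS := h.sorted g hg
  split_ifs with hL
  · have he : ∀ l ∈ Finset.range D.G.m.size, enumCost s i j l =
        if 0 < s.narr 27 i j ∧ s.narr 35 l 0 < s.narr 34 g 0 ∧ thrv s g l < s.rarr 27 i j
        then 2 ^ l else 0 := by
      intro l hl
      rw [enumCost, h.grp j hj, h.pow l (Finset.mem_range.mp hl), Nat.sub_add_cancel Nat.one_le_two_pow]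
    rw [Finset.sum_congr rfl he]
    refine sum_two_pow_le _ _ fun l hl ⟨h₁, h₂, h₃⟩ => ?_
    rw [h.pow l hl] at h₂
    have hpos : ∀ p < 2 ^ l, p < s.narr 34 g 0 := fun p hp => by omega
    rw [← Finset.card_range (2 ^ l)]
    -- The positions `0, …, 2 ^ l - 1` carry distinct targets with keys at most the threshold, the
    -- key at position `2 ^ l - 1`. As the threshold is below `lftX`, all of them are close.
    refine Finset.card_le_card_of_injOn (s.narr 33 g) (fun p hp => ?_) (fun p hp q hq hpq => ?_)
    · have hp : p < 2 ^ l := by simpa using hp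
      obtain ⟨a, b⟩ := hS.mem p (hpos p hp)
      obtain ⟨j', hj', hg', hR⟩ := h.member a b
      simp only [Finset.coe_filter, Finset.mem_range, Set.mem_ofPred_eq]
      refine ⟨a, j', hj', hg', _, hR, ?_⟩
      have := hS.mono p (2 ^ l - 1) (by omega) h₂
      rw [← (h.lft hi hj h₁).2]
      refine this.trans_lt ?_
      rwa [thrv, h.pow l hl] at h₃
    · exact hS.inj p q (hpos p (by simpa using hp)) (hpos q (by simpa using hq)) hpq
  · refine (Finset.sum_eq_zero fun l _ => ?_).le
    rw [enumCost, if_neg]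
    exact fun h' => hL (h.lft hi hj h'.1).1

end Alg

namespace Data

variable {D : Data} {n : ℕ}

-- A target `t` supplied by `Close.forward` accounts for at most two close vertices: `t` itself and
-- the head of its unique negative edge.
open Classical in
theorem card_close_forward (hD : D.WellFormed n) {i j : ℕ} (hj : j < 3 * D.G.m) (hL : D.Lft i j) :
    ((Finset.range D.G.m).filter (D.Close i j)).card ≤
      2 * ((Finset.range D.G.m).filter fun t => ∀ s ∈ D.inS i, D.Between s i t).card := by
  have hex : ∀ w, ∃ t, D.Close i j w → t < D.G.m ∧ (w = t ∨ D.G.IsNegEdge t w) ∧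
      ∀ s ∈ D.inS i, D.Between s i t := fun w => by
    by_cases hw : D.Close i j w
    · obtain ⟨t, h⟩ := hw.forward hD hj hL
      exact ⟨t, fun _ => h⟩
    · exact ⟨0, fun h => absurd h hw⟩
  choose f hf using hex
  refine Finset.card_le_mul_card_image_of_maps_to (f := f) (fun w hw => ?_) 2 fun t _ => ?_
  · have := hf w (Finset.mem_filter.mp hw).2
    exact Finset.mem_filter.mpr ⟨Finset.mem_range.mpr this.1, this.2.2⟩
  · by_cases hN : ∃ t', D.G.IsNegEdge t t'
    · obtain ⟨t', ht'⟩ := hN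
      refine (Finset.card_le_card (t := {t, t'}) fun w hw => ?_).trans Finset.card_le_two
      obtain ⟨hw', rfl⟩ := Finset.mem_filter.mp hw
      rcases (hf w (Finset.mem_filter.mp hw').2).2.1 with h | h
      · exact Finset.mem_insert.mpr (Or.inl h)
      · exact Finset.mem_insert.mpr (Or.inr (Finset.mem_singleton.mpr (hD.graph.head_unique h ht')))
    · refine (Finset.card_le_card (t := {t}) fun w hw => ?_).trans (by simp)
      obtain ⟨hw', rfl⟩ := Finset.mem_filter.mp hw
      rcases (hf w (Finset.mem_filter.mp hw').2).2.1 with h | h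
      · exact Finset.mem_singleton.mpr h
      · exact absurd ⟨w, h⟩ hN

open Classical in
theorem card_close_backward (hD : D.WellFormed n) {i j : ℕ} (hj : ¬ j < 3 * D.G.m)
    (hj6 : j < 6 * D.G.m) (hL : D.Lft i j) :
    ((Finset.range D.G.m).filter (D.Close i j)).card ≤
      ((Finset.range D.G.m).filter fun w => ∀ t ∈ D.outS i, D.Between w i t).card := by
  refine Finset.card_le_card fun w hw => ?_
  obtain ⟨h₁, h₂⟩ := (Finset.mem_filter.mp hw).2.backward hD hj hj6 hL
  exact Finset.mem_filter.mpr ⟨Finset.mem_range.mpr h₁, h₂⟩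

/-- At most three indices in a half have the same vertex. -/
theorem card_index_le {m : ℕ} (S : Finset ℕ) (P : ℕ → Prop) [DecidablePred P]
    (hP : ∀ j, j < 3 * m → P j → j % m ∈ S) :
    ((Finset.range (3 * m)).filter P).card ≤ 3 * S.card := by
  refine Finset.card_le_mul_card_image_of_maps_to (f := (· % m)) (fun j hj => ?_) 3 fun v _ => ?_
  · obtain ⟨h₁, h₂⟩ := Finset.mem_filter.mp hj
    exact hP j (Finset.mem_range.mp h₁) h₂
  · refine (Finset.card_le_card_of_injOn (t := Finset.range 3) (· / m) (fun j hj => ?_)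
      fun j hj j' hj' h => ?_).trans_eq (Finset.card_range 3)
    · have hj := (Finset.mem_filter.mp (Finset.mem_filter.mp hj).1).1
      rw [Finset.mem_range] at hj
      exact Finset.mem_coe.mpr (Finset.mem_range.mpr (Nat.div_lt_of_lt_mul (by linarith)))
    · have h₁ : j % m = v := (Finset.mem_filter.mp hj).2
      have h₂ : j' % m = v := (Finset.mem_filter.mp hj').2
      rw [← Nat.div_add_mod j m, ← Nat.div_add_mod j' m, h₁, h₂, show j / m = j' / m from h]

theorem sum_ite_le {m c : ℕ} (P : ℕ → Prop) [DecidablePred P] (f : ℕ → ℕ) (S : Finset ℕ)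
    (hf : ∀ j < 3 * m, P j → f j ≤ c) (hP : ∀ j < 3 * m, P j → j % m ∈ S) :
    ∑ j ∈ Finset.range (3 * m), (if P j then f j else 0) ≤ 3 * S.card * c := by
  rw [← Finset.sum_filter]
  refine (Finset.sum_le_card_nsmul _ _ c fun j hj => ?_).trans ?_
  · obtain ⟨h₁, h₂⟩ := Finset.mem_filter.mp hj
    exact hf j (Finset.mem_range.mp h₁) h₂
  · rw [smul_eq_mul]
    exact Nat.mul_le_mul_right _ (card_index_le S P hP)

open Classical in
/-- The targets that are separated from the sources in `inS i` by `i`. -/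
noncomputable def targets (D : Data) (i : ℕ) : Finset ℕ :=
  (Finset.range D.G.m).filter fun t => ∀ s ∈ D.inS i, D.Between s i t

open Classical in
/-- The sources that are separated from the targets in `outS i` by `i`. -/
noncomputable def sources (D : Data) (i : ℕ) : Finset ℕ :=
  (Finset.range D.G.m).filter fun w => ∀ t ∈ D.outS i, D.Between w i t

theorem Lft.mem_N {i j : ℕ} (h : D.Lft i j) : i ∈ D.N := by
  unfold Lft at h
  split_ifs at h
  exacts [h.1.1, h.1.1]

-- The balance of the two search sets enters here. The imaginary edges out of `i` number at most
-- `|outS i|`, but the betweenness controls `|inS i| * |targets i|`; replacing `|outS i|` by `|inS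
-- i| + 1` costs one extra term. The factor `12` comes from three kinds of edges, the geometric sum
-- and the two vertices per target; in the backward half the last factor is missing.
open Classical in
theorem sum_close_le (hD : D.WellFormed n) (i : ℕ) :
    ∑ j ∈ Finset.range (6 * D.G.m), (if D.Lft i j then
      2 * ((Finset.range D.G.m).filter (D.Close i j)).card else 0) ≤
    if i ∈ D.N then 12 * ((D.inS i).card * (D.targets i).card) + 12 * (D.targets i).card +
      6 * ((D.sources i).card * (D.outS i).card) + 6 * (D.sources i).card else 0 := by
  split_ifs with hN
  · have hS := hD.search i hN
    rw [show 6 * D.G.m = 3 * D.G.m + 3 * D.G.m by ring, Finset.sum_range_add]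
    have h₁ := sum_ite_le (m := D.G.m) (D.Lft i)
      (fun j => 2 * ((Finset.range D.G.m).filter (D.Close i j)).card) (D.outS i)
      (c := 2 * (2 * (D.targets i).card))
      (fun j hj hL => Nat.mul_le_mul_left _ (card_close_forward hD hj hL))
      (fun j hj hL => by rw [Lft, if_pos hj] at hL; exact hL.1.mem_outS hD hL.2)
    have h₂ := sum_ite_le (m := D.G.m) (fun j => D.Lft i (3 * D.G.m + j))
      (fun j => 2 * ((Finset.range D.G.m).filter (D.Close i (3 * D.G.m + j))).card) (D.inS i)
      (c := 2 * (D.sources i).card)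
      (fun j hj hL => Nat.mul_le_mul_left _ (card_close_backward hD (by omega) (by omega) hL))
      (fun j hj hL => by
        rw [Lft, if_neg (by omega), Nat.mul_add_mod'] at hL; exact hL.1.mem_inS hD hL.2)
    have h₃ := Nat.mul_le_mul_right (D.targets i).card hS.card_out_le
    have h₄ := Nat.mul_le_mul_right (D.sources i).card hS.card_inn_le
    refine (add_le_add h₁ h₂).trans ?_
    linarith
  · exact (Finset.sum_eq_zero fun j _ => if_neg fun h => hN h.mem_N).le

theorem card_between_le (hD : D.WellFormed n) {K s t : ℕ} (hs : s < D.G.m) (ht : t < D.G.m)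
    (hK : ∀ s < D.G.m, ∀ t < D.G.m, strongBetweenness D.hgr D.G.m D.N 2 s t ≤ K)
    (S : Finset ℕ) (hS : ∀ i ∈ S, D.Between s i t) : S.card ≤ K := by
  refine le_trans ?_ (hK s hs t ht)
  rw [← Set.ncard_coe_finset]
  refine Set.ncard_le_ncard (fun i hi => hS i hi) ((Set.finite_lt_nat D.G.m).subset ?_)
  rintro v ⟨⟨r, hr⟩, -⟩
  exact (hD.graph.neg_lt hr).1

-- For fixed `(s, t)`, the `i` with `s ∈ inS i` and `t ∈ targets i` are counted by the betweenness
-- of `(s, t)`, so double counting bounds the products by `m * m * K` (likewise for `sources` and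
-- `outS`). The terms from the imbalance of the search sets add at most `m * m` each.
open Classical in
theorem sum_sum_close_le (hD : D.WellFormed n) {K : ℕ}
    (hK : ∀ s < D.G.m, ∀ t < D.G.m, strongBetweenness D.hgr D.G.m D.N 2 s t ≤ K) :
    ∑ i ∈ Finset.range D.G.m, ∑ j ∈ Finset.range (6 * D.G.m), (if D.Lft i j then
      2 * ((Finset.range D.G.m).filter (D.Close i j)).card else 0) ≤
      18 * (D.G.m * D.G.m * (K + 1)) := by
  refine (Finset.sum_le_sum fun i _ => sum_close_le hD i).trans ?_
  rw [← Finset.sum_filter]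
  set S := (Finset.range D.G.m).filter (· ∈ D.N)
  have hin : ∀ i ∈ S, D.inS i ⊆ Finset.range D.G.m := fun i hi v hv => Finset.mem_range.mpr
    ((hD.search i (Finset.mem_filter.mp hi).2).inn_lt v hv)
  have hout : ∀ i ∈ S, D.outS i ⊆ Finset.range D.G.m := fun i hi v hv => Finset.mem_range.mpr
    ((hD.search i (Finset.mem_filter.mp hi).2).out_lt v hv)
  have htar : ∀ i ∈ S, D.targets i ⊆ Finset.range D.G.m := fun i _ => Finset.filter_subset _ _
  have hsrc : ∀ i ∈ S, D.sources i ⊆ Finset.range D.G.m := fun i _ => Finset.filter_subset _ _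
  have h₁ := sum_card_mul_card_le (K := K) S D.inS D.targets hin htar fun s hs t ht =>
    card_between_le hD hs ht hK _ fun i hi => by
      obtain ⟨-, a, b⟩ := Finset.mem_filter.mp hi
      exact (Finset.mem_filter.mp b).2 s a
  have h₂ := sum_card_mul_card_le (K := K) S D.sources D.outS hsrc hout fun s hs t ht =>
    card_between_le hD hs ht hK _ fun i hi => by
      obtain ⟨-, a, b⟩ := Finset.mem_filter.mp hi
      exact (Finset.mem_filter.mp a).2 t b
  have hSm : S.card ≤ D.G.m := (Finset.card_filter_le _ _).trans_eq (Finset.card_range _)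
  have key : ∀ A : ℕ → Finset ℕ, (∀ i ∈ S, A i ⊆ Finset.range D.G.m) →
      ∑ i ∈ S, (A i).card ≤ D.G.m * D.G.m := fun A hA =>
    (Finset.sum_le_card_nsmul _ _ D.G.m fun i hi =>
      (Finset.card_le_card (hA i hi)).trans_eq (Finset.card_range _)).trans
      (Nat.mul_le_mul_right _ hSm)
  have h₃ := key _ htar
  have h₄ := key _ hsrc
  simp only [Finset.sum_add_distrib, ← Finset.mul_sum]
  linarith

end Data

namespace Alg

open Classical in
theorem lefts₀Cost_le {D : Data} {s : Mem} {n K : ℕ} (hD : D.WellFormed n) (h : Tabulated D s)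
    (hK : ∀ s < D.G.m, ∀ t < D.G.m, strongBetweenness D.hgr D.G.m D.N 2 s t ≤ K) (o : Bool) :
    lefts₀Cost s D.G.m o ≤ D.G.m * (6 * D.G.m * (D.G.m.size * (leftCost o + 7) + 12) + 12) + 5 +
      directCost * (18 * (D.G.m * D.G.m * (K + 1))) := by
  have hsum := Data.sum_sum_close_le hD hK
  have hle : ∑ i ∈ Finset.range D.G.m, ∑ j ∈ Finset.range (6 * D.G.m),
      ∑ l ∈ Finset.range D.G.m.size, enumCost s i j l ≤ 18 * (D.G.m * D.G.m * (K + 1)) :=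
    (Finset.sum_le_sum fun i hi => Finset.sum_le_sum fun j hj => sum_enumCost_le h hD.graph
      (Finset.mem_range.mp hi) (Finset.mem_range.mp hj)).trans hsum
  have := Nat.mul_le_mul_left directCost hle
  refine le_trans (le_of_eq ?_) (Nat.add_le_add_left this _)
  unfold lefts₀Cost
  simp only [Finset.sum_add_distrib, ← Finset.sum_mul, Finset.sum_const, Finset.card_range,
    smul_eq_mul]
  ring

end Alg

end Shortcut

namespace Shortcut

open RealRAM

/-! ## The number of steps -/

/-- `f` grows at most like `m ^ i * log m ^ j`. -/
def Grows (i j : ℕ) (f : ℕ → ℕ) : Prop :=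
  ∃ K, ∀ m, f m ≤ K * ((m + 1) ^ i * (m.size + 1) ^ j)

namespace Grows

variable {i j : ℕ} {f g : ℕ → ℕ}

theorem const (c : ℕ) : Grows i j fun _ => c :=
  ⟨c, fun m => Nat.le_mul_of_pos_right c (by positivity)⟩

theorem add (hf : Grows i j f) (hg : Grows i j g) : Grows i j fun m => f m + g m := by
  obtain ⟨K, hK⟩ := hf
  obtain ⟨L, hL⟩ := hg
  exact ⟨K + L, fun m => by rw [add_mul]; exact add_le_add (hK m) (hL m)⟩

theorem const_mul (c : ℕ) (hf : Grows i j f) : Grows i j fun m => c * f m := by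
  obtain ⟨K, hK⟩ := hf
  exact ⟨c * K, fun m => by rw [mul_assoc]; exact Nat.mul_le_mul_left _ (hK m)⟩

theorem id_mul (hf : Grows i j f) : Grows (i + 1) j fun m => m * f m := by
  obtain ⟨K, hK⟩ := hf
  refine ⟨K, fun m => ?_⟩
  calc m * f m ≤ (m + 1) * (K * ((m + 1) ^ i * (m.size + 1) ^ j)) :=
        Nat.mul_le_mul (by omega) (hK m)
    _ = _ := by ring

theorem six_mul (hf : Grows i j f) : Grows (i + 1) j fun m => 6 * m * f m := by
  simpa only [mul_assoc] using hf.id_mul.const_mul 6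

theorem size_mul (hf : Grows i j f) : Grows i (j + 1) fun m => m.size * f m := by
  obtain ⟨K, hK⟩ := hf
  refine ⟨K, fun m => ?_⟩
  calc m.size * f m ≤ (m.size + 1) * (K * ((m + 1) ^ i * (m.size + 1) ^ j)) :=
        Nat.mul_le_mul (by omega) (hK m)
    _ = _ := by ring

end Grows

namespace Alg

theorem grows_prepareCost : Grows 2 1 prepareCost := by
  unfold prepareCost
  repeat' first
    | with_reducible exact Grows.const _
    | with_reducible apply Grows.add
    | with_reducible apply Grows.six_mul
    | with_reducible apply Grows.id_mul

theorem grows_sortCost : Grows 1 1 fun m => sortCost m.size m := by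
  unfold sortCost extractCost
  repeat' first
    | with_reducible exact Grows.const _
    | with_reducible apply Grows.add
    | with_reducible apply Grows.id_mul
    | with_reducible apply Grows.size_mul

theorem grows_sortingCost : Grows 2 1 sortingCost := by
  unfold sortingCost
  repeat' first
    | with_reducible exact Grows.const _
    | exact grows_sortCost
    | with_reducible apply Grows.add
    | with_reducible apply Grows.six_mul
    | with_reducible apply Grows.id_mul
    | with_reducible apply Grows.size_mul

theorem grows_allBound : Grows 2 1 allBound := by
  unfold allBound
  repeat' first
    | with_reducible exact Grows.const _
    | with_reducible apply Grows.add
    | with_reducible apply Grows.id_mul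

theorem grows_rights₀Cost (o : Bool) : Grows 2 1 fun m => rights₀Cost m o := by
  unfold rights₀Cost
  repeat' first
    | with_reducible exact Grows.const _
    | with_reducible apply Grows.add
    | with_reducible apply Grows.six_mul
    | with_reducible apply Grows.id_mul
    | with_reducible apply Grows.size_mul

theorem grows_leftCost (c : ℕ) :
    Grows 2 1 fun m => m * (6 * m * (m.size * (c + 7) + 12) + 12) + 5 := by
  repeat' first
    | with_reducible exact Grows.const _
    | with_reducible apply Grows.add
    | with_reducible apply Grows.six_mul
    | with_reducible apply Grows.id_mul
    | with_reducible apply Grows.size_mul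

/-- The program solves the problem in `O(m² log m · K)` steps, where `K` bounds the betweenness. -/
theorem exists_main_wp : ∃ A : ℕ, ∀ (W U B n K : ℕ) (D : Data), Par W U B D.G.m →
    D.WellFormed n → (∀ s < D.G.m, ∀ t < D.G.m,
      strongBetweenness D.hgr D.G.m D.N 2 s t ≤ K) →
    WP W U B main D.start (A * ((D.G.m + 1) ^ 2 * (D.G.m.size + 1) * (K + 1)))
      (fun s' => Tabulated D s' ∧ outEdges s' = Output D s') := by
  have hg : Grows 2 1 fun m => prepareCost m + (sortingCost m + (9 * allBound m +
      (rights₀Cost m true + (rights₀Cost m false + 2 *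
        (m * (6 * m * (m.size * (leftCost true + leftCost false + 7) + 12) + 12) + 5))))) :=
    grows_prepareCost.add (grows_sortingCost.add ((grows_allBound.const_mul 9).add
      ((grows_rights₀Cost true).add ((grows_rights₀Cost false).add
        ((grows_leftCost _).const_mul 2)))))
  obtain ⟨A, hA⟩ := hg
  -- The enumeration costs at most `18 * directCost` times `m * m * (K + 1)` in each of the two
  -- calls of `copyLeft`.
  refine ⟨A + 36 * directCost, fun W U B n K D hP hD hK => ?_⟩
  refine (main_wp (T := D.G.m * (6 * D.G.m * (D.G.m.size * (leftCost true + leftCost false + 7) +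
    12) + 12) + 5 + directCost * (18 * (D.G.m * D.G.m * (K + 1)))) hP hD.graph
      fun s o h => ?_).conseq ?_ fun _ _ h => h
  · refine (lefts₀Cost_le hD h hK o).trans ?_
    have : leftCost o ≤ leftCost true + leftCost false := by cases o <;> omega
    gcongr
  · have h₁ := hA D.G.m
    simp only [pow_one] at h₁
    have h₂ : (D.G.m + 1) ^ 2 * (D.G.m.size + 1) ≤
        (D.G.m + 1) ^ 2 * (D.G.m.size + 1) * (K + 1) := Nat.le_mul_of_pos_right _ (by omega)
    have h₃ : D.G.m * D.G.m * (K + 1) ≤ (D.G.m + 1) ^ 2 * (D.G.m.size + 1) * (K + 1) := by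
      refine Nat.mul_le_mul_right _ ?_
      calc D.G.m * D.G.m ≤ (D.G.m + 1) ^ 2 * 1 := by nlinarith
        _ ≤ _ := Nat.mul_le_mul_left _ (by omega)
    have h₄ := Nat.mul_le_mul_left A h₂
    have h₅ := Nat.mul_le_mul_left directCost h₃
    linarith

end Alg

end Shortcut

namespace Shortcut

open RealRAM

/-! ## Asymptotics -/

theorem one_le_logb {n : ℕ} (hn : 2 ≤ n) : 1 ≤ Real.logb 2 n := by
  rw [Real.le_logb_iff_rpow_le one_lt_two (by positivity), Real.rpow_one]
  exact_mod_cast hn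

theorem logb_le_self {x : ℝ} (hx : 0 < x) : Real.logb 2 x ≤ x := by
  rw [Real.logb_le_iff_le_rpow one_lt_two hx]
  by_cases h : x ≤ 1
  · exact h.trans (Real.one_le_rpow one_le_two hx.le)
  · have := one_add_mul_self_le_rpow_one_add (s := 1) (by norm_num) (not_le.mp h).le
    norm_num at this
    linarith

/-- The logarithm of `c₀ * n * ℓ ^ 2` is at most `|log c₀| + ℓ + 2 * ℓ`, with `ℓ = log n ≥ 1`, and
the bit length adds one; this gives the constant `4 + |log c₀|`. -/
theorem size_le {c₀ : ℝ} (hc : 0 < c₀) {n m : ℕ} (hn : 2 ≤ n)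
    (hm : (m : ℝ) ≤ c₀ * n * Real.logb 2 n ^ 2) :
    (m.size : ℝ) ≤ (4 + |Real.logb 2 c₀|) * Real.logb 2 n := by
  have hℓ := one_le_logb hn
  set ℓ := Real.logb 2 n with hℓdef
  have habs := abs_nonneg (Real.logb 2 c₀)
  rcases Nat.eq_zero_or_pos m with rfl | hpos
  · simp only [Nat.size_zero, Nat.cast_zero]
    positivity
  obtain ⟨k, hk⟩ : ∃ k, m.size = k + 1 :=
    ⟨m.size - 1, by have := Nat.size_pos.mpr hpos; omega⟩
  have h2k : (2 : ℝ) ^ k ≤ m := by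
    exact_mod_cast Nat.lt_size.mp (show k < m.size by omega)
  have hn0 : (0 : ℝ) < n := by positivity
  have hk' : (k : ℝ) ≤ Real.logb 2 (c₀ * n * ℓ ^ 2) := by
    rw [Real.le_logb_iff_rpow_le one_lt_two (by positivity), Real.rpow_natCast]
    exact h2k.trans hm
  rw [Real.logb_mul (by positivity) (by positivity), Real.logb_mul hc.ne' hn0.ne',
    Real.logb_pow] at hk'
  have h₁ := logb_le_self (x := ℓ) (by linarith)
  have h₂ := le_abs_self (Real.logb 2 c₀)
  have h₃ : |Real.logb 2 c₀| * 1 ≤ |Real.logb 2 c₀| * ℓ := by gcongr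
  rw [hk]
  push_cast at hk' ⊢
  rw [← hℓdef] at hk'
  linarith

/-- The exponent in the bound on the number of steps. -/
noncomputable def excess (A : ℝ) (n : ℕ) : ℝ :=
  (Real.logb 2 A + 5 * Real.logb 2 (Real.logb 2 n) + √(Real.logb 2 n)) / Real.logb 2 n

theorem tendsto_excess (A : ℝ) : Filter.Tendsto (excess A) Filter.atTop (nhds 0) := by
  have h : Filter.Tendsto (fun x : ℝ => (Real.logb 2 A + 5 * Real.logb 2 x + √x) / x)
      Filter.atTop (nhds 0) := by
    have h₁ : Filter.Tendsto (fun x : ℝ => Real.logb 2 A / x) Filter.atTop (nhds 0) :=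
      Filter.tendsto_id.const_div_atTop _
    have h₂ : Filter.Tendsto (fun x : ℝ => Real.log x / x) Filter.atTop (nhds 0) := by
      simpa using Real.isLittleO_log_id_atTop.tendsto_div_nhds_zero
    have h₃ : Filter.Tendsto (fun x : ℝ => (√x)⁻¹) Filter.atTop (nhds 0) :=
      Real.tendsto_sqrt_atTop.inv_tendsto_atTop
    have h₄ := (h₁.add (h₂.const_mul (5 / Real.log 2))).add h₃
    rw [mul_zero, add_zero, add_zero] at h₄
    refine h₄.congr fun x => ?_
    rw [add_div, add_div, Real.sqrt_div_self', Real.logb, Real.logb, one_div]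
    ring
  exact h.comp ((Real.tendsto_logb_atTop one_lt_two).comp tendsto_natCast_atTop_atTop)

/-- The exponent is defined as the logarithm to base `n` of all factors except `n ^ 2`, so that the
bound on the steps becomes an exact power of `n`. The fifth power of the logarithm comes from `m ^
2` (four) and `m.size` (one). -/
theorem rpow_excess {A : ℝ} (hA : 0 < A) {n : ℕ} (hn : 2 ≤ n) :
    (n : ℝ) ^ (2 + excess A n) =
      A * (n ^ 2 * Real.logb 2 n ^ 5 * (2 : ℝ) ^ √(Real.logb 2 n)) := by
  have hℓ := one_le_logb hn
  have hn0 : (0 : ℝ) < n := by positivity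
  have hn2 : (2 : ℝ) ^ Real.logb 2 n = n := Real.rpow_logb two_pos (by norm_num) hn0
  rw [Real.rpow_add hn0, Real.rpow_two]
  have : (n : ℝ) ^ excess A n = A * Real.logb 2 n ^ 5 * (2 : ℝ) ^ √(Real.logb 2 n) := by
    conv_lhs => rw [← hn2]
    rw [← Real.rpow_mul two_pos.le, excess, mul_div_cancel₀ _ (by linarith),
      Real.rpow_add two_pos, Real.rpow_add two_pos, Real.rpow_logb two_pos (by norm_num) hA,
      mul_comm (5 : ℝ), Real.rpow_mul two_pos.le, Real.rpow_logb two_pos (by norm_num) (by linarith)]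
    norm_cast
  rw [this]
  ring

/-- The bound on the number of steps in terms of the size parameter. -/
theorem steps_le {c₀ : ℝ} (hc : 0 < c₀) {n m A K : ℕ} (hn : 2 ≤ n)
    (hm : (m : ℝ) ≤ c₀ * n * Real.logb 2 n ^ 2) (hK : (K : ℝ) ≤ (2 : ℝ) ^ √(Real.logb 2 n)) :
    ((A * ((m + 1) ^ 2 * (m.size + 1) * (K + 1)) : ℕ) : ℝ) ≤
      (A + 1) * (c₀ + 1) ^ 2 * (5 + |Real.logb 2 c₀|) * 2 *
        (n ^ 2 * Real.logb 2 n ^ 5 * (2 : ℝ) ^ √(Real.logb 2 n)) := by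
  have hℓ := one_le_logb hn
  have hs := size_le hc hn hm
  set ℓ := Real.logb 2 n
  have hn1 : (1 : ℝ) ≤ n := by exact_mod_cast (by omega : 1 ≤ n)
  have h₁ : (m : ℝ) + 1 ≤ (c₀ + 1) * (n * ℓ ^ 2) := by
    have : 1 * 1 ≤ n * ℓ ^ 2 := mul_le_mul hn1 (one_le_pow₀ hℓ) zero_le_one (by linarith)
    linarith
  have h₂ : (m.size : ℝ) + 1 ≤ (5 + |Real.logb 2 c₀|) * ℓ := by linarith
  have h₃ : (K : ℝ) + 1 ≤ 2 * (2 : ℝ) ^ √ℓ := by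
    have := Real.one_le_rpow one_le_two (Real.sqrt_nonneg ℓ)
    linarith
  push_cast
  calc (A : ℝ) * ((m + 1) ^ 2 * (m.size + 1) * (K + 1))
      ≤ (A + 1) * (((c₀ + 1) * (n * ℓ ^ 2)) ^ 2 * ((5 + |Real.logb 2 c₀|) * ℓ) *
        (2 * (2 : ℝ) ^ √ℓ)) := by
        gcongr
        linarith
    _ = _ := by ring

/-- As `n ≥ 2`, a constant factor is absorbed into the exponent; words bounded by `n ^ a` have
`O(log n)` bits. -/
theorem exists_pow_ge (A : ℝ) : ∃ a : ℕ, ∀ n : ℕ, 2 ≤ n → ∀ x : ℕ, (x : ℝ) ≤ A * n ^ 8 →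
    x ≤ n ^ a := by
  obtain ⟨k, hk⟩ := pow_unbounded_of_one_lt A one_lt_two
  refine ⟨k + 8, fun n hn x hx => ?_⟩
  have hn2 : (2 : ℝ) ≤ n := by exact_mod_cast hn
  have : (x : ℝ) ≤ (n : ℝ) ^ (k + 8) := by
    rw [pow_add]
    refine hx.trans ?_
    gcongr
    exact hk.le.trans (by gcongr)
  exact_mod_cast this

/-- A crude bound suffices for the word length: each logarithm and the factor `2 ^ √(log n)` are at
most `n`, and `2 + 5 + 1 = 8`. -/
theorem pow_eight_ge {n : ℕ} (hn : 2 ≤ n) :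
    (n : ℝ) ^ 2 * Real.logb 2 n ^ 5 * (2 : ℝ) ^ √(Real.logb 2 n) ≤ n ^ 8 ∧
      n * Real.logb 2 n ^ 2 ≤ (n : ℝ) ^ 8 := by
  have hℓ := one_le_logb hn
  have hn0 : (0 : ℝ) < n := by positivity
  have hn1 : (1 : ℝ) ≤ n := by exact_mod_cast (by omega : 1 ≤ n)
  have hle := logb_le_self hn0
  have hpow : (2 : ℝ) ^ √(Real.logb 2 n) ≤ n := by
    calc (2 : ℝ) ^ √(Real.logb 2 n) ≤ (2 : ℝ) ^ Real.logb 2 n := by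
          refine Real.rpow_le_rpow_of_exponent_le one_le_two ?_
          rw [Real.sqrt_le_left (by linarith)]
          nlinarith
      _ = n := Real.rpow_logb two_pos (by norm_num) hn0
  constructor
  · calc (n : ℝ) ^ 2 * Real.logb 2 n ^ 5 * (2 : ℝ) ^ √(Real.logb 2 n) ≤ n ^ 2 * n ^ 5 * n := by
          gcongr
      _ = _ := by ring
  · calc (n : ℝ) * Real.logb 2 n ^ 2 ≤ n * n ^ 2 := by gcongr
      _ = (n : ℝ) ^ 3 := by ring
      _ ≤ _ := pow_le_pow_right₀ hn1 (by norm_num)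

theorem small_start {D : Data} (hG : D.G.WellFormed) {U : ℕ} (hU : D.G.m + 1 ≤ U) :
    Small U D.start := by
  intro A i j
  simp only [Data.start]
  split_ifs with h
  · have := (hG.base_isBase i h.2.1).1
    omega
  all_goals omega

end Shortcut

theorem mainTheorem3 :
    ∃ prog : RealRAM.Prog, ∀ c₀ : ℝ, 0 < c₀ →
      ∃ (C : ℝ) (a : ℕ) (ε : ℕ → ℝ), Filter.Tendsto ε Filter.atTop (nhds 0) ∧
        ∀ (n : ℕ) (D : Shortcut.Data), 2 ≤ n → D.WellFormed n →
          (D.G.m : ℝ) ≤ c₀ * n * Real.logb 2 n ^ 2 →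
          ∃ (t : ℕ) (s : RealRAM.Mem), RealRAM.Run (n ^ a) prog D.start t s ∧
            (t : ℝ) ≤ (n : ℝ) ^ (2 + ε n) ∧ D.IsGoodOutput n C s := by
  obtain ⟨A, hA⟩ := Shortcut.Alg.exists_main_wp
  refine ⟨Shortcut.Alg.main, fun c₀ hc => ?_⟩
  obtain ⟨A', hA'⟩ : ∃ A' : ℝ, A' = (A + 1) * (c₀ + 1) ^ 2 * (5 + |Real.logb 2 c₀|) * 2 := ⟨_, rfl⟩
  have hA'0 : 0 < A' := by
    have := abs_nonneg (Real.logb 2 c₀)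
    rw [hA']
    positivity
  obtain ⟨a, ha⟩ := Shortcut.exists_pow_ge (3 * (A' + 21 * c₀ + 20))
  -- Six groups per base vertex, each with at most `m.size` copies.
  refine ⟨6 * (4 + |Real.logb 2 c₀|), a, Shortcut.excess A', Shortcut.tendsto_excess A',
    fun n D hn hD hm => ?_⟩
  -- Betweenness values are integers, so rounding down loses nothing.
  set K := ⌊(2 : ℝ) ^ √(Real.logb 2 n)⌋₊
  set T := A * ((D.G.m + 1) ^ 2 * (D.G.m.size + 1) * (K + 1)) with hTdef
  have hT : (T : ℝ) ≤ A' * (n ^ 2 * Real.logb 2 n ^ 5 * (2 : ℝ) ^ √(Real.logb 2 n)) := by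
    rw [hA']
    exact Shortcut.steps_le hc hn hm (Nat.floor_le (by positivity))
  -- Variable `0` starts at `m` and may grow by one per step, so counters stay below `m + T`; the
  -- term `20 * (m + 1)` leaves room for vertices and indices in the arrays, and the factor `3` for
  -- sums of words. With `m ≤ c₀ * n ^ 8` this explains `A' + 21 * c₀ + 20`.
  have hW : 3 * (D.G.m + T + 20 * (D.G.m + 1)) ≤ n ^ a := by
    refine ha n hn _ ?_
    obtain ⟨h₁, h₂⟩ := Shortcut.pow_eight_ge hn
    have h₃ := mul_le_mul_of_nonneg_left h₁ hA'0.le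
    have h₄ := mul_le_mul_of_nonneg_left h₂ hc.le
    have h₅ : (1 : ℝ) ≤ (n : ℝ) ^ 8 := one_le_pow₀ (by exact_mod_cast (by omega : 1 ≤ n))
    push_cast
    linarith
  have hwp := hA (n ^ a) (D.G.m + T + 20 * (D.G.m + 1)) (D.G.m + T) n K D ⟨le_rfl, hW⟩ hD
    fun s hs t ht => Nat.le_floor (hD.betweenness s hs t ht)
  obtain ⟨t, s, hrun, ht, -, -, -, h₁, h₂⟩ := hwp
    (Shortcut.small_start hD.graph (by omega)) (by simp [Shortcut.Data.start, ← hTdef])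
    (by simp [Shortcut.Data.start, ← hTdef])
  refine ⟨t, s, hrun, ?_, Shortcut.Alg.isGoodOutput hD h₁ h₂ fun _ => ?_⟩
  · rw [Shortcut.rpow_excess hA'0 hn]
    exact le_trans (by exact_mod_cast ht) hT
  · rw [mul_assoc]
    exact mul_le_mul_of_nonneg_left (Shortcut.size_le hc hn hm) (by norm_num)
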